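/- **Theorem 5.1 (fringe-balanced BSTs, moments).** Let $t\ge 0$ be an integer. The median-of-$(2t+1)$ fringe-balanced binary search tree of a sequence of $n$ distinct keys is defined recursively: if $n\ge 2t+1$, the root holds the median of the first $2t+1$ keys, and the smaller (larger) keys, in their order of arrival, form the left (right) subtree, built in the same way; if $1\le n\le 2t$, it is the ordinary binary search tree of the sequence; if $n=0$ it is empty. For the tree built from a uniformly random permutation of $n$ elements, let $\mathcal S_n$ be the number of nodes with at least $2t$ proper descendants, and let $\mathcal X_n$ be the sum, over these nodes, of their numbers of proper descendants. (Thus $\mathcal S_n=\mathcal X_n=0$ for $n\le 2t$, and a root with $n\ge 2t+1$ keys contributes $1$ to $\mathcal S_n$ and $n-1$ to $\mathcal X_n$.) Write $H_n=\sum_{j=1}^n \frac1j$, $H_n^{(2)}=\sum_{j=1}^n\frac1{j^2}$, let $\psi$ be the digamma function and $\gamma$ Euler's constant. As $n\to\infty$: (a) If $1\le t\le 58$, then $\mathbb V(\mathcal S_n)\sim D_S\,n$ for some constant $D_S>0$ depending on $t$. (b) If $1\le t\le 28$, then $\mathrm{Cov}(\mathcal S_n,\mathcal X_n)\sim D_R\,n$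 for some constant $D_R\ne0$ depending on $t$. (c) If $t\ge 29$, the equation $(z+t)(z+t+1)\cdots(z+2t)=\frac{2(2t+1)!}{t!}$ has a (unique) zero $\varrho=\alpha_t+i\beta_t$ with $\beta_t>0$ and $\alpha_t<2$ such that every zero other than $2,\varrho,\bar\varrho$ has real part smaller than $\alpha_t$. With this $\varrho$, $$\mathrm{Cov}(\mathcal S_n,\mathcal X_n)=G_2(\beta_t\log n)\,n^{\alpha_t}+o(n^{\alpha_t}),$$ and if moreover $t\ge 59$, then $$\mathbb V(\mathcal S_n)\sim G_1(\beta_t\log n)\,n^{2\alpha_t-2}.$$ (d) For every $t\ge0$, $\mathbb V(\mathcal X_n)\sim D_X\,n^2$, where $$D_X=\frac1{(H_{2t+2}-H_{t+1})^2}\Big(\frac{2t+3}{t+1}H^{(2)}_{2t+2}-\frac{t+2}{t+1}H^{(2)}_{t+1}-\frac{\pi^2}6\Big).$$ Here, with $$C_2=\frac{t!}{2(\varrho-1)\varrho(\varrho+1)\cdots(\varrho+t-1)\sum_{t\le j\le 2t}\frac1{j+\varrho}},$$ the periodic functions are $$\begin{aligned}G_1(z)={}&2\frac{|C_2|^2}{|\Gamma(\varrho)|^2}\Big(-1+\frac{2(2t+1)!\,|\Gamma(\varrho+t)|^2}{t!^2\,\Gamma(2\alpha_t+2t)-2\,t!\,(2t+1)!\,\Gamma(2\alpha_t+t-1)}\Big)\\&+2\,\Re\Big(\frac{C_2^2e^{2iz}}{\Gamma(\varrho)^2}\Big(-1+\frac{2(2t+1)!\,\Gamma(\varrho+t)^2}{t!^2\,\Gamma(2\varrho+2t)-2\,t!\,(2t+1)!\,\Gamma(2\varrho+t-1)}\Big)\Big),\end{aligned}$$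 $$G_2(z)=2\,\Re\Big(\frac{C_2e^{iz}}{\Gamma(\varrho)}\Big(\frac{\varrho+2t+1}{t+1}-\frac{(\varrho+2t+1)\psi(\varrho+2t+2)-(\varrho+t)\psi(\varrho+t+1)-(t+1)(H_{t+1}-\gamma)}{(t+1)(H_{2t+2}-H_{t+1})}\Big)\Big).$$ -/

import Mathlib

open Filter Asymptotics
open scoped Nat ProbabilityTheory

noncomputable section

namespace FBBST

/-! ### Random median-of-`(2t+1)` fringe-balanced binary search trees -/

/-- The key stored at the root of the tree built from the sequence `x :: xs`: the median of the
first `2t+1` keys if there are that many keys, and the first key `x` otherwise. -/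
def pivot (t x : ℕ) (xs : List ℕ) : ℕ :=
  if 2 * t + 1 ≤ (x :: xs).length then
    (((x :: xs).take (2 * t + 1)).insertionSort (· ≤ ·)).getD t x
  else x

theorem pivot_mem (t x : ℕ) (xs : List ℕ) : pivot t x xs ∈ x :: xs := by
  unfold pivot
  split_ifs with h
  · have hlen : t < (((x :: xs).take (2 * t + 1)).insertionSort (· ≤ ·)).length := by
      rw [List.length_insertionSort, List.length_take]
      omega
    rw [List.getD_eq_getElem _ _ hlen]
    have h1 := List.getElem_mem hlen
    rw [List.mem_insertionSort] at h1
    exact List.mem_of_mem_take h1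
  · exact List.mem_cons_self

/-- The median-of-`(2t+1)` fringe-balanced binary search tree built from a sequence of distinct
keys. A subtree that receives at least `2t+1` keys has the median of the first `2t+1` of them at
its root (a subtree is re-organized around its median when its size reaches `2t+1`); the smaller
and the larger keys go, in their order of arrival, to the left and to the right subtree. A subtree
that receives at most `2t` keys is an ordinary binary search tree (its internal shape has no
influence on the two parameters below). -/
def tree (t : ℕ) : List ℕ → BinaryTree ℕ
  | [] => .nil
  | x :: xs =>
    .node (pivot t x xs)
      (tree t ((x :: xs).filter (fun y => y < pivot t x xs)))
      (tree t ((x :: xs).filter (fun y => pivot t x xs < y)))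
termination_by l => l.length
decreasing_by
  · exact List.length_filter_lt_length_iff_exists.2 ⟨_, pivot_mem t x xs, by simp⟩
  · exact List.length_filter_lt_length_iff_exists.2 ⟨_, pivot_mem t x xs, by simp⟩

/-- The number of nodes with at least `2t` (proper) descendants. -/
def bigNodes (t : ℕ) : BinaryTree ℕ → ℕ
  | .nil => 0
  | .node _ l r =>
    bigNodes t l + bigNodes t r + if 2 * t ≤ l.numNodes + r.numNodes then 1 else 0

/-- The total path length with respect to the nodes with at least `2t` descendants: the sum, over
these nodes, of their numbers of proper descendants (equivalently, the sum over all keys of the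
number of proper ancestors with at least `2t` descendants). It is the partitioning cost of
median-of-`(2t+1)` quicksort, a stage that splits `n` keys costing `n - 1`. -/
def pathLength (t : ℕ) : BinaryTree ℕ → ℕ
  | .nil => 0
  | .node _ l r =>
    pathLength t l + pathLength t r +
      if 2 * t ≤ l.numNodes + r.numNodes then l.numNodes + r.numNodes else 0

/-- The uniform distribution on the `n!` permutations of `n` elements. -/
def permMeasure (n : ℕ) : @MeasureTheory.Measure (Equiv.Perm (Fin n)) ⊤ :=
  @PMF.toMeasure _ ⊤ (PMF.uniformOfFintype (Equiv.Perm (Fin n)))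

/-- The fringe-balanced tree built from the permutation `σ`, read as the sequence
`σ 0, σ 1, …, σ (n - 1)`. -/
def permTree (t n : ℕ) (σ : Equiv.Perm (Fin n)) : BinaryTree ℕ :=
  tree t (List.ofFn fun i => (σ i : ℕ))

/-- The random variable `𝒮_n`. -/
def S (t n : ℕ) (σ : Equiv.Perm (Fin n)) : ℝ := bigNodes t (permTree t n σ)

/-- The random variable `𝒳_n`. -/
def X (t n : ℕ) (σ : Equiv.Perm (Fin n)) : ℝ := pathLength t (permTree t n σ)

/-! ### The indicial equation and the constants -/

/-- The indicial polynomial `(z+t)(z+t+1)⋯(z+2t) - 2(2t+1)!/t!`. -/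
def indicial (t : ℕ) (z : ℂ) : ℂ :=
  (∏ j ∈ Finset.Icc t (2 * t), (z + j)) - 2 * (2 * t + 1)! / t !

/-- `ρ` is the zero `ϱ₂` of the indicial polynomial: it has positive imaginary part and real part
smaller than `2`, and all zeros other than `2`, `ρ` and the conjugate of `ρ` have a smaller real
part. There is at most one such `ρ`. -/
structure IsSecondZero (t : ℕ) (ρ : ℂ) : Prop where
  zero : indicial t ρ = 0
  im_pos : 0 < ρ.im
  re_lt_two : ρ.re < 2
  re_lt : ∀ z : ℂ, indicial t z = 0 → z ≠ 2 → z ≠ ρ → z ≠ starRingEnd ℂ ρ → z.re < ρ.re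

/-- The coefficient `C₂ = t! / (2 (ρ-1) ρ ⋯ (ρ+t-1) ∑_{t ≤ j ≤ 2t} 1/(j+ρ))`. -/
def C₂ (t : ℕ) (ρ : ℂ) : ℂ :=
  t ! / (2 * ((ρ - 1) * ∏ j ∈ Finset.range t, (ρ + j)) *
    ∑ j ∈ Finset.Icc t (2 * t), 1 / ((j : ℂ) + ρ))

/-- The function `G₁`; here `α` is the real part of `ρ`. -/
def G₁ (t : ℕ) (ρ : ℂ) (z : ℝ) : ℝ :=
  2 * (‖C₂ t ρ‖ ^ 2 / ‖Complex.Gamma ρ‖ ^ 2) *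
      (-1 + 2 * (2 * t + 1)! * ‖Complex.Gamma (ρ + t)‖ ^ 2 /
        ((t ! : ℝ) ^ 2 * Real.Gamma (2 * ρ.re + 2 * t)
          - 2 * t ! * (2 * t + 1)! * Real.Gamma (2 * ρ.re + t - 1)))
    + 2 * (C₂ t ρ ^ 2 * Complex.exp (2 * Complex.I * z) / Complex.Gamma ρ ^ 2 *
      (-1 + 2 * (2 * t + 1)! * Complex.Gamma (ρ + t) ^ 2 /
        ((t ! : ℂ) ^ 2 * Complex.Gamma (2 * ρ + 2 * t)
          - 2 * t ! * (2 * t + 1)! * Complex.Gamma (2 * ρ + t - 1)))).re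

/-- The harmonic number `H_n` as a real number. -/
def H (n : ℕ) : ℝ := ∑ j ∈ Finset.Icc 1 n, 1 / (j : ℝ)

/-- The harmonic number `H_n^{(2)}` of second order. -/
def H2 (n : ℕ) : ℝ := ∑ j ∈ Finset.Icc 1 n, 1 / (j : ℝ) ^ 2

/-- The function `G₂`; `ψ` is the digamma function and `γ` is Euler's constant. -/
def G₂ (t : ℕ) (ρ : ℂ) (z : ℝ) : ℝ :=
  2 * (C₂ t ρ * Complex.exp (Complex.I * z) / Complex.Gamma ρ *
    ((ρ + 2 * t + 1) / (t + 1) -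
      ((ρ + 2 * t + 1) * Complex.digamma (ρ + 2 * t + 2)
        - (ρ + t) * Complex.digamma (ρ + t + 1)
        - (t + 1) * ((H (t + 1) : ℂ) - (Real.eulerMascheroniConstant : ℂ))) /
      ((t + 1) * ((H (2 * t + 2) : ℂ) - (H (t + 1) : ℂ))))).re

/-- The constant `D_X`. -/
def DX (t : ℕ) : ℝ :=
  1 / (H (2 * t + 2) - H (t + 1)) ^ 2 *
    ((2 * t + 3) / (t + 1) * H2 (2 * t + 2) - (t + 2) / (t + 1) * H2 (t + 1) - Real.pi ^ 2 / 6)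

end FBBST

end

open Filter Asymptotics
open scoped Nat ProbabilityTheory

noncomputable section

namespace FBBST

open scoped Topology

section Eigen

set_option linter.unusedSectionVars false

variable {K : Type*} [Field K] [CharZero K]

/-- The coefficient of `z ^ n` in `(1 - z) ^ (-a)`. -/
def eig (a : K) (n : ℕ) : K := ∏ i ∈ Finset.range n, (a + i) / (i + 1)

@[simp] theorem eig_zero (a : K) : eig a 0 = 1 := by simp [eig]

theorem eig_succ (a : K) (n : ℕ) : eig a (n + 1) = eig a n * ((a + n) / (n + 1)) := by
  rw [eig, Finset.prod_range_succ, ← eig]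

theorem succ_mul_eig_succ (a : K) (n : ℕ) : (n + 1) * eig a (n + 1) = (a + n) * eig a n := by
  rw [eig_succ]
  have : (n + 1 : K) ≠ 0 := Nat.cast_add_one_ne_zero n
  field_simp

@[simp] theorem eig_one (n : ℕ) : eig (1 : K) n = 1 := by
  refine Finset.prod_eq_one fun i _ => ?_
  rw [add_comm, div_self (Nat.cast_add_one_ne_zero i)]

@[simp] theorem eig_two (n : ℕ) : eig (2 : K) n = n + 1 := by
  induction n with
  | zero => simp
  | succ n ih =>
    have : (n + 1 : K) ≠ 0 := Nat.cast_add_one_ne_zero n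
    rw [eig_succ, ih]
    field_simp
    push_cast
    ring

theorem eig_ne_zero {a : K} {n : ℕ} (h : ∀ i < n, a + i ≠ 0) : eig a n ≠ 0 :=
  Finset.prod_ne_zero_iff.2 fun i hi =>
    div_ne_zero (h i (Finset.mem_range.1 hi)) (Nat.cast_add_one_ne_zero i)

theorem add_mul_eig (a : K) (n : ℕ) : (a + n) * eig a n = a * eig (a + 1) n := by
  induction n with
  | zero => simp
  | succ n ih =>
    have h : (n + 1 : K) ≠ 0 := Nat.cast_add_one_ne_zero n
    rw [eig_succ, eig_succ]
    field_simp
    push_cast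
    linear_combination (a + n + 1) * ih

/-- Vandermonde's convolution. -/
theorem sum_antidiagonal_eig (a b : K) (n : ℕ) :
    ∑ p ∈ Finset.HasAntidiagonal.antidiagonal n, eig a p.1 * eig b p.2 = eig (a + b) n := by
  induction n with
  | zero => simp
  | succ n ih =>
    have h : (n + 1 : K) ≠ 0 := Nat.cast_add_one_ne_zero n
    apply mul_left_cancel₀ h
    rw [succ_mul_eig_succ, ← ih, Finset.mul_sum, Finset.mul_sum]
    have h1 : ∑ p ∈ Finset.HasAntidiagonal.antidiagonal (n + 1), (p.1 : K) * (eig a p.1 * eig b p.2)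
        = ∑ p ∈ Finset.HasAntidiagonal.antidiagonal n, (a + p.1) * (eig a p.1 * eig b p.2) := by
      rw [Finset.Nat.sum_antidiagonal_succ]
      simp only [Nat.cast_zero, zero_mul, zero_add, Nat.cast_add, Nat.cast_one]
      refine Finset.sum_congr rfl fun p _ => ?_
      rw [← mul_assoc, succ_mul_eig_succ, mul_assoc]
    have h2 : ∑ p ∈ Finset.HasAntidiagonal.antidiagonal (n + 1), (p.2 : K) * (eig a p.1 * eig b p.2)
        = ∑ p ∈ Finset.HasAntidiagonal.antidiagonal n, (b + p.2) * (eig a p.1 * eig b p.2) := by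
      rw [Finset.Nat.sum_antidiagonal_succ']
      simp only [Nat.cast_zero, zero_mul, zero_add, Nat.cast_add, Nat.cast_one]
      refine Finset.sum_congr rfl fun p _ => ?_
      rw [mul_left_comm, succ_mul_eig_succ]
      ring
    calc _ = ∑ p ∈ Finset.HasAntidiagonal.antidiagonal (n + 1), (p.1 : K) * (eig a p.1 * eig b p.2)
          + ∑ p ∈ Finset.HasAntidiagonal.antidiagonal (n + 1), (p.2 : K) * (eig a p.1 * eig b p.2) := by
          rw [← Finset.sum_add_distrib]
          refine Finset.sum_congr rfl fun p hp => ?_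
          rw [← add_mul]
          congr 1
          have := Finset.HasAntidiagonal.mem_antidiagonal.1 hp
          rw [← Nat.cast_add, this]
          push_cast
          ring
      _ = _ := by
          rw [h1, h2, ← Finset.sum_add_distrib]
          refine Finset.sum_congr rfl fun p hp => ?_
          have := Finset.HasAntidiagonal.mem_antidiagonal.1 hp
          rw [← this]
          push_cast
          ring

theorem choose_mul_eig (a : K) (t k : ℕ) :
    ((t + k).choose t : K) * eig a (t + k) = eig a t * eig (a + t) k := by
  induction k with
  | zero => simp
  | succ k ih =>
    have h : (k + 1 : K) ≠ 0 := Nat.cast_add_one_ne_zero k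
    have h' : ((t + k : ℕ) + 1 : K) ≠ 0 := Nat.cast_add_one_ne_zero (t + k)
    have h2 : ((t + (k + 1)).choose t : K) * (k + 1) = (t + k).choose t * ((t + k : ℕ) + 1) := by
      have := Nat.choose_mul_succ_eq (t + k) t
      rw [show t + k + 1 - t = k + 1 by omega] at this
      exact_mod_cast this.symm
    apply mul_left_cancel₀ h
    rw [← add_assoc] at *
    calc _ = (((t + k + 1).choose t : K) * (k + 1)) * eig a (t + k + 1) := by ring
      _ = (t + k).choose t * (((t + k : ℕ) + 1) * eig a (t + k + 1)) := by rw [h2]; ring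
      _ = (a + (t + k : ℕ)) * ((t + k).choose t * eig a (t + k)) := by
          rw [succ_mul_eig_succ]; ring
      _ = eig a t * ((a + t + k) * eig (a + t) k) := by
          rw [ih]; push_cast; ring
      _ = eig a t * ((k + 1) * eig (a + t) (k + 1)) := by rw [succ_mul_eig_succ]
      _ = _ := by ring

/-- The probability that the left subtree of a tree with `n` nodes has `k` nodes. -/
def wt (K : Type*) [Field K] (t n k : ℕ) : K :=
  (k.choose t * (n - 1 - k).choose t : ℕ) / (n.choose (2 * t + 1) : ℕ)

/-- The average over the two subtrees of a product. -/
def avg₂ (t : ℕ) (f g : ℕ → K) (n : ℕ) : K :=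
  ∑ k ∈ Finset.range n, wt K t n k * (f k * g (n - 1 - k))

/-- The average over the left subtree. -/
def avg (t : ℕ) (f : ℕ → K) (n : ℕ) : K := ∑ k ∈ Finset.range n, wt K t n k * f k

theorem wt_symm {t n k : ℕ} (hk : k < n) : wt K t n (n - 1 - k) = wt K t n k := by
  rw [wt, wt, show n - 1 - (n - 1 - k) = k by omega, mul_comm ((n - 1 - k).choose t)]

theorem sum_wt_symm (t n : ℕ) (f : ℕ → K) :
    ∑ k ∈ Finset.range n, wt K t n k * f (n - 1 - k) = avg t f n := by
  rw [avg, ← Finset.sum_range_reflect]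
  refine Finset.sum_congr rfl fun k hk => ?_
  have := Finset.mem_range.1 hk
  rw [wt_symm this, show n - 1 - (n - 1 - k) = k by omega]

theorem avg_eq_avg₂ (t : ℕ) (f : ℕ → K) : avg t f = avg₂ t f (eig 1) := by
  funext n
  simp [avg, avg₂]

theorem avg₂_comm (t : ℕ) (f g : ℕ → K) (n : ℕ) : avg₂ t f g n = avg₂ t g f n := by
  rw [avg₂, avg₂, ← Finset.sum_range_reflect]
  refine Finset.sum_congr rfl fun k hk => ?_
  have := Finset.mem_range.1 hk
  rw [wt_symm this, show n - 1 - (n - 1 - k) = k by omega, mul_comm (f _)]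

theorem wt_eq_zero {t n k : ℕ} (h : k < t ∨ n - 1 - k < t) : wt K t n k = 0 := by
  rcases h with h | h <;> simp [wt, Nat.choose_eq_zero_of_lt h]

theorem wt_eq_zero_of_le {t n k : ℕ} (h : n ≤ 2 * t) : wt K t n k = 0 := by
  simp [wt, Nat.choose_eq_zero_of_lt (show n < 2 * t + 1 by omega)]

theorem avg_eq_zero_of_le {t n : ℕ} (f : ℕ → K) (h : n ≤ 2 * t) : avg t f n = 0 :=
  Finset.sum_eq_zero fun k _ => by rw [wt_eq_zero_of_le h, zero_mul]

theorem avg₂_eq_zero_of_le {t n : ℕ} (f g : ℕ → K) (h : n ≤ 2 * t) : avg₂ t f g n = 0 :=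
  Finset.sum_eq_zero fun k _ => by rw [wt_eq_zero_of_le h, zero_mul]

theorem avg_congr {t n : ℕ} {f g : ℕ → K} (h : ∀ k < n, t ≤ k → f k = g k) :
    avg t f n = avg t g n := by
  refine Finset.sum_congr rfl fun k hk => ?_
  rcases lt_or_ge k t with hkt | hkt
  · rw [wt_eq_zero (Or.inl hkt), zero_mul, zero_mul]
  · rw [h k (Finset.mem_range.1 hk) hkt]

theorem avg₂_congr {t n : ℕ} {f f' g g' : ℕ → K} (h : ∀ k, t ≤ k → f k = f' k)
    (h' : ∀ k, t ≤ k → g k = g' k) :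
    avg₂ t f g n = avg₂ t f' g' n := by
  refine Finset.sum_congr rfl fun k hk => ?_
  rcases lt_or_ge k t with hkt | hkt
  · rw [wt_eq_zero (Or.inl hkt), zero_mul, zero_mul]
  rcases lt_or_ge (n - 1 - k) t with hkt' | hkt'
  · rw [wt_eq_zero (Or.inr hkt'), zero_mul, zero_mul]
  rw [h k hkt, h' _ hkt']

/-- The weighted convolution over the two subtrees is an ordinary convolution. -/
theorem avg₂_eq_conv (t p : ℕ) (f g : ℕ → K) :
    avg₂ t f g (2 * t + 1 + p) =
      (∑ q ∈ Finset.HasAntidiagonal.antidiagonal p, (((t + q.1).choose t : K) * f (t + q.1)) *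
        (((t + q.2).choose t : K) * g (t + q.2))) / ((2 * t + 1 + p).choose (2 * t + 1) : ℕ) := by
  rw [avg₂, show 2 * t + 1 + p = t + (p + 1 + t) by omega, Finset.sum_range_add,
    Finset.sum_eq_zero, zero_add, Finset.sum_range_add, add_comm, Finset.sum_eq_zero, zero_add,
    Finset.sum_div, Finset.Nat.sum_antidiagonal_eq_sum_range_succ_mk]
  · refine Finset.sum_congr rfl fun k hk => ?_
    have hk := Finset.mem_range.1 hk
    rw [show t + (p + 1 + t) - 1 - (t + k) = t + (p - k) by omega, wt,
      show t + (p + 1 + t) - 1 - (t + k) = t + (p - k) by omega]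
    push_cast
    ring
  · intro k hk
    have hk := Finset.mem_range.1 hk
    rw [wt_eq_zero (Or.inr (by omega)), zero_mul]
  · intro k hk
    rw [wt_eq_zero (Or.inl (Finset.mem_range.1 hk)), zero_mul]

theorem avg₂_eig (t p : ℕ) (a b : K) :
    avg₂ t (eig a) (eig b) (2 * t + 1 + p) =
      eig a t * eig b t * eig (a + b + 2 * t) p / ((2 * t + 1 + p).choose (2 * t + 1) : ℕ) := by
  rw [avg₂_eq_conv]
  congr 1
  simp_rw [choose_mul_eig]
  rw [show a + b + 2 * t = (a + t) + (b + t) by ring, ← sum_antidiagonal_eig, Finset.mul_sum]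
  exact Finset.sum_congr rfl fun q _ => by ring

/-- The product `∏ (a + j) / (j + 1)` over `t ≤ j ≤ 2t`, twice the normalized indicial
polynomial. -/
def indProd (t : ℕ) (a : K) : K := ∏ j ∈ Finset.Icc t (2 * t), (a + j) / (j + 1)

theorem eig_two_mul_add_one (t : ℕ) (a : K) : eig a (2 * t + 1) = eig a t * indProd t a := by
  rw [eig, indProd, eig, Finset.range_eq_Ico, Finset.range_eq_Ico,
    ← Finset.prod_Ico_consecutive _ (Nat.zero_le t) (show t ≤ 2 * t + 1 by omega)]
  congr 1

theorem choose_ne_zero' (t p : ℕ) : (((2 * t + 1 + p).choose (2 * t + 1) : ℕ) : K) ≠ 0 :=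
  Nat.cast_ne_zero.2 (Nat.choose_pos (by omega)).ne'

theorem eig_add_sub_one (t p : ℕ) (a b : K) :
    eig (a + b + 2 * t) p / ((2 * t + 1 + p).choose (2 * t + 1) : ℕ)
      * (eig (a + b - 1) t * indProd t (a + b - 1))
      = eig (a + b - 1) (2 * t + 1 + p) := by
  have := choose_mul_eig (a + b - 1) (2 * t + 1) p
  rw [← eig_two_mul_add_one, div_mul_eq_mul_div, div_eq_iff (choose_ne_zero' t p), mul_comm,
    mul_comm (eig _ (2 * t + 1 + p)), this]
  congr 2
  push_cast
  ring

theorem avg₂_eig_mul {t n : ℕ} (hn : 2 * t + 1 ≤ n) (a b : K) :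
    avg₂ t (eig a) (eig b) n * (eig (a + b - 1) t * indProd t (a + b - 1)) =
      eig a t * eig b t * eig (a + b - 1) n := by
  obtain ⟨p, rfl⟩ := Nat.exists_eq_add_of_le hn
  rw [avg₂_eig, ← eig_add_sub_one]
  ring

theorem avg_eig_mul {t n : ℕ} (hn : 2 * t + 1 ≤ n) (a : K) :
    avg t (eig a) n * indProd t a = eig a n := by
  obtain ⟨p, rfl⟩ := Nat.exists_eq_add_of_le hn
  have h := eig_add_sub_one t p a 1
  rw [add_sub_cancel_right] at h
  rw [avg_eq_avg₂, avg₂_eig, ← h, eig_one]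
  ring

theorem indProd_two (t : ℕ) : indProd t (2 : K) = 2 := by
  have h1 := eig_two_mul_add_one t (2 : K)
  rw [eig_two, eig_two] at h1
  have : (t + 1 : K) ≠ 0 := Nat.cast_add_one_ne_zero t
  push_cast at h1
  apply mul_left_cancel₀ this
  linear_combination -h1

theorem indProd_one (t : ℕ) : indProd t (1 : K) = 1 := by
  have h1 := eig_two_mul_add_one t (1 : K)
  simpa using h1.symm

theorem avg_add (t : ℕ) (f g : ℕ → K) (n : ℕ) :
    avg t (fun k => f k + g k) n = avg t f n + avg t g n := by
  simp only [avg, ← Finset.sum_add_distrib, mul_add]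

theorem avg_sub (t : ℕ) (f g : ℕ → K) (n : ℕ) :
    avg t (fun k => f k - g k) n = avg t f n - avg t g n := by
  simp only [avg, ← Finset.sum_sub_distrib, mul_sub]

theorem avg_const_mul (t : ℕ) (c : K) (f : ℕ → K) (n : ℕ) :
    avg t (fun k => c * f k) n = c * avg t f n := by
  simp only [avg, Finset.mul_sum]
  exact Finset.sum_congr rfl fun k _ => by ring

theorem avg₂_add_left (t : ℕ) (f g h : ℕ → K) (n : ℕ) :
    avg₂ t (fun k => f k + g k) h n = avg₂ t f h n + avg₂ t g h n := by
  simp only [avg₂, ← Finset.sum_add_distrib]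
  exact Finset.sum_congr rfl fun k _ => by ring

theorem avg₂_const_mul_left (t : ℕ) (c : K) (f h : ℕ → K) (n : ℕ) :
    avg₂ t (fun k => c * f k) h n = c * avg₂ t f h n := by
  simp only [avg₂, Finset.mul_sum]
  exact Finset.sum_congr rfl fun k _ => by ring

theorem avg₂_sum_left {ι : Type*} (t : ℕ) (s : Finset ι) (f : ι → ℕ → K) (h : ℕ → K) (n : ℕ) :
    avg₂ t (fun k => ∑ i ∈ s, f i k) h n = ∑ i ∈ s, avg₂ t (f i) h n := by
  simp only [avg₂, Finset.mul_sum, Finset.sum_mul]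
  exact Finset.sum_comm

theorem avg₂_add_right (t : ℕ) (f g h : ℕ → K) (n : ℕ) :
    avg₂ t h (fun k => f k + g k) n = avg₂ t h f n + avg₂ t h g n := by
  simp only [avg₂, ← Finset.sum_add_distrib]
  exact Finset.sum_congr rfl fun k _ => by ring

theorem avg₂_const_mul_right (t : ℕ) (c : K) (f h : ℕ → K) (n : ℕ) :
    avg₂ t h (fun k => c * f k) n = c * avg₂ t h f n := by
  simp only [avg₂, Finset.mul_sum]
  exact Finset.sum_congr rfl fun k _ => by ring

theorem avg₂_sum_right {ι : Type*} (t : ℕ) (s : Finset ι) (f : ι → ℕ → K) (h : ℕ → K) (n : ℕ) :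
    avg₂ t h (fun k => ∑ i ∈ s, f i k) n = ∑ i ∈ s, avg₂ t h (f i) n := by
  simp only [avg₂, Finset.mul_sum]
  exact Finset.sum_comm

/-! ### The operator `θ = (1 - z) d/dz` on coefficient sequences -/

/-- The action of `(1 - z) d/dz` on coefficient sequences. -/
def theta : Module.End K (ℕ → K) where
  toFun a n := (n + 1) * a (n + 1) - n * a n
  map_add' a b := by funext n; simp only [Pi.add_apply]; ring
  map_smul' c a := by funext n; simp only [Pi.smul_apply, smul_eq_mul, RingHom.id_apply]; ring

theorem theta_apply (a : ℕ → K) (n : ℕ) : theta a n = (n + 1) * a (n + 1) - n * a n := rfl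

theorem theta_eig (a : K) : theta (eig a) = a • eig a := by
  funext n
  rw [theta_apply, succ_mul_eig_succ, Pi.smul_apply, smul_eq_mul]
  ring

/-- The operator `∏ (θ + j)` over `t ≤ j ≤ 2t`. -/
def thetaProd (t : ℕ) : Module.End K (ℕ → K) :=
  Polynomial.aeval theta (∏ j ∈ Finset.Icc t (2 * t), (Polynomial.X + Polynomial.C (j : K)))

/-- Partial convolutions that interpolate between a sequence and its averages. -/
def partialAvg (t i : ℕ) (a : ℕ → K) (n : ℕ) : K :=
  (∑ k ∈ Finset.range n, (k.choose t : K) * a k * ((n - 1 - k).choose i : ℕ)) /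
    (n.choose (t + 1 + i) : ℕ)

theorem partialAvg_num_eq_zero {t i n : ℕ} (a : ℕ → K) (h : n ≤ t + i) :
    ∑ k ∈ Finset.range n, (k.choose t : K) * a k * ((n - 1 - k).choose i : ℕ) = 0 := by
  refine Finset.sum_eq_zero fun k hk => ?_
  have := Finset.mem_range.1 hk
  rcases lt_or_ge k t with hkt | hkt
  · simp [Nat.choose_eq_zero_of_lt hkt]
  · simp [Nat.choose_eq_zero_of_lt (show n - 1 - k < i by omega)]

theorem partialAvg_num_succ (t i n : ℕ) (a : ℕ → K) :
    ∑ k ∈ Finset.range (n + 1), (k.choose t : K) * a k * ((n + 1 - 1 - k).choose (i + 1) : ℕ) =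
    ∑ k ∈ Finset.range n, (k.choose t : K) * a k * ((n - 1 - k).choose (i + 1) : ℕ) +
    ∑ k ∈ Finset.range n, (k.choose t : K) * a k * ((n - 1 - k).choose i : ℕ) := by
  rw [Finset.sum_range_succ]
  simp only [Nat.add_sub_cancel, Nat.sub_self, Nat.choose_zero_succ, Nat.cast_zero, mul_zero,
    add_zero]
  rw [← Finset.sum_add_distrib]
  refine Finset.sum_congr rfl fun k hk => ?_
  have := Finset.mem_range.1 hk
  obtain ⟨d, hd⟩ : ∃ d, n - k = d + 1 := ⟨n - k - 1, by omega⟩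
  rw [hd, show n - 1 - k = d by omega, Nat.choose_succ_succ]
  push_cast
  ring

theorem theta_partialAvg_succ (t i : ℕ) (a : ℕ → K) :
    Polynomial.aeval (theta (K := K)) (Polynomial.X + Polynomial.C ((t + 1 + i : ℕ) : K)) (partialAvg t (i + 1) a) =
      ((t + 2 + i : ℕ) : K) • partialAvg t i a := by
  funext n
  simp only [map_add, Polynomial.aeval_X, Polynomial.aeval_C, LinearMap.add_apply, Pi.add_apply, theta_apply,
    Module.algebraMap_end_apply, Pi.smul_apply, smul_eq_mul]
  rw [partialAvg, partialAvg, partialAvg, partialAvg_num_succ]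
  set u := ∑ k ∈ Finset.range n, (k.choose t : K) * a k * ((n - 1 - k).choose (i + 1) : ℕ) with hu
  set v := ∑ k ∈ Finset.range n, (k.choose t : K) * a k * ((n - 1 - k).choose i : ℕ) with hv
  have e1 : ((n + 1 : ℕ).choose (t + 1 + (i + 1)) : K) * (t + 2 + i : ℕ)
      = n.choose (t + 1 + i) * (n + 1) := by
    have := Nat.add_one_mul_choose_eq n (t + 1 + i)
    rw [show t + 1 + i + 1 = t + 1 + (i + 1) by ring] at this
    have h2 : ((t + 1 + (i + 1) : ℕ) : K) = (t + 2 + i : ℕ) := by push_cast; ring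
    rw [← h2]
    exact_mod_cast (this.symm.trans (mul_comm _ _))
  have q0 : ((t + 2 + i : ℕ) : K) ≠ 0 := Nat.cast_ne_zero.2 (by omega)
  rcases lt_or_ge n (t + 1 + i) with hn | hn
  · have hu0 : u = 0 := partialAvg_num_eq_zero a (by omega)
    have hv0 : v = 0 := partialAvg_num_eq_zero a (by omega)
    simp [hu0, hv0]
  have c1 : ((n.choose (t + 1 + i) : ℕ) : K) ≠ 0 := Nat.cast_ne_zero.2 (Nat.choose_pos hn).ne'
  have c2 : (((n + 1).choose (t + 1 + (i + 1)) : ℕ) : K) ≠ 0 :=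
    Nat.cast_ne_zero.2 (Nat.choose_pos (by omega)).ne'
  have n1 : (n + 1 : K) ≠ 0 := Nat.cast_add_one_ne_zero n
  have e3 : (n + 1 : K) * ((u + v) / ((n + 1).choose (t + 1 + (i + 1)) : ℕ))
      = (t + 2 + i : ℕ) * ((u + v) / (n.choose (t + 1 + i) : ℕ)) := by
    field_simp
    linear_combination -(u + v) * e1
  rw [e3]
  rcases hn.eq_or_lt with hn' | hn'
  · have hu0 : u = 0 := partialAvg_num_eq_zero a (by omega)
    rw [hu0]
    simp
  have c3 : ((n.choose (t + 1 + (i + 1)) : ℕ) : K) ≠ 0 :=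
    Nat.cast_ne_zero.2 (Nat.choose_pos (by omega)).ne'
  have e2 : ((n.choose (t + 1 + (i + 1)) : ℕ) : K) * (t + 2 + i : ℕ)
      = n.choose (t + 1 + i) * (n - (t + 1 + i : ℕ)) := by
    have := Nat.choose_succ_right_eq n (t + 1 + i)
    rw [show t + 1 + i + 1 = t + 1 + (i + 1) by ring] at this
    have h2 : ((t + 1 + (i + 1) : ℕ) : K) = (t + 2 + i : ℕ) := by push_cast; ring
    rw [← h2, ← Nat.cast_sub hn]
    exact_mod_cast this
  have e4 : (n - (t + 1 + i : ℕ) : K) * (u / (n.choose (t + 1 + (i + 1)) : ℕ))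
      = (t + 2 + i : ℕ) * (u / (n.choose (t + 1 + i) : ℕ)) := by
    field_simp
    linear_combination -u * e2
  linear_combination (exp := 1) -e4 + (t + 2 + i : ℕ) * (add_div u v (n.choose (t + 1 + i) : ℕ) : _)

theorem theta_partialAvg_zero (t : ℕ) (a : ℕ → K) :
    Polynomial.aeval (theta (K := K)) (Polynomial.X + Polynomial.C (t : K)) (partialAvg t 0 a) =
      ((t + 1 : ℕ) : K) • fun n => if t ≤ n then a n else 0 := by
  funext n
  simp only [map_add, Polynomial.aeval_X, Polynomial.aeval_C, LinearMap.add_apply, Pi.add_apply, theta_apply,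
    Module.algebraMap_end_apply, Pi.smul_apply, smul_eq_mul]
  simp only [partialAvg, Nat.choose_zero_right, Nat.cast_one, mul_one, add_zero,
    Finset.sum_range_succ]
  set u := ∑ k ∈ Finset.range n, (k.choose t : K) * a k with hu
  have n1 : (n + 1 : K) ≠ 0 := Nat.cast_add_one_ne_zero n
  split_ifs with hn
  · have c1 : ((n.choose t : ℕ) : K) ≠ 0 := Nat.cast_ne_zero.2 (Nat.choose_pos hn).ne'
    have c2 : (((n + 1).choose (t + 1) : ℕ) : K) ≠ 0 :=
      Nat.cast_ne_zero.2 (Nat.choose_pos (by omega)).ne'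
    have e1 : ((n + 1 : ℕ).choose (t + 1) : K) * (t + 1 : ℕ) = n.choose t * (n + 1) := by
      have := Nat.add_one_mul_choose_eq n t
      exact_mod_cast (this.symm.trans (mul_comm _ _))
    have e3 : (n + 1 : K) * ((u + n.choose t * a n) / ((n + 1).choose (t + 1) : ℕ))
        = (t + 1 : ℕ) * ((u + n.choose t * a n) / (n.choose t : ℕ)) := by
      field_simp
      linear_combination -(u + n.choose t * a n) * e1
    rw [e3]
    rcases hn.eq_or_lt with hn' | hn'
    · have hu0 : u = 0 := by
        have := partialAvg_num_eq_zero (t := t) (i := 0) (n := n) a (by omega)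
        simpa using this
      rw [hu0]
      field_simp
      simp [mul_assoc]
    have c3 : ((n.choose (t + 1) : ℕ) : K) ≠ 0 :=
      Nat.cast_ne_zero.2 (Nat.choose_pos (by omega)).ne'
    have e2 : ((n.choose (t + 1) : ℕ) : K) * (t + 1 : ℕ) = n.choose t * (n - t) := by
      have := Nat.choose_succ_right_eq n t
      rw [← Nat.cast_sub hn]
      exact_mod_cast this
    have e4 : (n - t : K) * (u / (n.choose (t + 1) : ℕ)) = (t + 1 : ℕ) * (u / (n.choose t : ℕ)) := by
      field_simp
      linear_combination -u * e2
    have e5 : (u + n.choose t * a n) / (n.choose t : ℕ) = u / (n.choose t : ℕ) + a n := by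
      field_simp
    rw [e5]
    linear_combination -e4
  · push Not at hn
    have hu0 : u = 0 := by
      have := partialAvg_num_eq_zero (t := t) (i := 0) (n := n) a (by omega)
      simpa using this
    simp [hu0, Nat.choose_eq_zero_of_lt hn]

theorem aeval_theta_prod_partialAvg (t i : ℕ) (a : ℕ → K) :
    Polynomial.aeval (theta (K := K)) (∏ j ∈ Finset.range (i + 1), (Polynomial.X + Polynomial.C ((t + j : ℕ) : K)))
        (partialAvg t i a) =
      (∏ j ∈ Finset.range (i + 1), ((t + j + 1 : ℕ) : K)) • fun n => if t ≤ n then a n else 0 := by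
  induction i with
  | zero =>
    simp only [zero_add, Finset.prod_range_one, add_zero]
    exact theta_partialAvg_zero t a
  | succ i ih =>
    rw [Finset.prod_range_succ, map_mul, Module.End.mul_apply,
      show t + (i + 1) = t + 1 + i by ring, theta_partialAvg_succ, map_smul, ih, smul_smul,
      Finset.prod_range_succ _ (i + 1), mul_comm]
    congr 3
    ring

theorem Icc_eq_image (t : ℕ) {M : Type*} [CommMonoid M] (f : ℕ → M) :
    ∏ j ∈ Finset.Icc t (2 * t), f j = ∏ j ∈ Finset.range (t + 1), f (t + j) := by
  rw [← Finset.Ico_add_one_right_eq_Icc, Finset.prod_Ico_eq_prod_range,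
    show 2 * t + 1 - t = t + 1 by omega]

/-- The fundamental differential equation behind the recurrences. -/
theorem thetaProd_avg (t : ℕ) (a : ℕ → K) :
    thetaProd t (avg t a) =
      (∏ j ∈ Finset.Icc t (2 * t), ((j + 1 : ℕ) : K)) • fun n => if t ≤ n then a n else 0 := by
  have h := aeval_theta_prod_partialAvg t t a
  rw [thetaProd, Icc_eq_image, Icc_eq_image, ← h]
  congr 1
  funext n
  rw [avg, partialAvg, Finset.sum_div]
  refine Finset.sum_congr rfl fun k _ => ?_
  rw [wt, show 2 * t + 1 = t + 1 + t by ring]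
  push_cast
  ring

end Eigen

/-! ### The zeros of the indicial polynomial -/

theorem Icc_reflect_mem {t j : ℕ} (hj : j ∈ Finset.Icc t (2 * t)) :
    3 * t - j ∈ Finset.Icc t (2 * t) := by
  rw [Finset.mem_Icc] at *
  omega

theorem prod_Icc_reflect {M : Type*} [CommMonoid M] (t : ℕ) (g : ℕ → M) :
    ∏ j ∈ Finset.Icc t (2 * t), g (3 * t - j) = ∏ j ∈ Finset.Icc t (2 * t), g j :=
  Finset.prod_nbij' (fun j => 3 * t - j) (fun j => 3 * t - j) (fun _ => Icc_reflect_mem)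
    (fun _ => Icc_reflect_mem) (fun j hj => by rw [Finset.mem_Icc] at hj; omega)
    (fun j hj => by rw [Finset.mem_Icc] at hj; omega) (fun _ _ => rfl)

theorem sum_Icc_reflect {M : Type*} [AddCommMonoid M] (t : ℕ) (g : ℕ → M) :
    ∑ j ∈ Finset.Icc t (2 * t), g (3 * t - j) = ∑ j ∈ Finset.Icc t (2 * t), g j :=
  Finset.sum_nbij' (fun j => 3 * t - j) (fun j => 3 * t - j) (fun _ => Icc_reflect_mem)
    (fun _ => Icc_reflect_mem) (fun j hj => by rw [Finset.mem_Icc] at hj; omega)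
    (fun j hj => by rw [Finset.mem_Icc] at hj; omega) (fun _ _ => rfl)

theorem cast_reflect {t j : ℕ} (hj : j ∈ Finset.Icc t (2 * t)) :
    ((3 * t - j : ℕ) : ℂ) = 3 * t - j := by
  rw [Finset.mem_Icc] at hj
  rw [Nat.cast_sub (by omega)]
  push_cast
  ring

theorem Icc_nonempty (t : ℕ) : (Finset.Icc t (2 * t)).Nonempty :=
  ⟨t, Finset.mem_Icc.2 ⟨le_rfl, by omega⟩⟩

theorem card_Icc_two_mul (t : ℕ) : (Finset.Icc t (2 * t)).card = t + 1 := by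
  rw [Nat.card_Icc]
  omega

theorem prod_add_sq (t : ℕ) (z : ℂ) :
    (∏ j ∈ Finset.Icc t (2 * t), (z + j)) ^ 2 =
      ∏ j ∈ Finset.Icc t (2 * t), ((z + 3 * t / 2) ^ 2 - ((j : ℂ) - 3 * t / 2) ^ 2) := by
  rw [sq]
  conv_lhs => rw [← prod_Icc_reflect t fun j => z + (j : ℂ), prod_Icc_reflect t fun j => z + (j : ℂ)]
  nth_rewrite 1 [← prod_Icc_reflect t fun j => z + (j : ℂ)]
  rw [← Finset.prod_mul_distrib]
  refine Finset.prod_congr rfl fun j hj => ?_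
  rw [cast_reflect hj]
  ring

theorem indProd_eq_div (t : ℕ) (z : ℂ) :
    indProd t z = (∏ j ∈ Finset.Icc t (2 * t), (z + j)) / ∏ j ∈ Finset.Icc t (2 * t), (j + 1 : ℂ) :=
  Finset.prod_div_distrib ..

theorem prod_Icc_add_one_ne_zero (t : ℕ) : ∏ j ∈ Finset.Icc t (2 * t), (j + 1 : ℂ) ≠ 0 :=
  Finset.prod_ne_zero_iff.2 fun j _ => Nat.cast_add_one_ne_zero j

theorem prod_add_two (t : ℕ) :
    ∏ j ∈ Finset.Icc t (2 * t), (2 + j : ℂ) = 2 * ∏ j ∈ Finset.Icc t (2 * t), (j + 1 : ℂ) := by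
  have := indProd_eq_div t 2
  rwa [indProd_two, eq_div_iff (prod_Icc_add_one_ne_zero t), eq_comm] at this

theorem prod_add_eq_of_root {t : ℕ} {z : ℂ} (hz : indProd t z = 2) :
    ∏ j ∈ Finset.Icc t (2 * t), (z + j) = ∏ j ∈ Finset.Icc t (2 * t), (2 + j : ℂ) := by
  rw [indProd_eq_div, div_eq_iff (prod_Icc_add_one_ne_zero t)] at hz
  rw [hz, prod_add_two]

theorem abs_sub_le {t j : ℕ} (hj : j ∈ Finset.Icc t (2 * t)) :
    ((j : ℝ) - 3 * t / 2) ^ 2 ≤ (t : ℝ) ^ 2 / 4 := by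
  rw [Finset.mem_Icc] at hj
  have h1 : (t : ℝ) ≤ j := by exact_mod_cast hj.1
  have h2 : (j : ℝ) ≤ 2 * t := by exact_mod_cast hj.2
  nlinarith

theorem norm_sq_prod (t : ℕ) (z : ℂ) (hz : indProd t z = 2) :
    ∏ j ∈ Finset.Icc t (2 * t), ‖(z + 3 * t / 2) ^ 2 - ((j : ℂ) - 3 * t / 2) ^ 2‖ =
      ∏ j ∈ Finset.Icc t (2 * t), ((2 + 3 * t / 2 : ℝ) ^ 2 - ((j : ℝ) - 3 * t / 2) ^ 2) := by
  rw [← norm_prod, ← prod_add_sq, prod_add_eq_of_root hz, prod_add_sq, norm_prod]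
  refine Finset.prod_congr rfl fun j hj => ?_
  have h : ((2 : ℂ) + 3 * t / 2) ^ 2 - ((j : ℂ) - 3 * t / 2) ^ 2 =
      (((2 + 3 * t / 2 : ℝ) ^ 2 - ((j : ℝ) - 3 * t / 2) ^ 2 : ℝ) : ℂ) := by push_cast; ring
  rw [h, Complex.norm_real, Real.norm_eq_abs, abs_of_nonneg]
  have := abs_sub_le hj
  have h0 : (0 : ℝ) ≤ t := Nat.cast_nonneg t
  nlinarith

theorem norm_real_sq_sub (t j : ℕ) : ‖((j : ℂ) - 3 * t / 2) ^ 2‖ = ((j : ℝ) - 3 * t / 2) ^ 2 := by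
  have : ((j : ℂ) - 3 * t / 2) ^ 2 = ((((j : ℝ) - 3 * t / 2) ^ 2 : ℝ) : ℂ) := by push_cast; ring
  rw [this, Complex.norm_real, Real.norm_eq_abs, abs_of_nonneg (sq_nonneg _)]

/-- All zeros lie in the disc with centre `-3t/2` whose boundary passes through `2`. -/
theorem norm_root_le {t : ℕ} {z : ℂ} (hz : indProd t z = 2) : ‖z + 3 * t / 2‖ ≤ 2 + 3 * t / 2 := by
  by_contra! h
  have h0 : (0 : ℝ) ≤ t := Nat.cast_nonneg t
  refine (norm_sq_prod t z hz).not_gt (Finset.prod_lt_prod_of_nonempty ?_ ?_ (Icc_nonempty t))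
  · intro j hj
    have := abs_sub_le hj
    nlinarith
  · intro j hj
    have h1 := norm_sub_norm_le ((z + 3 * t / 2) ^ 2) (((j : ℂ) - 3 * t / 2) ^ 2)
    rw [norm_real_sq_sub, norm_pow] at h1
    nlinarith

theorem lt_norm_root {t : ℕ} {z : ℂ} (hz : indProd t z = 2) : (t : ℝ) / 2 < ‖z + 3 * t / 2‖ := by
  by_contra! h
  have h0 : (0 : ℝ) ≤ t := Nat.cast_nonneg t
  have hb : ∀ j ∈ Finset.Icc t (2 * t), ‖(z + 3 * t / 2) ^ 2 - ((j : ℂ) - 3 * t / 2) ^ 2‖ <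
      (2 + 3 * t / 2 : ℝ) ^ 2 - ((j : ℝ) - 3 * t / 2) ^ 2 := by
    intro j hj
    have h1 := norm_sub_le ((z + 3 * t / 2) ^ 2) (((j : ℂ) - 3 * t / 2) ^ 2)
    rw [norm_real_sq_sub, norm_pow] at h1
    have := abs_sub_le hj
    have : ‖z + 3 * t / 2‖ ^ 2 ≤ (t / 2 : ℝ) ^ 2 := by gcongr
    nlinarith
  have hne : ∏ j ∈ Finset.Icc t (2 * t), ‖(z + 3 * t / 2) ^ 2 - ((j : ℂ) - 3 * t / 2) ^ 2‖ ≠ 0 := by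
    rw [norm_sq_prod t z hz]
    exact Finset.prod_ne_zero_iff.2 fun j hj => ((norm_nonneg _).trans_lt (hb j hj)).ne'
  refine (norm_sq_prod t z hz).not_lt (Finset.prod_lt_prod_of_nonempty ?_ hb (Icc_nonempty t))
  intro j hj
  exact (norm_nonneg _).lt_of_ne (Finset.prod_ne_zero_iff.1 hne j hj).symm

theorem re_lt_two_of_root {t : ℕ} {z : ℂ} (hz : indProd t z = 2) (h2 : z ≠ 2) : z.re < 2 := by
  by_contra! h
  have h1 := norm_root_le hz
  have h0 : (0 : ℝ) ≤ t := Nat.cast_nonneg t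
  have h3 : ‖z + 3 * t / 2‖ ^ 2 ≤ (2 + 3 * t / 2 : ℝ) ^ 2 := by gcongr
  rw [Complex.sq_norm, Complex.normSq_apply] at h3
  have e1 : (z + 3 * t / 2).re = z.re + 3 * t / 2 := by
    simp
  have e2 : (z + 3 * t / 2).im = z.im := by simp
  rw [e1, e2] at h3
  apply h2
  apply Complex.ext
  · simp; nlinarith [mul_self_nonneg z.im]
  · simp; nlinarith [mul_self_nonneg z.im]

theorem root_add_ne_zero {t : ℕ} {z : ℂ} (hz : indProd t z = 2) {j : ℕ}
    (hj : j ∈ Finset.Icc t (2 * t)) : z + j ≠ 0 := by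
  intro h
  have : indProd t z = 0 := Finset.prod_eq_zero hj (by rw [h, zero_div])
  rw [this] at hz
  exact two_ne_zero hz.symm

/-- The logarithmic derivative of the indicial product. -/
def logDerivSum (t : ℕ) (z : ℂ) : ℂ := ∑ j ∈ Finset.Icc t (2 * t), 1 / (z + j)

theorem re_inv_one_sub {ζ : ℂ} (h : ‖ζ‖ < 1) : 1 / (1 + ‖ζ‖) ≤ (1 / (1 - ζ)).re := by
  have hn : Complex.normSq (1 - ζ) ≠ 0 := by
    rw [Ne, Complex.normSq_eq_zero, sub_eq_zero]
    rintro rfl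
    simp at h
  have hpos : 0 < Complex.normSq (1 - ζ) := lt_of_le_of_ne (Complex.normSq_nonneg _) hn.symm
  have h1 : (1 / (1 - ζ)).re = (1 - ζ.re) / Complex.normSq (1 - ζ) := by
    rw [one_div, Complex.inv_re]; simp
  rw [h1, div_le_div_iff₀ (by positivity) hpos, Complex.normSq_apply]
  have hs : ‖ζ‖ ^ 2 = ζ.re * ζ.re + ζ.im * ζ.im := by rw [Complex.sq_norm, Complex.normSq_apply]
  have hr := neg_le_of_abs_le (Complex.abs_re_le_norm ζ)
  simp only [Complex.sub_re, Complex.one_re, Complex.sub_im, Complex.one_im]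
  nlinarith [mul_nonneg (show 0 ≤ ‖ζ‖ + ζ.re by linarith) (show 0 ≤ 1 - ‖ζ‖ by linarith)]

theorem le_norm_logDerivSum {t : ℕ} {z : ℂ} (hz : indProd t z = 2) :
    (t + 1) * (2 + 3 * t / 2) / ((2 + 3 * t / 2) ^ 2 + t ^ 2 / 4) ≤ ‖logDerivSum t z‖ := by
  have h0 : (0 : ℝ) ≤ t := Nat.cast_nonneg t
  set w := z + 3 * t / 2 with hw
  have hlt := lt_norm_root hz
  have hle := norm_root_le hz
  rw [← hw] at hlt hle
  have hwpos : 0 < ‖w‖ := by linarith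
  have hw0 : w ≠ 0 := norm_pos_iff.1 hwpos
  have key : w * logDerivSum t z =
      ∑ j ∈ Finset.Icc t (2 * t), 1 / (1 - ((j : ℂ) - 3 * t / 2) ^ 2 / w ^ 2) := by
    have h2 : 2 * logDerivSum t z = ∑ j ∈ Finset.Icc t (2 * t),
        (1 / (z + j) + 1 / (z + (3 * t - j))) := by
      rw [Finset.sum_add_distrib, two_mul, logDerivSum]
      congr 1
      rw [← sum_Icc_reflect]
      exact Finset.sum_congr rfl fun j hj => by rw [cast_reflect hj]
    have : w * logDerivSum t z = w / 2 * (2 * logDerivSum t z) := by ring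
    rw [this, h2, Finset.mul_sum]
    refine Finset.sum_congr rfl fun j hj => ?_
    have a1 := root_add_ne_zero hz hj
    have a2 := root_add_ne_zero hz (Icc_reflect_mem hj)
    rw [cast_reflect hj] at a2
    have a3 : w ^ 2 - ((j : ℂ) - 3 * t / 2) ^ 2 ≠ 0 := by
      have : w ^ 2 - ((j : ℂ) - 3 * t / 2) ^ 2 = (z + j) * (z + (3 * t - j)) := by rw [hw]; ring
      rw [this]
      exact mul_ne_zero a1 a2
    have a4 : 1 - ((j : ℂ) - 3 * t / 2) ^ 2 / w ^ 2 =
        (z + j) * (z + (3 * t - j)) / w ^ 2 := by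
      field_simp
      rw [hw]; ring
    rw [a4]
    field_simp
    rw [hw]; ring
  have hre : (t + 1) * (1 / (1 + t ^ 2 / 4 / ‖w‖ ^ 2)) ≤ (w * logDerivSum t z).re := by
    rw [key, Complex.re_sum]
    have : ((t : ℝ) + 1) * (1 / (1 + t ^ 2 / 4 / ‖w‖ ^ 2)) =
        ∑ j ∈ Finset.Icc t (2 * t), 1 / (1 + (t : ℝ) ^ 2 / 4 / ‖w‖ ^ 2) := by
      rw [Finset.sum_const, card_Icc_two_mul, nsmul_eq_mul]
      push_cast
      rfl
    rw [this]
    refine Finset.sum_le_sum fun j hj => ?_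
    have hn : ‖((j : ℂ) - 3 * t / 2) ^ 2 / w ^ 2‖ = ((j : ℝ) - 3 * t / 2) ^ 2 / ‖w‖ ^ 2 := by
      rw [norm_div, norm_real_sq_sub, norm_pow]
    have hsq := abs_sub_le hj
    refine le_trans ?_ (re_inv_one_sub ?_)
    · rw [hn]
      gcongr
    · rw [hn, div_lt_one (by positivity)]
      nlinarith
  have hn := (hre.trans (Complex.re_le_norm _))
  rw [norm_mul] at hn
  have h3 : (t + 1) * (1 / (1 + t ^ 2 / 4 / ‖w‖ ^ 2)) / ‖w‖ ≤ ‖logDerivSum t z‖ := by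
    rw [div_le_iff₀ hwpos, mul_comm ‖logDerivSum t z‖]
    exact hn
  refine le_trans ?_ h3
  have e : (t + 1) * (1 / (1 + t ^ 2 / 4 / ‖w‖ ^ 2)) / ‖w‖ =
      (t + 1) * ‖w‖ / (‖w‖ ^ 2 + t ^ 2 / 4) := by
    field_simp
  rw [e, div_le_div_iff₀ (by positivity) (by positivity)]
  have : 0 ≤ (t + 1 : ℝ) * (((2 + 3 * t / 2) - ‖w‖) * ((2 + 3 * t / 2) * ‖w‖ - t ^ 2 / 4)) := by
    apply mul_nonneg (by positivity)
    apply mul_nonneg (by linarith)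
    nlinarith
  nlinarith

theorem logDerivSum_ne_zero {t : ℕ} {z : ℂ} (hz : indProd t z = 2) : logDerivSum t z ≠ 0 := by
  rw [← norm_pos_iff]
  refine lt_of_lt_of_le ?_ (le_norm_logDerivSum hz)
  positivity

/-- The indicial polynomial. -/
def indPoly (t : ℕ) : Polynomial ℂ :=
  ∏ j ∈ Finset.Icc t (2 * t), (Polynomial.X + Polynomial.C (j : ℂ)) -
    Polynomial.C (2 * ∏ j ∈ Finset.Icc t (2 * t), (j + 1 : ℂ))

theorem eval_prod_X_add (t : ℕ) (z : ℂ) :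
    (∏ j ∈ Finset.Icc t (2 * t), (Polynomial.X + Polynomial.C (j : ℂ))).eval z =
      ∏ j ∈ Finset.Icc t (2 * t), (z + j) := by
  simp [Polynomial.eval_prod]

theorem eval_indPoly (t : ℕ) (z : ℂ) :
    (indPoly t).eval z = (∏ j ∈ Finset.Icc t (2 * t), (j + 1 : ℂ)) * (indProd t z - 2) := by
  rw [indPoly, Polynomial.eval_sub, eval_prod_X_add, Polynomial.eval_C, indProd_eq_div]
  have := prod_Icc_add_one_ne_zero t
  field_simp

theorem natDegree_prod_X_add (t : ℕ) :
    (∏ j ∈ Finset.Icc t (2 * t), (Polynomial.X + Polynomial.C (j : ℂ))).natDegree = t + 1 := by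
  rw [Polynomial.natDegree_prod_of_monic _ _ fun _ _ => Polynomial.monic_X_add_C _]
  simp only [Polynomial.natDegree_X_add_C, Finset.sum_const, card_Icc_two_mul, smul_eq_mul, mul_one]

theorem monic_prod_X_add (t : ℕ) :
    (∏ j ∈ Finset.Icc t (2 * t), (Polynomial.X + Polynomial.C (j : ℂ))).Monic :=
  Polynomial.monic_prod_of_monic _ _ fun _ _ => Polynomial.monic_X_add_C _

theorem monic_indPoly (t : ℕ) : (indPoly t).Monic := by
  refine (monic_prod_X_add t).sub_of_left ?_
  rw [Polynomial.degree_eq_natDegree (monic_prod_X_add t).ne_zero, natDegree_prod_X_add]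
  exact Polynomial.degree_C_le.trans_lt (by exact_mod_cast Nat.succ_pos t)

/-- The zeros of the indicial polynomial. -/
def indRoots (t : ℕ) : Finset ℂ := (indPoly t).roots.toFinset

theorem mem_indRoots {t : ℕ} {z : ℂ} : z ∈ indRoots t ↔ indProd t z = 2 := by
  rw [indRoots, Multiset.mem_toFinset, Polynomial.mem_roots (monic_indPoly t).ne_zero,
    Polynomial.IsRoot, eval_indPoly, mul_eq_zero, or_iff_right (prod_Icc_add_one_ne_zero t),
    sub_eq_zero]

theorem two_mem_indRoots (t : ℕ) : (2 : ℂ) ∈ indRoots t := mem_indRoots.2 (indProd_two t)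

theorem eval_derivative_prod (t : ℕ) {z : ℂ} (hz : ∀ j ∈ Finset.Icc t (2 * t), z + (j : ℂ) ≠ 0) :
    (Polynomial.derivative (indPoly t)).eval z =
      (∏ j ∈ Finset.Icc t (2 * t), (z + j)) * logDerivSum t z := by
  rw [indPoly, Polynomial.derivative_sub, Polynomial.derivative_C, sub_zero,
    Polynomial.derivative_prod_finset, Polynomial.eval_finsetSum, logDerivSum, Finset.mul_sum]
  refine Finset.sum_congr rfl fun j hj => ?_
  simp only [Polynomial.derivative_add, Polynomial.derivative_X, Polynomial.derivative_C, add_zero,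
    mul_one, Polynomial.eval_prod, Polynomial.eval_add, Polynomial.eval_X, Polynomial.eval_C]
  rw [← Finset.mul_prod_erase _ _ hj]
  have := hz j hj
  field_simp

theorem eval_derivative_indPoly {t : ℕ} {z : ℂ} (hz : indProd t z = 2) :
    (Polynomial.derivative (indPoly t)).eval z =
      2 * (∏ j ∈ Finset.Icc t (2 * t), (j + 1 : ℂ)) * logDerivSum t z := by
  rw [eval_derivative_prod t fun j hj => root_add_ne_zero hz hj, prod_add_eq_of_root hz, prod_add_two]

theorem nodup_roots_indPoly (t : ℕ) : (indPoly t).roots.Nodup := by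
  rw [Multiset.nodup_iff_count_le_one]
  intro z
  rw [Polynomial.count_roots]
  by_contra! h
  have h1 := (Polynomial.one_lt_rootMultiplicity_iff_isRoot (monic_indPoly t).ne_zero).1 h
  have hz : indProd t z = 2 := mem_indRoots.1 (by
    rw [indRoots, Multiset.mem_toFinset, Polynomial.mem_roots (monic_indPoly t).ne_zero]
    exact h1.1)
  have h2 := h1.2
  rw [Polynomial.IsRoot, eval_derivative_indPoly hz] at h2
  exact mul_ne_zero (mul_ne_zero two_ne_zero (prod_Icc_add_one_ne_zero t)) (logDerivSum_ne_zero hz) h2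

theorem indPoly_eq_nodal (t : ℕ) : indPoly t = Lagrange.nodal (indRoots t) id := by
  have h := (IsAlgClosed.splits (indPoly t)).eq_prod_roots_of_monic (monic_indPoly t)
  conv_lhs => rw [h]
  rw [Lagrange.nodal, Finset.prod, indRoots, Multiset.toFinset_val, (nodup_roots_indPoly t).dedup]
  rfl

/-- The residue of `1 / (f - 1)` at a zero, where `f` is the normalized indicial product. -/
def res (t : ℕ) (z : ℂ) : ℂ := 1 / logDerivSum t z

/-- The Lagrange basis polynomial of a zero. -/
def basisPoly (t : ℕ) (z : ℂ) : Polynomial ℂ := Lagrange.basis (indRoots t) id z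

theorem sum_basisPoly (t : ℕ) : ∑ z ∈ indRoots t, basisPoly t z = 1 :=
  Lagrange.sum_basis (Set.injOn_id _) ⟨2, two_mem_indRoots t⟩

theorem X_sub_C_mul_basisPoly {t : ℕ} {z : ℂ} (hz : z ∈ indRoots t) :
    (Polynomial.X - Polynomial.C z) * basisPoly t z =
      Polynomial.C (res t z / (2 * ∏ j ∈ Finset.Icc t (2 * t), (j + 1 : ℂ))) * indPoly t := by
  rw [basisPoly, Lagrange.basis_eq_prod_sub_inv_mul_nodal_div hz,
    Lagrange.nodalWeight_eq_eval_derivative_nodal hz, ← Lagrange.nodal_erase_eq_nodal_div hz,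
    mul_left_comm, show Polynomial.X - Polynomial.C z = Polynomial.X - Polynomial.C (id z) from rfl,
    ← Lagrange.nodal_eq_mul_nodal_erase hz, ← indPoly_eq_nodal,
    show id z = z from rfl, eval_derivative_indPoly (mem_indRoots.1 hz), res]
  congr 2
  rw [one_div, mul_inv, div_eq_mul_inv, mul_comm]

/-- Partial fractions for `1 / (f - 1)`. -/
theorem sum_res_div {t : ℕ} {b : ℂ} (hb : indProd t b ≠ 2) :
    ∑ z ∈ indRoots t, res t z / (b - z) = 2 / (indProd t b - 2) := by
  have h1 := congrArg (Polynomial.eval b) (sum_basisPoly t)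
  rw [Polynomial.eval_finsetSum, Polynomial.eval_one] at h1
  have hb' : indProd t b - 2 ≠ 0 := sub_ne_zero.2 hb
  have h3 : (2 : ℂ) = ∑ z ∈ indRoots t, 2 * (basisPoly t z).eval b := by
    rw [← Finset.mul_sum, h1, mul_one]
  rw [eq_div_iff hb', Finset.sum_mul]
  refine Eq.trans ?_ h3.symm
  refine Finset.sum_congr rfl fun z hz => ?_
  have hbz : b - z ≠ 0 := by
    rw [sub_ne_zero]
    rintro rfl
    exact hb (mem_indRoots.1 hz)
  have h2 := congrArg (Polynomial.eval b) (X_sub_C_mul_basisPoly hz)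
  simp only [Polynomial.eval_mul, Polynomial.eval_sub, Polynomial.eval_X, Polynomial.eval_C,
    eval_indPoly] at h2
  have := prod_Icc_add_one_ne_zero t
  field_simp at h2 ⊢
  linear_combination -h2

/-! ### Growth of the eigensequences -/

theorem ofReal_eig (s : ℝ) (n : ℕ) : ((eig s n : ℝ) : ℂ) = eig (s : ℂ) n := by
  simp [eig, Complex.ofReal_prod]

theorem eig_pos {s : ℝ} (hs : 0 < s) (n : ℕ) : 0 < eig s n :=
  Finset.prod_pos fun i _ => by positivity

theorem eig_neg_nat {m n : ℕ} (h : m < n) : eig (-(m : ℂ)) n = 0 :=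
  Finset.prod_eq_zero (Finset.mem_range.2 h) (by simp)

theorem eig_mul_factorial (a : ℂ) (n : ℕ) : eig a n * n ! = ∏ i ∈ Finset.range n, (a + i) := by
  rw [eig, Finset.prod_div_distrib, ← Finset.prod_range_add_one_eq_factorial]
  push_cast
  exact div_mul_cancel₀ _ (Finset.prod_ne_zero_iff.2 fun i _ => Nat.cast_add_one_ne_zero i)

theorem tendsto_eig (a : ℂ) :
    Tendsto (fun n : ℕ => eig a n / (n : ℂ) ^ (a - 1)) atTop (𝓝 (1 / Complex.Gamma a)) := by
  by_cases ha : ∃ m : ℕ, a = -m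
  · obtain ⟨m, rfl⟩ := ha
    rw [Complex.Gamma_neg_nat_eq_zero, div_zero]
    refine tendsto_const_nhds.congr' ?_
    filter_upwards [eventually_gt_atTop m] with n hn
    rw [eig_neg_nat hn, zero_div]
  · push Not at ha
    have h1 := (Complex.GammaSeq_tendsto_Gamma a).inv₀ (Complex.Gamma_ne_zero ha)
    have h2 : Tendsto (fun n : ℕ => ((n : ℂ) + a) / n) atTop (𝓝 1) := by
      have : Tendsto (fun n : ℕ => 1 + a / (n : ℂ)) atTop (𝓝 (1 + 0)) :=
        tendsto_const_nhds.add (tendsto_const_div_atTop_nhds_zero_nat a)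
      rw [add_zero] at this
      refine this.congr' ?_
      filter_upwards [eventually_gt_atTop 0] with n hn
      have : (n : ℂ) ≠ 0 := Nat.cast_ne_zero.2 hn.ne'
      field_simp
    have h3 := h1.div h2 one_ne_zero
    rw [div_one, ← one_div] at h3
    refine h3.congr' ?_
    filter_upwards [eventually_gt_atTop 0] with n hn
    have hn' : (n : ℂ) ≠ 0 := Nat.cast_ne_zero.2 hn.ne'
    have hna : (n : ℂ) + a ≠ 0 := fun h => ha n (eq_neg_of_add_eq_zero_right h)
    have hf : (n ! : ℂ) ≠ 0 := Nat.cast_ne_zero.2 n.factorial_ne_zero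
    have hc : (n : ℂ) ^ a ≠ 0 := (Complex.cpow_ne_zero_iff_of_exponent_ne_zero (by
      rintro rfl; exact ha 0 (by simp))).2 hn'
    simp only [Complex.GammaSeq, Pi.div_apply]
    rw [Finset.prod_range_succ, ← eig_mul_factorial, Complex.cpow_sub _ _ hn',
      Complex.cpow_one]
    by_cases he : eig a n = 0
    · simp [he]
    · have : a + n ≠ 0 := by rwa [add_comm]
      field_simp
      ring

theorem tendsto_norm_eig (a : ℂ) :
    Tendsto (fun n : ℕ => ‖eig a n‖ / ((n : ℝ) + 1) ^ (a.re - 1)) atTop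
      (𝓝 ‖1 / Complex.Gamma a‖) := by
  have h1 := (tendsto_eig a).norm
  have h2 : Tendsto (fun n : ℕ => (((n : ℝ) / (n + 1)) ^ (a.re - 1))) atTop (𝓝 1) := by
    have := (tendsto_natCast_div_add_atTop (1 : ℝ)).rpow_const (p := a.re - 1)
      (Or.inl one_ne_zero)
    rwa [Real.one_rpow] at this
  have h3 := h1.mul h2
  rw [mul_one] at h3
  refine h3.congr' ?_
  filter_upwards [eventually_gt_atTop 0] with n hn
  have hn' : (0 : ℝ) < n := Nat.cast_pos.2 hn
  rw [norm_div, Complex.norm_natCast_cpow_of_pos hn, Real.div_rpow hn'.le (by positivity),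
    Complex.sub_re, Complex.one_re]
  have : (n : ℝ) ^ (a.re - 1) ≠ 0 := (Real.rpow_pos_of_pos hn' _).ne'
  field_simp

theorem norm_eig_le (a : ℂ) : ∃ C, 0 < C ∧ ∀ n : ℕ, ‖eig a n‖ ≤ C * ((n : ℝ) + 1) ^ (a.re - 1) := by
  obtain ⟨C, hC⟩ := (tendsto_norm_eig a).bddAbove_range
  refine ⟨max C 1, by positivity, fun n => ?_⟩
  have := hC ⟨n, rfl⟩
  dsimp only at this
  rw [div_le_iff₀ (by positivity)] at this
  exact this.trans (by gcongr; exact le_max_left ..)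

theorem norm_eig_le_of_re_le {a : ℂ} {e : ℝ} (h : a.re - 1 ≤ e) :
    ∃ C, 0 < C ∧ ∀ n : ℕ, ‖eig a n‖ ≤ C * ((n : ℝ) + 1) ^ e := by
  obtain ⟨C, hC, h1⟩ := norm_eig_le a
  refine ⟨C, hC, fun n => (h1 n).trans ?_⟩
  gcongr
  linarith [Nat.cast_nonneg (α := ℝ) n]

theorem eig_le {s : ℝ} (hs : 0 < s) :
    ∃ C, 0 < C ∧ ∀ n : ℕ, eig s n ≤ C * ((n : ℝ) + 1) ^ (s - 1) := by
  obtain ⟨C, hC, h⟩ := norm_eig_le (s : ℂ)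
  refine ⟨C, hC, fun n => ?_⟩
  have := h n
  rwa [← ofReal_eig, Complex.norm_real, Real.norm_eq_abs, abs_of_pos (eig_pos hs n),
    Complex.ofReal_re] at this

theorem le_eig {s : ℝ} (hs : 0 < s) :
    ∃ C, 0 < C ∧ ∀ n : ℕ, ((n : ℝ) + 1) ^ (s - 1) ≤ C * eig s n := by
  have h := (tendsto_norm_eig (s : ℂ)).inv₀ (by
    rw [norm_ne_zero_iff]
    refine div_ne_zero one_ne_zero ?_
    rw [Complex.Gamma_ofReal]
    exact_mod_cast (Real.Gamma_pos_of_pos hs).ne')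
  obtain ⟨C, hC⟩ := h.bddAbove_range
  refine ⟨max C 1, by positivity, fun n => ?_⟩
  have := hC ⟨n, rfl⟩
  dsimp only at this
  rw [← ofReal_eig, Complex.norm_real, Real.norm_eq_abs, abs_of_pos (eig_pos hs n), inv_div,
    div_le_iff₀ (eig_pos hs n), Complex.ofReal_re] at this
  refine this.trans ?_
  have := (eig_pos hs n).le
  gcongr
  exact le_max_left ..

/-! ### Averages of powers -/

theorem wt_nonneg (t n k : ℕ) : 0 ≤ wt ℝ t n k := by
  unfold wt
  positivity

theorem ofReal_wt (t n k : ℕ) : ((wt ℝ t n k : ℝ) : ℂ) = wt ℂ t n k := by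
  simp [wt]

theorem norm_avg₂_le {t n : ℕ} {f g : ℕ → ℂ} {F G : ℕ → ℝ} (hf : ∀ k, t ≤ k → ‖f k‖ ≤ F k)
    (hg : ∀ k, t ≤ k → ‖g k‖ ≤ G k) : ‖avg₂ t f g n‖ ≤ avg₂ t F G n := by
  refine (norm_sum_le _ _).trans (Finset.sum_le_sum fun k _ => ?_)
  rcases lt_or_ge k t with hkt | hkt
  · simp [wt_eq_zero (Or.inl hkt)]
  rcases lt_or_ge (n - 1 - k) t with hkt' | hkt'
  · simp [wt_eq_zero (Or.inr hkt')]
  rw [norm_mul, norm_mul, ← ofReal_wt, Complex.norm_real, Real.norm_eq_abs,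
    abs_of_nonneg (wt_nonneg t n k)]
  have := wt_nonneg t n k
  have := hf k hkt
  have := hg _ hkt'
  have := (norm_nonneg (f k)).trans (hf k hkt)
  gcongr

theorem avg₂_mono {t n : ℕ} {f g F G : ℕ → ℝ} (hf0 : ∀ k, t ≤ k → 0 ≤ f k)
    (hg0 : ∀ k, t ≤ k → 0 ≤ g k) (hf : ∀ k, t ≤ k → f k ≤ F k)
    (hg : ∀ k, t ≤ k → g k ≤ G k) : avg₂ t f g n ≤ avg₂ t F G n := by
  refine Finset.sum_le_sum fun k _ => ?_
  rcases lt_or_ge k t with hkt | hkt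
  · simp [wt_eq_zero (Or.inl hkt)]
  rcases lt_or_ge (n - 1 - k) t with hkt' | hkt'
  · simp [wt_eq_zero (Or.inr hkt')]
  have := wt_nonneg t n k
  have := hf k hkt
  have := hg _ hkt'
  have := hf0 k hkt
  have := hg0 _ hkt'
  gcongr
  linarith

theorem le_choose (t : ℕ) : ∃ c : ℝ, 0 < c ∧ ∀ p : ℕ,
    ((p : ℝ) + 1) ^ ((2 * t + 1 : ℕ) : ℝ) ≤ c * ((2 * t + 1 + p).choose (2 * t + 1) : ℕ) := by
  obtain ⟨C, hC, h⟩ := le_eig (s := (2 * t + 2 : ℕ)) (by positivity)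
  refine ⟨C, hC, fun p => ?_⟩
  have h1 := choose_mul_eig (1 : ℝ) (2 * t + 1) p
  rw [eig_one, eig_one, mul_one, one_mul] at h1
  have h2 : (1 : ℝ) + (2 * t + 1 : ℕ) = (2 * t + 2 : ℕ) := by push_cast; ring
  rw [h1, h2]
  convert h p using 2
  push_cast
  ring

/-- The average of a product of powers has the expected order. -/
theorem avg₂_rpow_le {t : ℕ} {e f : ℝ} (he : -1 < e) (hf : -1 < f) :
    ∃ C, 0 < C ∧ ∀ n : ℕ, avg₂ t (fun k => ((k : ℝ) + 1) ^ e) (fun k => ((k : ℝ) + 1) ^ f) n ≤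
      C * ((n : ℝ) + 1) ^ (e + f) := by
  obtain ⟨C₁, hC₁, h₁⟩ := le_eig (s := e + 1) (by linarith)
  obtain ⟨C₂, hC₂, h₂⟩ := le_eig (s := f + 1) (by linarith)
  obtain ⟨C₃, hC₃, h₃⟩ := eig_le (s := e + 1 + (f + 1) + 2 * t) (by linarith)
  obtain ⟨C₄, hC₄, h₄⟩ := le_choose t
  simp only [add_sub_cancel_right] at h₁ h₂
  set D := (2 * t + 2 : ℝ) ^ |e + f| with hD
  have hD0 : 0 < D := by positivity
  have hx := (eig_pos (show 0 < e + 1 by linarith) t).le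
  have hy := (eig_pos (show 0 < f + 1 by linarith) t).le
  refine ⟨C₁ * C₂ * (eig (e + 1) t * eig (f + 1) t) * C₃ * C₄ * D + 1, by positivity, fun n => ?_⟩
  rcases le_or_gt n (2 * t) with hn | hn
  · rw [avg₂_eq_zero_of_le _ _ hn]
    positivity
  obtain ⟨p, rfl⟩ := Nat.exists_eq_add_of_le (show 2 * t + 1 ≤ n from hn)
  have hch : (0 : ℝ) < ((2 * t + 1 + p).choose (2 * t + 1) : ℕ) :=
    Nat.cast_pos.2 (Nat.choose_pos (by omega))
  have hp : ((p : ℝ) + 1) ^ (e + f) ≤ D * (((2 * t + 1 + p : ℕ) : ℝ) + 1) ^ (e + f) := by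
    rcases le_or_gt 0 (e + f) with h0 | h0
    · have h1 : (1 : ℝ) ≤ D := Real.one_le_rpow (by linarith [Nat.cast_nonneg (α := ℝ) t])
        (abs_nonneg _)
      refine le_trans ?_ (le_mul_of_one_le_left (by positivity) h1)
      gcongr
      linarith
    · rw [hD, abs_of_neg h0, Real.rpow_neg (by positivity), ← div_eq_inv_mul, le_div_iff₀ (by positivity),
        ← Real.mul_rpow (by positivity) (by positivity)]
      apply Real.rpow_le_rpow_of_nonpos (by positivity) _ h0.le
      push_cast
      nlinarith [Nat.cast_nonneg (α := ℝ) t, Nat.cast_nonneg (α := ℝ) p,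
        mul_nonneg (Nat.cast_nonneg (α := ℝ) t) (Nat.cast_nonneg (α := ℝ) p)]
  calc _ ≤ avg₂ t (fun k => C₁ * eig (e + 1) k) (fun k => C₂ * eig (f + 1) k) (2 * t + 1 + p) :=
        avg₂_mono (fun k _ => by positivity) (fun k _ => by positivity) (fun k _ => h₁ k)
          (fun k _ => h₂ k)
    _ = C₁ * C₂ * (eig (e + 1) t * eig (f + 1) t) * (eig (e + 1 + (f + 1) + 2 * t) p) /
          ((2 * t + 1 + p).choose (2 * t + 1) : ℕ) := by
        rw [avg₂_const_mul_left, avg₂_const_mul_right, avg₂_eig]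
        ring
    _ ≤ C₁ * C₂ * (eig (e + 1) t * eig (f + 1) t) *
          (C₃ * (((p : ℝ) + 1) ^ (e + f) * ((p : ℝ) + 1) ^ ((2 * t + 1 : ℕ) : ℝ))) /
          ((2 * t + 1 + p).choose (2 * t + 1) : ℕ) := by
        gcongr
        refine (h₃ p).trans (le_of_eq ?_)
        rw [← Real.rpow_add (by positivity)]
        congr 2
        push_cast
        ring
    _ ≤ C₁ * C₂ * (eig (e + 1) t * eig (f + 1) t) *
          (C₃ * (((p : ℝ) + 1) ^ (e + f) * (C₄ * ((2 * t + 1 + p).choose (2 * t + 1) : ℕ)))) /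
          ((2 * t + 1 + p).choose (2 * t + 1) : ℕ) := by
        gcongr
        exact h₄ p
    _ = C₁ * C₂ * (eig (e + 1) t * eig (f + 1) t) * C₃ * C₄ * ((p : ℝ) + 1) ^ (e + f) := by
        field_simp
    _ ≤ C₁ * C₂ * (eig (e + 1) t * eig (f + 1) t) * C₃ * C₄ *
          (D * (((2 * t + 1 + p : ℕ) : ℝ) + 1) ^ (e + f)) := by
        gcongr
    _ ≤ _ := by
        have : 0 ≤ (((2 * t + 1 + p : ℕ) : ℝ) + 1) ^ (e + f) := by positivity
        nlinarith

theorem norm_avg₂_le_rpow {t : ℕ} {f g : ℕ → ℂ} {e e' A B : ℝ} (he : -1 < e) (he' : -1 < e')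
    (hf : ∀ k, t ≤ k → ‖f k‖ ≤ A * ((k : ℝ) + 1) ^ e)
    (hg : ∀ k, t ≤ k → ‖g k‖ ≤ B * ((k : ℝ) + 1) ^ e') :
    ∃ C, 0 < C ∧ ∀ n : ℕ, ‖avg₂ t f g n‖ ≤ C * ((n : ℝ) + 1) ^ (e + e') := by
  obtain ⟨C, hC, h⟩ := avg₂_rpow_le (t := t) he he'
  have hA : 0 ≤ A := by
    have := (norm_nonneg _).trans (hf t le_rfl)
    exact nonneg_of_mul_nonneg_left this (by positivity)
  have hB : 0 ≤ B := by
    have := (norm_nonneg _).trans (hg t le_rfl)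
    exact nonneg_of_mul_nonneg_left this (by positivity)
  refine ⟨A * B * C + 1, by positivity, fun n => (norm_avg₂_le hf hg).trans ?_⟩
  rw [avg₂_const_mul_left, avg₂_const_mul_right, ← mul_assoc]
  have h1 := h n
  have h2 : 0 ≤ ((n : ℝ) + 1) ^ (e + e') := by positivity
  have h3 : 0 ≤ A * B := by positivity
  nlinarith

theorem indProd_real_gt {t : ℕ} {s : ℝ} (hs : 2 < s) : 2 < indProd t s := by
  rw [← indProd_two (K := ℝ) t]
  refine Finset.prod_lt_prod_of_nonempty (fun j _ => by positivity) (fun j _ => ?_) (Icc_nonempty t)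
  have : (0 : ℝ) < j + 1 := by positivity
  gcongr

/-- Above the linear order the solution of the recurrence has the order of the toll. -/
theorem transfer_superlinear {t : ℕ} {a b : ℕ → ℂ} {e B : ℝ} (he : 1 < e)
    (h : ∀ n, 2 * t + 1 ≤ n → a n = b n + 2 * avg t a n)
    (hb : ∀ n, ‖b n‖ ≤ B * ((n : ℝ) + 1) ^ e) :
    ∃ C, 0 < C ∧ ∀ n : ℕ, ‖a n‖ ≤ C * ((n : ℝ) + 1) ^ e := by
  obtain ⟨C₁, hC₁, h₁⟩ := le_eig (s := e + 1) (by linarith)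
  obtain ⟨C₂, hC₂, h₂⟩ := eig_le (s := e + 1) (by linarith)
  simp only [add_sub_cancel_right] at h₁ h₂
  have hP := indProd_real_gt (t := t) (show 2 < e + 1 by linarith)
  set P := indProd t (e + 1) with hPdef
  have hpos := fun n => eig_pos (show 0 < e + 1 by linarith) n
  have hB : 0 ≤ B := by
    have := (norm_nonneg _).trans (hb 0)
    exact nonneg_of_mul_nonneg_left this (by positivity)
  set D := B * C₁ * P / (P - 2) + ∑ i ∈ Finset.range (2 * t + 1), ‖a i‖ / eig (e + 1) i + 1 with hD
  have hP2 : 0 < P - 2 := by linarith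
  have hsum : 0 ≤ ∑ i ∈ Finset.range (2 * t + 1), ‖a i‖ / eig (e + 1) i :=
    Finset.sum_nonneg fun i _ => by have := hpos i; positivity
  have hq : 0 ≤ B * C₁ * P / (P - 2) := by positivity
  have hD0 : 0 < D := by positivity
  have key : ∀ n, ‖a n‖ ≤ D * eig (e + 1) n := by
    intro n
    induction n using Nat.strong_induction_on with
    | _ n ih =>
      rcases lt_or_ge n (2 * t + 1) with hn | hn
      · rw [← div_le_iff₀ (hpos n)]
        have := Finset.single_le_sum (f := fun i => ‖a i‖ / eig (e + 1) i)
          (fun i _ => by have := hpos i; positivity) (Finset.mem_range.2 hn)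
        linarith
      · rw [h n hn]
        have h3 : ‖avg t a n‖ ≤ D * avg t (eig (e + 1)) n := by
          rw [← avg_const_mul]
          refine (norm_sum_le _ _).trans (Finset.sum_le_sum fun k hk => ?_)
          rw [norm_mul, ← ofReal_wt, Complex.norm_real, Real.norm_eq_abs,
            abs_of_nonneg (wt_nonneg t n k)]
          exact mul_le_mul_of_nonneg_left (ih k (Finset.mem_range.1 hk)) (wt_nonneg t n k)
        have h4 := avg_eig_mul hn (e + 1)
        rw [← hPdef] at h4
        have h5 : avg t (eig (e + 1)) n = eig (e + 1) n / P := by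
          rw [eq_div_iff (by linarith), h4]
        have h6 : ‖b n‖ ≤ D * eig (e + 1) n * ((P - 2) / P) := by
          refine (hb n).trans ?_
          calc B * ((n : ℝ) + 1) ^ e ≤ B * (C₁ * eig (e + 1) n) := by gcongr; exact h₁ n
            _ = B * C₁ * P / (P - 2) * eig (e + 1) n * ((P - 2) / P) := by
                have : P ≠ 0 := by linarith
                have : P - 2 ≠ 0 := by linarith
                field_simp
            _ ≤ _ := by
                have := (hpos n).le
                have : 0 ≤ (P - 2) / P := by apply div_nonneg <;> linarith
                gcongr
                linarith
        refine (norm_add_le _ _).trans ?_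
        rw [norm_mul, Complex.norm_ofNat]
        rw [h5] at h3
        have : D * eig (e + 1) n * ((P - 2) / P) + 2 * (D * (eig (e + 1) n / P))
            = D * eig (e + 1) n := by
          have : P ≠ 0 := by linarith
          field_simp
          ring
        linarith
  refine ⟨D * C₂, by positivity, fun n => (key n).trans ?_⟩
  rw [mul_assoc]
  exact mul_le_mul_of_nonneg_left (h₂ n) hD0.le

/-! ### The spectral decomposition -/

section Theta

set_option linter.unusedSectionVars false

variable {K : Type*} [Field K] [CharZero K]

theorem aeval_theta_eig (q : Polynomial K) (a : K) :
    Polynomial.aeval theta q (eig a) = q.eval a • eig a := by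
  induction q using Polynomial.induction_on' with
  | add p q hp hq => rw [map_add, LinearMap.add_apply, hp, hq, Polynomial.eval_add, add_smul]
  | monomial n c =>
    have : ∀ n : ℕ, (theta (K := K) ^ n) (eig a) = a ^ n • eig a := by
      intro n
      induction n with
      | zero => simp
      | succ n ih => rw [pow_succ', Module.End.mul_apply, ih, map_smul, theta_eig, smul_smul, pow_succ]
    rw [Polynomial.aeval_monomial, Module.End.mul_apply, this, Module.algebraMap_end_apply, smul_smul,
      Polynomial.eval_monomial]

theorem theta_pow_eq_zero {c : ℕ → K} {N : ℕ} (hc : ∀ n ≤ N, c n = 0) (d : ℕ) :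
    ∀ n, n + d ≤ N → (theta ^ d) c n = 0 := by
  induction d with
  | zero => intro n hn; exact hc n hn
  | succ d ih =>
    intro n hn
    rw [pow_succ', Module.End.mul_apply, theta_apply, ih n (by omega), ih (n + 1) (by omega)]
    simp

theorem aeval_theta_eq_zero {c : ℕ → K} {N d : ℕ} (hc : ∀ n ≤ N, c n = 0) {q : Polynomial K}
    (hq : q.natDegree ≤ d) {n : ℕ} (hn : n + d ≤ N) : Polynomial.aeval theta q c n = 0 := by
  rw [Polynomial.aeval_eq_sum_range, LinearMap.sum_apply, Finset.sum_apply]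
  refine Finset.sum_eq_zero fun i hi => ?_
  rw [LinearMap.smul_apply, Pi.smul_apply, theta_pow_eq_zero hc i n, smul_zero]
  have := Finset.mem_range.1 hi
  omega

theorem aeval_prod_eq_zero (t i : ℕ) {b : ℕ → K} (hb : ∀ n, t + i ≤ n → b n = 0) :
    ∀ n, t ≤ n → Polynomial.aeval (theta (K := K))
      (∏ j ∈ Finset.range i, (Polynomial.X + Polynomial.C ((t + j : ℕ) : K))) b n = 0 := by
  induction i generalizing b with
  | zero => simpa using hb
  | succ i ih =>
    rw [Finset.prod_range_succ, map_mul, Module.End.mul_eq_comp]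
    refine ih fun n hn => ?_
    simp only [map_add, Polynomial.aeval_X, Polynomial.aeval_C, LinearMap.add_apply, Pi.add_apply,
      theta_apply, Module.algebraMap_end_apply, Pi.smul_apply, smul_eq_mul]
    rw [hb (n + 1) (by omega)]
    rcases hn.eq_or_lt with rfl | hn
    · ring
    · rw [hb n (by omega)]
      ring

theorem thetaProd_eq_zero (t : ℕ) {b : ℕ → K} (hb : ∀ n, 2 * t + 1 ≤ n → b n = 0) {n : ℕ}
    (hn : t ≤ n) : thetaProd t b n = 0 := by
  rw [thetaProd, Icc_eq_image]
  exact aeval_prod_eq_zero t (t + 1) (fun n hn => hb n (by omega)) n hn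

end Theta

theorem natDegree_basisPoly_le {t : ℕ} {z : ℂ} (hz : z ∈ indRoots t) :
    (basisPoly t z).natDegree ≤ t := by
  have h := Lagrange.degree_basis (s := indRoots t) (v := id) (Set.injOn_id _) hz
  have hc : (indRoots t).card = t + 1 := by
    have h1 := congrArg Polynomial.natDegree (indPoly_eq_nodal t)
    rw [Lagrange.natDegree_nodal] at h1
    rw [← h1, indPoly, Polynomial.natDegree_sub_C, natDegree_prod_X_add]
  rw [hc] at h
  exact Polynomial.natDegree_le_of_degree_le (by rw [basisPoly, h]; simp)

/-- The component of a sequence that belongs to a zero of the indicial polynomial. -/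
def component (t : ℕ) (z : ℂ) (a : ℕ → ℂ) : ℕ → ℂ := Polynomial.aeval theta (basisPoly t z) a

theorem sum_component (t : ℕ) (a : ℕ → ℂ) (n : ℕ) :
    ∑ z ∈ indRoots t, component t z a n = a n := by
  have := congrArg (fun q => Polynomial.aeval (theta (K := ℂ)) q a n) (sum_basisPoly t)
  simpa [component, LinearMap.sum_apply] using this

theorem theta_component {t : ℕ} {z : ℂ} (hz : z ∈ indRoots t) (a : ℕ → ℂ) (n : ℕ) :
    (n + 1) * component t z a (n + 1) = (n + z) * component t z a n +
      res t z / (2 * ∏ j ∈ Finset.Icc t (2 * t), (j + 1 : ℂ)) *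
        Polynomial.aeval theta (indPoly t) a n := by
  have h := congrArg (fun q => Polynomial.aeval (theta (K := ℂ)) q a n) (X_sub_C_mul_basisPoly hz)
  simp only [map_mul, map_sub, Polynomial.aeval_X, Polynomial.aeval_C, Module.End.mul_apply,
    LinearMap.sub_apply, Pi.sub_apply, Module.algebraMap_end_apply, Pi.smul_apply, smul_eq_mul,
    theta_apply] at h
  rw [component]
  linear_combination h

theorem aeval_indPoly (t : ℕ) (a : ℕ → ℂ) (n : ℕ) :
    Polynomial.aeval theta (indPoly t) a n =
      thetaProd t a n - 2 * (∏ j ∈ Finset.Icc t (2 * t), (j + 1 : ℂ)) * a n := by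
  rw [indPoly, map_sub, LinearMap.sub_apply, Pi.sub_apply, Polynomial.aeval_C,
    Module.algebraMap_end_apply, Pi.smul_apply, smul_eq_mul, thetaProd]

theorem thetaProd_two_avg (t : ℕ) (a : ℕ → ℂ) (n : ℕ) :
    thetaProd t (fun k => 2 * avg t a k) n =
      2 * (∏ j ∈ Finset.Icc t (2 * t), (j + 1 : ℂ)) * if t ≤ n then a n else 0 := by
  have h : (fun k => 2 * avg t a k) = (2 : ℂ) • avg t a := rfl
  rw [h, map_smul, thetaProd_avg, Pi.smul_apply, Pi.smul_apply, smul_eq_mul, smul_eq_mul]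
  push_cast
  ring

theorem eig_root_ne_zero {t : ℕ} {z : ℂ} (hz : indProd t z = 2) : eig z t ≠ 0 := by
  refine eig_ne_zero fun i hi h => ?_
  have hzi : z = -(i : ℂ) := eq_neg_of_add_eq_zero_left h
  have h1 : ‖indProd t z‖ ≤ 1 := by
    rw [indProd, norm_prod]
    refine Finset.prod_le_one (fun _ _ => norm_nonneg _) fun j hj => ?_
    rw [Finset.mem_Icc] at hj
    rw [norm_div, hzi, show (-(i : ℂ) + j) = ((j - i : ℕ) : ℂ) by
      rw [Nat.cast_sub (by omega)]; ring, show ((j : ℂ) + 1) = ((j + 1 : ℕ) : ℂ) by push_cast; rfl,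
      Complex.norm_natCast, Complex.norm_natCast]
    refine div_le_one_of_le₀ ?_ (by positivity)
    exact_mod_cast (by omega)
  rw [hz] at h1
  norm_num at h1

/-- Solutions of the homogeneous recurrence are combinations of the eigensequences. -/
theorem homogeneous_expansion {t : ℕ} {a : ℕ → ℂ}
    (h : ∀ n, 2 * t + 1 ≤ n → a n = 2 * avg t a n) {n : ℕ} (hn : t ≤ n) :
    a n = ∑ z ∈ indRoots t, component t z a t / eig z t * eig z n := by
  have hzero : ∀ n, t ≤ n → Polynomial.aeval theta (indPoly t) a n = 0 := by
    intro n hn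
    have h1 : a = (fun n => a n - 2 * avg t a n) + fun n => 2 * avg t a n := by
      funext n; simp
    have h2 : thetaProd t a n = 2 * (∏ j ∈ Finset.Icc t (2 * t), (j + 1 : ℂ)) * a n := by
      conv_lhs => rw [h1]
      rw [map_add, Pi.add_apply, thetaProd_two_avg, if_pos hn,
        thetaProd_eq_zero t (fun n hn => ?_) hn, zero_add]
      rw [h n hn, ← h n hn, sub_self]
    rw [aeval_indPoly, h2, sub_self]
  rw [← sum_component t a n]
  refine Finset.sum_congr rfl fun z hz => ?_
  have he := eig_root_ne_zero (mem_indRoots.1 hz)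
  induction n, hn using Nat.le_induction with
  | base => field_simp
  | succ n hn ih =>
    have h1 := theta_component hz a n
    rw [hzero n hn, mul_zero, add_zero, ih] at h1
    apply mul_left_cancel₀ (Nat.cast_add_one_ne_zero n : (n + 1 : ℂ) ≠ 0)
    rw [h1, mul_left_comm (_ + 1 : ℂ), succ_mul_eig_succ]
    ring

/-- The component of a sequence that is constant up to index `2t`. -/
theorem component_of_eq_one {t : ℕ} {z : ℂ} (hz : z ∈ indRoots t) {a : ℕ → ℂ}
    (ha : ∀ n ≤ 2 * t, a n = 1) : component t z a t = res t z / (2 * (z - 1)) := by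
  have h1 : component t z a t = component t z (eig 1) t := by
    rw [← sub_eq_zero, component, component, ← Pi.sub_apply, ← map_sub]
    refine aeval_theta_eq_zero (N := 2 * t) (fun n hn => ?_) (natDegree_basisPoly_le hz) (by omega)
    rw [Pi.sub_apply, ha n hn, eig_one, sub_self]
  rw [h1, component, aeval_theta_eig, Pi.smul_apply, eig_one, smul_eq_mul, mul_one]
  have h2 := congrArg (Polynomial.eval 1) (X_sub_C_mul_basisPoly hz)
  simp only [Polynomial.eval_mul, Polynomial.eval_sub, Polynomial.eval_X, Polynomial.eval_C,
    eval_indPoly, indProd_one] at h2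
  have hz1 : z - 1 ≠ 0 := by
    rw [sub_ne_zero]
    rintro rfl
    have := mem_indRoots.1 hz
    rw [indProd_one] at this
    norm_num at this
  have := prod_Icc_add_one_ne_zero t
  field_simp at h2 ⊢
  linear_combination -h2

theorem norm_nat_add_le {z : ℂ} {s : ℝ} (hs : z.re < s) :
    ∃ δ, 0 < δ ∧ ∀ᶠ n : ℕ in atTop, ‖(n : ℂ) + z‖ ≤ n + s - δ := by
  refine ⟨(s - z.re) / 2, by linarith, ?_⟩
  have h1 : ∀ᶠ n : ℕ in atTop, z.im ^ 2 / (s - z.re) + |z.re| + |s| + 1 ≤ (n : ℝ) :=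
    tendsto_natCast_atTop_atTop.eventually_ge_atTop _
  filter_upwards [h1] with n hn
  have hd : 0 < s - z.re := by linarith
  have hq : 0 ≤ z.im ^ 2 / (s - z.re) := by positivity
  have e1 := neg_abs_le z.re
  have e2 := neg_abs_le s
  have e3 : z.im ^ 2 ≤ (n + z.re) * (s - z.re) := by
    rw [← div_le_iff₀ hd]
    have := abs_nonneg s
    linarith [le_abs_self z.re]
  refine (pow_le_pow_iff_left₀ (norm_nonneg _) (by linarith [abs_nonneg z.re, abs_nonneg s, le_abs_self s]) two_ne_zero).1 ?_
  rw [Complex.sq_norm, Complex.normSq_apply]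
  simp only [Complex.add_re, Complex.natCast_re, Complex.add_im, Complex.natCast_im, zero_add]
  nlinarith

/-- A first-order recurrence whose solution is smaller than its driving exponent. -/
theorem first_order_bound {c b : ℕ → ℂ} {z r : ℂ} {e B : ℝ} (he : 0 ≤ e) (hz : z.re - 1 < e)
    (h : ∀ n : ℕ, (n + 1) * c (n + 1) = (n + z) * c n + r * b n)
    (hb : ∀ n, ‖b n‖ ≤ B * ((n : ℝ) + 1) ^ e) :
    ∃ C, 0 < C ∧ ∀ n : ℕ, ‖c n‖ ≤ C * ((n : ℝ) + 1) ^ e := by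
  obtain ⟨C₁, hC₁, h₁⟩ := le_eig (s := e + 1) (by linarith)
  obtain ⟨C₂, hC₂, h₂⟩ := eig_le (s := e + 1) (by linarith)
  simp only [add_sub_cancel_right] at h₁ h₂
  obtain ⟨δ, hδ, hev⟩ := norm_nat_add_le (z := z) (s := e + 1) (by linarith)
  obtain ⟨N, hN⟩ := eventually_atTop.1 hev
  have hpos := fun n => eig_pos (show 0 < e + 1 by linarith) n
  have hB : 0 ≤ B := by
    have := (norm_nonneg _).trans (hb 0)
    exact nonneg_of_mul_nonneg_left this (by positivity)
  set D := ‖r‖ * B * C₁ / δ + ∑ i ∈ Finset.range (N + 1), ‖c i‖ / eig (e + 1) i + 1 with hD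
  have hsum : 0 ≤ ∑ i ∈ Finset.range (N + 1), ‖c i‖ / eig (e + 1) i :=
    Finset.sum_nonneg fun i _ => by have := hpos i; positivity
  have hq : 0 ≤ ‖r‖ * B * C₁ / δ := by positivity
  have hD0 : 0 < D := by positivity
  have hsmall : ∀ n ≤ N, ‖c n‖ ≤ D * eig (e + 1) n := by
    intro n hn
    rw [← div_le_iff₀ (hpos n)]
    have := Finset.single_le_sum (f := fun i => ‖c i‖ / eig (e + 1) i)
      (fun i _ => by have := hpos i; positivity) (Finset.mem_range.2 (Nat.lt_succ_of_le hn))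
    linarith
  have key : ∀ n, ‖c n‖ ≤ D * eig (e + 1) n := by
    intro n
    rcases le_total n N with hn | hn
    · exact hsmall n hn
    · induction n, hn using Nat.le_induction with
      | base => exact hsmall N le_rfl
      | succ n hn ih =>
        have h3 : ((n : ℝ) + 1) * ‖c (n + 1)‖ ≤ ((n : ℝ) + 1) * (D * eig (e + 1) (n + 1)) := by
          have e1 : ‖((n : ℂ) + 1) * c (n + 1)‖ = ((n : ℝ) + 1) * ‖c (n + 1)‖ := by
            rw [norm_mul, show ((n : ℂ) + 1) = ((n + 1 : ℕ) : ℂ) by push_cast; rfl,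
              Complex.norm_natCast]
            push_cast
            rfl
          rw [← e1, h n, mul_left_comm, succ_mul_eig_succ]
          refine (norm_add_le _ _).trans ?_
          rw [norm_mul, norm_mul]
          have e2 : ‖(n : ℂ) + z‖ * ‖c n‖ ≤ (n + (e + 1) - δ) * (D * eig (e + 1) n) := by
            have := hN n hn
            gcongr
            exact (norm_nonneg _).trans this
          have e3 : ‖r‖ * ‖b n‖ ≤ δ * (D * eig (e + 1) n) := by
            calc ‖r‖ * ‖b n‖ ≤ ‖r‖ * (B * (C₁ * eig (e + 1) n)) := by
                  gcongr
                  exact (hb n).trans (by gcongr; exact h₁ n)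
              _ = δ * ((‖r‖ * B * C₁ / δ) * eig (e + 1) n) := by field_simp
              _ ≤ _ := by
                have := (hpos n).le
                gcongr
                linarith
          nlinarith
        exact le_of_mul_le_mul_left h3 (by positivity)
  refine ⟨D * C₂, by positivity, fun n => (key n).trans ?_⟩
  rw [mul_assoc]
  exact mul_le_mul_of_nonneg_left (h₂ n) hD0.le

theorem tendsto_rpow_div {e : ℝ} (he : e < 1) :
    Tendsto (fun n : ℕ => ((n : ℝ) + 1) ^ e / (n + 1)) atTop (𝓝 0) := by
  have h1 : Tendsto (fun n : ℕ => ((n : ℝ) + 1) ^ (-(1 - e))) atTop (𝓝 0) :=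
    (tendsto_rpow_neg_atTop (by linarith)).comp
      (tendsto_atTop_add_const_right _ _ tendsto_natCast_atTop_atTop)
  refine h1.congr fun n => ?_
  rw [neg_sub, Real.rpow_sub_one (by positivity)]

/-- The weights of the linear functional that gives the linear term of a solution. -/
def tollWeight (t : ℕ) (b : ℕ → ℂ) (n : ℕ) : ℂ :=
  if t ≤ n then b n / ((n + 1) * (n + 2)) else 0

theorem norm_tollWeight_le (t : ℕ) {b : ℕ → ℂ} {e B : ℝ}
    (hb : ∀ n, ‖b n‖ ≤ B * ((n : ℝ) + 1) ^ e) (n : ℕ) :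
    ‖tollWeight t b n‖ ≤ B * ((n : ℝ) + 1) ^ (e - 2) := by
  have h0 := (norm_nonneg _).trans (hb n)
  have hB : 0 ≤ B := nonneg_of_mul_nonneg_left h0 (by positivity)
  unfold tollWeight
  split_ifs
  · rw [norm_div, norm_mul, show ((n : ℂ) + 1) = ((n + 1 : ℕ) : ℂ) by push_cast; rfl,
      show ((n : ℂ) + 2) = ((n + 2 : ℕ) : ℂ) by push_cast; rfl, Complex.norm_natCast,
      Complex.norm_natCast, Real.rpow_sub (by positivity), ← mul_div_assoc]
    push_cast
    rw [show (2 : ℝ) = ((2 : ℕ) : ℝ) by norm_num, Real.rpow_natCast]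
    gcongr
    · exact hb n
    · push_cast
      nlinarith [Nat.cast_nonneg (α := ℝ) n]
  · rw [norm_zero]
    positivity

theorem summable_rpow_succ {e : ℝ} (he : e < -1) : Summable fun n : ℕ => ((n : ℝ) + 1) ^ e := by
  have := (summable_nat_add_iff 1).2 (Real.summable_nat_rpow.2 he)
  simpa using this

theorem summable_tollWeight (t : ℕ) {b : ℕ → ℂ} {e B : ℝ} (he : e < 1)
    (hb : ∀ n, ‖b n‖ ≤ B * ((n : ℝ) + 1) ^ e) : Summable (tollWeight t b) :=
  Summable.of_norm_bounded ((summable_rpow_succ (by linarith)).mul_left B) (norm_tollWeight_le t hb)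

/-- Below the linear order, the solution of the recurrence is asymptotically linear. -/
theorem transfer_sublinear {t : ℕ} {a b : ℕ → ℂ} {e B : ℝ} (he : e < 1)
    (h : ∀ n, a n = b n + 2 * avg t a n) (hb : ∀ n, ‖b n‖ ≤ B * ((n : ℝ) + 1) ^ e) :
    Tendsto (fun n => a n / (n + 1)) atTop (𝓝 (res t 2 * ∑' n, tollWeight t b n)) := by
  set c : ℕ → ℂ := fun n => 2 * avg t a n with hc
  have hB : 0 ≤ B := by
    have := (norm_nonneg _).trans (hb 0)
    exact nonneg_of_mul_nonneg_left this (by positivity)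
  set b' : ℕ → ℂ := fun n => if t ≤ n then b n else 0 with hb'
  have hb'le : ∀ n, ‖b' n‖ ≤ B * ((n : ℝ) + 1) ^ e := by
    intro n
    simp only [hb']
    split_ifs
    · exact hb n
    · rw [norm_zero]; positivity
  have hc0 : ∀ n ≤ 2 * t, c n = 0 := fun n hn => by simp [hc, avg_eq_zero_of_le a hn]
  have hP := prod_Icc_add_one_ne_zero t
  have hrec : ∀ z ∈ indRoots t, ∀ n : ℕ,
      (n + 1) * component t z c (n + 1) = (n + z) * component t z c n + res t z * b' n := by
    intro z hz n
    rw [theta_component hz, aeval_indPoly, hc, thetaProd_two_avg]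
    simp only [hb']
    split_ifs with hn
    · rw [h n]
      field_simp
      ring
    · rw [avg_eq_zero_of_le a (by omega)]
      ring
  have hz0 : ∀ z ∈ indRoots t, component t z c 0 = 0 := fun z hz =>
    aeval_theta_eq_zero hc0 (natDegree_basisPoly_le hz) (by omega)
  have hother : ∀ z ∈ (indRoots t).erase 2,
      Tendsto (fun n : ℕ => component t z c n / (n + 1)) atTop (𝓝 0) := by
    intro z hz
    obtain ⟨hz2, hz⟩ := Finset.mem_erase.1 hz
    have hre := re_lt_two_of_root (mem_indRoots.1 hz) hz2
    obtain ⟨e', h1, h2⟩ := exists_between (max_lt (max_lt he zero_lt_one)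
      (show z.re - 1 < 1 by linarith))
    obtain ⟨C, hC, hbd⟩ := first_order_bound (e := e') (B := B) (by
      linarith [le_max_right e 0, le_max_left (max e 0) (z.re - 1)])
      (by linarith [le_max_right (max e 0) (z.re - 1)]) (hrec z hz) (fun n => (hb'le n).trans (by
        gcongr
        · linarith [Nat.cast_nonneg (α := ℝ) n]
        · linarith [le_max_left e 0, le_max_left (max e 0) (z.re - 1)]))
    refine squeeze_zero_norm (a := fun n : ℕ => C * (((n : ℝ) + 1) ^ e' / (n + 1))) (fun n => ?_) ?_
    · rw [norm_div, show ((n : ℂ) + 1) = ((n + 1 : ℕ) : ℂ) by push_cast; rfl, Complex.norm_natCast,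
        ← mul_div_assoc]
      push_cast
      gcongr
      exact hbd n
    · simpa using (tendsto_rpow_div h2).const_mul C
  have hmain : Tendsto (fun n : ℕ => component t 2 c n / (n + 1)) atTop
      (𝓝 (res t 2 * ∑' n, tollWeight t b n)) := by
    have h1 : ∀ n : ℕ, component t 2 c n / (n + 1) =
        res t 2 * ∑ i ∈ Finset.range n, tollWeight t b i := by
      intro n
      induction n with
      | zero => simp [hz0 2 (two_mem_indRoots t)]
      | succ n ih =>
        have h2 := hrec 2 (two_mem_indRoots t) n
        have n1 : (n + 1 : ℂ) ≠ 0 := Nat.cast_add_one_ne_zero n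
        have n2 : (n + 2 : ℂ) ≠ 0 := by
          have := Nat.cast_add_one_ne_zero (R := ℂ) (n + 1)
          push_cast at this
          intro h
          apply this
          linear_combination h
        have h3 : tollWeight t b n = b' n / ((n + 1) * (n + 2)) := by
          simp only [tollWeight, hb']
          split_ifs <;> simp
        rw [Finset.sum_range_succ, mul_add, ← ih, h3]
        have n3 : ((n + 1 : ℕ) : ℂ) + 1 = n + 2 := by push_cast; ring
        rw [n3]
        field_simp
        linear_combination h2
    simp_rw [h1]
    exact ((summable_tollWeight t he hb).hasSum.tendsto_sum_nat).const_mul _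
  have hbt : Tendsto (fun n : ℕ => b n / (n + 1)) atTop (𝓝 0) := by
    refine squeeze_zero_norm (a := fun n : ℕ => B * (((n : ℝ) + 1) ^ e / (n + 1))) (fun n => ?_) ?_
    · rw [norm_div, show ((n : ℂ) + 1) = ((n + 1 : ℕ) : ℂ) by push_cast; rfl, Complex.norm_natCast,
        ← mul_div_assoc]
      push_cast
      gcongr
      exact hb n
    · simpa using (tendsto_rpow_div he).const_mul B
  have htot := (hbt.add hmain).add (tendsto_finsetSum _ hother)
  simp only [Finset.sum_const_zero, add_zero, zero_add] at htot
  refine htot.congr fun n => ?_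
  rw [← Finset.sum_div, ← add_div, ← add_div, add_assoc,
    Finset.add_sum_erase _ (fun z => component t z c n) (two_mem_indRoots t),
    sum_component, ← h n]

/-! ### The tree of a list -/

theorem length_filter_lt_add (l : List ℕ) (p : ℕ) (hl : l.Nodup) (hp : p ∈ l) :
    (l.filter (fun y => y < p)).length + (l.filter (fun y => p < y)).length + 1 = l.length := by
  induction l with
  | nil => simp at hp
  | cons x xs ih =>
    rw [List.nodup_cons] at hl
    rw [List.filter_cons, List.filter_cons]
    rcases List.mem_cons.1 hp with rfl | hp
    · have : ∀ l : List ℕ, p ∉ l →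
          (l.filter (fun y => y < p)).length + (l.filter (fun y => p < y)).length = l.length := by
        intro l
        induction l with
        | nil => simp
        | cons y ys ih =>
          intro hy
          rw [List.mem_cons, not_or] at hy
          have := ih hy.2
          rw [List.filter_cons, List.filter_cons]
          rcases lt_or_gt_of_ne hy.1 with h | h
          · simp [h, not_lt.2 h.le]; omega
          · simp [h, not_lt.2 h.le]; omega
      have := this xs hl.1
      simp
      omega
    · have h1 := ih hl.2 hp
      have hne : x ≠ p := fun h => hl.1 (h ▸ hp)
      rcases lt_or_gt_of_ne hne with h | h
      · simp [h, not_lt.2 h.le]; omega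
      · simp [h, not_lt.2 h.le]; omega

theorem numNodes_tree (t : ℕ) (l : List ℕ) (hl : l.Nodup) : (tree t l).numNodes = l.length := by
  induction hn : l.length using Nat.strong_induction_on generalizing l with
  | _ n ih =>
    cases l with
    | nil => subst hn; simp [tree, BinaryTree.numNodes]
    | cons x xs =>
      have h := length_filter_lt_add (x :: xs) _ hl (pivot_mem t x xs)
      rw [tree, BinaryTree.numNodes, ih _ (by omega) _ (hl.filter _) rfl,
        ih _ (by omega) _ (hl.filter _) rfl]
      omega

theorem pivot_map (t x : ℕ) (xs : List ℕ) {f : ℕ → ℕ} (hf : StrictMono f) :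
    pivot t (f x) (xs.map f) = f (pivot t x xs) := by
  unfold pivot
  rw [← List.map_cons, List.length_map]
  split_ifs
  · rw [← List.map_take, ← List.map_insertionSort (r := (· ≤ ·)) (s := (· ≤ ·)) f _
      fun a _ b _ => hf.le_iff_le.symm, List.getD_map]
  · rfl

/-- The two parameters depend only on the relative order of the keys. -/
theorem params_map (t : ℕ) (l : List ℕ) (hl : l.Nodup) {f : ℕ → ℕ} (hf : StrictMono f) :
    bigNodes t (tree t (l.map f)) = bigNodes t (tree t l) ∧
      pathLength t (tree t (l.map f)) = pathLength t (tree t l) := by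
  induction hn : l.length using Nat.strong_induction_on generalizing l with
  | _ n ih =>
    cases l with
    | nil => simp
    | cons x xs =>
      have h := length_filter_lt_add (x :: xs) _ hl (pivot_mem t x xs)
      have e1 : ((x :: xs).map f).filter (fun y => y < f (pivot t x xs)) =
          ((x :: xs).filter (fun y => y < pivot t x xs)).map f := by
        rw [List.filter_map]
        congr 1
        refine List.filter_congr fun y _ => ?_
        simp [hf.lt_iff_lt]
      have e2 : ((x :: xs).map f).filter (fun y => f (pivot t x xs) < y) =
          ((x :: xs).filter (fun y => pivot t x xs < y)).map f := by
        rw [List.filter_map]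
        congr 1
        refine List.filter_congr fun y _ => ?_
        simp [hf.lt_iff_lt]
      have i1 := ih _ (by omega) ((x :: xs).filter (fun y => y < pivot t x xs)) (hl.filter _) rfl
      have i2 := ih _ (by omega) ((x :: xs).filter (fun y => pivot t x xs < y)) (hl.filter _) rfl
      have n1 : ∀ p : ℕ → Bool, (tree t (((x :: xs).filter p).map f)).numNodes =
          (tree t ((x :: xs).filter p)).numNodes := fun p => by
        rw [numNodes_tree _ _ ((hl.filter _).map hf.injective), numNodes_tree _ _ (hl.filter _),
          List.length_map]
      rw [List.map_cons, tree, tree, pivot_map t x xs hf, ← List.map_cons, e1, e2]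
      simp only [bigNodes, pathLength, i1, i2, n1, and_self]

/-- Splitting a tree with at least `2t+1` keys at its root. -/
theorem params_cons (t x : ℕ) (xs : List ℕ) (hl : (x :: xs).Nodup) (h : 2 * t ≤ xs.length) :
    bigNodes t (tree t (x :: xs)) =
        1 + bigNodes t (tree t ((x :: xs).filter (fun y => y < pivot t x xs))) +
          bigNodes t (tree t ((x :: xs).filter (fun y => pivot t x xs < y))) ∧
      pathLength t (tree t (x :: xs)) =
        xs.length + pathLength t (tree t ((x :: xs).filter (fun y => y < pivot t x xs))) +
          pathLength t (tree t ((x :: xs).filter (fun y => pivot t x xs < y))) := by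
  have h1 := length_filter_lt_add (x :: xs) _ hl (pivot_mem t x xs)
  rw [tree, bigNodes, pathLength, numNodes_tree _ _ (hl.filter _), numNodes_tree _ _ (hl.filter _)]
  rw [List.length_cons] at h1
  rw [if_pos (by omega), if_pos (by omega)]
  omega

theorem params_eq_zero (t : ℕ) (l : List ℕ) (hl : l.Nodup) (h : l.length ≤ 2 * t) :
    bigNodes t (tree t l) = 0 ∧ pathLength t (tree t l) = 0 := by
  induction hn : l.length using Nat.strong_induction_on generalizing l with
  | _ n ih =>
    cases l with
    | nil => simp [tree, bigNodes, pathLength]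
    | cons x xs =>
      have h1 := length_filter_lt_add (x :: xs) _ hl (pivot_mem t x xs)
      have i1 := ih _ (by omega) ((x :: xs).filter (fun y => y < pivot t x xs)) (hl.filter _)
        (by omega) rfl
      have i2 := ih _ (by omega) ((x :: xs).filter (fun y => pivot t x xs < y)) (hl.filter _)
        (by omega) rfl
      rw [tree, bigNodes, pathLength, numNodes_tree _ _ (hl.filter _),
        numNodes_tree _ _ (hl.filter _), if_neg (by omega), if_neg (by omega), i1.1, i1.2, i2.1, i2.2]
      simp

/-- The rank of an entry of a strictly increasing list. -/
theorem length_filter_lt_getElem (s : List ℕ) (hs : s.Pairwise (· < ·)) (i : ℕ) (hi : i < s.length) :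
    (s.filter (fun y => y < s[i])).length = i := by
  induction s generalizing i with
  | nil => simp at hi
  | cons x xs ih =>
    rw [List.pairwise_cons] at hs
    cases i with
    | zero =>
      simp only [List.getElem_cons_zero, List.length_eq_zero_iff, List.filter_eq_nil_iff]
      intro a ha
      rcases List.mem_cons.1 ha with rfl | ha
      · simp
      · simpa using (hs.1 a ha).le
    | succ i =>
      simp only [List.length_cons, Nat.add_lt_add_iff_right] at hi
      have h1 := hs.1 xs[i] (List.getElem_mem hi)
      simp only [List.getElem_cons_succ]
      rw [List.filter_cons, if_pos (by simpa using h1), List.length_cons, ih hs.2 i hi]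

/-- The pivot is the element of rank `t` among the first `2t+1` keys. -/
theorem pivot_eq_iff (t x : ℕ) (xs : List ℕ) (hl : (x :: xs).Nodup) (h : 2 * t ≤ xs.length) (k : ℕ) :
    pivot t x xs = k ↔ k ∈ (x :: xs).take (2 * t + 1) ∧
      (((x :: xs).take (2 * t + 1)).filter (fun y => y < k)).length = t := by
  set T := (x :: xs).take (2 * t + 1) with hT
  set s := T.insertionSort (· ≤ ·) with hs
  have hperm : s.Perm T := List.perm_insertionSort _ _
  have hTn : T.Nodup := hl.sublist (List.take_sublist _ _)
  have hTl : T.length = 2 * t + 1 := by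
    rw [hT, List.length_take, List.length_cons]
    omega
  have hsl : s.length = 2 * t + 1 := by rw [hperm.length_eq, hTl]
  have hsorted : s.Pairwise (· < ·) :=
    ((List.pairwise_insertionSort (· ≤ ·) T).and (hperm.nodup_iff.2 hTn)).imp
      fun h => lt_of_le_of_ne h.1 h.2
  have hfil : ∀ k, (T.filter (fun y => y < k)).length = (s.filter (fun y => y < k)).length :=
    fun k => ((hperm.filter _).length_eq).symm
  have hp : pivot t x xs = s[t]'(by omega) := by
    rw [pivot, if_pos (by rw [List.length_cons]; omega), List.getD_eq_getElem]
  rw [hp, hfil, ← hperm.mem_iff]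
  constructor
  · rintro rfl
    exact ⟨List.getElem_mem _, length_filter_lt_getElem s hsorted t _⟩
  · rintro ⟨hk, hc⟩
    obtain ⟨i, hi, rfl⟩ := List.mem_iff_getElem.1 hk
    rw [length_filter_lt_getElem s hsorted i hi] at hc
    subst hc
    rfl

/-! ### The law of the two subtrees -/

/-- The list of a permutation restricted to the range of an embedding. -/
theorem exists_filter_ofFn {n k : ℕ} (e : Fin k ↪ Fin n) (p : Fin n → Bool)
    (hp : ∀ x, p x = true ↔ x ∈ Set.range e) (σ : Equiv.Perm (Fin n)) :
    ∃ τ : Equiv.Perm (Fin k), (List.ofFn σ).filter p = (List.ofFn τ).map e := by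
  have hnd : ((List.ofFn σ).filter p).Nodup := (List.nodup_ofFn.2 σ.injective).filter _
  have hmem : (List.ofFn σ).filter p ∈ Set.range (List.map e) := by
    rw [Set.range_list_map]
    intro x hx
    exact (hp x).1 (List.mem_filter.1 hx).2
  obtain ⟨l, hl⟩ := hmem
  have hln : l.Nodup := List.Nodup.of_map e (hl ▸ hnd)
  have hll : l.length = k := by
    have h1 : l.toFinset = Finset.univ := by
      ext i
      have : e i ∈ (List.ofFn σ).filter p := by
        rw [List.mem_filter]
        refine ⟨?_, (hp _).2 ⟨i, rfl⟩⟩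
        rw [List.mem_ofFn]
        exact ⟨σ.symm (e i), by simp⟩
      rw [← hl, List.mem_map] at this
      obtain ⟨j, hj, hji⟩ := this
      simpa using e.injective hji ▸ hj
    rw [← List.toFinset_card_of_nodup hln, h1, Finset.card_univ, Fintype.card_fin]
  have key : ∀ m : ℕ, l.length = m → ∃ f : Fin m → Fin k, List.ofFn f = l ∧ f.Injective := by
    rintro m rfl
    exact ⟨l.get, List.ofFn_get l, List.nodup_iff_injective_get.1 hln⟩
  obtain ⟨f, hf, hfi⟩ := key k hll
  refine ⟨Equiv.ofBijective f (Finite.injective_iff_bijective.1 hfi), ?_⟩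
  rw [← hl]
  congr 1
  exact hf.symm

theorem ofFn_perm_inj {k : ℕ} {τ τ' : Equiv.Perm (Fin k)} (h : List.ofFn τ = List.ofFn τ') : τ = τ' :=
  Equiv.ext fun i => congrFun (List.ofFn_injective h) i

section Split

variable {n : ℕ} (k : Fin n)

/-- The embedding of the small keys. -/
def smallEmb : Fin k ↪ Fin n := Fin.castLEEmb k.is_lt.le

/-- The embedding of the large keys. -/
def largeEmb : Fin (n - 1 - k) ↪ Fin n where
  toFun i := ⟨i + (k + 1), by have := i.is_lt; have := k.is_lt; omega⟩
  inj' i j h := by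
    have := congrArg Fin.val h
    ext
    simpa using this

theorem mem_range_smallEmb {x : Fin n} : x ∈ Set.range (smallEmb k) ↔ x < k := by
  constructor
  · rintro ⟨i, rfl⟩
    exact i.is_lt
  · intro h
    exact ⟨⟨x, h⟩, rfl⟩

theorem mem_range_largeEmb {x : Fin n} : x ∈ Set.range (largeEmb k) ↔ k < x := by
  constructor
  · rintro ⟨i, rfl⟩
    rw [Fin.lt_def]
    change (k : ℕ) < i + (k + 1)
    omega
  · intro h
    rw [Fin.lt_def] at h
    refine ⟨⟨x - (k + 1), by have := x.is_lt; omega⟩, ?_⟩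
    ext
    change (x - (k + 1) : ℕ) + (k + 1) = x
    omega

/-- The relative order of the small keys. -/
def smallPerm (σ : Equiv.Perm (Fin n)) : Equiv.Perm (Fin k) :=
  (exists_filter_ofFn (smallEmb k) (fun x => x < k)
    (fun x => by rw [mem_range_smallEmb, decide_eq_true_iff]) σ).choose

theorem filter_small (σ : Equiv.Perm (Fin n)) :
    (List.ofFn σ).filter (fun x => x < k) = (List.ofFn (smallPerm k σ)).map (smallEmb k) :=
  (exists_filter_ofFn (smallEmb k) (fun x => x < k)
    (fun x => by rw [mem_range_smallEmb, decide_eq_true_iff]) σ).choose_spec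

/-- The relative order of the large keys. -/
def largePerm (σ : Equiv.Perm (Fin n)) : Equiv.Perm (Fin (n - 1 - k)) :=
  (exists_filter_ofFn (largeEmb k) (fun x => k < x)
    (fun x => by rw [mem_range_largeEmb, decide_eq_true_iff]) σ).choose

theorem filter_large (σ : Equiv.Perm (Fin n)) :
    (List.ofFn σ).filter (fun x => k < x) = (List.ofFn (largePerm k σ)).map (largeEmb k) :=
  (exists_filter_ofFn (largeEmb k) (fun x => k < x)
    (fun x => by rw [mem_range_largeEmb, decide_eq_true_iff]) σ).choose_spec

/-- Permuting the small keys among themselves, and the large keys among themselves. -/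
def splitPerm (q : Equiv.Perm (Fin k) × Equiv.Perm (Fin (n - 1 - k))) : Equiv.Perm (Fin n) :=
  q.1.viaFintypeEmbedding (smallEmb k) * q.2.viaFintypeEmbedding (largeEmb k)

variable (q : Equiv.Perm (Fin k) × Equiv.Perm (Fin (n - 1 - k)))

theorem splitPerm_small (i : Fin k) : splitPerm k q (smallEmb k i) = smallEmb k (q.1 i) := by
  have h : q.2.viaFintypeEmbedding (largeEmb k) (smallEmb k i) = smallEmb k i := by
    apply Equiv.Perm.viaFintypeEmbedding_apply_notMem_range
    rw [mem_range_largeEmb]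
    exact not_lt.2 ((mem_range_smallEmb k).1 ⟨i, rfl⟩).le
  rw [splitPerm, Equiv.Perm.mul_apply, h, Equiv.Perm.viaFintypeEmbedding_apply_image]

theorem splitPerm_large (i : Fin (n - 1 - k)) :
    splitPerm k q (largeEmb k i) = largeEmb k (q.2 i) := by
  rw [splitPerm, Equiv.Perm.mul_apply, Equiv.Perm.viaFintypeEmbedding_apply_image,
    Equiv.Perm.viaFintypeEmbedding_apply_notMem_range]
  rw [mem_range_smallEmb]
  exact not_lt.2 ((mem_range_largeEmb k).1 ⟨_, rfl⟩).le

theorem splitPerm_self : splitPerm k q k = k := by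
  have h : q.2.viaFintypeEmbedding (largeEmb k) k = k := by
    apply Equiv.Perm.viaFintypeEmbedding_apply_notMem_range
    rw [mem_range_largeEmb]
    exact lt_irrefl _
  rw [splitPerm, Equiv.Perm.mul_apply, h]
  apply Equiv.Perm.viaFintypeEmbedding_apply_notMem_range
  rw [mem_range_smallEmb]
  exact lt_irrefl _

theorem splitPerm_lt_iff (x : Fin n) : splitPerm k q x < k ↔ x < k := by
  rcases lt_trichotomy x k with h | rfl | h
  · obtain ⟨i, rfl⟩ := (mem_range_smallEmb k).2 h
    rw [splitPerm_small]
    exact iff_of_true ((mem_range_smallEmb k).1 ⟨_, rfl⟩) h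
  · rw [splitPerm_self]
  · obtain ⟨i, rfl⟩ := (mem_range_largeEmb k).2 h
    rw [splitPerm_large]
    exact iff_of_false (not_lt.2 ((mem_range_largeEmb k).1 ⟨_, rfl⟩).le) (not_lt.2 h.le)

theorem lt_splitPerm_iff (x : Fin n) : k < splitPerm k q x ↔ k < x := by
  rcases lt_trichotomy x k with h | rfl | h
  · have := (splitPerm_lt_iff k q x).2 h
    exact iff_of_false (not_lt.2 this.le) (not_lt.2 h.le)
  · rw [splitPerm_self]
  · obtain ⟨i, rfl⟩ := (mem_range_largeEmb k).2 h
    rw [splitPerm_large]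
    exact iff_of_true ((mem_range_largeEmb k).1 ⟨_, rfl⟩) h

theorem ofFn_mul {m : ℕ} (g σ : Equiv.Perm (Fin m)) : List.ofFn (g * σ) = (List.ofFn σ).map g := by
  rw [List.map_ofFn]
  rfl

theorem smallPerm_splitPerm (σ : Equiv.Perm (Fin n)) :
    smallPerm k (splitPerm k q * σ) = q.1 * smallPerm k σ := by
  apply ofFn_perm_inj
  apply List.map_injective_iff.2 (smallEmb k).injective
  rw [← filter_small, ofFn_mul, ofFn_mul, List.filter_map, List.map_map]
  have : (List.ofFn σ).filter ((fun x => decide (x < k)) ∘ splitPerm k q) =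
      (List.ofFn σ).filter (fun x => decide (x < k)) :=
    List.filter_congr fun x _ => by simp [splitPerm_lt_iff]
  rw [this, filter_small, List.map_map]
  congr 1
  funext i
  exact splitPerm_small k q i

theorem largePerm_splitPerm (σ : Equiv.Perm (Fin n)) :
    largePerm k (splitPerm k q * σ) = q.2 * largePerm k σ := by
  apply ofFn_perm_inj
  apply List.map_injective_iff.2 (largeEmb k).injective
  rw [← filter_large, ofFn_mul, ofFn_mul, List.filter_map, List.map_map]
  have : (List.ofFn σ).filter ((fun x => decide (k < x)) ∘ splitPerm k q) =
      (List.ofFn σ).filter (fun x => decide (k < x)) :=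
    List.filter_congr fun x _ => by simp [lt_splitPerm_iff]
  rw [this, filter_large, List.map_map]
  congr 1
  funext i
  exact splitPerm_large k q i

/-- A set has median `k` if it contains `k` and `t` smaller elements. -/
def IsMedian (t : ℕ) (B : Finset (Fin n)) : Prop := k ∈ B ∧ (B.filter (fun x => x < k)).card = t

open Classical in
/-- The set of the first `m` values of a permutation. -/
def firstKeys (m : ℕ) (σ : Equiv.Perm (Fin n)) : Finset (Fin n) :=
  (Finset.univ.filter fun i : Fin n => (i : ℕ) < m).image σ

open Classical in
theorem firstKeys_mul (m : ℕ) (g σ : Equiv.Perm (Fin n)) :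
    firstKeys m (g * σ) = (firstKeys m σ).image g := by
  rw [firstKeys, firstKeys, Finset.image_image]
  rfl

theorem isMedian_splitPerm (t m : ℕ) (σ : Equiv.Perm (Fin n)) :
    IsMedian k t (firstKeys m (splitPerm k q * σ)) ↔ IsMedian k t (firstKeys m σ) := by
  classical
  unfold IsMedian
  rw [firstKeys_mul, Finset.filter_image, Finset.card_image_of_injective _ (Equiv.injective _)]
  have h1 : k ∈ (firstKeys m σ).image (splitPerm k q) ↔ k ∈ firstKeys m σ := by
    have := (Equiv.injective (splitPerm k q)).mem_finset_image (s := firstKeys m σ) (a := k)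
    rwa [splitPerm_self] at this
  simp only [h1, splitPerm_lt_iff]

open Classical in
/-- Given the pivot, the two subtrees are independent and uniform. -/
theorem sum_perm_split (t m : ℕ)
    (Φ : Equiv.Perm (Fin k) → Equiv.Perm (Fin (n - 1 - k)) → ℝ) :
    ((k : ℕ) ! * (n - 1 - k)! : ℕ) *
      ∑ σ ∈ Finset.univ.filter (fun σ : Equiv.Perm (Fin n) => IsMedian k t (firstKeys m σ)),
        Φ (smallPerm k σ) (largePerm k σ) =
      ((Finset.univ.filter (fun σ : Equiv.Perm (Fin n) => IsMedian k t (firstKeys m σ))).card : ℝ) *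
        ∑ τ, ∑ τ', Φ τ τ' := by
  set A := Finset.univ.filter (fun σ : Equiv.Perm (Fin n) => IsMedian k t (firstKeys m σ)) with hA
  have h1 : ∀ q : Equiv.Perm (Fin k) × Equiv.Perm (Fin (n - 1 - k)),
      ∑ σ ∈ A, Φ (smallPerm k σ) (largePerm k σ) =
        ∑ σ ∈ A, Φ (q.1 * smallPerm k σ) (q.2 * largePerm k σ) := by
    intro q
    symm
    refine Finset.sum_bij (fun σ _ => splitPerm k q * σ) ?_ ?_ ?_ ?_
    · intro σ hσ
      rw [hA, Finset.mem_filter] at hσ ⊢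
      exact ⟨Finset.mem_univ _, (isMedian_splitPerm k q t m σ).2 hσ.2⟩
    · intro σ _ σ' _ h
      exact mul_left_cancel h
    · intro σ hσ
      rw [hA, Finset.mem_filter] at hσ
      refine ⟨(splitPerm k q)⁻¹ * σ, ?_, by simp⟩
      rw [hA, Finset.mem_filter]
      refine ⟨Finset.mem_univ _, ?_⟩
      rw [← isMedian_splitPerm k q, mul_inv_cancel_left]
      exact hσ.2
    · intro σ _
      rw [smallPerm_splitPerm, largePerm_splitPerm]
  have h2 : ∑ q : Equiv.Perm (Fin k) × Equiv.Perm (Fin (n - 1 - k)),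
      ∑ σ ∈ A, Φ (smallPerm k σ) (largePerm k σ) = (A.card : ℝ) * ∑ τ, ∑ τ', Φ τ τ' := by
    rw [Finset.sum_congr rfl fun q _ => h1 q, Finset.sum_comm, ← nsmul_eq_mul, ← Finset.sum_const]
    refine Finset.sum_congr rfl fun σ _ => ?_
    rw [Fintype.sum_prod_type]
    rw [← Equiv.sum_comp (Equiv.mulRight (smallPerm k σ)) fun τ => ∑ τ', Φ τ τ']
    refine Finset.sum_congr rfl fun α _ => ?_
    rw [← Equiv.sum_comp (Equiv.mulRight (largePerm k σ)) fun τ' => Φ _ τ']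
    rfl
  rw [← h2, Finset.sum_const, nsmul_eq_mul, Finset.card_univ, Fintype.card_prod, Fintype.card_perm,
    Fintype.card_perm, Fintype.card_fin, Fintype.card_fin]

open Classical in
theorem card_firstKeys_eq {m : ℕ} (B B' : Finset (Fin n)) (h : B.card = B'.card) :
    (Finset.univ.filter fun σ : Equiv.Perm (Fin n) => firstKeys m σ = B).card =
      (Finset.univ.filter fun σ : Equiv.Perm (Fin n) => firstKeys m σ = B').card := by
  obtain ⟨g, hg⟩ := Equiv.Perm.exists_map_finset_eq B B' h
  have hg' : B.image g = B' := by rw [← hg, Finset.map_eq_image]; rfl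
  refine Finset.card_bij (fun σ _ => g * σ) ?_ ?_ ?_
  · intro σ hσ
    rw [Finset.mem_filter] at hσ ⊢
    exact ⟨Finset.mem_univ _, by rw [firstKeys_mul, hσ.2, hg']⟩
  · intro σ _ σ' _ h
    exact mul_left_cancel h
  · intro σ hσ
    rw [Finset.mem_filter] at hσ
    refine ⟨g⁻¹ * σ, ?_, by simp⟩
    rw [Finset.mem_filter]
    refine ⟨Finset.mem_univ _, ?_⟩
    apply Finset.image_injective g.injective
    rw [hg', ← firstKeys_mul, mul_inv_cancel_left, hσ.2]

theorem card_firstKeys {m : ℕ} (hm : m ≤ n) (σ : Equiv.Perm (Fin n)) :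
    (firstKeys m σ).card = m := by
  classical
  rw [firstKeys, Finset.card_image_of_injective _ σ.injective]
  have : (Finset.univ.filter fun i : Fin n => (i : ℕ) < m) =
      Finset.univ.map (Fin.castLEEmb hm) := by
    ext i
    simp only [Finset.mem_filter, Finset.mem_univ, true_and, Finset.mem_map, Fin.castLEEmb_apply]
    constructor
    · intro h
      exact ⟨⟨i, h⟩, rfl⟩
    · rintro ⟨j, rfl⟩
      exact j.is_lt
  rw [this, Finset.card_map, Finset.card_univ, Fintype.card_fin]

open Classical in
theorem card_medianSets (t : ℕ) :
    ((Finset.powersetCard (2 * t + 1) Finset.univ).filter fun B : Finset (Fin n) => IsMedian k t B).card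
      = (k : ℕ).choose t * (n - 1 - k).choose t := by
  have c1 : (Finset.univ.filter fun x : Fin n => x < k).card = k := by
    rw [← Fin.card_Iio k]
    congr 1
    ext; simp
  have c2 : (Finset.univ.filter fun x : Fin n => k < x).card = n - 1 - k := by
    rw [← Fin.card_Ioi k]
    congr 1
    ext; simp
  have c3 : (k : ℕ).choose t * (n - 1 - k).choose t =
      (Finset.univ.filter fun x : Fin n => x < k).card.choose t *
        (Finset.univ.filter fun x : Fin n => k < x).card.choose t := by rw [c1, c2]
  rw [c3, ← Finset.card_powersetCard, ← Finset.card_powersetCard, ← Finset.card_product]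
  have hsplit : ∀ B : Finset (Fin n), k ∈ B → B = insert k (B.filter (fun x => x < k) ∪
      B.filter (fun x => k < x)) := by
    intro B hB
    ext x
    simp only [Finset.mem_insert, Finset.mem_union, Finset.mem_filter]
    constructor
    · intro hx
      rcases lt_trichotomy x k with h | h | h
      · exact Or.inr (Or.inl ⟨hx, h⟩)
      · exact Or.inl h
      · exact Or.inr (Or.inr ⟨hx, h⟩)
    · rintro (rfl | h | h)
      · exact hB
      · exact h.1
      · exact h.1
  have hcard : ∀ L R : Finset (Fin n), (∀ x ∈ L, x < k) → (∀ x ∈ R, k < x) →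
      (insert k (L ∪ R)).card = L.card + R.card + 1 := by
    intro L R hL hR
    rw [Finset.card_insert_of_notMem, Finset.card_union_of_disjoint]
    · rw [Finset.disjoint_left]
      intro x h1 h2
      exact lt_asymm (hL x h1) (hR x h2)
    · rw [Finset.mem_union, not_or]
      exact ⟨fun h => lt_irrefl _ (hL _ h), fun h => lt_irrefl _ (hR _ h)⟩
  refine Finset.card_bij' (fun B _ => (B.filter (fun x => x < k), B.filter (fun x => k < x)))
    (fun p _ => insert k (p.1 ∪ p.2)) ?_ ?_ ?_ ?_
  · intro B hB
    rw [Finset.mem_filter, Finset.mem_powersetCard] at hB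
    have h1 := hcard (B.filter (fun x => x < k)) (B.filter (fun x => k < x)) (by simp) (by simp)
    rw [← hsplit B hB.2.1, hB.1.2, hB.2.2] at h1
    rw [Finset.mem_product, Finset.mem_powersetCard, Finset.mem_powersetCard]
    refine ⟨⟨Finset.filter_subset_filter _ (Finset.subset_univ _), hB.2.2⟩,
      Finset.filter_subset_filter _ (Finset.subset_univ _), ?_⟩
    dsimp only
    omega
  · intro p hp
    rw [Finset.mem_product, Finset.mem_powersetCard, Finset.mem_powersetCard] at hp
    have hL : ∀ x ∈ p.1, x < k := fun x hx => by simpa using hp.1.1 hx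
    have hR : ∀ x ∈ p.2, k < x := fun x hx => by simpa using hp.2.1 hx
    rw [Finset.mem_filter, Finset.mem_powersetCard]
    refine ⟨⟨Finset.subset_univ _, ?_⟩, Finset.mem_insert_self _ _, ?_⟩
    · rw [hcard _ _ hL hR, hp.1.2, hp.2.2]
      omega
    · rw [← hp.1.2]
      congr 1
      ext x
      simp only [Finset.mem_filter, Finset.mem_insert, Finset.mem_union]
      constructor
      · rintro ⟨rfl | h | h, hx⟩
        · exact absurd hx (lt_irrefl _)
        · exact h
        · exact absurd hx (lt_asymm (hR x h))
      · intro h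
        exact ⟨Or.inr (Or.inl h), hL x h⟩
  · intro B hB
    rw [Finset.mem_filter] at hB
    exact (hsplit B hB.2.1).symm
  · intro p hp
    rw [Finset.mem_product, Finset.mem_powersetCard, Finset.mem_powersetCard] at hp
    have hL : ∀ x ∈ p.1, x < k := fun x hx => by simpa using hp.1.1 hx
    have hR : ∀ x ∈ p.2, k < x := fun x hx => by simpa using hp.2.1 hx
    ext x
    · simp only [Finset.mem_filter, Finset.mem_insert, Finset.mem_union]
      constructor
      · rintro ⟨rfl | h | h, hx⟩
        · exact absurd hx (lt_irrefl _)
        · exact h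
        · exact absurd hx (lt_asymm (hR x h))
      · intro h
        exact ⟨Or.inr (Or.inl h), hL x h⟩
    · simp only [Finset.mem_filter, Finset.mem_insert, Finset.mem_union]
      constructor
      · rintro ⟨rfl | h | h, hx⟩
        · exact absurd hx (lt_irrefl _)
        · exact absurd hx (lt_asymm (hL x h))
        · exact h
      · intro h
        exact ⟨Or.inr (Or.inr h), hR x h⟩

open Classical in
/-- The number of permutations with a given pivot. -/
theorem card_median (t : ℕ) (hn : 2 * t + 1 ≤ n) :
    ((Finset.univ.filter (fun σ : Equiv.Perm (Fin n) =>
      IsMedian k t (firstKeys (2 * t + 1) σ))).card : ℝ) = n ! * wt ℝ t n k := by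
  set m := 2 * t + 1 with hm
  obtain ⟨B₀, hB₀⟩ : ∃ B : Finset (Fin n), B.card = m := by
    obtain ⟨B, _, h⟩ := Finset.exists_subset_card_eq (s := (Finset.univ : Finset (Fin n))) (n := m)
      (by simpa using hn)
    exact ⟨B, h⟩
  set c := (Finset.univ.filter fun σ : Equiv.Perm (Fin n) => firstKeys m σ = B₀).card with hc
  have hfib : ∀ B ∈ Finset.powersetCard m (Finset.univ : Finset (Fin n)),
      (Finset.univ.filter fun σ : Equiv.Perm (Fin n) => firstKeys m σ = B).card = c := by
    intro B hB
    exact card_firstKeys_eq B B₀ ((Finset.mem_powersetCard.1 hB).2.trans hB₀.symm)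
  have h1 : n ! = n.choose m * c := by
    have := Finset.card_eq_sum_card_fiberwise (f := firstKeys m) (s := (Finset.univ : Finset (Equiv.Perm (Fin n))))
      (t := Finset.powersetCard m Finset.univ) (fun σ _ => by
        simp only [Finset.mem_coe, Finset.mem_powersetCard]
        exact ⟨Finset.subset_univ _, card_firstKeys hn σ⟩)
    rw [Finset.sum_congr rfl hfib, Finset.sum_const, Finset.card_powersetCard, Finset.card_univ,
      Fintype.card_perm, Finset.card_univ, Fintype.card_fin, smul_eq_mul] at this
    exact this
  have h2 : (Finset.univ.filter (fun σ : Equiv.Perm (Fin n) => IsMedian k t (firstKeys m σ))).card =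
      ((k : ℕ).choose t * (n - 1 - k).choose t) * c := by
    have := Finset.card_eq_sum_card_fiberwise (f := firstKeys m)
      (s := Finset.univ.filter (fun σ : Equiv.Perm (Fin n) => IsMedian k t (firstKeys m σ)))
      (t := (Finset.powersetCard m Finset.univ).filter fun B : Finset (Fin n) => IsMedian k t B)
      (fun σ hσ => by
        simp only [Finset.mem_coe, Finset.mem_filter, Finset.mem_powersetCard] at hσ ⊢
        exact ⟨⟨Finset.subset_univ _, card_firstKeys hn σ⟩, hσ.2⟩)
    rw [this, Finset.sum_congr rfl (g := fun _ => c), Finset.sum_const, card_medianSets, smul_eq_mul]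
    intro B hB
    rw [Finset.mem_filter] at hB
    rw [← hfib B hB.1, Finset.filter_filter]
    congr 1
    ext σ
    simp only [Finset.mem_filter, Finset.mem_univ, true_and]
    constructor
    · exact fun h => h.2
    · exact fun h => ⟨h ▸ hB.2, h⟩
  have hch : ((n.choose m : ℕ) : ℝ) ≠ 0 := Nat.cast_ne_zero.2 (Nat.choose_pos hn).ne'
  rw [h2, h1, wt, ← hm]
  push_cast
  field_simp

end Split

/-! ### Averages over permutations -/

theorem ofFn_val_eq_map {n : ℕ} (σ : Equiv.Perm (Fin n)) :
    (List.ofFn fun i => (σ i : ℕ)) = (List.ofFn σ).map Fin.val := by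
  rw [List.map_ofFn]
  rfl

theorem nodup_ofFn_val {n : ℕ} (σ : Equiv.Perm (Fin n)) :
    (List.ofFn fun i => (σ i : ℕ)).Nodup :=
  List.nodup_ofFn.2 (Fin.val_injective.comp σ.injective)

theorem toFinset_take {n : ℕ} (m : ℕ) (σ : Equiv.Perm (Fin n)) :
    ((List.ofFn σ).take m).toFinset = firstKeys m σ := by
  classical
  ext x
  rw [List.mem_toFinset, List.mem_take_iff_getElem, firstKeys, Finset.mem_image]
  constructor
  · rintro ⟨i, hi, rfl⟩
    rw [List.length_ofFn] at hi
    refine ⟨⟨i, by omega⟩, ?_, by simp⟩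
    rw [Finset.mem_filter]
    exact ⟨Finset.mem_univ _, show i < m by omega⟩
  · rintro ⟨i, hi, rfl⟩
    rw [Finset.mem_filter] at hi
    exact ⟨i, by rw [List.length_ofFn]; exact lt_min hi.2 i.is_lt, by simp⟩

theorem pivot_eq_iff_isMedian {t n x : ℕ} {xs : List ℕ} (hn : 2 * t + 1 ≤ n)
    (σ : Equiv.Perm (Fin n)) (h : (List.ofFn fun i => (σ i : ℕ)) = x :: xs) (k : Fin n) :
    pivot t x xs = k ↔ IsMedian k t (firstKeys (2 * t + 1) σ) := by
  have hlen := congrArg List.length h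
  rw [List.length_ofFn, List.length_cons] at hlen
  rw [pivot_eq_iff t x xs (h ▸ nodup_ofFn_val σ) (by omega), ← h, ofFn_val_eq_map, ← List.map_take,
    List.filter_map, List.length_map, IsMedian, ← toFinset_take, List.mem_toFinset]
  refine and_congr ?_ ?_
  · exact List.mem_map_of_injective Fin.val_injective
  · have hnd : ((List.ofFn σ).take (2 * t + 1)).Nodup :=
      (List.nodup_ofFn.2 σ.injective).sublist (List.take_sublist _ _)
    rw [← List.toFinset_card_of_nodup (hnd.filter _), List.toFinset_filter]
    refine Eq.congr_left (congrArg Finset.card (Finset.filter_congr fun x _ => ?_))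
    simp

theorem existsUnique_isMedian {t n : ℕ} (hn : 2 * t + 1 ≤ n) (σ : Equiv.Perm (Fin n)) :
    ∃! k : Fin n, IsMedian k t (firstKeys (2 * t + 1) σ) := by
  obtain ⟨x, xs, h⟩ : ∃ x xs, (List.ofFn fun i => (σ i : ℕ)) = x :: xs := by
    apply List.exists_cons_of_ne_nil
    rw [← List.length_pos_iff, List.length_ofFn]
    omega
  have hp : pivot t x xs < n := by
    have := pivot_mem t x xs
    rw [← h, List.mem_ofFn] at this
    obtain ⟨i, hi⟩ := this
    rw [← hi]
    exact (σ i).is_lt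
  refine ⟨⟨_, hp⟩, (pivot_eq_iff_isMedian hn σ h _).1 rfl, fun k hk => ?_⟩
  ext
  exact ((pivot_eq_iff_isMedian hn σ h k).2 hk).symm

/-- A parameter that vanishes for at most `2t` keys and is, up to a toll, additive over the two
subtrees. -/
structure IsAdditive (t : ℕ) (U : ∀ n, Equiv.Perm (Fin n) → ℝ) (τ : ℕ → ℝ) : Prop where
  zero : ∀ n σ, n ≤ 2 * t → U n σ = 0
  split : ∀ n σ (k : Fin n), 2 * t + 1 ≤ n → IsMedian k t (firstKeys (2 * t + 1) σ) →
    U n σ = τ n + U k (smallPerm k σ) + U (n - 1 - k) (largePerm k σ)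

theorem params_split {t n : ℕ} (σ : Equiv.Perm (Fin n)) (k : Fin n) (hn : 2 * t + 1 ≤ n)
    (hk : IsMedian k t (firstKeys (2 * t + 1) σ)) :
    S t n σ = 1 + S t k (smallPerm k σ) + S t (n - 1 - k) (largePerm k σ) ∧
      X t n σ = (n - 1 : ℝ) + X t k (smallPerm k σ) + X t (n - 1 - k) (largePerm k σ) := by
  obtain ⟨x, xs, h⟩ : ∃ x xs, (List.ofFn fun i => (σ i : ℕ)) = x :: xs := by
    apply List.exists_cons_of_ne_nil
    rw [← List.length_pos_iff, List.length_ofFn]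
    omega
  have hlen := congrArg List.length h
  rw [List.length_ofFn, List.length_cons] at hlen
  have hxs : (xs.length : ℝ) = n - 1 := by rw [hlen]; push_cast; ring
  have hpk := (pivot_eq_iff_isMedian hn σ h k).2 hk
  have h1 := params_cons t x xs (h ▸ nodup_ofFn_val σ) (by omega)
  rw [hpk, ← h] at h1
  have e1 : (List.ofFn fun i => (σ i : ℕ)).filter (fun y => y < (k : ℕ)) =
      List.ofFn fun i => (smallPerm k σ i : ℕ) := by
    rw [ofFn_val_eq_map, List.filter_map]
    have : (fun y : ℕ => decide (y < (k : ℕ))) ∘ Fin.val = fun x : Fin n => decide (x < k) := rfl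
    rw [this, filter_small, List.map_map, ofFn_val_eq_map]
    rfl
  have e2 : (List.ofFn fun i => (σ i : ℕ)).filter (fun y => (k : ℕ) < y) =
      (List.ofFn fun i => (largePerm k σ i : ℕ)).map (· + ((k : ℕ) + 1)) := by
    rw [ofFn_val_eq_map, List.filter_map]
    have : (fun y : ℕ => decide ((k : ℕ) < y)) ∘ Fin.val = fun x : Fin n => decide (k < x) := rfl
    rw [this, filter_large, List.map_map, ofFn_val_eq_map, List.map_map]
    rfl
  have h2 := params_map t (List.ofFn fun i => (largePerm k σ i : ℕ)) (nodup_ofFn_val _)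
    (f := (· + ((k : ℕ) + 1))) fun a b h => Nat.add_lt_add_right h _
  rw [e1, e2, h2.1, h2.2] at h1
  simp only [S, X, permTree]
  constructor
  · exact_mod_cast h1.1
  · rw [← hxs]
    exact_mod_cast h1.2

theorem isAdditive_S (t : ℕ) : IsAdditive t (S t) fun _ => 1 where
  zero n σ hn := by
    rw [S, permTree, (params_eq_zero t _ (nodup_ofFn_val σ) (by simpa using hn)).1, Nat.cast_zero]
  split n σ k hn hk := (params_split σ k hn hk).1

theorem isAdditive_X (t : ℕ) : IsAdditive t (X t) fun n => (n : ℝ) - 1 where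
  zero n σ hn := by
    rw [X, permTree, (params_eq_zero t _ (nodup_ofFn_val σ) (by simpa using hn)).2, Nat.cast_zero]
  split n σ k hn hk := (params_split σ k hn hk).2

/-- The average over all permutations. -/
def permAvg (n : ℕ) (F : Equiv.Perm (Fin n) → ℝ) : ℝ := (n ! : ℝ)⁻¹ * ∑ σ, F σ

section permAvg

variable {n : ℕ} (F G : Equiv.Perm (Fin n) → ℝ) (c : ℝ)

theorem permAvg_add : permAvg n (fun σ => F σ + G σ) = permAvg n F + permAvg n G := by
  simp only [permAvg, Finset.sum_add_distrib, mul_add]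

theorem permAvg_sub : permAvg n (fun σ => F σ - G σ) = permAvg n F - permAvg n G := by
  simp only [permAvg, Finset.sum_sub_distrib, mul_sub]

theorem permAvg_const_mul : permAvg n (fun σ => c * F σ) = c * permAvg n F := by
  simp only [permAvg, ← Finset.mul_sum]
  ring

theorem permAvg_mul_const : permAvg n (fun σ => F σ * c) = permAvg n F * c := by
  simp only [permAvg, ← Finset.sum_mul]
  ring

theorem permAvg_const : permAvg n (fun _ => c) = c := by
  rw [permAvg, Finset.sum_const, Finset.card_univ, Fintype.card_perm, Fintype.card_fin,
    nsmul_eq_mul, inv_mul_cancel_left₀ (by positivity)]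

theorem integral_permMeasure :
    @MeasureTheory.integral _ _ _ _ ⊤ (permMeasure n) F = permAvg n F := by
  let _ : MeasurableSpace (Equiv.Perm (Fin n)) := ⊤
  rw [permMeasure, PMF.integral_eq_sum, permAvg, Finset.mul_sum]
  refine Finset.sum_congr rfl fun σ _ => ?_
  rw [PMF.uniformOfFintype_apply, Fintype.card_perm, Fintype.card_fin, smul_eq_mul]
  simp

/-- The mixed second moment about the point `(a, b)`. -/
def moment (a b : ℝ) : ℝ := permAvg n fun σ => (F σ - a) * (G σ - b)

theorem moment_eq (a b : ℝ) : moment F G a b =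
    moment F G (permAvg n F) (permAvg n G) + (permAvg n F - a) * (permAvg n G - b) := by
  have : ∀ a b, moment F G a b =
      permAvg n (fun σ => F σ * G σ) - permAvg n F * b - a * permAvg n G + a * b := by
    intro a b
    rw [← permAvg_mul_const, ← permAvg_const_mul, ← permAvg_const (n := n) (a * b), ← permAvg_sub,
      ← permAvg_sub, ← permAvg_add, moment]
    congr 1
    funext σ
    ring
  rw [this, this]
  ring

theorem cov_permMeasure :
    cov[F, G; permMeasure n] = moment F G (permAvg n F) (permAvg n G) := by
  rw [ProbabilityTheory.covariance, integral_permMeasure, integral_permMeasure,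
    integral_permMeasure]
  rfl

theorem var_permMeasure :
    Var[F; permMeasure n] = moment F F (permAvg n F) (permAvg n F) := by
  rw [← cov_permMeasure, ProbabilityTheory.covariance_self]
  exact (measurable_from_top).aemeasurable

end permAvg

/-- Conditioning on the two subtrees. -/
theorem permAvg_split {t n : ℕ} (hn : 2 * t + 1 ≤ n) (F : Equiv.Perm (Fin n) → ℝ)
    (Φ : ∀ k : Fin n, Equiv.Perm (Fin k) → Equiv.Perm (Fin (n - 1 - k)) → ℝ)
    (h : ∀ σ k, IsMedian k t (firstKeys (2 * t + 1) σ) →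
      F σ = Φ k (smallPerm k σ) (largePerm k σ)) :
    permAvg n F = ∑ k : Fin n, wt ℝ t n k *
      permAvg k fun τ => permAvg (n - 1 - k) fun τ' => Φ k τ τ' := by
  classical
  choose piv hpiv huniq using fun σ => existsUnique_isMedian hn σ
  have hfib : ∀ k, Finset.univ.filter (fun σ => piv σ = k) =
      Finset.univ.filter (fun σ : Equiv.Perm (Fin n) => IsMedian k t (firstKeys (2 * t + 1) σ)) := by
    intro k
    refine Finset.filter_congr fun σ _ => ⟨fun h => h ▸ hpiv σ, fun h => (huniq σ k h).symm⟩
  rw [permAvg, ← Finset.sum_fiberwise _ piv, Finset.mul_sum]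
  refine Finset.sum_congr rfl fun k _ => ?_
  have h1 := sum_perm_split k t (2 * t + 1) (Φ k)
  rw [card_median k t hn] at h1
  have h2 : ∑ σ with piv σ = k, F σ =
      ∑ σ ∈ Finset.univ.filter (fun σ : Equiv.Perm (Fin n) => IsMedian k t (firstKeys (2 * t + 1) σ)),
        Φ k (smallPerm k σ) (largePerm k σ) := by
    rw [← hfib]
    refine Finset.sum_congr rfl fun σ hσ => h σ k ?_
    rw [← (Finset.mem_filter.1 hσ).2]
    exact hpiv σ
  rw [h2]
  simp only [permAvg, ← Finset.mul_sum]
  have e1 : ((k : ℕ) ! : ℝ) ≠ 0 := by positivity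
  have e2 : ((n - 1 - k)! : ℝ) ≠ 0 := by positivity
  have e3 : (n ! : ℝ) ≠ 0 := by positivity
  push_cast at h1
  field_simp
  linear_combination h1

section Recursion

variable {t : ℕ} {U V : ∀ n, Equiv.Perm (Fin n) → ℝ} {τ τ' : ℕ → ℝ}

theorem IsAdditive.mean_eq_zero (hU : IsAdditive t U τ) {n : ℕ} (hn : n ≤ 2 * t) :
    permAvg n (U n) = 0 := by
  have : U n = fun _ => 0 := funext fun σ => hU.zero n σ hn
  rw [this, permAvg_const]

theorem sum_wt {t n : ℕ} (hn : 2 * t + 1 ≤ n) : ∑ k ∈ Finset.range n, wt ℝ t n k = 1 := by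
  have h := permAvg_split hn (fun _ => 1) (fun _ _ _ => 1) fun _ _ _ => rfl
  simp only [permAvg_const, mul_one] at h
  rw [h, Finset.sum_range]

/-- The second moments satisfy a recurrence of quicksort type. -/
theorem IsAdditive.moment_rec (hU : IsAdditive t U τ) (hV : IsAdditive t V τ') (a b : ℕ → ℝ) {n : ℕ}
    (hn : 2 * t + 1 ≤ n) :
    moment (U n) (V n) (a n) (b n) = ∑ k ∈ Finset.range n, wt ℝ t n k *
      (moment (U k) (V k) (a k) (b k) +
        moment (U (n - 1 - k)) (V (n - 1 - k)) (a (n - 1 - k)) (b (n - 1 - k)) +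
        (permAvg k (U k) - a k) *
          (permAvg (n - 1 - k) (V (n - 1 - k)) - b (n - 1 - k) +
            (τ' n + b k + b (n - 1 - k) - b n)) +
        (permAvg (n - 1 - k) (U (n - 1 - k)) - a (n - 1 - k)) *
          (permAvg k (V k) - b k + (τ' n + b k + b (n - 1 - k) - b n)) +
        (τ n + a k + a (n - 1 - k) - a n) *
          (permAvg k (V k) - b k + (permAvg (n - 1 - k) (V (n - 1 - k)) - b (n - 1 - k)) +
            (τ' n + b k + b (n - 1 - k) - b n))) := by
  rw [moment, permAvg_split hn _ (fun k τ₁ τ₂ =>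
    ((U k τ₁ - a k) + (U (n - 1 - k) τ₂ - a (n - 1 - k)) + (τ n + a k + a (n - 1 - k) - a n)) *
    ((V k τ₁ - b k) + (V (n - 1 - k) τ₂ - b (n - 1 - k)) + (τ' n + b k + b (n - 1 - k) - b n)))]
  · rw [Finset.sum_range]
    refine Finset.sum_congr rfl fun k _ => ?_
    congr 1
    set d := τ n + a k + a (n - 1 - k) - a n
    set d' := τ' n + b k + b (n - 1 - k) - b n
    set m := n - 1 - (k : ℕ)
    have h1 : ∀ x y : ℝ, permAvg m (fun τ₂ => (x + (U m τ₂ - a m) + d) * (y + (V m τ₂ - b m) + d')) =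
        moment (U m) (V m) (a m) (b m) + (x + d) * (y + d') + (x + d) * (permAvg m (V m) - b m) +
          (permAvg m (U m) - a m) * (y + d') := by
      intro x y
      have e : (fun τ₂ => (x + (U m τ₂ - a m) + d) * (y + (V m τ₂ - b m) + d')) =
          fun τ₂ => ((((U m τ₂ - a m) * (V m τ₂ - b m) + (x + d) * (y + d')) +
            (x + d) * (V m τ₂ - b m)) + (U m τ₂ - a m) * (y + d')) := by
        funext τ₂
        ring
      rw [e, permAvg_add, permAvg_add, permAvg_add, permAvg_const, permAvg_const_mul,
        permAvg_mul_const, permAvg_sub, permAvg_sub, permAvg_const, permAvg_const, moment]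
    simp only [h1]
    have e : (fun τ₁ => moment (U m) (V m) (a m) (b m) + (U k τ₁ - a k + d) * (V k τ₁ - b k + d') +
        (U k τ₁ - a k + d) * (permAvg m (V m) - b m) +
          (permAvg m (U m) - a m) * (V k τ₁ - b k + d')) =
        fun τ₁ => (((U k τ₁ - a k) * (V k τ₁ - b k) + (U k τ₁ - a k) * (d' + (permAvg m (V m) - b m)))
          + (d + (permAvg m (U m) - a m)) * (V k τ₁ - b k)) +
          (moment (U m) (V m) (a m) (b m) + d * d' + d * (permAvg m (V m) - b m) +
            (permAvg m (U m) - a m) * d') := by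
      funext τ₁
      ring
    rw [e, permAvg_add, permAvg_add, permAvg_add, permAvg_const, permAvg_const_mul,
        permAvg_mul_const, permAvg_sub, permAvg_sub, permAvg_const, permAvg_const]
    simp only [moment]
    ring
  · intro σ k hk
    rw [hU.split n σ k hn hk, hV.split n σ k hn hk]
    ring

theorem sum_wt_reflect (t n : ℕ) (f : ℕ → ℝ) :
    ∑ k ∈ Finset.range n, wt ℝ t n k * f (n - 1 - k) = avg t f n := sum_wt_symm t n f

theorem IsAdditive.mean_rec (hU : IsAdditive t U τ) {n : ℕ} (hn : 2 * t + 1 ≤ n) :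
    permAvg n (U n) = τ n + 2 * avg t (fun n => permAvg n (U n)) n := by
  rw [permAvg_split hn _ (fun k τ₁ τ₂ => τ n + U k τ₁ + U (n - 1 - k) τ₂)
    fun σ k hk => hU.split n σ k hn hk]
  simp only [permAvg_add, permAvg_const]
  rw [← Finset.sum_range (n := n) (f := fun k => wt ℝ t n k *
    (τ n + permAvg k (U k) + permAvg (n - 1 - k) (U (n - 1 - k))))]
  simp only [mul_add, Finset.sum_add_distrib, ← Finset.sum_mul, sum_wt hn]
  rw [sum_wt_reflect t n fun n => permAvg n (U n), avg]
  ring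

/-- The covariance of two parameters. -/
def covSeq (U V : ∀ n, Equiv.Perm (Fin n) → ℝ) (n : ℕ) : ℝ :=
  moment (U n) (V n) (permAvg n (U n)) (permAvg n (V n))

theorem IsAdditive.covSeq_eq_zero (hU : IsAdditive t U τ) {n : ℕ} (hn : n ≤ 2 * t) :
    covSeq U V n = 0 := by
  have : U n = fun _ => 0 := funext fun σ => hU.zero n σ hn
  rw [covSeq, moment, this, permAvg_const]
  simp [permAvg]

/-- The recurrence of the covariance. -/
theorem IsAdditive.covSeq_rec (hU : IsAdditive t U τ) (hV : IsAdditive t V τ') {u v : ℕ → ℝ}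
    (hu : ∀ n, permAvg n (U n) = u n) (hv : ∀ n, permAvg n (V n) = v n) {n : ℕ}
    (hn : 2 * t + 1 ≤ n) :
    covSeq U V n = 2 * avg t (covSeq U V) n + ∑ k ∈ Finset.range n, wt ℝ t n k *
      ((τ n + u k + u (n - 1 - k) - u n) * (τ' n + v k + v (n - 1 - k) - v n)) := by
  have h := hU.moment_rec hV u v hn
  simp only [hu, hv, sub_self, zero_mul, add_zero, zero_add, mul_add, Finset.sum_add_distrib] at h
  have e : ∀ k, moment (U k) (V k) (u k) (v k) = covSeq U V k := fun k => by
    rw [covSeq, hu, hv]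
  simp only [e] at h
  rw [h, sum_wt_reflect t n (covSeq U V), avg]
  ring

/-- The recurrence of the second moments about sequences for which the tolls are deterministic. -/
theorem IsAdditive.covSeq_add_mul_rec (hU : IsAdditive t U τ) (hV : IsAdditive t V τ')
    {u v a b α β : ℕ → ℝ} (hu : ∀ n, permAvg n (U n) = u n + a n) (hv : ∀ n, permAvg n (V n) = v n + b n)
    (hα : ∀ n, ∀ k < n, τ n + a k + a (n - 1 - k) - a n = α n)
    (hβ : ∀ n, ∀ k < n, τ' n + b k + b (n - 1 - k) - b n = β n) {n : ℕ} (hn : 2 * t + 1 ≤ n) :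
    covSeq U V n + u n * v n = 2 * avg t (fun n => covSeq U V n + u n * v n) n +
      2 * avg₂ t u v n + α n * v n + β n * u n - α n * β n := by
  have hvn : v n = β n + 2 * avg t v n := by
    have h1 := hV.mean_rec hn
    simp only [hv, avg_add] at h1
    have h2 : τ' n + 2 * avg t b n - b n = β n := by
      rw [← mul_one (β n), ← sum_wt hn, Finset.mul_sum, avg, two_mul]
      nth_rewrite 2 [← avg]
      rw [← sum_wt_reflect, ← Finset.sum_add_distrib]
      have : τ' n - b n = ∑ k ∈ Finset.range n, wt ℝ t n k * (τ' n - b n) := by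
        rw [← Finset.sum_mul, sum_wt hn, one_mul]
      rw [add_sub_right_comm, this, ← Finset.sum_add_distrib]
      refine Finset.sum_congr rfl fun k hk => ?_
      rw [← hβ n k (Finset.mem_range.1 hk)]
      ring
    linarith
  have hun : u n = α n + 2 * avg t u n := by
    have h1 := hU.mean_rec hn
    simp only [hu, avg_add] at h1
    have h2 : τ n + 2 * avg t a n - a n = α n := by
      rw [← mul_one (α n), ← sum_wt hn, Finset.mul_sum, avg, two_mul]
      nth_rewrite 2 [← avg]
      rw [← sum_wt_reflect, ← Finset.sum_add_distrib]
      have : τ n - a n = ∑ k ∈ Finset.range n, wt ℝ t n k * (τ n - a n) := by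
        rw [← Finset.sum_mul, sum_wt hn, one_mul]
      rw [add_sub_right_comm, this, ← Finset.sum_add_distrib]
      refine Finset.sum_congr rfl fun k hk => ?_
      rw [← hα n k (Finset.mem_range.1 hk)]
      ring
    linarith
  have e : ∀ k, moment (U k) (V k) (a k) (b k) = covSeq U V k + u k * v k := fun k => by
    rw [moment_eq, covSeq, hu, hv]
    ring
  have h := hU.moment_rec hV a b hn
  simp only [e, hu, hv, add_sub_cancel_right] at h
  rw [h]
  have h3 : ∀ k ∈ Finset.range n, wt ℝ t n k *
      (covSeq U V k + u k * v k + (covSeq U V (n - 1 - k) + u (n - 1 - k) * v (n - 1 - k)) +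
        u k * (v (n - 1 - k) + (τ' n + b k + b (n - 1 - k) - b n)) +
        u (n - 1 - k) * (v k + (τ' n + b k + b (n - 1 - k) - b n)) +
        (τ n + a k + a (n - 1 - k) - a n) *
          (v k + v (n - 1 - k) + (τ' n + b k + b (n - 1 - k) - b n))) =
      wt ℝ t n k * (covSeq U V k + u k * v k) +
      wt ℝ t n k * (covSeq U V (n - 1 - k) + u (n - 1 - k) * v (n - 1 - k)) +
      wt ℝ t n k * (u k * v (n - 1 - k)) + wt ℝ t n k * (v k * u (n - 1 - k)) +
      (wt ℝ t n k * u k) * β n + (wt ℝ t n k * u (n - 1 - k)) * β n +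
      (wt ℝ t n k * v k) * α n + (wt ℝ t n k * v (n - 1 - k)) * α n +
      wt ℝ t n k * (α n * β n) := by
    intro k hk
    rw [hα n k (Finset.mem_range.1 hk), hβ n k (Finset.mem_range.1 hk)]
    ring
  rw [Finset.sum_congr rfl h3]
  simp only [Finset.sum_add_distrib, ← Finset.sum_mul, sum_wt hn]
  rw [sum_wt_reflect t n fun k => covSeq U V k + u k * v k, sum_wt_reflect t n u,
    sum_wt_reflect t n v]
  have e1 : ∑ k ∈ Finset.range n, wt ℝ t n k * (u k * v (n - 1 - k)) = avg₂ t u v n := rfl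
  have e2 : ∑ k ∈ Finset.range n, wt ℝ t n k * (v k * u (n - 1 - k)) = avg₂ t u v n :=
    avg₂_comm t v u n
  have e3 : ∀ f, ∑ k ∈ Finset.range n, wt ℝ t n k * f k = avg t f n := fun f => rfl
  rw [e1, e2, e3 u, e3 v, e3 fun k => covSeq U V k + u k * v k]
  linear_combination (-β n) * hun - α n * hvn

end Recursion

/-! ### Polynomial growth -/

/-- `f n = O((n+1)^e)`. -/
def PolyBound (f : ℕ → ℂ) (e : ℝ) : Prop := ∃ C, 0 < C ∧ ∀ n : ℕ, ‖f n‖ ≤ C * ((n : ℝ) + 1) ^ e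

namespace PolyBound

variable {f g : ℕ → ℂ} {e e' : ℝ}

theorem mono (hf : PolyBound f e) (h : e ≤ e') : PolyBound f e' := by
  obtain ⟨C, hC, hf⟩ := hf
  refine ⟨C, hC, fun n => (hf n).trans ?_⟩
  gcongr
  linarith [n.cast_nonneg (α := ℝ)]

theorem add (hf : PolyBound f e) (hg : PolyBound g e) : PolyBound (fun n => f n + g n) e := by
  obtain ⟨C, hC, hf⟩ := hf
  obtain ⟨D, hD, hg⟩ := hg
  refine ⟨C + D, by positivity, fun n => (norm_add_le _ _).trans ?_⟩
  rw [add_mul]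
  exact add_le_add (hf n) (hg n)

theorem mul (hf : PolyBound f e) (hg : PolyBound g e') :
    PolyBound (fun n => f n * g n) (e + e') := by
  obtain ⟨C, hC, hf⟩ := hf
  obtain ⟨D, hD, hg⟩ := hg
  refine ⟨C * D, by positivity, fun n => ?_⟩
  rw [norm_mul, Real.rpow_add (by positivity), mul_mul_mul_comm]
  exact mul_le_mul (hf n) (hg n) (norm_nonneg _) (by positivity)

theorem mul_le {e'' : ℝ} (hf : PolyBound f e) (hg : PolyBound g e') (h : e + e' ≤ e'') :
    PolyBound (fun n => f n * g n) e'' := (hf.mul hg).mono h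

theorem const (c : ℂ) (he : 0 ≤ e) : PolyBound (fun _ => c) e := by
  refine ⟨‖c‖ + 1, by positivity, fun n => ?_⟩
  have : (1 : ℝ) ≤ ((n : ℝ) + 1) ^ e :=
    Real.one_le_rpow (by linarith [n.cast_nonneg (α := ℝ)]) he
  nlinarith [norm_nonneg c]

theorem const_mul (c : ℂ) (hf : PolyBound f e) : PolyBound (fun n => c * f n) e :=
  (const c le_rfl).mul_le hf (by linarith)

theorem sub (hf : PolyBound f e) (hg : PolyBound g e) : PolyBound (fun n => f n - g n) e := by
  have := hf.add (hg.const_mul (-1))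
  simpa [sub_eq_add_neg] using this

theorem zero : PolyBound (fun _ => 0) e := by
  refine ⟨1, one_pos, fun n => ?_⟩
  rw [norm_zero]
  positivity

theorem sum {ι : Type*} {s : Finset ι} {F : ι → ℕ → ℂ} (h : ∀ i ∈ s, PolyBound (F i) e) :
    PolyBound (fun n => ∑ i ∈ s, F i n) e := by
  classical
  induction s using Finset.induction_on with
  | empty => simpa using zero
  | insert i s hi ih =>
    simp only [Finset.sum_insert hi]
    exact (h i (Finset.mem_insert_self _ _)).add (ih fun j hj => h j (Finset.mem_insert_of_mem hj))

theorem of_eq {N : ℕ} (hg : PolyBound g e) (h : ∀ n, N ≤ n → f n = g n) : PolyBound f e := by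
  obtain ⟨D, hD, hg⟩ := hg
  have hp : ∀ n : ℕ, 0 < ((n : ℝ) + 1) ^ e := fun n => by positivity
  refine ⟨D + ∑ k ∈ Finset.range N, ‖f k‖ / ((k : ℝ) + 1) ^ e,
    add_pos_of_pos_of_nonneg hD (Finset.sum_nonneg fun k _ => by positivity), fun n => ?_⟩
  by_cases hn : N ≤ n
  · rw [h n hn]
    refine (hg n).trans (mul_le_mul_of_nonneg_right ?_ (hp n).le)
    have : 0 ≤ ∑ k ∈ Finset.range N, ‖f k‖ / ((k : ℝ) + 1) ^ e :=
      Finset.sum_nonneg fun k _ => by positivity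
    linarith
  · rw [← div_le_iff₀ (hp n)]
    have := Finset.single_le_sum (f := fun k : ℕ => ‖f k‖ / ((k : ℝ) + 1) ^ e)
      (fun k _ => by positivity) (Finset.mem_range.2 (not_le.1 hn))
    linarith

theorem cast_add (c : ℂ) (he : 1 ≤ e) : PolyBound (fun n => (n : ℂ) + c) e := by
  refine mono ?_ he
  refine add ⟨1, one_pos, fun n => ?_⟩ (const c zero_le_one)
  rw [Complex.norm_natCast, Real.rpow_one]
  linarith

theorem avg₂_le {t : ℕ} {e'' : ℝ} (hf : PolyBound f e) (hg : PolyBound g e') (he : -1 < e)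
    (he' : -1 < e') (h : e + e' ≤ e'') : PolyBound (FBBST.avg₂ t f g) e'' := by
  obtain ⟨C, hC, hf⟩ := hf
  obtain ⟨D, hD, hg⟩ := hg
  exact PolyBound.mono (norm_avg₂_le_rpow he he' (fun k _ => hf k) fun k _ => hg k) h

theorem eig {a : ℂ} (h : a.re - 1 ≤ e) : PolyBound (FBBST.eig a) e := norm_eig_le_of_re_le h

theorem isLittleO (hf : PolyBound f e) (h : e < e') : f =o[atTop] fun n : ℕ => (n : ℝ) ^ e' := by
  obtain ⟨C, hC, hf⟩ := hf
  have h1 : f =O[atTop] fun n : ℕ => ((n : ℝ) + 1) ^ e := by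
    refine IsBigO.of_bound C (Eventually.of_forall fun n => ?_)
    rw [Real.norm_of_nonneg (by positivity)]
    exact hf n
  have h2 : (fun n : ℕ => ((n : ℝ) + 1) ^ e) =o[atTop] fun n : ℕ => ((n : ℝ) + 1) ^ e' := by
    rw [isLittleO_iff_tendsto' (Eventually.of_forall fun n h => absurd h (by positivity))]
    have : Tendsto (fun n : ℕ => ((n : ℝ) + 1) ^ (-(e' - e))) atTop (𝓝 0) :=
      (tendsto_rpow_neg_atTop (sub_pos.2 h)).comp
        (tendsto_atTop_add_const_right _ _ tendsto_natCast_atTop_atTop)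
    refine this.congr fun n => ?_
    rw [← Real.rpow_sub (by positivity)]
    congr 1
    ring
  have h3 : (fun n : ℕ => ((n : ℝ) + 1) ^ e') =O[atTop] fun n : ℕ => (n : ℝ) ^ e' := by
    refine IsBigO.of_bound (max 1 ((2 : ℝ) ^ e')) (eventually_atTop.2 ⟨1, fun n hn => ?_⟩)
    have hn' : (1 : ℝ) ≤ n := by exact_mod_cast hn
    rw [Real.norm_of_nonneg (by positivity), Real.norm_of_nonneg (by positivity)]
    rcases le_or_gt 0 e' with he | he
    · refine (Real.rpow_le_rpow (by positivity) (show (n : ℝ) + 1 ≤ 2 * n by linarith) he).trans ?_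
      rw [Real.mul_rpow (by norm_num) (by positivity)]
      gcongr
      exact le_max_right _ _
    · refine (Real.rpow_le_rpow_of_nonpos (show (0 : ℝ) < n by linarith)
        (by linarith) he.le).trans ?_
      exact le_mul_of_one_le_left (by positivity) (le_max_left _ _)
  exact (h1.trans_isLittleO h2).trans_isBigO h3

end PolyBound

/-! ### Derivatives with respect to the parameter -/

/-- The sum `∑_{i<n} 1/(a+i)`. -/
def psum (a : ℂ) (n : ℕ) : ℂ := ∑ i ∈ Finset.range n, 1 / (a + i)

/-- The sum `∑_{i<n} 1/(a+i)^2`. -/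
def psumSq (a : ℂ) (n : ℕ) : ℂ := ∑ i ∈ Finset.range n, 1 / (a + i) ^ 2

/-- The derivative of `a ↦ eig a n`. -/
def deig (a : ℂ) (n : ℕ) : ℂ := eig a n * psum a n

/-- The second derivative of `a ↦ eig a n`. -/
def ddeig (a : ℂ) (n : ℕ) : ℂ := eig a n * (psum a n ^ 2 - psumSq a n)

theorem polyBound_psum (a : ℂ) {e : ℝ} (he : 0 < e) : PolyBound (psum a) e := by
  have h1 : ∃ C : ℝ, 0 < C ∧ ∀ n : ℕ, ‖1 / (a + n)‖ ≤ C * (1 / ((n : ℝ) + 1)) := by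
    have : PolyBound (fun n => 1 / (a + n)) (-1) := by
      obtain ⟨N, hN⟩ := exists_nat_gt (2 * ‖a‖ + 1)
      refine (show PolyBound (fun n : ℕ => if N ≤ n then 1 / (a + n) else 0) (-1) from ?_).of_eq
        (N := N) fun n hn => by rw [if_pos hn]
      refine ⟨4, by norm_num, fun n => ?_⟩
      rw [Real.rpow_neg_one]
      beta_reduce
      split_ifs with h
      · have h2 : (N : ℝ) ≤ n := by exact_mod_cast h
        have h3 : (n : ℝ) - ‖a‖ ≤ ‖a + n‖ := by
          have := norm_sub_norm_le (n : ℂ) (-a)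
          rw [Complex.norm_natCast, norm_neg, sub_neg_eq_add, add_comm (n : ℂ)] at this
          exact this
        have h4 : ((n : ℝ) + 1) / 4 ≤ ‖a + n‖ := by linarith [norm_nonneg a]
        rw [norm_div, norm_one, ← div_eq_mul_inv, div_le_div_iff₀ (by
          have : (0 : ℝ) < (n + 1) / 4 := by positivity
          linarith) (by positivity)]
        linarith
      · rw [norm_zero]; positivity
    obtain ⟨C, hC, h⟩ := this
    exact ⟨C, hC, fun n => by rw [one_div ((n : ℝ) + 1), ← Real.rpow_neg_one]; exact h n⟩
  obtain ⟨C, hC, h⟩ := h1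
  refine ⟨C * (1 + 1 / e), by positivity, fun n => ?_⟩
  have h2 : ‖psum a n‖ ≤ C * ∑ i ∈ Finset.range n, 1 / ((i : ℝ) + 1) := by
    rw [Finset.mul_sum]
    exact (norm_sum_le _ _).trans (Finset.sum_le_sum fun i _ => h i)
  have h3 : ∑ i ∈ Finset.range n, 1 / ((i : ℝ) + 1) ≤ 1 + Real.log (n + 1) := by
    rcases Nat.eq_zero_or_pos n with rfl | hn
    · simp
    · have := harmonic_le_one_add_log n
      simp only [harmonic, Rat.cast_sum, Rat.cast_inv, Rat.cast_natCast] at this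
      have h4 : Real.log n ≤ Real.log (n + 1) :=
        Real.log_le_log (by exact_mod_cast hn) (by linarith)
      refine le_trans (le_of_eq ?_) (this.trans (by linarith))
      refine Finset.sum_congr rfl fun i _ => ?_
      push_cast
      rw [one_div]
  have h4 := Real.log_le_rpow_div (show (0 : ℝ) ≤ n + 1 by positivity) he
  have h5 : (1 : ℝ) ≤ ((n : ℝ) + 1) ^ e :=
    Real.one_le_rpow (by linarith [n.cast_nonneg (α := ℝ)]) he.le
  rw [mul_assoc]
  refine h2.trans (mul_le_mul_of_nonneg_left (h3.trans ?_) hC.le)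
  rw [add_mul, one_mul, one_div, inv_mul_eq_div]
  linarith

theorem polyBound_deig {a : ℂ} {e : ℝ} (h : a.re - 1 < e) : PolyBound (deig a) e :=
  (PolyBound.eig le_rfl).mul_le (polyBound_psum a (sub_pos.2 h)) (by linarith)

theorem hasDerivAt_prod_add {ι : Type*} (s : Finset ι) (x : ι → ℂ) (c : ι → ℂ) {a : ℂ}
    (h : ∀ i ∈ s, a + x i ≠ 0) :
    HasDerivAt (fun z => ∏ i ∈ s, (z + x i) / c i)
      ((∏ i ∈ s, (a + x i) / c i) * ∑ i ∈ s, 1 / (a + x i)) a := by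
  classical
  induction s using Finset.induction_on with
  | empty => simpa using hasDerivAt_const a (1 : ℂ)
  | insert i s hi ih =>
    simp only [Finset.prod_insert hi, Finset.sum_insert hi]
    have h1 := ((hasDerivAt_id a).add_const (x i)).div_const (c i)
    have h2 := h1.mul (ih fun j hj => h j (Finset.mem_insert_of_mem hj))
    refine h2.congr_deriv ?_
    have := h i (Finset.mem_insert_self _ _)
    simp only [id]
    field_simp

theorem add_natCast_ne_zero {a : ℂ} (ha : 0 < a.re) (n : ℕ) : a + n ≠ 0 := by
  intro h
  have := congrArg Complex.re h
  rw [Complex.add_re, Complex.natCast_re, Complex.zero_re] at this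
  linarith [n.cast_nonneg (α := ℝ)]

theorem hasDerivAt_eig {a : ℂ} (ha : 0 < a.re) (n : ℕ) :
    HasDerivAt (fun z => eig z n) (deig a n) a :=
  hasDerivAt_prod_add _ _ _ fun i _ => add_natCast_ne_zero ha i

theorem hasDerivAt_indProd {a : ℂ} (ha : 0 < a.re) (t : ℕ) :
    HasDerivAt (fun z => indProd t z) (indProd t a * logDerivSum t a) a :=
  hasDerivAt_prod_add _ _ _ fun i _ => add_natCast_ne_zero ha i

theorem hasDerivAt_sum_inv {ι : Type*} (s : Finset ι) (x : ι → ℂ) {a : ℂ}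
    (h : ∀ i ∈ s, a + x i ≠ 0) :
    HasDerivAt (fun z => ∑ i ∈ s, 1 / (z + x i)) (-∑ i ∈ s, 1 / (a + x i) ^ 2) a := by
  rw [← Finset.sum_neg_distrib]
  refine HasDerivAt.fun_sum fun i hi => ?_
  have := (((hasDerivAt_id a).add_const (x i)).inv (h i hi))
  simp only [one_div]
  refine this.congr_deriv ?_
  simp [neg_div]

theorem hasDerivAt_psum {a : ℂ} (ha : 0 < a.re) (n : ℕ) :
    HasDerivAt (fun z => psum z n) (-psumSq a n) a :=
  hasDerivAt_sum_inv _ _ fun i _ => add_natCast_ne_zero ha i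

theorem hasDerivAt_deig {a : ℂ} (ha : 0 < a.re) (n : ℕ) :
    HasDerivAt (fun z => deig z n) (ddeig a n) a := by
  refine ((hasDerivAt_eig ha n).mul (hasDerivAt_psum ha n)).congr_deriv ?_
  rw [ddeig, deig]
  ring

/-- The sum `∑_{t≤j≤2t} 1/(a+j)^2`. -/
def logDerivSumSq (t : ℕ) (a : ℂ) : ℂ := ∑ j ∈ Finset.Icc t (2 * t), 1 / (a + j) ^ 2

theorem hasDerivAt_logDerivSum {a : ℂ} (ha : 0 < a.re) (t : ℕ) :
    HasDerivAt (fun z => logDerivSum t z) (-logDerivSumSq t a) a :=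
  hasDerivAt_sum_inv _ _ fun i _ => add_natCast_ne_zero ha i

theorem HasDerivAt.avg₂_right {F : ℂ → ℕ → ℂ} {F' : ℕ → ℂ} {a : ℂ}
    (h : ∀ k, HasDerivAt (fun z => F z k) (F' k) a) (t : ℕ) (f : ℕ → ℂ) (n : ℕ) :
    HasDerivAt (fun z => avg₂ t f (F z) n) (avg₂ t f F' n) a :=
  HasDerivAt.fun_sum fun _ _ => ((h _).const_mul _).const_mul _

theorem HasDerivAt.avg {F : ℂ → ℕ → ℂ} {F' : ℕ → ℂ} {a : ℂ}
    (h : ∀ k, HasDerivAt (fun z => F z k) (F' k) a) (t n : ℕ) :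
    HasDerivAt (fun z => avg t (F z) n) (avg t F' n) a :=
  HasDerivAt.fun_sum fun _ _ => (h _).const_mul _

theorem avg_deig_mul {t n : ℕ} (hn : 2 * t + 1 ≤ n) {a : ℂ} (ha : 0 < a.re) :
    avg t (deig a) n * indProd t a = deig a n - logDerivSum t a * eig a n := by
  have h1 := (HasDerivAt.avg (fun k => hasDerivAt_eig ha k) t n).mul (hasDerivAt_indProd ha t)
  have h2 : (fun z : ℂ => avg t (eig z) n) * (fun z => indProd t z) = fun z => eig z n :=
    funext fun z => avg_eig_mul hn z
  have h3 := (h2 ▸ h1).unique (hasDerivAt_eig ha n)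
  linear_combination h3 - logDerivSum t a * avg_eig_mul hn a

theorem eventually_re_pos {a : ℂ} (ha : 0 < a.re) : ∀ᶠ z : ℂ in 𝓝 a, 0 < z.re :=
  (isOpen_lt continuous_const Complex.continuous_re).mem_nhds ha

theorem avg_ddeig_mul {t n : ℕ} (hn : 2 * t + 1 ≤ n) {a : ℂ} (ha : 0 < a.re) :
    avg t (ddeig a) n * indProd t a = ddeig a n - 2 * logDerivSum t a * deig a n +
      (logDerivSum t a ^ 2 + logDerivSumSq t a) * eig a n := by
  have h1 := (HasDerivAt.avg (fun k => hasDerivAt_deig ha k) t n).mul (hasDerivAt_indProd ha t)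
  have h2 : (fun z => avg t (deig z) n) * (fun z => indProd t z) =ᶠ[𝓝 a]
      fun z => deig z n - logDerivSum t z * eig z n := by
    filter_upwards [eventually_re_pos ha] with z hz
    exact avg_deig_mul hn hz
  have h3 := (h1.congr_of_eventuallyEq h2.symm).unique
    ((hasDerivAt_deig ha n).sub ((hasDerivAt_logDerivSum ha t).mul (hasDerivAt_eig ha n)))
  linear_combination h3 - logDerivSum t a * avg_deig_mul hn ha

theorem avg₂_eig_mul' {t n : ℕ} (hn : 2 * t + 1 ≤ n) (a b : ℂ) :
    avg₂ t (eig a) (eig b) n * eig (a + b - 1) (2 * t + 1) =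
      eig a t * eig b t * eig (a + b - 1) n := by
  rw [eig_two_mul_add_one]
  exact avg₂_eig_mul hn a b

theorem avg₂_eig_deig_mul {t n : ℕ} (hn : 2 * t + 1 ≤ n) {a b : ℂ} (hb : 0 < b.re)
    (hab : 0 < (a + b - 1).re) :
    avg₂ t (eig a) (deig b) n * eig (a + b - 1) (2 * t + 1) = eig a t * eig b t *
      eig (a + b - 1) n * (psum b t + psum (a + b - 1) n - psum (a + b - 1) (2 * t + 1)) := by
  have hs : HasDerivAt (fun z => a + z - 1) 1 b := ((hasDerivAt_id b).const_add a).sub_const 1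
  have h1 := (HasDerivAt.avg₂_right (fun k => hasDerivAt_eig hb k) t (eig a) n).mul
    (HasDerivAt.comp b (hasDerivAt_eig hab (2 * t + 1)) hs)
  have h2 := ((hasDerivAt_eig hb t).const_mul (eig a t)).mul
    (HasDerivAt.comp b (hasDerivAt_eig hab n) hs)
  have h3 : (fun z => avg₂ t (eig a) (eig z) n) *
      ((fun z => eig z (2 * t + 1)) ∘ fun z => a + z - 1) =
      (fun z => eig a t * eig z t) * ((fun z => eig z n) ∘ fun z => a + z - 1) :=
    funext fun z => avg₂_eig_mul' hn a z
  rw [h3] at h1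
  have h4 := h1.unique h2
  simp only [Function.comp_apply, mul_one, deig] at h4
  linear_combination h4 - psum (a + b - 1) (2 * t + 1) * avg₂_eig_mul' hn a b

theorem avg₂_deig_deig_mul {t n : ℕ} (hn : 2 * t + 1 ≤ n) {a b : ℂ} (ha : 0 < a.re) (hb : 0 < b.re)
    (hab : 0 < (a + b - 1).re) :
    avg₂ t (deig a) (deig b) n * eig (a + b - 1) (2 * t + 1) = eig a t * eig b t *
      eig (a + b - 1) n *
      ((psum a t + psum (a + b - 1) n - psum (a + b - 1) (2 * t + 1)) *
        (psum b t + psum (a + b - 1) n - psum (a + b - 1) (2 * t + 1)) -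
        (psumSq (a + b - 1) n - psumSq (a + b - 1) (2 * t + 1))) := by
  have hs : HasDerivAt (fun z => z + b - 1) 1 a := ((hasDerivAt_id a).add_const b).sub_const 1
  have h1 := (HasDerivAt.avg₂_right (fun k => hasDerivAt_eig ha k) t (deig b) n).mul
    (HasDerivAt.comp a (hasDerivAt_eig hab (2 * t + 1)) hs)
  have h2 := (((hasDerivAt_eig ha t).mul_const (eig b t)).mul
    (HasDerivAt.comp a (hasDerivAt_eig hab n) hs)).mul
    (((HasDerivAt.comp a (hasDerivAt_psum hab n) hs).const_add (psum b t)).sub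
      (HasDerivAt.comp a (hasDerivAt_psum hab (2 * t + 1)) hs))
  have hcont : ∀ᶠ z in 𝓝 a, 0 < (z + b - 1).re :=
    hs.continuousAt.eventually (eventually_re_pos hab)
  have h5 := h1.unique (h2.congr_of_eventuallyEq (by
    filter_upwards [hcont] with z hz
    rw [Pi.mul_apply, avg₂_comm]
    exact avg₂_eig_deig_mul hn hb hz))
  have h6 := avg₂_eig_deig_mul hn hb hab
  rw [avg₂_comm] at h6
  rw [avg₂_comm]
  simp only [Function.comp_apply, mul_one, deig, Pi.mul_apply, Pi.sub_apply] at h5 h6 ⊢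
  linear_combination h5 - psum (a + b - 1) (2 * t + 1) * h6

/-! ### The expectations -/

theorem ofReal_avg₂ (t : ℕ) (f g : ℕ → ℝ) (n : ℕ) :
    ((avg₂ t f g n : ℝ) : ℂ) = avg₂ t (fun k => (f k : ℂ)) (fun k => (g k : ℂ)) n := by
  simp only [avg₂, Complex.ofReal_sum, Complex.ofReal_mul, ofReal_wt]

theorem ofReal_avg (t : ℕ) (f : ℕ → ℝ) (n : ℕ) :
    ((avg t f n : ℝ) : ℂ) = avg t (fun k => (f k : ℂ)) n := by
  simp only [avg, Complex.ofReal_sum, Complex.ofReal_mul, ofReal_wt]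

theorem avg_const {t n : ℕ} (hn : 2 * t + 1 ≤ n) (c : ℂ) : avg t (fun _ => c) n = c := by
  rw [avg, ← Finset.sum_mul]
  simp only [← ofReal_wt, ← Complex.ofReal_sum, sum_wt hn, Complex.ofReal_one, one_mul]

/-- The sum `∑_{t≤j≤2t} 1/(2+j)`. -/
def invSum (t : ℕ) : ℝ := ∑ j ∈ Finset.Icc t (2 * t), 1 / (2 + j)

theorem ofReal_invSum (t : ℕ) : ((invSum t : ℝ) : ℂ) = logDerivSum t 2 := by
  simp [invSum, logDerivSum]

theorem invSum_pos (t : ℕ) : 0 < invSum t :=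
  Finset.sum_pos (fun j _ => by positivity) (Icc_nonempty t)

theorem res_two (t : ℕ) : res t 2 = ((1 / invSum t : ℝ) : ℂ) := by
  rw [res, ← ofReal_invSum]
  push_cast
  rfl

/-- The expectation of `𝒮_n`. -/
def sMean (t n : ℕ) : ℝ := permAvg n (S t n)

/-- The expectation of `𝒳_n`. -/
def xMean (t n : ℕ) : ℝ := permAvg n (X t n)

/-- The deviation of `E 𝒮_n + 1` from its linear part. -/
def sDev (t n : ℕ) : ℝ := sMean t n + 1 - 1 / (2 * invSum t * (t + 1)) * (n + 1)

/-- The coefficient of `eig z` in the expansion of `E 𝒮_n + 1`. -/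
def sCoeff (t : ℕ) (z : ℂ) : ℂ := res t z / (2 * (z - 1)) / eig z t

theorem eig_two' (n : ℕ) : eig (2 : ℂ) n = n + 1 := eig_two n

theorem sDev_eq {t n : ℕ} (hn : t ≤ n) :
    (sDev t n : ℂ) = ∑ z ∈ (indRoots t).erase 2, sCoeff t z * eig z n := by
  have h := homogeneous_expansion (t := t) (a := fun n => (sMean t n : ℂ) + 1) (fun n hn => by
    rw [avg_add, avg_const hn, ← ofReal_avg, show sMean t n = 1 + 2 * avg t (sMean t) n from (isAdditive_S t).mean_rec hn]
    push_cast
    ring) hn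
  have hc : ∀ z ∈ indRoots t, component t z (fun n => (sMean t n : ℂ) + 1) t / eig z t * eig z n =
      sCoeff t z * eig z n := by
    intro z hz
    rw [component_of_eq_one hz, sCoeff]
    intro n hn
    rw [sMean, (isAdditive_S t).mean_eq_zero hn]
    simp
  rw [Finset.sum_congr rfl hc, ← Finset.add_sum_erase _ _ (two_mem_indRoots t)] at h
  rw [sDev]
  push_cast
  rw [h, sCoeff, eig_two', eig_two', res_two]
  push_cast
  have h1 : (invSum t : ℂ) ≠ 0 := by exact_mod_cast (invSum_pos t).ne'
  have h2 : (t + 1 : ℂ) ≠ 0 := by exact_mod_cast t.succ_ne_zero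
  field_simp
  ring

theorem xMean_rec {t n : ℕ} (hn : 2 * t + 1 ≤ n) :
    (xMean t n : ℂ) = n - 1 + 2 * avg t (fun k => (xMean t k : ℂ)) n := by
  rw [← ofReal_avg, show xMean t n = n - 1 + 2 * avg t (xMean t) n from
    (isAdditive_X t).mean_rec hn]
  push_cast
  rfl

theorem two_mul_avg_deig_two {t n : ℕ} (hn : 2 * t + 1 ≤ n) :
    2 * avg t (deig 2) n = deig 2 n - invSum t * (n + 1) := by
  have := avg_deig_mul hn (a := 2) (by norm_num)
  rw [indProd_two, eig_two', ← ofReal_invSum] at this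
  linear_combination this

theorem xMean_expansion (t : ℕ) : ∃ B : ℝ, ∀ e : ℝ, (∀ z ∈ (indRoots t).erase 2, z.re - 1 ≤ e) →
    PolyBound (fun n => ((xMean t n - B * (n + 1) : ℝ) : ℂ) - (1 / invSum t * deig 2 n + 2)) e := by
  set a : ℕ → ℂ := fun n => xMean t n - (1 / invSum t * deig 2 n + 2) with ha
  have him : (invSum t : ℂ) ≠ 0 := by exact_mod_cast (invSum_pos t).ne'
  have hrec : ∀ n, 2 * t + 1 ≤ n → a n = 2 * avg t a n := by
    intro n hn
    rw [ha, avg_sub, avg_add, avg_const_mul, avg_const hn]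
    simp only
    rw [xMean_rec hn]
    have := two_mul_avg_deig_two hn
    field_simp
    linear_combination this
  have hreal : ∀ n, ((xMean t n - (1 / invSum t * ((n + 1) * ∑ i ∈ Finset.range n, (1 : ℝ) / (2 + i)) + 2) : ℝ)
      : ℂ) = a n := by
    intro n
    rw [ha]
    simp only [deig, psum, eig_two']
    push_cast
    rfl
  set c : ℂ := component t 2 a t / eig 2 t with hc
  refine ⟨c.re, fun e he => ?_⟩
  set r : ℕ → ℂ := fun n => ∑ z ∈ (indRoots t).erase 2, component t z a t / eig z t * eig z n with hr
  have hrb : PolyBound r e := PolyBound.sum fun z hz => (PolyBound.eig (he z hz)).const_mul _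
  have hrb' : PolyBound (fun n => ((r n).re : ℂ)) e := by
    obtain ⟨C, hC, h⟩ := hrb
    refine ⟨C, hC, fun n => ?_⟩
    rw [Complex.norm_real]
    exact (Complex.abs_re_le_norm _).trans (h n)
  refine hrb'.of_eq (N := t) fun n hn => ?_
  have h1 := homogeneous_expansion hrec hn
  rw [← Finset.add_sum_erase _ _ (two_mem_indRoots t), ← hc, eig_two'] at h1
  have h2 := congrArg Complex.re h1
  rw [← hreal, Complex.ofReal_re, Complex.add_re, ← Nat.cast_one (R := ℂ), ← Nat.cast_add,
    mul_comm c, ← Complex.ofReal_natCast, Complex.re_ofReal_mul] at h2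
  have h3 := congrArg (fun x : ℝ => (x : ℂ)) h2
  rw [hreal, ha] at h3
  simp only at h3
  have h4 : ((r n).re : ℂ) =
      ((∑ z ∈ (indRoots t).erase 2, component t z a t / eig z t * eig z n).re : ℂ) := rfl
  rw [h4]
  push_cast at h3 ⊢
  linear_combination h3

theorem exists_re_le {t : ℕ} {x lo : ℝ} (h : ∀ z ∈ (indRoots t).erase 2, z.re < x) (hlo : lo < x) :
    ∃ y, lo < y ∧ y < x ∧ ∀ z ∈ (indRoots t).erase 2, z.re ≤ y := by
  classical
  obtain ⟨y, hy1, hy2⟩ : ∃ y < x, ∀ w ∈ insert lo (((indRoots t).erase 2).image Complex.re), w < y := by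
    have hne : (insert lo (((indRoots t).erase 2).image Complex.re)).Nonempty := ⟨lo, by simp⟩
    have : (insert lo (((indRoots t).erase 2).image Complex.re)).max' hne < x := by
      rw [Finset.max'_lt_iff]
      intro w hw
      rcases Finset.mem_insert.1 hw with rfl | hw
      · exact hlo
      · obtain ⟨z, hz, rfl⟩ := Finset.mem_image.1 hw
        exact h z hz
    obtain ⟨y, hy1, hy2⟩ := exists_between this
    exact ⟨y, hy2, (Finset.max'_lt_iff _ _).1 hy1⟩
  exact ⟨y, hy2 lo (by simp), hy1, fun z hz =>
    (hy2 z.re (Finset.mem_insert_of_mem (Finset.mem_image_of_mem _ hz))).le⟩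

theorem re_lt_two_of_mem {t : ℕ} {z : ℂ} (hz : z ∈ (indRoots t).erase 2) : z.re < 2 :=
  re_lt_two_of_root (mem_indRoots.1 (Finset.mem_of_mem_erase hz)) (Finset.ne_of_mem_erase hz)

theorem polyBound_sDev {t : ℕ} {e : ℝ} (h : ∀ z ∈ (indRoots t).erase 2, z.re - 1 ≤ e) :
    PolyBound (fun n => (sDev t n : ℂ)) e :=
  PolyBound.of_eq (PolyBound.sum fun z hz => (PolyBound.eig (h z hz)).const_mul (sCoeff t z))
    fun _ hn => sDev_eq hn

theorem polyBound_xMean (t : ℕ) {e : ℝ} (he : 1 < e) : PolyBound (fun n => (xMean t n : ℂ)) e := by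
  obtain ⟨B, hB⟩ := xMean_expansion t
  have h1 := (hB e fun z hz => by linarith [re_lt_two_of_mem hz]).add
    (((polyBound_deig (a := 2) (e := e) (by norm_num; linarith)).const_mul (1 / invSum t : ℂ)).add
    (PolyBound.const 2 (by linarith)))
  have h2 := h1.add ((PolyBound.cast_add 1 he.le).const_mul (B : ℂ))
  refine h2.of_eq (N := 0) fun n _ => ?_
  push_cast
  ring

theorem cov_eq_covSeq (t n : ℕ) : cov[S t n, X t n; permMeasure n] = covSeq (S t) (X t) n :=
  cov_permMeasure _ _

theorem var_S_eq_covSeq (t n : ℕ) : Var[S t n; permMeasure n] = covSeq (S t) (S t) n :=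
  var_permMeasure _

theorem var_X_eq_covSeq (t n : ℕ) : Var[X t n; permMeasure n] = covSeq (X t) (X t) n :=
  var_permMeasure _

theorem sMean_eq (t n : ℕ) :
    permAvg n (S t n) = sDev t n + (1 / (2 * invSum t * (t + 1)) * (n + 1) - 1) := by
  rw [sDev, sMean]
  ring

theorem cast_sub_one_sub {n k : ℕ} (hk : k < n) : ((n - 1 - k : ℕ) : ℝ) = n - 1 - k := by
  rw [Nat.cast_sub (by omega), Nat.cast_sub (by omega), Nat.cast_one]

theorem sDev_toll (μ : ℝ) (n k : ℕ) (hk : k < n) :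
    1 + (μ * ((k : ℝ) + 1) - 1) + (μ * (((n - 1 - k : ℕ) : ℝ) + 1) - 1) - (μ * ((n : ℝ) + 1) - 1) =
      0 := by
  rw [cast_sub_one_sub hk]
  ring

theorem xDev_toll (μ : ℝ) (n k : ℕ) (hk : k < n) :
    ((n : ℝ) - 1) + (μ * ((k : ℝ) + 1)) + (μ * (((n - 1 - k : ℕ) : ℝ) + 1)) - (μ * ((n : ℝ) + 1)) =
      n - 1 := by
  rw [cast_sub_one_sub hk]
  ring

theorem covSS_rec {t n : ℕ} (hn : 2 * t + 1 ≤ n) :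
    covSeq (S t) (S t) n + sDev t n * sDev t n =
      2 * avg t (fun n => covSeq (S t) (S t) n + sDev t n * sDev t n) n +
        2 * avg₂ t (sDev t) (sDev t) n := by
  have := (isAdditive_S t).covSeq_add_mul_rec (isAdditive_S t) (α := fun _ => 0) (β := fun _ => 0)
    (sMean_eq t) (sMean_eq t) (sDev_toll _) (sDev_toll _) hn
  simpa using this

theorem covSX_rec {t n : ℕ} (B : ℝ) (hn : 2 * t + 1 ≤ n) :
    covSeq (S t) (X t) n + sDev t n * (xMean t n - B * (n + 1)) =
      2 * avg t (fun n => covSeq (S t) (X t) n + sDev t n * (xMean t n - B * (n + 1))) n +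
        2 * avg₂ t (sDev t) (fun n => xMean t n - B * (n + 1)) n + (n - 1) * sDev t n := by
  have := (isAdditive_S t).covSeq_add_mul_rec (isAdditive_X t) (α := fun _ => 0)
    (β := fun n => (n : ℝ) - 1) (v := fun n => xMean t n - B * (n + 1)) (b := fun n => B * (n + 1))
    (sMean_eq t) (fun n => by rw [sub_add_cancel]; rfl) (sDev_toll _) (xDev_toll _) hn
  simpa using this

theorem covXX_rec {t n : ℕ} (B : ℝ) (hn : 2 * t + 1 ≤ n) :
    covSeq (X t) (X t) n + (xMean t n - B * (n + 1)) * (xMean t n - B * (n + 1)) =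
      2 * avg t (fun n => covSeq (X t) (X t) n +
        (xMean t n - B * (n + 1)) * (xMean t n - B * (n + 1))) n +
        2 * avg₂ t (fun n => xMean t n - B * (n + 1)) (fun n => xMean t n - B * (n + 1)) n +
        2 * (n - 1) * (xMean t n - B * (n + 1)) - (n - 1) ^ 2 := by
  have := (isAdditive_X t).covSeq_add_mul_rec (isAdditive_X t)
    (α := fun n => (n : ℝ) - 1) (u := fun n => xMean t n - B * (n + 1)) (a := fun n => B * (n + 1))
    (β := fun n => (n : ℝ) - 1) (v := fun n => xMean t n - B * (n + 1)) (b := fun n => B * (n + 1))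
    (fun n => by rw [sub_add_cancel]; rfl) (fun n => by rw [sub_add_cancel]; rfl) (xDev_toll _)
    (xDev_toll _) hn
  rw [this]
  ring

/-! ### Linear growth -/

theorem isEquivalent_of_tendsto_div_succ {f : ℕ → ℝ} {D : ℝ} (hD : D ≠ 0)
    (h : Tendsto (fun n : ℕ => f n / ((n : ℝ) + 1)) atTop (𝓝 D)) :
    f ~[atTop] fun n : ℕ => D * (n : ℝ) := by
  have h1 : Tendsto (fun n : ℕ => ((n : ℝ) + 1) / n) atTop (𝓝 1) := by
    have : Tendsto (fun n : ℕ => 1 + 1 / (n : ℝ)) atTop (𝓝 (1 + 0)) :=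
      tendsto_const_nhds.add tendsto_one_div_atTop_nhds_zero_nat
    rw [add_zero] at this
    refine this.congr' (eventually_atTop.2 ⟨1, fun n hn => ?_⟩)
    have : (n : ℝ) ≠ 0 := by positivity
    field_simp
  rw [isEquivalent_iff_tendsto_one (eventually_atTop.2 ⟨1, fun n hn => by
    have : (n : ℝ) ≠ 0 := by positivity
    positivity⟩)]
  have h2 := (h.mul h1).div_const D
  rw [mul_one, div_self hD] at h2
  refine h2.congr' (eventually_atTop.2 ⟨1, fun n hn => ?_⟩)
  have : (n : ℝ) ≠ 0 := by positivity
  have h3 : (n : ℝ) + 1 ≠ 0 := by positivity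
  rw [Pi.div_apply]
  field_simp

/-- The toll in the recurrence of the variance of `𝒮_n`. -/
def varToll (t n : ℕ) : ℝ :=
  ∑ k ∈ Finset.range n, wt ℝ t n k * (1 + sMean t k + sMean t (n - 1 - k) - sMean t n) ^ 2

theorem varToll_nonneg (t n : ℕ) : 0 ≤ varToll t n :=
  Finset.sum_nonneg fun k _ => mul_nonneg (wt_nonneg t n k) (sq_nonneg _)

theorem covSS_eq (t n : ℕ) :
    covSeq (S t) (S t) n = varToll t n + 2 * avg t (covSeq (S t) (S t)) n := by
  rcases le_or_gt (2 * t + 1) n with hn | hn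
  · rw [(isAdditive_S t).covSeq_rec (isAdditive_S t) (fun _ => rfl) (fun _ => rfl) hn, add_comm,
      varToll]
    simp only [sq, sMean]
  · rw [(isAdditive_S t).covSeq_eq_zero (by omega), avg_eq_zero_of_le _ (by omega), varToll]
    simp only [wt_eq_zero_of_le (K := ℝ) (show n ≤ 2 * t by omega), zero_mul, mul_zero, add_zero,
      Finset.sum_const_zero]

theorem sMean_succ_two_mul (t : ℕ) : sMean t (2 * t + 1) = 1 := by
  have h := (isAdditive_S t).mean_rec (n := 2 * t + 1) le_rfl
  rw [sMean, h, avg_congr (g := fun _ => 0)]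
  · simp [avg]
  · intro k hk _
    exact (isAdditive_S t).mean_eq_zero (by omega)

theorem exists_varToll_pos {t : ℕ} (ht : 1 ≤ t) : 0 < varToll t (3 * t + 2) := by
  have hw : ∀ k, t ≤ k → k ≤ 2 * t + 1 → 0 < wt ℝ t (3 * t + 2) k := by
    intro k h1 h2
    have c1 := Nat.choose_pos h1
    have c2 := Nat.choose_pos (n := 3 * t + 2 - 1 - k) (k := t) (by omega)
    have c3 := Nat.choose_pos (n := 3 * t + 2) (k := 2 * t + 1) (by omega)
    rw [wt]
    push_cast
    positivity
  have hz : ∀ k, k ≤ 2 * t → sMean t k = 0 := fun k hk => (isAdditive_S t).mean_eq_zero hk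
  by_contra hcon
  have h0 : varToll t (3 * t + 2) = 0 := le_antisymm (not_lt.1 hcon) (varToll_nonneg _ _)
  rw [varToll, Finset.sum_eq_zero_iff_of_nonneg
    fun k _ => mul_nonneg (wt_nonneg _ _ k) (sq_nonneg _)] at h0
  have h1 := h0 (2 * t + 1) (Finset.mem_range.2 (by omega))
  have h2 := h0 (2 * t) (Finset.mem_range.2 (by omega))
  rw [mul_eq_zero, or_iff_right (hw _ (by omega) (by omega)).ne', sq_eq_zero_iff] at h1 h2
  rw [sMean_succ_two_mul, hz (3 * t + 2 - 1 - (2 * t + 1)) (by omega)] at h1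
  rw [hz (2 * t) le_rfl, hz (3 * t + 2 - 1 - 2 * t) (by omega)] at h2
  linarith

theorem var_S_linear {t : ℕ} (ht : 1 ≤ t) (h : ∀ z ∈ (indRoots t).erase 2, z.re < 3 / 2) :
    ∃ D : ℝ, 0 < D ∧ (fun n : ℕ => Var[S t n; permMeasure n]) ~[atTop] fun n : ℕ => D * (n : ℝ) := by
  obtain ⟨y, hy1, hy2, hy⟩ := exists_re_le h (show (1 : ℝ) < 3 / 2 by norm_num)
  have hu : PolyBound (fun n => (sDev t n : ℂ)) (y - 1) :=
    polyBound_sDev fun z hz => by linarith [hy z hz]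
  have htoll : ∀ n, 2 * t + 1 ≤ n → varToll t n =
      2 * avg t (fun n => sDev t n * sDev t n) n + 2 * avg₂ t (sDev t) (sDev t) n -
        sDev t n * sDev t n := by
    intro n hn
    have h1 := covSS_rec hn
    rw [avg_add] at h1
    linear_combination h1 - covSS_eq t n
  have hb : PolyBound (fun n => (varToll t n : ℂ)) (2 * (y - 1)) := by
    have h1 : PolyBound (fun n => (sDev t n : ℂ) * sDev t n) (2 * (y - 1)) :=
      hu.mul_le hu (by linarith)
    have h2 : PolyBound (avg t fun n => (sDev t n : ℂ) * sDev t n) (2 * (y - 1)) := by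
      rw [avg_eq_avg₂]
      exact h1.avg₂_le (PolyBound.eig (a := 1) (e := 0) (by simp)) (by linarith) (by linarith)
        (by linarith)
    have h3 : PolyBound (avg₂ t (fun n => (sDev t n : ℂ)) fun n => (sDev t n : ℂ)) (2 * (y - 1)) :=
      hu.avg₂_le hu (by linarith) (by linarith) (by linarith)
    refine (((h2.const_mul 2).add (h3.const_mul 2)).sub h1).of_eq (N := 2 * t + 1) fun n hn => ?_
    rw [htoll n hn]
    push_cast [ofReal_avg, ofReal_avg₂]
    rfl
  obtain ⟨C, hC, hCb⟩ := hb
  have hlim := transfer_sublinear (t := t) (a := fun n => (covSeq (S t) (S t) n : ℂ)) (e := 2 * (y - 1))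
    (by linarith) (fun n => by
      rw [covSS_eq]
      push_cast [ofReal_avg]
      rfl) hCb
  have hsum := summable_tollWeight t (e := 2 * (y - 1)) (by linarith) hCb
  set w : ℕ → ℝ := fun n => if t ≤ n then varToll t n / ((n + 1) * (n + 2)) else 0 with hw
  have hwe : tollWeight t (fun n => (varToll t n : ℂ)) = fun n => (w n : ℂ) := by
    funext n
    simp only [tollWeight, hw]
    split_ifs <;> push_cast <;> rfl
  rw [hwe] at hsum hlim
  have hsum' : Summable w := Complex.summable_ofReal.1 hsum
  rw [← Complex.ofReal_tsum, res_two, ← Complex.ofReal_mul] at hlim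
  have hpos : 0 < ∑' n, w n := by
    refine hsum'.tsum_pos (fun n => ?_) (3 * t + 2) ?_
    · simp only [hw]
      split_ifs
      · exact div_nonneg (varToll_nonneg _ _) (by positivity)
      · exact le_rfl
    · simp only [hw]
      rw [if_pos (by omega)]
      exact div_pos (exists_varToll_pos ht) (by positivity)
  have hD : 0 < 1 / invSum t * ∑' n, w n := mul_pos (one_div_pos.2 (invSum_pos t)) hpos
  refine ⟨_, hD, ?_⟩
  simp only [var_S_eq_covSeq]
  refine isEquivalent_of_tendsto_div_succ hD.ne' ?_
  have := (Complex.continuous_re.tendsto _).comp hlim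
  refine this.congr fun n => ?_
  rw [Function.comp_apply, ← Nat.cast_one (R := ℂ), ← Nat.cast_add, Complex.div_natCast_re,
    Complex.ofReal_re]
  push_cast
  rfl

/-- The toll in the recurrence of the second mixed moment. -/
def covToll (t n : ℕ) : ℂ :=
  if 2 * t + 1 ≤ n then
    2 * avg₂ t (fun n => (sDev t n : ℂ)) (fun n => (xMean t n : ℂ)) n + (n - 1) * sDev t n
  else 0

theorem polyBound_covToll {t : ℕ} {e : ℝ} (he : 0 < e)
    (h : ∀ z ∈ (indRoots t).erase 2, z.re < e) : PolyBound (covToll t) e := by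
  obtain ⟨y, hy1, hy2, hy⟩ := exists_re_le h he
  have hu : PolyBound (fun n => (sDev t n : ℂ)) (y - 1) :=
    polyBound_sDev fun z hz => by linarith [hy z hz]
  have hx : PolyBound (fun n => (xMean t n : ℂ)) (1 + (e - y)) := polyBound_xMean t (by linarith)
  have h1 := hu.avg₂_le (t := t) hx (e'' := e) (by linarith) (by linarith) (by linarith)
  have h2 := (PolyBound.cast_add (-1) le_rfl).mul_le hu (e'' := e) (by linarith)
  refine ((h1.const_mul 2).add h2).of_eq (N := 2 * t + 1) fun n hn => ?_
  rw [covToll, if_pos hn]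
  ring

theorem tendsto_cov {t : ℕ} (h : ∀ z ∈ (indRoots t).erase 2, z.re < 1) :
    Tendsto (fun n => (covSeq (S t) (X t) n : ℂ) / (n + 1)) atTop
      (𝓝 (res t 2 * ∑' n, tollWeight t (covToll t) n)) := by
  obtain ⟨y, hy1, hy2, hy⟩ := exists_re_le h zero_lt_one
  obtain ⟨e, he1, he2⟩ := exists_between hy2
  obtain ⟨C, -, hC⟩ := polyBound_covToll (e := e) (by linarith) fun z hz => (hy z hz).trans_lt he1
  have hlim := transfer_sublinear (t := t)
    (a := fun n => (covSeq (S t) (X t) n : ℂ) + sDev t n * xMean t n) (e := e) he2 (fun n => by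
      rcases le_or_gt (2 * t + 1) n with hn | hn
      · have := congrArg (fun x : ℝ => (x : ℂ)) (covSX_rec 0 hn)
        simp only [zero_mul, sub_zero] at this
        push_cast [ofReal_avg, ofReal_avg₂] at this
        rw [covToll, if_pos hn, this]
        ring
      · rw [(isAdditive_S t).covSeq_eq_zero (by omega), avg_eq_zero_of_le _ (by omega), covToll,
          if_neg (by omega), xMean, (isAdditive_X t).mean_eq_zero (by omega)]
        simp) hC
  have hsx : PolyBound (fun n => (sDev t n : ℂ) * xMean t n) e :=
    (polyBound_sDev fun z hz => by linarith [hy z hz]).mul_le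
      (polyBound_xMean t (e := 1 + (e - y)) (by linarith)) (e := y - 1) (by linarith)
  have h0 : Tendsto (fun n => (sDev t n : ℂ) * xMean t n / (n + 1)) atTop (𝓝 0) := by
    obtain ⟨D, hD, hsx⟩ := hsx
    have h1 := (tendsto_rpow_div he2).const_mul D
    rw [mul_zero] at h1
    refine squeeze_zero_norm (fun n => ?_) h1
    have : ‖(n : ℂ) + 1‖ = n + 1 := by
      rw [← Nat.cast_one, ← Nat.cast_add, Complex.norm_natCast]; push_cast; ring
    rw [norm_div, this, ← mul_div_assoc]
    exact div_le_div_of_nonneg_right (hsx n) (by positivity)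
  have := hlim.sub h0
  rw [sub_zero] at this
  refine this.congr fun n => ?_
  ring

theorem cov_linear {t : ℕ} (h : ∀ z ∈ (indRoots t).erase 2, z.re < 1)
    (h0 : ∑' n, tollWeight t (covToll t) n ≠ 0) :
    ∃ D : ℝ, D ≠ 0 ∧ (fun n : ℕ => cov[S t n, X t n; permMeasure n])
      ~[atTop] fun n : ℕ => D * (n : ℝ) := by
  have hlim := tendsto_cov h
  set D := res t 2 * ∑' n, tollWeight t (covToll t) n with hD
  have hD0 : D ≠ 0 := by
    refine mul_ne_zero ?_ h0
    rw [res_two, Complex.ofReal_ne_zero]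
    exact (one_div_pos.2 (invSum_pos t)).ne'
  have hform : ∀ n : ℕ, (covSeq (S t) (X t) n : ℂ) / (n + 1) =
      ((covSeq (S t) (X t) n / ((n : ℝ) + 1) : ℝ) : ℂ) := fun n => by push_cast; rfl
  simp only [hform] at hlim
  have hre := (Complex.continuous_re.tendsto _).comp hlim
  have him := (Complex.continuous_im.tendsto _).comp hlim
  have him0 : D.im = 0 := by
    refine tendsto_nhds_unique him ?_
    simp only [Function.comp_def, Complex.ofReal_im]
    exact tendsto_const_nhds
  refine ⟨D.re, fun h => hD0 (Complex.ext h him0), ?_⟩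
  simp only [cov_eq_covSeq]
  exact isEquivalent_of_tendsto_div_succ (fun h => hD0 (Complex.ext h him0)) hre

/-! ### The location of the roots -/

/-- The sum of the arguments of `z+j` for `t≤j≤2t`. -/
def argSum (t : ℕ) (z : ℂ) : ℝ := ∑ j ∈ Finset.Icc t (2 * t), (z + j).arg

/-- The sum of `arctan (y/(x+j))` for `t≤j≤2t`. -/
def arctanSum (t : ℕ) (x y : ℝ) : ℝ := ∑ j ∈ Finset.Icc t (2 * t), Real.arctan (y / (x + j))

/-- The product of the squared moduli of `x+iy+j` for `t≤j≤2t`. -/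
def modProd (t : ℕ) (x y : ℝ) : ℝ := ∏ j ∈ Finset.Icc t (2 * t), ((x + j) ^ 2 + y ^ 2)

theorem arg_eq_arctan {w : ℂ} (h : 0 < w.re) : w.arg = Real.arctan (w.im / w.re) := by
  have h1 := abs_lt.1 (Complex.abs_arg_lt_pi_div_two_iff.2 (Or.inl h))
  rw [← Complex.tan_arg, Real.arctan_tan h1.1 h1.2]

theorem add_pos_of_mem {t j : ℕ} {x : ℝ} (hx : -(t : ℝ) < x) (hj : j ∈ Finset.Icc t (2 * t)) :
    0 < x + j := by
  have : (t : ℝ) ≤ j := by exact_mod_cast (Finset.mem_Icc.1 hj).1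
  linarith

theorem argSum_eq_arctanSum {t : ℕ} {z : ℂ} (hz : -(t : ℝ) < z.re) :
    argSum t z = arctanSum t z.re z.im := by
  refine Finset.sum_congr rfl fun j hj => ?_
  have h : 0 < (z + j).re := by
    rw [Complex.add_re, Complex.natCast_re]
    exact add_pos_of_mem hz hj
  rw [arg_eq_arctan h, Complex.add_re, Complex.natCast_re, Complex.add_im, Complex.natCast_im,
    add_zero]

theorem modProd_eq_norm (t : ℕ) (z : ℂ) :
    modProd t z.re z.im = (∏ j ∈ Finset.Icc t (2 * t), ‖z + j‖) ^ 2 := by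
  rw [modProd, ← Finset.prod_pow]
  refine Finset.prod_congr rfl fun j _ => ?_
  rw [Complex.sq_norm, Complex.normSq_apply, Complex.add_re, Complex.natCast_re, Complex.add_im,
    Complex.natCast_im, add_zero]
  ring

theorem norm_two_add (j : ℕ) : ‖(2 + j : ℂ)‖ = 2 + j := by
  have := Complex.norm_natCast (2 + j)
  push_cast at this
  exact this

theorem modProd_of_root {t : ℕ} {z : ℂ} (hz : indProd t z = 2) :
    modProd t z.re z.im = modProd t 2 0 := by
  have h := congrArg norm (prod_add_eq_of_root hz)
  rw [norm_prod, norm_prod] at h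
  rw [modProd_eq_norm, h, modProd, ← Finset.prod_pow]
  refine Finset.prod_congr rfl fun j _ => ?_
  rw [norm_two_add]
  ring

theorem prod_eq_exp (t : ℕ) (z : ℂ) : ∏ j ∈ Finset.Icc t (2 * t), (z + j) =
    ((∏ j ∈ Finset.Icc t (2 * t), ‖z + j‖ : ℝ) : ℂ) * Complex.exp (argSum t z * Complex.I) := by
  rw [argSum]
  push_cast
  rw [Finset.sum_mul, Complex.exp_sum, ← Finset.prod_mul_distrib]
  exact Finset.prod_congr rfl fun j _ => (Complex.norm_mul_exp_arg_mul_I _).symm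

theorem exists_argSum_of_root {t : ℕ} {z : ℂ} (hz : indProd t z = 2) :
    ∃ k : ℤ, argSum t z = k * (2 * Real.pi) := by
  have h := prod_add_eq_of_root hz
  have hn := congrArg norm h
  rw [norm_prod, norm_prod] at hn
  rw [prod_eq_exp, hn, Complex.ofReal_prod] at h
  simp only [norm_two_add] at h
  push_cast at h
  have h0 : ∏ j ∈ Finset.Icc t (2 * t), (2 + j : ℂ) ≠ 0 :=
    Finset.prod_ne_zero_iff.2 fun j _ => by
      rw [← norm_ne_zero_iff, norm_two_add]; positivity
  rw [mul_eq_left₀ h0, Complex.exp_eq_one_iff] at h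
  obtain ⟨k, hk⟩ := h
  refine ⟨k, ?_⟩
  have : (argSum t z : ℂ) = k * (2 * Real.pi) := by
    have hI : (Complex.I : ℂ) ≠ 0 := Complex.I_ne_zero
    apply mul_right_cancel₀ hI
    rw [hk]
    ring
  exact_mod_cast this

theorem root_of_modProd {t : ℕ} {z : ℂ} (h : modProd t z.re z.im = modProd t 2 0)
    (k : ℤ) (hk : argSum t z = k * (2 * Real.pi)) : indProd t z = 2 := by
  have h2 : modProd t 2 0 = (∏ j ∈ Finset.Icc t (2 * t), (2 + j : ℝ)) ^ 2 := by
    rw [modProd, ← Finset.prod_pow]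
    exact Finset.prod_congr rfl fun j _ => by ring
  rw [modProd_eq_norm, h2] at h
  have h3 := (pow_left_inj₀ (Finset.prod_nonneg fun j _ => norm_nonneg _)
    (Finset.prod_nonneg fun j _ => by positivity) two_ne_zero).1 h
  have h4 := prod_eq_exp t z
  rw [h3, hk] at h4
  have h5 : Complex.exp (((k * (2 * Real.pi) : ℝ) : ℂ) * Complex.I) = 1 := by
    rw [Complex.exp_eq_one_iff]
    exact ⟨k, by push_cast; ring⟩
  rw [h5, mul_one] at h4
  push_cast at h4
  rw [indProd_eq_div, h4, prod_add_two, mul_div_assoc, div_self (prod_Icc_add_one_ne_zero t), mul_one]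

theorem re_log_sub_log_pos {w w' : ℂ} (hw : 0 < w.re) (hw' : 0 < w'.re) (hne : w ≠ w') :
    0 < ((Complex.log w - Complex.log w') * starRingEnd ℂ (w - w')).re := by
  set d := w - w' with hd
  have hd0 : d ≠ 0 := sub_ne_zero.2 hne
  have hre : ∀ s ∈ Set.Icc (0 : ℝ) 1, 0 < (w' + s * d).re := by
    intro s hs
    rw [Complex.add_re, Complex.re_ofReal_mul, hd, Complex.sub_re]
    rcases hs.2.eq_or_lt with h | h
    · rw [h]; linarith
    · nlinarith [hs.1, mul_pos (sub_pos.2 h) hw', mul_nonneg hs.1 hw.le]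
  have hder : ∀ s ∈ Set.Icc (0 : ℝ) 1,
      HasDerivAt (fun s : ℝ => (Complex.log (w' + s * d) * starRingEnd ℂ d).re)
        ((d / (w' + s * d) * starRingEnd ℂ d).re) s := by
    intro s hs
    have h1 : HasDerivAt (fun s : ℝ => w' + (s : ℂ) * d) d s := by
      simpa using ((Complex.ofRealCLM.hasDerivAt (x := s)).mul_const d).const_add w'
    have h2 := (h1.clog_real (Or.inl (hre s hs))).mul_const (starRingEnd ℂ d)
    exact Complex.reCLM.hasFDerivAt.comp_hasDerivAt s h2
  obtain ⟨c, hc, h⟩ := exists_hasDerivAt_eq_slope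
    (fun s : ℝ => (Complex.log (w' + s * d) * starRingEnd ℂ d).re)
    (fun s : ℝ => (d / (w' + s * d) * starRingEnd ℂ d).re) zero_lt_one
    (fun s hs => (hder s hs).continuousAt.continuousWithinAt)
    (fun s hs => hder s (Set.Ioo_subset_Icc_self hs))
  have hpos := hre c (Set.Ioo_subset_Icc_self hc)
  have h3 : d / (w' + c * d) * starRingEnd ℂ d = (Complex.normSq d : ℂ) * (w' + c * d)⁻¹ := by
    rw [← Complex.mul_conj]
    ring
  rw [h3, Complex.re_ofReal_mul, Complex.inv_re] at h
  have h4 : w' + (1 : ℂ) * d = w := by rw [hd]; ring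
  simp only [Complex.ofReal_zero, Complex.ofReal_one, zero_mul, add_zero, h4, sub_zero, div_one] at h
  rw [sub_mul, Complex.sub_re, ← h]
  have h5 : 0 < Complex.normSq d := Complex.normSq_pos.2 hd0
  have h6 : 0 < Complex.normSq (w' + c * d) := Complex.normSq_pos.2 fun h0 => by
    rw [h0] at hpos
    exact lt_irrefl _ hpos
  positivity

/-- The map `z ↦ ∑ log (z+j)` is injective on a half-plane. -/
theorem eq_of_argSum_eq {t : ℕ} {z z' : ℂ} (hz : indProd t z = 2) (hz' : indProd t z' = 2)
    (h : -(t : ℝ) < z.re) (h' : -(t : ℝ) < z'.re) (harg : argSum t z = argSum t z') : z = z' := by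
  by_contra hne
  have hpos : 0 < (∑ j ∈ Finset.Icc t (2 * t), ((Complex.log (z + j) - Complex.log (z' + j)) *
      starRingEnd ℂ (z - z'))).re := by
    rw [Complex.re_sum]
    refine Finset.sum_pos (fun j hj => ?_) (Icc_nonempty t)
    have h1 : z - z' = (z + j) - (z' + j) := by ring
    rw [h1]
    apply re_log_sub_log_pos
    · rw [Complex.add_re, Complex.natCast_re]
      exact add_pos_of_mem h hj
    · rw [Complex.add_re, Complex.natCast_re]
      exact add_pos_of_mem h' hj
    · exact fun h => hne (add_right_cancel h)
  have hlog : ∀ w : ℂ, indProd t w = 2 → ∑ j ∈ Finset.Icc t (2 * t), Complex.log (w + j) =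
      ((Real.log (∏ j ∈ Finset.Icc t (2 * t), (2 + j : ℝ)) : ℝ) : ℂ) + argSum t w * Complex.I := by
    intro w hw
    have h1 : ∏ j ∈ Finset.Icc t (2 * t), ‖w + j‖ = ∏ j ∈ Finset.Icc t (2 * t), (2 + j : ℝ) := by
      have h := congrArg norm (prod_add_eq_of_root hw)
      rw [norm_prod, norm_prod] at h
      rw [h]
      exact Finset.prod_congr rfl fun j _ => norm_two_add j
    rw [← h1, Real.log_prod fun j hj => norm_ne_zero_iff.2 (root_add_ne_zero hw hj), argSum]
    push_cast
    rw [Finset.sum_mul, ← Finset.sum_add_distrib]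
    exact Finset.sum_congr rfl fun j _ => by rw [Complex.log]
  rw [← Finset.sum_mul, Finset.sum_sub_distrib, hlog z hz, hlog z' hz', harg, sub_self, zero_mul] at hpos
  exact lt_irrefl _ hpos

theorem argSum_two (t : ℕ) : argSum t 2 = 0 := by
  refine Finset.sum_eq_zero fun j _ => ?_
  have : (2 + j : ℂ) = ((2 + j : ℝ) : ℂ) := by push_cast; rfl
  rw [this, Complex.arg_ofReal_of_nonneg (by positivity)]

theorem two_pi_le_of_root {t : ℕ} {z : ℂ} (hz : indProd t z = 2) (h2 : z ≠ 2)
    (h : -(t : ℝ) < z.re) : 2 * Real.pi ≤ |argSum t z| := by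
  obtain ⟨k, hk⟩ := exists_argSum_of_root hz
  have hk0 : k ≠ 0 := by
    rintro rfl
    apply h2
    refine eq_of_argSum_eq hz (indProd_two t) h ?_ ?_
    · simp only [Complex.re_ofNat]
      linarith [t.cast_nonneg (α := ℝ)]
    · rw [hk, argSum_two]
      simp
  rw [hk, abs_mul, abs_of_pos Real.two_pi_pos]
  have : (1 : ℝ) ≤ |(k : ℝ)| := by
    rw [← Int.cast_abs]
    exact_mod_cast Int.one_le_abs hk0
  nlinarith [Real.two_pi_pos]

theorem modProd_lt {t : ℕ} {x x' y y' : ℝ} (hx : -(t : ℝ) < x) (hxx : x ≤ x') (hy : 0 ≤ y)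
    (hyy : y < y') : modProd t x y < modProd t x' y' := by
  refine Finset.prod_lt_prod_of_nonempty (fun j hj => ?_) (fun j hj => ?_) (Icc_nonempty t)
  · have := add_pos_of_mem hx hj
    positivity
  · have := add_pos_of_mem hx hj
    nlinarith

theorem modProd_le {t : ℕ} {x x' y y' : ℝ} (hx : -(t : ℝ) < x) (hxx : x ≤ x') (hy : 0 ≤ y)
    (hyy : y ≤ y') : modProd t x y ≤ modProd t x' y' := by
  refine Finset.prod_le_prod (fun j hj => ?_) (fun j hj => ?_)
  · positivity
  · have := add_pos_of_mem hx hj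
    nlinarith

theorem arctanSum_le {t : ℕ} {x x' y y' : ℝ} (hx : -(t : ℝ) < x) (hxx : x ≤ x') (hy : 0 ≤ y)
    (hyy : y ≤ y') : arctanSum t x' y ≤ arctanSum t x y' := by
  refine Finset.sum_le_sum fun j hj => Real.arctan_mono ?_
  have := add_pos_of_mem hx hj
  exact div_le_div₀ (hy.trans hyy) hyy this (by linarith)

theorem arctanSum_neg (t : ℕ) (x y : ℝ) : arctanSum t x (-y) = -arctanSum t x y := by
  simp only [arctanSum, neg_div, Real.arctan_neg, Finset.sum_neg_distrib]

theorem modProd_abs (t : ℕ) (x y : ℝ) : modProd t x |y| = modProd t x y := by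
  simp only [modProd, sq_abs]

theorem abs_arctanSum {t : ℕ} {x : ℝ} (hx : -(t : ℝ) < x) (y : ℝ) :
    |arctanSum t x y| = arctanSum t x |y| := by
  have h : ∀ y : ℝ, 0 ≤ y → 0 ≤ arctanSum t x y := fun y hy =>
    Finset.sum_nonneg fun j hj => Real.arctan_nonneg.2 (div_nonneg hy (add_pos_of_mem hx hj).le)
  rcases le_total 0 y with hy | hy
  · rw [abs_of_nonneg hy, abs_of_nonneg (h y hy)]
  · rw [abs_of_nonpos hy, arctanSum_neg, abs_of_nonpos]
    have := h (-y) (by linarith)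
    rw [arctanSum_neg] at this
    linarith

/-- A criterion for the absence of roots in a half-plane. -/
theorem re_lt_of_root {t : ℕ} {x₀ y₀ : ℝ} (hx : -(t : ℝ) < x₀) (hy : 0 ≤ y₀)
    (hmod : modProd t 2 0 < modProd t x₀ y₀) (harg : arctanSum t x₀ y₀ < 2 * Real.pi) :
    ∀ z ∈ (indRoots t).erase 2, z.re < x₀ := by
  intro z hz
  by_contra hcon
  rw [not_lt] at hcon
  have hz2 := mem_indRoots.1 (Finset.mem_of_mem_erase hz)
  have h1 := two_pi_le_of_root hz2 (Finset.ne_of_mem_erase hz) (hx.trans_le hcon)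
  rw [argSum_eq_arctanSum (hx.trans_le hcon), abs_arctanSum (hx.trans_le hcon)] at h1
  have h2 := modProd_of_root hz2
  rw [← modProd_abs] at h2
  rcases le_or_gt y₀ |z.im| with h | h
  · have := modProd_le hx hcon hy h
    linarith
  · have := arctanSum_le hx hcon (abs_nonneg z.im) h.le
    linarith

/-- A criterion for the existence of a root in a half-plane. -/
theorem exists_root {t : ℕ} {x₀ y₀ : ℝ} (hx : -(t : ℝ) < x₀) (hx2 : x₀ ≤ 2) (hy : 0 ≤ y₀)
    (hmod : modProd t x₀ y₀ < modProd t 2 0) (harg : 2 * Real.pi < arctanSum t x₀ y₀) :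
    ∃ z ∈ (indRoots t).erase 2, x₀ < z.re := by
  set Y : ℝ := 2 * t + 2 with hY
  have hYmod : ∀ x, modProd t 2 0 ≤ modProd t x Y := by
    intro x
    refine Finset.prod_le_prod (fun j hj => by positivity) (fun j hj => ?_)
    have h1 : (j : ℝ) ≤ 2 * t := by exact_mod_cast (Finset.mem_Icc.1 hj).2
    have h2 : (0 : ℝ) ≤ j := j.cast_nonneg
    nlinarith [sq_nonneg (x + j)]
  have hcm : Continuous fun p : ℝ × ℝ => modProd t p.1 p.2 := by
    unfold modProd
    fun_prop
  set K : Set (ℝ × ℝ) := (Set.Icc x₀ 2 ×ˢ Set.Icc 0 Y) ∩ {p | modProd t p.1 p.2 = modProd t 2 0}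
    with hK
  have hKc : IsCompact K :=
    (isCompact_Icc.prod isCompact_Icc).inter_right (isClosed_eq hcm continuous_const)
  have hca : ContinuousOn (fun p : ℝ × ℝ => arctanSum t p.1 p.2) K := by
    unfold arctanSum
    refine continuousOn_finsetSum _ fun j hj => ?_
    refine Real.continuous_arctan.comp_continuousOn ?_
    refine continuousOn_snd.div (continuousOn_fst.add continuousOn_const) fun p hp => ?_
    have := hp.1.1.1
    exact (add_pos_of_mem (hx.trans_le this) hj).ne'
  have hPc : IsCompact (K ∩ (fun p : ℝ × ℝ => arctanSum t p.1 p.2) ⁻¹' Set.Ici (2 * Real.pi)) :=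
    hca.preimage_isClosed_of_isClosed hKc.isClosed isClosed_Ici |> fun h =>
      hKc.of_isClosed_subset h Set.inter_subset_left
  have hNc : IsCompact (K ∩ (fun p : ℝ × ℝ => arctanSum t p.1 p.2) ⁻¹' Set.Iic (2 * Real.pi)) :=
    hca.preimage_isClosed_of_isClosed hKc.isClosed isClosed_Iic |> fun h =>
      hKc.of_isClosed_subset h Set.inter_subset_left
  have hP := (hPc.image continuous_fst).isClosed
  have hN := (hNc.image continuous_fst).isClosed
  have hex : ∀ x ∈ Set.Icc x₀ 2, ∃ y ∈ Set.Icc 0 Y, modProd t x y = modProd t 2 0 := by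
    intro x hxx
    have h := intermediate_value_Icc (f := fun y => modProd t x y) (show (0 : ℝ) ≤ Y by positivity)
      (by unfold modProd; fun_prop)
    obtain ⟨y, hy, h⟩ := h ⟨modProd_le (hx.trans_le hxx.1) hxx.2 le_rfl le_rfl, hYmod x⟩
    exact ⟨y, hy, h⟩
  have hy0 : ∀ y, 0 ≤ y → modProd t x₀ y = modProd t 2 0 → y₀ < y := by
    intro y hy' h
    by_contra hcon
    rw [not_lt] at hcon
    exact ((modProd_le hx le_rfl hy' hcon).trans_lt hmod).ne h
  obtain ⟨x, hxI, hxP, hxN⟩ := isPreconnected_closed_iff.1 (isPreconnected_Icc (a := x₀) (b := 2)) _ _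
    hP hN (by
      intro x hxx
      obtain ⟨y, hy, h⟩ := hex x hxx
      rcases le_total (2 * Real.pi) (arctanSum t x y) with h1 | h1
      · exact Or.inl ⟨(x, y), ⟨⟨⟨hxx, hy⟩, h⟩, h1⟩, rfl⟩
      · exact Or.inr ⟨(x, y), ⟨⟨⟨hxx, hy⟩, h⟩, h1⟩, rfl⟩)
    (by
      obtain ⟨y, hy', h⟩ := hex x₀ ⟨le_rfl, hx2⟩
      refine ⟨x₀, ⟨le_rfl, hx2⟩, (x₀, y), ⟨⟨⟨⟨le_rfl, hx2⟩, hy'⟩, h⟩, ?_⟩, rfl⟩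
      exact harg.le.trans (arctanSum_le hx le_rfl hy (hy0 y hy'.1 h).le))
    (by
      refine ⟨2, ⟨hx2, le_rfl⟩, (2, 0), ⟨⟨⟨⟨hx2, le_rfl⟩, le_rfl, by positivity⟩, rfl⟩, ?_⟩, rfl⟩
      simp only [Set.mem_preimage, arctanSum, zero_div, Real.arctan_zero, Finset.sum_const_zero]
      exact Real.two_pi_pos.le)
  obtain ⟨⟨x', y⟩, ⟨⟨⟨hx', hy'⟩, hm⟩, ha⟩, rfl⟩ := hxP
  obtain ⟨⟨x'', y'⟩, ⟨⟨⟨hx'', hy''⟩, hm'⟩, ha'⟩, hxx⟩ := hxN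
  simp only at hx' hy' hx'' hy'' hxx
  simp only [Set.mem_ofPred_eq, Set.mem_preimage, Set.mem_Ici, Set.mem_Iic] at hm hm' ha ha'
  subst hxx
  have hyy : y = y' := by
    rcases lt_trichotomy y y' with h | h | h
    · have := modProd_lt (hx.trans_le hx'.1) (le_refl x'') hy'.1 h
      linarith
    · exact h
    · have := modProd_lt (hx.trans_le hx'.1) (le_refl x'') hy''.1 h
      linarith
  subst hyy
  have ha2 : arctanSum t x'' y = 2 * Real.pi := le_antisymm ha' ha
  refine ⟨⟨x'', y⟩, ?_, ?_⟩
  · rw [Finset.mem_erase, mem_indRoots]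
    constructor
    · intro h
      have him := congrArg Complex.im h
      simp only [Complex.im_ofNat] at him
      rw [him] at ha2
      simp only [arctanSum, zero_div, Real.arctan_zero, Finset.sum_const_zero] at ha2
      linarith [Real.two_pi_pos]
    · refine root_of_modProd hm 1 ?_
      rw [argSum_eq_arctanSum (hx.trans_le hx'.1)]
      simpa using ha2
  · refine lt_of_le_of_ne hx'.1 fun h => ?_
    change x₀ = x'' at h
    subst h
    have h2 := arctanSum_le hx le_rfl hy (hy0 y hy'.1 hm).le
    linarith

/-! ### Bounds for the arc tangent -/

theorem arctan_le_quintic {u : ℝ} (hu : 0 ≤ u) : Real.arctan u ≤ u - u ^ 3 / 3 + u ^ 5 / 5 := by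
  have h : MonotoneOn (fun u : ℝ => u - u ^ 3 / 3 + u ^ 5 / 5 - Real.arctan u) (Set.Ici 0) := by
    refine monotoneOn_of_hasDerivWithinAt_nonneg (convex_Ici 0) (by fun_prop)
      (f' := fun u => 1 - 3 * u ^ 2 / 3 + 5 * u ^ 4 / 5 - 1 / (1 + u ^ 2)) (fun x _ => ?_) fun x _ => ?_
    · exact ((((hasDerivAt_id x).sub ((hasDerivAt_pow 3 x).div_const 3)).add
        ((hasDerivAt_pow 5 x).div_const 5)).sub (Real.hasDerivAt_arctan x)).hasDerivWithinAt
    · rw [sub_nonneg, div_le_iff₀ (by positivity)]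
      nlinarith [pow_nonneg (sq_nonneg x) 3]
  have := h Set.self_mem_Ici hu hu
  simp only [Real.arctan_zero] at this
  linarith

theorem cubic_le_arctan {u : ℝ} (hu : 0 ≤ u) : u - u ^ 3 / 3 ≤ Real.arctan u := by
  have h : MonotoneOn (fun u : ℝ => Real.arctan u - (u - u ^ 3 / 3)) (Set.Ici 0) := by
    refine monotoneOn_of_hasDerivWithinAt_nonneg (convex_Ici 0) (by fun_prop)
      (f' := fun u => 1 / (1 + u ^ 2) - (1 - 3 * u ^ 2 / 3)) (fun x _ => ?_) fun x _ => ?_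
    · exact ((Real.hasDerivAt_arctan x).sub
        ((hasDerivAt_id x).sub ((hasDerivAt_pow 3 x).div_const 3))).hasDerivWithinAt
    · rw [sub_nonneg, le_div_iff₀ (by positivity)]
      nlinarith [pow_nonneg (sq_nonneg x) 2]
  have := h Set.self_mem_Ici hu hu
  simp only [Real.arctan_zero] at this
  linarith

theorem arctan_le_self {u : ℝ} (hu : 0 ≤ u) : Real.arctan u ≤ u := by
  have h : MonotoneOn (fun u : ℝ => u - Real.arctan u) (Set.Ici 0) := by
    refine monotoneOn_of_hasDerivWithinAt_nonneg (convex_Ici 0) (by fun_prop)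
      (f' := fun u => 1 - 1 / (1 + u ^ 2)) (fun x _ => ?_) fun x _ => ?_
    · exact ((hasDerivAt_id x).sub (Real.hasDerivAt_arctan x)).hasDerivWithinAt
    · rw [sub_nonneg, div_le_iff₀ (by positivity)]
      nlinarith [sq_nonneg x]
  have := h Set.self_mem_Ici hu hu
  simp only [Real.arctan_zero] at this
  linarith

/-- The tangent line of the arc tangent at `1`. -/
theorem arctan_le_tangent {u : ℝ} (hu : 0 ≤ u) : Real.arctan u ≤ Real.pi / 4 + (u - 1) / 2 := by
  have hder : ∀ x : ℝ, HasDerivAt (fun u : ℝ => u / 2 - Real.arctan u) (1 / 2 - 1 / (1 + x ^ 2)) x :=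
    fun x => ((hasDerivAt_id x).div_const 2).sub (Real.hasDerivAt_arctan x)
  have h1 : u / 2 - Real.arctan u ≥ 1 / 2 - Real.pi / 4 := by
    rw [← Real.arctan_one]
    rcases le_total 1 u with h | h
    · have hm : MonotoneOn (fun u : ℝ => u / 2 - Real.arctan u) (Set.Ici 1) := by
        refine monotoneOn_of_hasDerivWithinAt_nonneg (convex_Ici 1) (by fun_prop)
          (fun x _ => (hder x).hasDerivWithinAt) fun x hx => ?_
        rw [interior_Ici, Set.mem_Ioi] at hx
        rw [sub_nonneg, div_le_div_iff₀ (by positivity) (by norm_num)]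
        nlinarith
      exact hm Set.self_mem_Ici h h
    · have hm : AntitoneOn (fun u : ℝ => u / 2 - Real.arctan u) (Set.Icc 0 1) := by
        refine antitoneOn_of_hasDerivWithinAt_nonpos (convex_Icc 0 1) (by fun_prop)
          (fun x _ => (hder x).hasDerivWithinAt) fun x hx => ?_
        rw [interior_Icc, Set.mem_Ioo] at hx
        rw [sub_nonpos, div_le_div_iff₀ (by norm_num) (by positivity)]
        nlinarith
      exact hm ⟨hu, h⟩ ⟨zero_le_one, le_rfl⟩ h
  linarith

/-! ### Monotonicity in `t` -/

theorem prod_Icc_succ {M : Type*} [CommMonoid M] (t : ℕ) (g : ℕ → M) :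
    (∏ j ∈ Finset.Icc (t + 1) (2 * (t + 1)), g j) * g t =
      (∏ j ∈ Finset.Icc t (2 * t), g j) * (g (2 * t + 1) * g (2 * t + 2)) := by
  have h1 : ∏ j ∈ Finset.Icc t (2 * t + 2), g j =
      g t * ∏ j ∈ Finset.Icc (t + 1) (2 * t + 2), g j := by
    rw [← Finset.insert_Icc_add_one_left_eq_Icc (by omega : t ≤ 2 * t + 2), Finset.prod_insert (by simp)]
  rw [show 2 * (t + 1) = 2 * t + 2 by ring, mul_comm, ← h1,
    Finset.prod_Icc_succ_top (by omega : t ≤ 2 * t + 1 + 1),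
    Finset.prod_Icc_succ_top (by omega : t ≤ 2 * t + 1), mul_assoc]

theorem modProd_succ (t : ℕ) (x y : ℝ) : modProd (t + 1) x y * ((x + t) ^ 2 + y ^ 2) =
    modProd t x y * (((x + (2 * t + 1)) ^ 2 + y ^ 2) * ((x + (2 * t + 2)) ^ 2 + y ^ 2)) := by
  have := prod_Icc_succ t fun j => (x + (j : ℝ)) ^ 2 + y ^ 2
  push_cast at this
  exact this

theorem arctanSum_succ (t : ℕ) (x y : ℝ) : arctanSum (t + 1) x y + Real.arctan (y / (x + t)) =
    arctanSum t x y +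
      (Real.arctan (y / (x + (2 * t + 1))) + Real.arctan (y / (x + (2 * t + 2)))) := by
  have := prod_Icc_succ t fun j => Multiplicative.ofAdd (Real.arctan (y / (x + (j : ℝ))))
  rw [← ofAdd_sum, ← ofAdd_sum] at this
  have h := congrArg Multiplicative.toAdd this
  simp only [toAdd_mul, toAdd_ofAdd] at h
  push_cast at h
  exact h

theorem modProd_pos {t : ℕ} {x : ℝ} (hx : -(t : ℝ) < x) (y : ℝ) : 0 < modProd t x y :=
  Finset.prod_pos fun j hj => by
    have := add_pos_of_mem hx hj
    positivity

theorem modProd_two_pos (t : ℕ) : 0 < modProd t 2 0 :=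
  modProd_pos (by linarith [t.cast_nonneg (α := ℝ)]) 0

/-- The relative modulus of the indicial polynomial decreases with `t`. -/
theorem modProd_div_succ_le {t : ℕ} {x y : ℝ} (hx : 0 < x)
    (h : ((x + (2 * t + 1)) ^ 2 + y ^ 2) * ((x + (2 * t + 2)) ^ 2 + y ^ 2) ≤
      4 * (2 * t + 3) ^ 2 * ((x + t) ^ 2 + y ^ 2)) :
    modProd (t + 1) x y / modProd (t + 1) 2 0 ≤ modProd t x y / modProd t 2 0 := by
  have h1 := modProd_succ t x y
  have h2 := modProd_succ t 2 0
  have hp : 0 < (x + (t : ℝ)) ^ 2 + y ^ 2 := by positivity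
  have hp2 : (0 : ℝ) < (2 + (t : ℝ)) ^ 2 + 0 ^ 2 := by positivity
  rw [div_le_div_iff₀ (modProd_two_pos _) (modProd_two_pos _)]
  rw [← mul_le_mul_iff_of_pos_right (mul_pos hp hp2)]
  have e1 : modProd (t + 1) x y * modProd t 2 0 * (((x + t) ^ 2 + y ^ 2) * ((2 + t) ^ 2 + 0 ^ 2)) =
      (modProd t x y * modProd t 2 0 * (2 + t) ^ 2) *
        (((x + (2 * t + 1)) ^ 2 + y ^ 2) * ((x + (2 * t + 2)) ^ 2 + y ^ 2)) := by
    linear_combination (modProd t 2 0 * ((2 + t) ^ 2 + 0 ^ 2)) * h1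
  have e2 : modProd t x y * modProd (t + 1) 2 0 * (((x + t) ^ 2 + y ^ 2) * ((2 + t) ^ 2 + 0 ^ 2)) =
      (modProd t x y * modProd t 2 0 * (2 + t) ^ 2) *
        (4 * (2 * t + 3) ^ 2 * ((x + t) ^ 2 + y ^ 2)) := by
    linear_combination (modProd t x y * ((x + t) ^ 2 + y ^ 2)) * h2
  rw [e1, e2]
  refine mul_le_mul_of_nonneg_left h ?_
  have := (modProd_two_pos t).le
  have : 0 ≤ modProd t x y := Finset.prod_nonneg fun j _ => by positivity
  positivity

theorem arctanSum_le_succ {t : ℕ} {x y : ℝ} (hx : 0 < x) (hy : 0 ≤ y)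
    (h1 : y ^ 2 < (x + (2 * t + 1)) * (x + (2 * t + 2)))
    (h2 : (x + (2 * t + 1)) * (x + (2 * t + 2)) - y ^ 2 ≤ (x + t) * (2 * x + (4 * t + 3))) :
    arctanSum t x y ≤ arctanSum (t + 1) x y := by
  have h := arctanSum_succ t x y
  set a := x + (2 * t + 1) with ha
  set b := x + (2 * (t : ℝ) + 2) with hb
  have ha0 : 0 < a := by positivity
  have hb0 : 0 < b := by positivity
  have hc0 : 0 < x + t := by positivity
  have hprod : y / a * (y / b) < 1 := by
    rw [div_mul_div_comm, div_lt_one (by positivity)]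
    linarith
  have hle : Real.arctan (y / (x + t)) ≤ Real.arctan (y / a) + Real.arctan (y / b) := by
    rw [Real.arctan_add hprod]
    apply Real.arctan_mono
    have e : (y / a + y / b) / (1 - y / a * (y / b)) = y * (a + b) / (a * b - y ^ 2) := by
      have : a * b - y ^ 2 ≠ 0 := by linarith
      field_simp
      ring
    rw [e, div_le_div_iff₀ hc0 (by linarith), mul_assoc]
    refine mul_le_mul_of_nonneg_left ?_ hy
    rw [ha, hb] at h2 ⊢
    linarith
  linarith

theorem modProd_antitone_three_half {y : ℝ} (hy : y ^ 2 ≤ 90) {s t : ℕ} (hs : 10 ≤ s) (hst : s ≤ t) :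
    modProd t (3 / 2) y / modProd t 2 0 ≤ modProd s (3 / 2) y / modProd s 2 0 := by
  induction t, hst using Nat.le_induction with
  | base => exact le_rfl
  | succ t ht ih =>
    refine (modProd_div_succ_le (by norm_num) ?_).trans ih
    have : (10 : ℝ) ≤ t := by exact_mod_cast hs.trans ht
    nlinarith [mul_nonneg (sq_nonneg y) (sub_nonneg.2 hy), mul_nonneg (sq_nonneg y) (sub_nonneg.2 this)]

theorem arctanSum_mono_three_half {y : ℝ} (hy : y ^ 2 ≤ 90) (hy0 : 0 ≤ y) {s t : ℕ} (hs : 10 ≤ s)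
    (hst : s ≤ t) : arctanSum s (3 / 2) y ≤ arctanSum t (3 / 2) y := by
  induction t, hst using Nat.le_induction with
  | base => exact le_rfl
  | succ t ht ih =>
    have : (10 : ℝ) ≤ t := by exact_mod_cast hs.trans ht
    refine ih.trans (arctanSum_le_succ (by norm_num) hy0 ?_ ?_)
    · nlinarith
    · nlinarith [sq_nonneg y]

theorem modProd_antitone_one {y : ℝ} (hy : y ^ 2 ≤ 90) {s t : ℕ} (hs : 10 ≤ s) (hst : s ≤ t) :
    modProd t 1 y / modProd t 2 0 ≤ modProd s 1 y / modProd s 2 0 := by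
  induction t, hst using Nat.le_induction with
  | base => exact le_rfl
  | succ t ht ih =>
    refine (modProd_div_succ_le (by norm_num) ?_).trans ih
    have : (10 : ℝ) ≤ t := by exact_mod_cast hs.trans ht
    nlinarith [mul_nonneg (sq_nonneg y) (sub_nonneg.2 hy), mul_nonneg (sq_nonneg y) (sub_nonneg.2 this)]

theorem arctanSum_mono_one {y : ℝ} (hy : y ^ 2 ≤ 90) (hy0 : 0 ≤ y) (hy80 : 80 ≤ y ^ 2) {s t : ℕ}
    (hs : 10 ≤ s) (hst : s ≤ t) (ht : t ≤ 60) : arctanSum s 1 y ≤ arctanSum t 1 y := by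
  induction t, hst using Nat.le_induction with
  | base => exact le_rfl
  | succ t hst ih =>
    have h1 : (10 : ℝ) ≤ t := by exact_mod_cast hs.trans hst
    have h2 : (t : ℝ) + 1 ≤ 60 := by exact_mod_cast ht
    refine (ih (by omega)).trans (arctanSum_le_succ (by norm_num) hy0 ?_ ?_)
    · nlinarith
    · nlinarith

/-! ### Numerical thresholds -/

theorem arctanSum_le_rat {t : ℕ} {x y : ℚ} (hx : 0 < x) (hy : 0 ≤ y) {c : ℚ}
    (h : ∑ j ∈ Finset.Icc t (2 * t), (y / (x + j) - (y / (x + j)) ^ 3 / 3 + (y / (x + j)) ^ 5 / 5) ≤ c) :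
    arctanSum t x y ≤ c := by
  have h' : ((∑ j ∈ Finset.Icc t (2 * t),
    (y / (x + j) - (y / (x + j)) ^ 3 / 3 + (y / (x + j)) ^ 5 / 5) : ℚ) : ℝ) ≤ c := by exact_mod_cast h
  refine le_trans (Finset.sum_le_sum fun j _ => ?_) (by push_cast at h'; exact h')
  have : (0 : ℝ) < x := by exact_mod_cast hx
  have : (0 : ℝ) ≤ y := by exact_mod_cast hy
  exact arctan_le_quintic (by positivity)

theorem le_arctanSum_rat {t : ℕ} {x y : ℚ} (hx : 0 < x) (hy : 0 ≤ y) {c : ℚ}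
    (h : c ≤ ∑ j ∈ Finset.Icc t (2 * t), (y / (x + j) - (y / (x + j)) ^ 3 / 3)) :
    (c : ℝ) ≤ arctanSum t x y := by
  have h' : (c : ℝ) ≤ ((∑ j ∈ Finset.Icc t (2 * t), (y / (x + j) - (y / (x + j)) ^ 3 / 3) : ℚ) : ℝ) := by
    exact_mod_cast h
  refine le_trans (by push_cast at h'; exact h') (Finset.sum_le_sum fun j _ => ?_)
  have : (0 : ℝ) < x := by exact_mod_cast hx
  have : (0 : ℝ) ≤ y := by exact_mod_cast hy
  exact cubic_le_arctan (by positivity)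

theorem modProd_rat (t : ℕ) (x y : ℚ) :
    modProd t x y = ((∏ j ∈ Finset.Icc t (2 * t), ((x + j) ^ 2 + y ^ 2) : ℚ) : ℝ) := by
  rw [modProd]
  push_cast
  rfl

theorem modProd_two_rat (t : ℕ) :
    modProd t 2 0 = ((∏ j ∈ Finset.Icc t (2 * t), ((2 + j : ℚ) ^ 2 + 0 ^ 2) : ℚ) : ℝ) := by
  rw [modProd]
  push_cast
  rfl

theorem re_lt_three_half {t : ℕ} (h10 : 10 ≤ t) (h58 : t ≤ 58) :
    ∀ z ∈ (indRoots t).erase 2, z.re < 3 / 2 := by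
  have hm : modProd 58 2 0 < modProd 58 ((3 / 2 : ℚ) : ℝ) ((908 / 100 : ℚ) : ℝ) := by
    rw [modProd_rat, modProd_two_rat, Rat.cast_lt]
    decide +kernel
  have ha : arctanSum 58 ((3 / 2 : ℚ) : ℝ) ((908 / 100 : ℚ) : ℝ) ≤ ((628318 / 100000 : ℚ) : ℝ) :=
    arctanSum_le_rat (by norm_num) (by norm_num) (by decide +kernel)
  push_cast at hm ha
  have hpi := Real.pi_gt_d6
  have h1 := modProd_antitone_three_half (y := 908 / 100) (by norm_num) h10 h58
  have h2 := arctanSum_mono_three_half (y := 908 / 100) (by norm_num) (by norm_num) h10 h58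
  refine re_lt_of_root (y₀ := 908 / 100) ?_ (by norm_num) ?_ (by linarith)
  · linarith [t.cast_nonneg (α := ℝ)]
  · rw [← one_lt_div (modProd_two_pos _)] at hm ⊢
    exact hm.trans_le h1

theorem re_lt_one {t : ℕ} (h10 : 10 ≤ t) (h28 : t ≤ 28) : ∀ z ∈ (indRoots t).erase 2, z.re < 1 := by
  have hm : modProd 28 2 0 < modProd 28 ((1 : ℚ) : ℝ) ((904 / 100 : ℚ) : ℝ) := by
    rw [modProd_rat, modProd_two_rat, Rat.cast_lt]
    decide +kernel
  have ha : arctanSum 28 ((1 : ℚ) : ℝ) ((904 / 100 : ℚ) : ℝ) ≤ ((628318 / 100000 : ℚ) : ℝ) :=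
    arctanSum_le_rat (by norm_num) (by norm_num) (by decide +kernel)
  push_cast at hm ha
  have hpi := Real.pi_gt_d6
  have h1 := modProd_antitone_one (y := 904 / 100) (by norm_num) h10 h28
  have h2 := arctanSum_mono_one (y := 904 / 100) (by norm_num) (by norm_num) (by norm_num) h10 h28
    (by omega)
  refine re_lt_of_root (y₀ := 904 / 100) ?_ (by norm_num) ?_ (by linarith)
  · linarith [t.cast_nonneg (α := ℝ)]
  · rw [← one_lt_div (modProd_two_pos _)] at hm ⊢
    exact hm.trans_le h1

theorem exists_root_three_half {t : ℕ} (h59 : 59 ≤ t) : ∃ z ∈ (indRoots t).erase 2, 3 / 2 < z.re := by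
  have hm : modProd 59 ((3 / 2 : ℚ) : ℝ) ((912 / 100 : ℚ) : ℝ) < modProd 59 2 0 := by
    rw [modProd_rat, modProd_two_rat, Rat.cast_lt]
    decide +kernel
  have ha : ((62832 / 10000 : ℚ) : ℝ) ≤ arctanSum 59 ((3 / 2 : ℚ) : ℝ) ((912 / 100 : ℚ) : ℝ) :=
    le_arctanSum_rat (by norm_num) (by norm_num) (by decide +kernel)
  push_cast at hm ha
  have hpi := Real.pi_lt_d6
  have h1 := modProd_antitone_three_half (y := 912 / 100) (by norm_num) (by norm_num) h59
  have h2 := arctanSum_mono_three_half (y := 912 / 100) (by norm_num) (by norm_num) (by norm_num) h59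
  refine exists_root (y₀ := 912 / 100) ?_ (by norm_num) (by norm_num) ?_ (by linarith)
  · linarith [t.cast_nonneg (α := ℝ)]
  · rw [← div_lt_one (modProd_two_pos _)] at hm ⊢
    exact h1.trans_lt hm

theorem exists_root_one {t : ℕ} (h29 : 29 ≤ t) : ∃ z ∈ (indRoots t).erase 2, 1 < z.re := by
  rcases le_or_gt 59 t with h59 | h59
  · obtain ⟨z, hz, h⟩ := exists_root_three_half h59
    exact ⟨z, hz, by linarith⟩
  have hm : modProd 29 ((1 : ℚ) : ℝ) ((4559 / 500 : ℚ) : ℝ) < modProd 29 2 0 := by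
    rw [modProd_rat, modProd_two_rat, Rat.cast_lt]
    decide +kernel
  have ha : ((62832 / 10000 : ℚ) : ℝ) ≤ arctanSum 29 ((1 : ℚ) : ℝ) ((4559 / 500 : ℚ) : ℝ) :=
    le_arctanSum_rat (by norm_num) (by norm_num) (by decide +kernel)
  push_cast at hm ha
  have hpi := Real.pi_lt_d6
  have h1 := modProd_antitone_one (y := 4559 / 500) (by norm_num) (by norm_num) h29
  have h2 := arctanSum_mono_one (y := 4559 / 500) (by norm_num) (by norm_num) (by norm_num)
    (by norm_num) h29 (by omega)
  refine exists_root (y₀ := 4559 / 500) ?_ (by norm_num) (by norm_num) ?_ (by linarith)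
  · linarith [t.cast_nonneg (α := ℝ)]
  · rw [← div_lt_one (modProd_two_pos _)] at hm ⊢
    exact h1.trans_lt hm

/-! ### The second zero -/

theorem indicial_eq_zero_iff {t : ℕ} {z : ℂ} : indicial t z = 0 ↔ indProd t z = 2 := by
  have h : (2 * (2 * t + 1)! / t ! : ℂ) = 2 * ∏ j ∈ Finset.Icc t (2 * t), (j + 1 : ℂ) := by
    have h1 : (t ! : ℂ) ≠ 0 := by exact_mod_cast t.factorial_ne_zero
    have h2 : ((2 * t + 1)! : ℂ) = t ! * ∏ j ∈ Finset.Icc t (2 * t), (j + 1 : ℂ) := by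
      have := eig_two_mul_add_one t (1 : ℂ)
      have h3 : ∀ s : ℕ, t ≤ s → ((s + 1)! : ℂ) = t ! * ∏ j ∈ Finset.Icc t s, (j + 1 : ℂ) := by
        intro s hs
        induction s, hs using Nat.le_induction with
        | base => simp [Nat.factorial_succ, mul_comm]
        | succ s hs ih =>
          rw [Finset.prod_Icc_succ_top (by omega), ← mul_assoc, ← ih, Nat.factorial_succ (s + 1)]
          push_cast
          ring
      exact h3 (2 * t) (by omega)
    rw [h2]
    field_simp
  rw [indicial, h, sub_eq_zero, indProd_eq_div, div_eq_iff (prod_Icc_add_one_ne_zero t)]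

theorem conj_root {t : ℕ} {z : ℂ} (hz : indProd t z = 2) : indProd t (starRingEnd ℂ z) = 2 := by
  have := congrArg (starRingEnd ℂ) hz
  rw [indProd] at this ⊢
  rw [map_prod, map_ofNat] at this
  simpa using this

theorem exists_secondZero {t : ℕ} (h29 : 29 ≤ t) :
    ∃ ρ : ℂ, IsSecondZero t ρ ∧ 1 < ρ.re ∧ (59 ≤ t → 3 / 2 < ρ.re) := by
  classical
  obtain ⟨z₁, hz₁, hre₁⟩ := exists_root_one h29
  obtain ⟨z₀, hz₀, hmax⟩ := Finset.exists_max_image ((indRoots t).erase 2) Complex.re ⟨z₁, hz₁⟩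
  have hre₀ : 1 < z₀.re := hre₁.trans_le (hmax z₁ hz₁)
  have hr₀ := mem_indRoots.1 (Finset.mem_of_mem_erase hz₀)
  have hlt : ∀ {x : ℝ}, 1 < x → -(t : ℝ) < x := fun h => by linarith [t.cast_nonneg (α := ℝ)]
  have him : z₀.im ≠ 0 := by
    intro h
    have := two_pi_le_of_root hr₀ (Finset.ne_of_mem_erase hz₀) (hlt hre₀)
    rw [argSum_eq_arctanSum (hlt hre₀), h] at this
    simp only [arctanSum, zero_div, Real.arctan_zero, Finset.sum_const_zero, abs_zero] at this
    linarith [Real.two_pi_pos]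
  obtain ⟨ρ, hρ, hρre, hρim⟩ : ∃ ρ : ℂ, indProd t ρ = 2 ∧ ρ.re = z₀.re ∧ 0 < ρ.im := by
    rcases lt_or_gt_of_ne him with h | h
    · exact ⟨starRingEnd ℂ z₀, conj_root hr₀, rfl, by rw [Complex.conj_im]; linarith⟩
    · exact ⟨z₀, hr₀, rfl, h⟩
  refine ⟨ρ, ⟨indicial_eq_zero_iff.2 hρ, hρim, ?_, ?_⟩, hρre ▸ hre₀, fun h59 => ?_⟩
  · refine re_lt_two_of_root hρ fun h => ?_
    rw [h] at hρim
    simp at hρim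
  · intro z hz hz2 hzρ hzρ'
    have hzr := indicial_eq_zero_iff.1 hz
    have hzm : z ∈ (indRoots t).erase 2 := Finset.mem_erase.2 ⟨hz2, mem_indRoots.2 hzr⟩
    refine lt_of_le_of_ne (hρre ▸ hmax z hzm) fun heq => ?_
    have hx : -(t : ℝ) < z.re := by rw [heq, hρre]; exact hlt hre₀
    have h1 := modProd_of_root hzr
    have h2 := modProd_of_root hρ
    rw [← modProd_abs, heq] at h1
    rcases lt_trichotomy |z.im| ρ.im with h | h | h
    · have := modProd_lt (heq ▸ hx) (le_refl ρ.re) (abs_nonneg _) h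
      linarith
    · rcases abs_choice z.im with h' | h'
      · exact hzρ (Complex.ext heq (h' ▸ h))
      · refine hzρ' (Complex.ext (by rw [heq, Complex.conj_re]) ?_)
        rw [Complex.conj_im, ← h, h', neg_neg]
    · have := modProd_lt (heq ▸ hx) (le_refl ρ.re) hρim.le h
      linarith
  · obtain ⟨z₂, hz₂, hre₂⟩ := exists_root_three_half h59
    rw [hρre]
    exact hre₂.trans_le (hmax z₂ hz₂)

/-! ### Telescoping sums -/

theorem PolyBound.tendsto_div_succ {f : ℕ → ℂ} {e : ℝ} (hf : PolyBound f e) (he : e < 1) :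
    Tendsto (fun n : ℕ => f n / (n + 1)) atTop (𝓝 0) := by
  obtain ⟨D, hD, hf⟩ := hf
  have h1 := (tendsto_rpow_div he).const_mul D
  rw [mul_zero] at h1
  refine squeeze_zero_norm (fun n => ?_) h1
  have : ‖(n : ℂ) + 1‖ = n + 1 := by
    rw [← Nat.cast_one, ← Nat.cast_add, Complex.norm_natCast]; push_cast; ring
  rw [norm_div, this, ← mul_div_assoc]
  exact div_le_div_of_nonneg_right (hf n) (by positivity)

theorem hasSum_tollWeight {N : ℕ} {f G : ℕ → ℂ} {e : ℝ} (hf : PolyBound f e) (he : e < 1)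
    (h : ∀ n, N ≤ n → G (n + 1) - G n = f n / ((n + 1) * (n + 2))) (hG : Tendsto G atTop (𝓝 0)) :
    HasSum (tollWeight N f) (-G N) := by
  obtain ⟨C, hC, hf⟩ := hf
  have hs := (summable_tollWeight N he hf).hasSum
  have h1 : ∀ n, N ≤ n → ∑ i ∈ Finset.range n, tollWeight N f i = G n - G N := by
    intro n hn
    induction n, hn using Nat.le_induction with
    | base =>
      rw [sub_self]
      refine Finset.sum_eq_zero fun i hi => ?_
      rw [tollWeight, if_neg (not_le.2 (Finset.mem_range.1 hi))]
    | succ n hn ih =>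
      rw [Finset.sum_range_succ, ih, tollWeight, if_pos hn, ← h n hn]
      ring
  have h2 : Tendsto (fun n => G n - G N) atTop (𝓝 (0 - G N)) := hG.sub_const _
  rw [zero_sub] at h2
  have h3 := h2.congr' (eventually_atTop.2 ⟨N, fun n hn => (h1 n hn).symm⟩)
  rwa [tendsto_nhds_unique hs.tendsto_sum_nat h3] at hs

theorem natCast_add_ne_zero (n k : ℕ) : (n : ℂ) + (k + 1 : ℕ) ≠ 0 := by
  exact_mod_cast (by omega : n + (k + 1) ≠ 0)

/-- The weighted sum of a sequence that satisfies the recurrence of `eig ν`. -/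
theorem hasSum_tollWeight_eigen {N : ℕ} {f : ℕ → ℂ} {ν : ℂ} {e : ℝ} (hf : PolyBound f e) (he : e < 1)
    (hν : ν ≠ 2) (h : ∀ n, N ≤ n → (n + 1) * f (n + 1) = (n + ν) * f n) :
    HasSum (tollWeight N f) (f N / ((N + 1) * (2 - ν))) := by
  have hν' : ν - 2 ≠ 0 := sub_ne_zero.2 hν
  have := hasSum_tollWeight (N := N) (G := fun n => f n / (n + 1) * (1 / (ν - 2))) hf he
    (fun n hn => by
      have h1 := natCast_add_ne_zero n 0
      have h2 := natCast_add_ne_zero n 1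
      push_cast at h1 h2 ⊢
      have := h n hn
      rw [add_assoc (n : ℂ) 1 1]
      norm_num only at h2 ⊢
      field_simp
      linear_combination this)
    (by simpa using (hf.tendsto_div_succ he).mul_const (1 / (ν - 2)))
  convert this using 1
  have h1 := natCast_add_ne_zero N 0
  have h2 : 2 - ν ≠ 0 := sub_ne_zero.2 hν.symm
  push_cast at h1
  field_simp
  ring

/-- The weighted sum of the derivative of an eigensequence. -/
theorem hasSum_tollWeight_deriv {N : ℕ} {f g : ℕ → ℂ} {ν : ℂ} {e : ℝ} (hf : PolyBound f e)
    (hg : PolyBound g e) (he : e < 1) (hν : ν ≠ 2)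
    (h : ∀ n, N ≤ n → (n + 1) * f (n + 1) = (n + ν) * f n)
    (h' : ∀ n, N ≤ n → (n + 1) * g (n + 1) = (n + ν) * g n + f n) :
    HasSum (tollWeight N g) ((g N / (2 - ν) + f N / (2 - ν) ^ 2) / (N + 1)) := by
  have hν' : ν - 2 ≠ 0 := sub_ne_zero.2 hν
  have := hasSum_tollWeight (N := N)
    (G := fun n => g n / (n + 1) * (1 / (ν - 2)) - f n / (n + 1) * (1 / (ν - 2) ^ 2)) hg he
    (fun n hn => by
      have h1 := natCast_add_ne_zero n 0
      have h2 := natCast_add_ne_zero n 1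
      push_cast at h1 h2 ⊢
      have e1 := h n hn
      have e2 := h' n hn
      rw [add_assoc (n : ℂ) 1 1]
      norm_num only at h2 ⊢
      field_simp
      linear_combination (ν - 2) * e2 - e1)
    (by
      have := ((hg.tendsto_div_succ he).mul_const (1 / (ν - 2))).sub
        ((hf.tendsto_div_succ he).mul_const (1 / (ν - 2) ^ 2))
      simpa using this)
  convert this using 1
  have h1 := natCast_add_ne_zero N 0
  have h2 : 2 - ν ≠ 0 := sub_ne_zero.2 hν.symm
  have h3 : (ν - 2) = -(2 - ν) := by ring
  rw [h3]
  push_cast at h1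
  field_simp
  ring

theorem avg₂_at (t : ℕ) (f g : ℕ → ℂ) : avg₂ t f g (2 * t + 1) = f t * g t := by
  rw [avg₂, Finset.sum_eq_single t]
  · simp [wt, show 2 * t - t = t by omega]
  · intro k hk hkt
    have := Finset.mem_range.1 hk
    rw [wt_eq_zero (by omega), zero_mul]
  · intro h
    exact absurd (Finset.mem_range.2 (by omega)) h

theorem avg₂_eig_succ (t : ℕ) (a b : ℂ) {n : ℕ} (hn : 2 * t + 1 ≤ n) :
    (n + 1) * avg₂ t (eig a) (eig b) (n + 1) = (n + (a + b - 1)) * avg₂ t (eig a) (eig b) n := by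
  obtain ⟨p, rfl⟩ := Nat.exists_eq_add_of_le hn
  rw [add_assoc _ p, avg₂_eig, avg₂_eig, eig_succ]
  have h := Nat.choose_mul_succ_eq (2 * t + 1 + p) (2 * t + 1)
  rw [show 2 * t + 1 + p + 1 - (2 * t + 1) = p + 1 by omega] at h
  have h' := congrArg (fun x : ℕ => (x : ℂ)) h
  push_cast at h'
  have c1 := choose_ne_zero' (K := ℂ) t p
  have c2 := choose_ne_zero' (K := ℂ) t (p + 1)
  have c3 : (p : ℂ) + 1 ≠ 0 := by exact_mod_cast p.succ_ne_zero
  rw [← add_assoc] at c2 ⊢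
  push_cast at c1 c2 h' ⊢
  field_simp
  linear_combination (a + b + 2 * t + p) * eig a t * eig b t * eig (a + b + 2 * t) p * h'

theorem avg₂_eig_deig_succ (t : ℕ) (a : ℂ) {b : ℂ} (hb : 0 < b.re) {n : ℕ} (hn : 2 * t + 1 ≤ n) :
    (n + 1) * avg₂ t (eig a) (deig b) (n + 1) =
      (n + (a + b - 1)) * avg₂ t (eig a) (deig b) n + avg₂ t (eig a) (eig b) n := by
  have h1 := (HasDerivAt.avg₂_right (fun k => hasDerivAt_eig hb k) t (eig a) (n + 1)).const_mul
    ((n : ℂ) + 1)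
  have h2 := ((((hasDerivAt_id b).const_add a).sub_const 1).const_add (n : ℂ)).mul
    (HasDerivAt.avg₂_right (fun k => hasDerivAt_eig hb k) t (eig a) n)
  have h3 : (fun z => ((n : ℂ) + 1) * avg₂ t (eig a) (eig z) (n + 1)) = _ :=
    funext fun z => avg₂_eig_succ t a z hn
  rw [h3] at h1
  have := h1.unique h2
  simp only [id, one_mul] at this
  linear_combination this

section Functional

variable {t : ℕ} {l : ℂ}

theorem hasSum_avg₂_eig (hl : l.re < 1) {z : ℂ} (hz : z.re ≤ 2) :
    HasSum (tollWeight (2 * t + 1) (avg₂ t (eig l) (eig z)))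
      (eig l t * eig z t / ((2 * t + 2) * (3 - l - z))) := by
  have hl' : max (l.re - 1) (-1 / 2) < 0 := max_lt (by linarith) (by norm_num)
  have hpb : PolyBound (avg₂ t (eig l) (eig z)) (max (l.re - 1) (-1 / 2) + 1) :=
    (PolyBound.eig (le_max_left _ _)).avg₂_le (PolyBound.eig (by linarith))
      (lt_of_lt_of_le (by norm_num) (le_max_right _ _)) (by norm_num) le_rfl
  have h := hasSum_tollWeight_eigen hpb (by linarith) (ν := l + z - 1) (fun h => by
    have := congrArg Complex.re h
    simp only [Complex.sub_re, Complex.add_re, Complex.one_re, Complex.re_ofNat] at this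
    linarith) fun n hn => avg₂_eig_succ t l z hn
  rw [avg₂_at] at h
  convert h using 2
  push_cast
  ring

theorem hasSum_avg₂_deig (hl : l.re < 1) :
    HasSum (tollWeight (2 * t + 1) (avg₂ t (eig l) (deig 2)))
      (eig l t * (deig 2 t / (1 - l) + eig 2 t / (1 - l) ^ 2) / (2 * t + 2)) := by
  have hl' : max (l.re - 1) (-1 / 2) < 0 := max_lt (by linarith) (by norm_num)
  set d := -max (l.re - 1) (-1 / 2) / 2 with hd
  have h0 : PolyBound (eig l) (-2 * d) := PolyBound.eig (by
    rw [hd]; linarith [le_max_left (l.re - 1) (-1 / 2)])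
  have h1 : -1 < -2 * d := by
    rw [hd]; linarith [le_max_right (l.re - 1) (-1 / 2)]
  have hpb : PolyBound (avg₂ t (eig l) (eig 2)) (1 - d) :=
    h0.avg₂_le (PolyBound.eig (e := 1) (by norm_num)) h1 (by norm_num) (by linarith)
  have hpb' : PolyBound (avg₂ t (eig l) (deig 2)) (1 - d) :=
    h0.avg₂_le (polyBound_deig (e := 1 + d) (by norm_num; linarith)) h1 (by linarith)
      (by linarith)
  have h := hasSum_tollWeight_deriv hpb hpb' (by linarith) (ν := l + 2 - 1) (fun h => by
    have := congrArg Complex.re h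
    simp only [Complex.sub_re, Complex.add_re, Complex.one_re, Complex.re_ofNat] at this
    linarith) (fun n hn => avg₂_eig_succ t l 2 hn)
    fun n hn => avg₂_eig_deig_succ t l (by norm_num) hn
  rw [avg₂_at, avg₂_at] at h
  convert h using 1
  push_cast
  rw [show 2 - (l + 2 - 1) = 1 - l by ring]
  ring

theorem HasDerivAt.aeval_theta {F : ℂ → ℕ → ℂ} {F' : ℕ → ℂ} {a : ℂ}
    (h : ∀ k, HasDerivAt (fun z => F z k) (F' k) a) (q : Polynomial ℂ) :
    ∀ k, HasDerivAt (fun z => Polynomial.aeval theta q (F z) k) (Polynomial.aeval theta q F' k) a := by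
  induction q using Polynomial.induction_on' generalizing F F' with
  | add p q hp hq =>
    intro k
    simp only [map_add, LinearMap.add_apply, Pi.add_apply]
    exact (hp h k).add (hq h k)
  | monomial n c =>
    intro k
    have : ∀ k, HasDerivAt (fun z => (theta ^ n) (F z) k) ((theta ^ n) F' k) a := by
      induction n generalizing F F' with
      | zero => simpa using h
      | succ n ih =>
        intro k
        simp only [pow_succ, Module.End.mul_apply]
        refine ih (F := fun z => theta (F z)) (F' := theta F') (fun k => ?_) k
        simp only [theta_apply]
        exact ((h (k + 1)).const_mul _).sub ((h k).const_mul _)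
    simp only [Polynomial.aeval_monomial, Module.End.mul_apply, Module.algebraMap_end_apply,
      Pi.smul_apply, smul_eq_mul]
    exact (this k).const_mul c

theorem indProd_ne_two {b : ℂ} (hb : 2 < b.re) : indProd t b ≠ 2 := by
  intro h
  have := re_lt_two_of_root h (by rintro rfl; simp at hb)
  linarith

/-- The polynomial `∑ basisPoly z / (b - z)`. -/
def resolventPoly (t : ℕ) (b : ℂ) : Polynomial ℂ :=
  ∑ z ∈ indRoots t, Polynomial.C (1 / (b - z)) * basisPoly t z

theorem sub_mul_eval_resolventPoly {b : ℂ} (hb : 2 < b.re) (s : ℂ) :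
    (b - s) * (resolventPoly t b).eval s = 1 - (indProd t s - 2) / (indProd t b - 2) := by
  have hb2 := indProd_ne_two (t := t) hb
  have hc := prod_Icc_add_one_ne_zero t
  have hbz : ∀ z ∈ indRoots t, b - z ≠ 0 := by
    intro z hz h
    rw [← sub_eq_zero.1 h] at hz
    exact hb2 (mem_indRoots.1 hz)
  have h1 := congrArg (Polynomial.eval s) (sum_basisPoly t)
  rw [Polynomial.eval_finsetSum, Polynomial.eval_one] at h1
  have h2 : ∀ z ∈ indRoots t, (s - z) * (basisPoly t z).eval s = res t z * (indProd t s - 2) / 2 := by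
    intro z hz
    have := congrArg (Polynomial.eval s) (X_sub_C_mul_basisPoly hz)
    simp only [Polynomial.eval_mul, Polynomial.eval_sub, Polynomial.eval_X, Polynomial.eval_C,
      eval_indPoly] at this
    rw [this]
    field_simp
  have h3 := sum_res_div hb2
  rw [resolventPoly, Polynomial.eval_finsetSum, Finset.mul_sum]
  have h4 : ∀ z ∈ indRoots t, (b - s) * (Polynomial.C (1 / (b - z)) * basisPoly t z).eval s =
      (basisPoly t z).eval s - (indProd t s - 2) / 2 * (res t z / (b - z)) := by
    intro z hz
    have := h2 z hz
    have := hbz z hz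
    rw [Polynomial.eval_mul, Polynomial.eval_C]
    field_simp
    linear_combination -2 * h2 z hz
  rw [Finset.sum_congr rfl h4, Finset.sum_sub_distrib, h1, ← Finset.mul_sum, h3]
  have : indProd t b - 2 ≠ 0 := sub_ne_zero.2 hb2
  field_simp

/-- The weighted sum of `avg₂ (eig l) x`, where `x` is the expectation of the path length. -/
theorem hasSum_avg₂_xMean (hl : l.re < 1) :
    HasSum (tollWeight (2 * t + 1) (avg₂ t (eig l) fun n => (xMean t n : ℂ)))
      (eig l t / (2 * t + 2) * (((2 * t + 2) / (1 - l) - 2 / (2 - l)) / (indProd t (3 - l) - 2))) := by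
  set a : ℕ → ℂ := fun n => xMean t n - (1 / invSum t * deig 2 n + 2) with ha
  have him : (invSum t : ℂ) ≠ 0 := by exact_mod_cast (invSum_pos t).ne'
  have hrec : ∀ n, 2 * t + 1 ≤ n → a n = 2 * avg t a n := by
    intro n hn
    rw [ha, avg_sub, avg_add, avg_const_mul, avg_const hn]
    simp only
    rw [xMean_rec hn]
    have := two_mul_avg_deig_two hn
    field_simp
    linear_combination this
  set b := 3 - l with hb
  have hbre : 2 < b.re := by rw [hb, Complex.sub_re, Complex.re_ofNat]; linarith
  have hb2 := indProd_ne_two (t := t) hbre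
  have hbz : ∀ z ∈ indRoots t, z.re ≤ 2 := by
    intro z hz
    rcases eq_or_ne z 2 with rfl | h
    · simp
    · exact (re_lt_two_of_root (mem_indRoots.1 hz) h).le
  have hsum : HasSum (tollWeight (2 * t + 1) (avg₂ t (eig l) fun n => (xMean t n : ℂ)))
      (1 / invSum t * (eig l t * (deig 2 t / (1 - l) + eig 2 t / (1 - l) ^ 2) / (2 * t + 2)) +
        2 * (eig l t * eig 1 t / ((2 * t + 2) * (3 - l - 1))) +
        ∑ z ∈ indRoots t, component t z a t / eig z t *
          (eig l t * eig z t / ((2 * t + 2) * (3 - l - z)))) := by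
    have h := (((hasSum_avg₂_deig (t := t) hl).mul_left (1 / (invSum t : ℂ))).add
      ((hasSum_avg₂_eig (t := t) hl (z := 1) (by norm_num)).mul_left 2)).add
      (hasSum_sum fun z hz => (hasSum_avg₂_eig (t := t) hl (hbz z hz)).mul_left
        (component t z a t / eig z t))
    refine h.congr_fun fun n => ?_
    simp only [tollWeight]
    split_ifs with hn
    · have e : avg₂ t (eig l) (fun n => (xMean t n : ℂ)) n = avg₂ t (eig l) (fun n =>
          (1 / invSum t * deig 2 n + 2 * eig 1 n) +
            ∑ z ∈ indRoots t, component t z a t / eig z t * eig z n) n := by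
        refine avg₂_congr (fun _ _ => rfl) fun k hk => ?_
        rw [← homogeneous_expansion hrec hk, ha, eig_one]
        ring
      rw [e, avg₂_add_right, avg₂_add_right, avg₂_const_mul_right, avg₂_const_mul_right,
        avg₂_sum_right]
      simp only [avg₂_const_mul_right, add_div, Finset.sum_div]
      congr 1
      · congr 1 <;> ring
      · exact Finset.sum_congr rfl fun z _ => by ring
    · simp
  have hcomp : ∑ z ∈ indRoots t, component t z a t / eig z t *
      (eig l t * eig z t / ((2 * t + 2) * (3 - l - z))) =
      eig l t / (2 * t + 2) * Polynomial.aeval theta (resolventPoly t b) a t := by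
    rw [resolventPoly, map_sum, LinearMap.sum_apply, Finset.sum_apply, Finset.mul_sum]
    refine Finset.sum_congr rfl fun z hz => ?_
    have h1 := eig_root_ne_zero (mem_indRoots.1 hz)
    rw [map_mul, Polynomial.aeval_C, Module.End.mul_apply, Module.algebraMap_end_apply, Pi.smul_apply,
      smul_eq_mul, component, ← hb]
    field_simp
  set q := resolventPoly t b with hq
  have hqd : q.natDegree ≤ t := by
    refine Polynomial.natDegree_sum_le_of_forall_le _ _ fun z hz => ?_
    exact (Polynomial.natDegree_C_mul_le _ _).trans (natDegree_basisPoly_le hz)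
  have hqa : Polynomial.aeval theta q a t =
      -(1 / invSum t) * (q.derivative.eval 2 * eig 2 t + q.eval 2 * deig 2 t) - 2 * q.eval 1 := by
    have h1 : Polynomial.aeval theta q a t = Polynomial.aeval theta q
        (-(1 / invSum t : ℂ) • deig 2 - (2 : ℂ) • eig 1) t := by
      rw [← sub_eq_zero, ← Pi.sub_apply, ← map_sub]
      refine aeval_theta_eq_zero (N := 2 * t) (fun n hn => ?_) hqd (by omega)
      rw [ha]
      simp only [Pi.sub_apply, Pi.smul_apply, smul_eq_mul, eig_one]
      rw [xMean, (isAdditive_X t).mean_eq_zero hn]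
      push_cast
      ring
    have h2 : Polynomial.aeval theta q (deig 2) t = q.derivative.eval 2 * eig 2 t + q.eval 2 * deig 2 t := by
      have e1 := HasDerivAt.aeval_theta (fun k => hasDerivAt_eig (a := 2) (by norm_num) k) q t
      have e2 := (q.hasDerivAt 2).mul (hasDerivAt_eig (a := 2) (by norm_num) t)
      have e3 : (fun z : ℂ => Polynomial.aeval theta q (eig z) t) = _ := funext fun z => by
        rw [aeval_theta_eig, Pi.smul_apply, smul_eq_mul]
      rw [e3] at e1
      exact e1.unique e2
    rw [h1, map_sub, map_smul, map_smul, Pi.sub_apply, Pi.smul_apply, Pi.smul_apply, h2,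
      aeval_theta_eig, Pi.smul_apply, eig_one]
    simp only [smul_eq_mul]
    ring
  have hres := sub_mul_eval_resolventPoly (t := t) hbre
  rw [← hq] at hres
  have hb2' : indProd t b - 2 ≠ 0 := sub_ne_zero.2 hb2
  have hl1 : 1 - l ≠ 0 := by
    intro h
    rw [sub_eq_zero.1 h |>.symm] at hl
    simp at hl
  have hl2 : 2 - l ≠ 0 := by
    intro h
    rw [sub_eq_zero.1 h |>.symm] at hl
    norm_num at hl
  have hq2 : q.eval 2 = 1 / (1 - l) := by
    have := hres 2
    rw [indProd_two, sub_self, zero_div, sub_zero, hb] at this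
    rw [eq_div_iff hl1]
    linear_combination this
  have hq1 : q.eval 1 = (1 + 1 / (indProd t b - 2)) / (2 - l) := by
    have := hres 1
    rw [indProd_one, hb] at this
    rw [eq_div_iff hl2]
    rw [← hb] at this
    rw [hb] at this
    linear_combination this
  have hqd2 : q.derivative.eval 2 =
      (1 / (1 - l) - 2 * invSum t / (indProd t b - 2)) / (1 - l) := by
    have e1 := ((hasDerivAt_id (2 : ℂ)).const_sub b).mul (q.hasDerivAt 2)
    have e2 := (((hasDerivAt_indProd (a := 2) (by norm_num) t).sub_const 2).div_const
      (indProd t b - 2)).const_sub 1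
    have e3 : (fun s => b - id s) * (fun s => q.eval s) = fun s => 1 - (indProd t s - 2) / (indProd t b - 2) :=
      funext hres
    have e4 := (e3 ▸ e1).unique e2
    rw [hq2, indProd_two, ← ofReal_invSum] at e4
    simp only [id] at e4
    rw [eq_div_iff hl1]
    rw [hb] at e4 ⊢
    linear_combination e4
  rw [hcomp, hqa, hq1, hq2, hqd2, eig_two', eig_one] at hsum
  convert hsum using 1
  have ht : (2 * t + 2 : ℂ) ≠ 0 := by exact_mod_cast (by omega : 2 * t + 2 ≠ 0)
  rw [show 3 - l - 1 = 2 - l by ring]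
  field_simp
  ring

theorem hasSum_eig (hl : l.re < 1) :
    HasSum (tollWeight (2 * t + 1) fun n => (n - 1) * eig l n)
      (eig l (2 * t + 1) / (2 * t + 2) * ((2 * t + 2) / (1 - l) - 3 / (2 - l))) := by
  have hl1 : 1 - l ≠ 0 := by
    intro h
    rw [sub_eq_zero.1 h |>.symm] at hl
    simp at hl
  have hl2 : 2 - l ≠ 0 := by
    intro h
    rw [sub_eq_zero.1 h |>.symm] at hl
    norm_num at hl
  have h1 := hasSum_tollWeight_eigen (N := 2 * t + 1) (f := eig (l + 1)) (ν := l + 1) (e := l.re)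
    (PolyBound.eig (by simp)) hl (fun h => hl1 (by linear_combination -h))
    fun n _ => by rw [succ_mul_eig_succ]; ring
  have h2 := hasSum_tollWeight_eigen (N := 2 * t + 1) (f := eig l) (ν := l) (e := l.re)
    (PolyBound.eig (by linarith)) hl (fun h => hl2 (by linear_combination -h))
    fun n _ => by rw [succ_mul_eig_succ]; ring
  have h3 := (h1.mul_left l).sub (h2.mul_left (l + 1))
  have h4 := add_mul_eig l (2 * t + 1)
  have ht : (2 * t + 2 : ℂ) ≠ 0 := by exact_mod_cast (by omega : 2 * t + 2 ≠ 0)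
  have h5 : eig l (2 * t + 1) / (2 * t + 2) * ((2 * t + 2) / (1 - l) - 3 / (2 - l)) =
      l * (eig (l + 1) (2 * t + 1) / (((2 * t + 1 : ℕ) + 1) * (2 - (l + 1)))) -
        (l + 1) * (eig l (2 * t + 1) / (((2 * t + 1 : ℕ) + 1) * (2 - l))) := by
    rw [← mul_div_assoc, ← h4]
    push_cast
    rw [show (2 * t + 1 + 1 : ℂ) = 2 * t + 2 by ring,
      show 2 - (l + 1) = 1 - l by ring]
    field_simp
    ring
  rw [h5]
  refine h3.congr_fun fun n => ?_
  simp only [tollWeight]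
  split_ifs with hn
  · rw [← mul_div_assoc, ← add_mul_eig]
    ring
  · simp

end Functional

/-- The leading constant of the covariance as a sum over the zeros. -/
theorem tsum_covToll {t : ℕ} (h : ∀ z ∈ (indRoots t).erase 2, z.re < 1) :
    ∑' n, tollWeight t (covToll t) n = ∑ l ∈ (indRoots t).erase 2, res t l / ((l - 1) * (2 * t + 2)) *
      (((2 * t + 2) / (1 - l) - 2 / (2 - l)) / (indProd t (3 - l) - 2) +
        ((2 * t + 2) / (1 - l) - 3 / (2 - l))) := by
  have hs := hasSum_sum fun l (hl : l ∈ (indRoots t).erase 2) =>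
    (((hasSum_avg₂_xMean (t := t) (h l hl)).mul_left 2).add (hasSum_eig (t := t) (h l hl))).mul_left
      (sCoeff t l)
  have he : ∀ n, tollWeight t (covToll t) n = ∑ l ∈ (indRoots t).erase 2, sCoeff t l *
      (2 * tollWeight (2 * t + 1) (avg₂ t (eig l) fun n => (xMean t n : ℂ)) n +
        tollWeight (2 * t + 1) (fun n => (n - 1) * eig l n) n) := by
    intro n
    simp only [tollWeight, covToll]
    by_cases hn : 2 * t + 1 ≤ n
    · simp only [if_pos hn, if_pos (show t ≤ n by omega)]
      have e : avg₂ t (fun n => (sDev t n : ℂ)) (fun n => (xMean t n : ℂ)) n =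
          avg₂ t (fun n => ∑ z ∈ (indRoots t).erase 2, sCoeff t z * eig z n)
            (fun n => (xMean t n : ℂ)) n := avg₂_congr (fun k hk => sDev_eq hk) fun _ _ => rfl
      rw [e, avg₂_sum_left, sDev_eq (by omega), Finset.mul_sum, Finset.mul_sum,
        ← Finset.sum_add_distrib, Finset.sum_div]
      refine Finset.sum_congr rfl fun z _ => ?_
      rw [avg₂_const_mul_left]
      ring
    · simp [show ¬ 2 * t < n by omega]
  rw [tsum_congr he, hs.tsum_eq]
  refine Finset.sum_congr rfl fun l hl => ?_
  have hr := mem_indRoots.1 (Finset.mem_of_mem_erase hl)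
  have h0 := eig_root_ne_zero hr
  have hl1 : l - 1 ≠ 0 := by
    intro h'
    have := h l hl
    rw [sub_eq_zero.1 h'] at this
    simp at this
  have ht : (2 * t + 2 : ℂ) ≠ 0 := by exact_mod_cast (by omega : 2 * t + 2 ≠ 0)
  rw [eig_two_mul_add_one, hr, sCoeff]
  field_simp

/-! ### Sums over the zeros of the indicial polynomial -/

theorem eval_derivative_indPoly_of_re_pos (t : ℕ) {z : ℂ} (hz : 0 < z.re) :
    (Polynomial.derivative (indPoly t)).eval z =
      (∏ j ∈ Finset.Icc t (2 * t), (j + 1 : ℂ)) * (indProd t z * logDerivSum t z) := by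
  have h1 := (indPoly t).hasDerivAt z
  have h2 := ((hasDerivAt_indProd hz t).sub_const 2).const_mul
    (∏ j ∈ Finset.Icc t (2 * t), (j + 1 : ℂ))
  exact h1.unique (h2.congr_of_eventuallyEq (Eventually.of_forall fun s => eval_indPoly t s))

theorem eval_derivative_derivative_indPoly (t : ℕ) {z : ℂ} (hz : 0 < z.re) :
    (Polynomial.derivative (Polynomial.derivative (indPoly t))).eval z =
      (∏ j ∈ Finset.Icc t (2 * t), (j + 1 : ℂ)) *
        (indProd t z * logDerivSum t z * logDerivSum t z + indProd t z * -logDerivSumSq t z) := by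
  have h1 := (Polynomial.derivative (indPoly t)).hasDerivAt z
  have h2 := ((hasDerivAt_indProd hz t).mul (hasDerivAt_logDerivSum hz t)).const_mul
    (∏ j ∈ Finset.Icc t (2 * t), (j + 1 : ℂ))
  refine h1.unique (h2.congr_of_eventuallyEq ?_)
  filter_upwards [eventually_re_pos hz] with s hs
  exact eval_derivative_indPoly_of_re_pos t hs

theorem sum_eval_derivative_basisPoly (t : ℕ) (s : ℂ) :
    ∑ z ∈ indRoots t, (Polynomial.derivative (basisPoly t z)).eval s = 0 := by
  have := congrArg (fun p => (Polynomial.derivative p).eval s) (sum_basisPoly t)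
  simpa [Polynomial.derivative_sum, Polynomial.eval_finsetSum] using this

theorem eval_basisPoly_add {t : ℕ} {z : ℂ} (hz : z ∈ indRoots t) (s : ℂ) :
    (basisPoly t z).eval s + (s - z) * (Polynomial.derivative (basisPoly t z)).eval s =
      res t z / (2 * ∏ j ∈ Finset.Icc t (2 * t), (j + 1 : ℂ)) *
        (Polynomial.derivative (indPoly t)).eval s := by
  have := congrArg (fun p => (Polynomial.derivative p).eval s) (X_sub_C_mul_basisPoly hz)
  simpa [Polynomial.derivative_mul] using this

theorem sub_mul_eval_basisPoly {t : ℕ} {z : ℂ} (hz : z ∈ indRoots t) (s : ℂ) :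
    (s - z) * (basisPoly t z).eval s =
      res t z / (2 * ∏ j ∈ Finset.Icc t (2 * t), (j + 1 : ℂ)) * (indPoly t).eval s := by
  have := congrArg (fun p => p.eval s) (X_sub_C_mul_basisPoly hz)
  simpa using this

theorem one_sub_ne_zero_of_mem {t : ℕ} {z : ℂ} (hz : z ∈ indRoots t) : 1 - z ≠ 0 := by
  intro h
  have := mem_indRoots.1 hz
  rw [← sub_eq_zero.1 h, indProd_one] at this
  norm_num at this

theorem two_sub_ne_zero_of_mem {t : ℕ} {z : ℂ} (hz : z ∈ (indRoots t).erase 2) : 2 - z ≠ 0 :=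
  fun h => Finset.ne_of_mem_erase hz (sub_eq_zero.1 h).symm

theorem sum_res_div_one_sub (t : ℕ) : ∑ z ∈ indRoots t, res t z / (1 - z) = -2 := by
  rw [sum_res_div (by rw [indProd_one]; norm_num), indProd_one]
  norm_num

theorem sum_res_div_one_sub_sq (t : ℕ) :
    ∑ z ∈ indRoots t, res t z / (1 - z) ^ 2 = 2 * logDerivSum t 1 := by
  have hc := prod_Icc_add_one_ne_zero t
  have h := sum_eval_derivative_basisPoly t 1
  have h1 : ∀ z ∈ indRoots t, (Polynomial.derivative (basisPoly t z)).eval 1 =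
      1 / 2 * (logDerivSum t 1 * (res t z / (1 - z)) + res t z / (1 - z) ^ 2) := by
    intro z hz
    have hz1 := one_sub_ne_zero_of_mem hz
    have e1 := eval_basisPoly_add hz 1
    have e2 := sub_mul_eval_basisPoly hz 1
    rw [eval_derivative_indPoly_of_re_pos t (by norm_num), indProd_one] at e1
    rw [eval_indPoly, indProd_one] at e2
    field_simp at e1 e2 ⊢
    linear_combination (1 - z) * e1 - e2
  rw [Finset.sum_congr rfl h1, ← Finset.mul_sum, Finset.sum_add_distrib, ← Finset.mul_sum,
    sum_res_div_one_sub] at h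
  linear_combination 2 * h

theorem sum_res_div_two_sub (t : ℕ) :
    ∑ z ∈ (indRoots t).erase 2, res t z / (2 - z) =
      -1 / 2 + logDerivSumSq t 2 / (2 * logDerivSum t 2 ^ 2) := by
  have hc := prod_Icc_add_one_ne_zero t
  have hm : logDerivSum t 2 ≠ 0 := logDerivSum_ne_zero (indProd_two t)
  have h := sum_eval_derivative_basisPoly t 2
  rw [← Finset.add_sum_erase _ _ (two_mem_indRoots t)] at h
  have h1 : ∀ z ∈ (indRoots t).erase 2, (Polynomial.derivative (basisPoly t z)).eval 2 =
      logDerivSum t 2 * (res t z / (2 - z)) := by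
    intro z hz
    have hz2 := two_sub_ne_zero_of_mem hz
    have e1 := eval_basisPoly_add (Finset.mem_of_mem_erase hz) 2
    have e2 := sub_mul_eval_basisPoly (Finset.mem_of_mem_erase hz) 2
    rw [eval_derivative_indPoly_of_re_pos t (by norm_num), indProd_two] at e1
    rw [eval_indPoly, indProd_two] at e2
    have e3 : Polynomial.eval 2 (basisPoly t z) = 0 := by
      simpa [hz2] using e2
    rw [e3] at e1
    field_simp at e1 ⊢
    linear_combination e1
  have h2 : (Polynomial.derivative (basisPoly t 2)).eval 2 =
      1 / 2 * (logDerivSum t 2 - logDerivSumSq t 2 / logDerivSum t 2) := by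
    have e1 := congrArg (fun p => (Polynomial.derivative (Polynomial.derivative p)).eval 2)
      (X_sub_C_mul_basisPoly (two_mem_indRoots t))
    simp only [Polynomial.derivative_mul, Polynomial.derivative_X_sub_C, Polynomial.derivative_add,
      Polynomial.derivative_C, Polynomial.eval_add, Polynomial.eval_mul, Polynomial.eval_sub,
      Polynomial.eval_X, Polynomial.eval_C, Polynomial.eval_one, Polynomial.eval_zero,
      Polynomial.derivative_one] at e1
    rw [eval_derivative_derivative_indPoly t (by norm_num), indProd_two, res] at e1
    rw [Polynomial.derivative_zero, Polynomial.eval_zero] at e1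
    field_simp at e1 ⊢
    linear_combination e1
  rw [h2, Finset.sum_congr rfl h1, ← Finset.mul_sum] at h
  field_simp at h ⊢
  linear_combination h

theorem sum_inv_one_sub (t : ℕ) :
    ∑ z ∈ (indRoots t).erase 2, 1 / (1 - z) = 1 - logDerivSum t 1 := by
  have hne : (indPoly t).eval 1 ≠ 0 := by
    rw [eval_indPoly, indProd_one]
    exact mul_ne_zero (prod_Icc_add_one_ne_zero t) (by norm_num)
  have h := (IsAlgClosed.splits (indPoly t)).eval_derivative_div_eval_of_ne_zero hne
  rw [eval_derivative_indPoly_of_re_pos t (by norm_num), eval_indPoly, indProd_one,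
    mul_div_mul_left _ _ (prod_Icc_add_one_ne_zero t)] at h
  have h2 : ((indPoly t).roots.map fun z => 1 / (1 - z)).sum = ∑ z ∈ indRoots t, 1 / (1 - z) := by
    rw [Finset.sum, indRoots, Multiset.toFinset_val, (nodup_roots_indPoly t).dedup]
  rw [h2, ← Finset.add_sum_erase _ _ (two_mem_indRoots t)] at h
  linear_combination -h

theorem sum_one_sub_re_div (t : ℕ) :
    ∑ z ∈ (indRoots t).erase 2, (1 - z.re) / ‖1 - z‖ ^ 2 =
      1 - ∑ j ∈ Finset.Icc t (2 * t), 1 / ((j : ℝ) + 1) := by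
  have h := congrArg Complex.re (sum_inv_one_sub t)
  have e : logDerivSum t 1 = ((∑ j ∈ Finset.Icc t (2 * t), 1 / ((j : ℝ) + 1) : ℝ) : ℂ) := by
    rw [logDerivSum]
    push_cast
    exact Finset.sum_congr rfl fun j _ => by rw [add_comm]
  rw [e, ← Complex.ofReal_one, ← Complex.ofReal_sub, Complex.ofReal_re, Complex.re_sum] at h
  rw [← h]
  refine Finset.sum_congr rfl fun z _ => ?_
  rw [Complex.ofReal_one, one_div, Complex.inv_re, Complex.normSq_eq_norm_sq]
  simp

/-! ### Lower bounds for the indicial product -/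

theorem one_add_mul_pow_le_prod {ι : Type*} (s : Finset ι) {b : ι → ℝ} (hb : ∀ i ∈ s, 0 < b i)
    {κ : ℝ} (hκ : 0 < κ) (h : κ ^ s.card ≤ ∏ i ∈ s, b i) {u : ℝ} (hu : 0 ≤ u) :
    (1 + u * κ) ^ s.card ≤ ∏ i ∈ s, (1 + u * b i) := by
  have h0 : 0 < 1 + u * κ := by positivity
  set w := u * κ / (1 + u * κ) with hw
  have hw0 : 0 ≤ w := by positivity
  have hw1 : 1 - w = 1 / (1 + u * κ) := by rw [hw]; field_simp; ring
  have hw1' : 0 ≤ 1 - w := by rw [hw1]; positivity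
  have key : ∀ i ∈ s, (1 + u * κ) * (b i / κ) ^ w ≤ 1 + u * b i := by
    intro i hi
    have := hb i hi
    have e := Real.geom_mean_le_arith_mean2_weighted hw1' hw0 zero_le_one
      (by positivity : 0 ≤ b i / κ) (by ring)
    rw [Real.one_rpow, one_mul] at e
    calc (1 + u * κ) * (b i / κ) ^ w ≤ (1 + u * κ) * ((1 - w) * 1 + w * (b i / κ)) :=
          mul_le_mul_of_nonneg_left e h0.le
      _ = 1 + u * b i := by rw [hw1, hw]; field_simp
  have h1 : 1 ≤ ∏ i ∈ s, (b i / κ) ^ w := by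
    rw [Real.finsetProd_rpow _ _ (fun i hi => (div_pos (hb i hi) hκ).le), Finset.prod_div_distrib,
      Finset.prod_const]
    exact Real.one_le_rpow ((one_le_div (by positivity)).2 h) hw0
  calc (1 + u * κ) ^ s.card ≤ (1 + u * κ) ^ s.card * ∏ i ∈ s, (b i / κ) ^ w :=
        le_mul_of_one_le_right (by positivity) h1
    _ = ∏ i ∈ s, (1 + u * κ) * (b i / κ) ^ w := by rw [Finset.prod_mul_distrib, Finset.prod_const]
    _ ≤ _ := Finset.prod_le_prod (fun i hi => by have := hb i hi; positivity) key

/-- A lower bound for the geometric mean of `(2j+3)/(j+2)²`. -/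
def gapRate (t : ℕ) : ℚ := 1 / (3 * t / 4 + 5 / 4 + 1 / (4 * (2 * t + 3)))

theorem gapRate_pos (t : ℕ) : (0 : ℝ) < gapRate t := by
  have : 0 < gapRate t := by rw [gapRate]; positivity
  exact_mod_cast this

theorem gapRate_pow_le (t : ℕ) :
    (gapRate t : ℝ) ^ (t + 1) ≤ ∏ j ∈ Finset.Icc t (2 * t), (2 * j + 3 : ℝ) / (j + 2) ^ 2 := by
  have hκ := gapRate_pos t
  have hP : 0 < ∏ j ∈ Finset.Icc t (2 * t), (2 * j + 3 : ℝ) / (j + 2) ^ 2 :=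
    Finset.prod_pos fun j _ => by positivity
  refine le_of_sq_le_sq ?_ hP.le
  rw [sq (∏ j ∈ _, _)]
  nth_rewrite 1 [← prod_Icc_reflect t fun j => (2 * (j : ℝ) + 3) / (j + 2) ^ 2]
  rw [← Finset.prod_mul_distrib, ← pow_mul, mul_comm, pow_mul]
  have hcard : (Finset.Icc t (2 * t)).card = t + 1 := by rw [Nat.card_Icc]; omega
  rw [← hcard, ← Finset.prod_const]
  refine Finset.prod_le_prod (fun _ _ => by positivity) fun j hj => ?_
  have hj' := Finset.mem_Icc.1 hj
  have h1 : (t : ℝ) ≤ j := by exact_mod_cast hj'.1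
  have h2 : (t : ℝ) ≤ (3 * t - j : ℕ) := by exact_mod_cast (by omega : t ≤ 3 * t - j)
  have h3 : ((3 * t - j : ℕ) : ℝ) = 3 * t - j := by
    rw [Nat.cast_sub (by omega)]
    push_cast
    ring
  have ht : (0 : ℝ) ≤ t := t.cast_nonneg
  set x : ℝ := (j + 2) ^ 2 / (2 * j + 3) with hx
  set y : ℝ := ((3 * t - j : ℕ) + 2) ^ 2 / (2 * (3 * t - j : ℕ) + 3) with hy
  have hj0 : (0 : ℝ) < 2 * j + 3 := by positivity
  have hj0' : (0 : ℝ) < 2 * (3 * t - j : ℕ) + 3 := by positivity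
  have hx0 : 0 < x := by positivity
  have hy0 : 0 < y := by positivity
  have ex : x = (2 * j + 3) / 4 + 1 / 2 + 1 / (4 * (2 * j + 3)) := by
    rw [hx]; field_simp; ring
  have ey : y = (2 * (3 * t - j : ℕ) + 3) / 4 + 1 / 2 + 1 / (4 * (2 * (3 * t - j : ℕ) + 3)) := by
    rw [hy]; field_simp; ring
  have i1 : 1 / (4 * (2 * (j : ℝ) + 3)) ≤ 1 / (4 * (2 * t + 3)) :=
    one_div_le_one_div_of_le (by positivity) (by linarith)
  have i2 : 1 / (4 * (2 * ((3 * t - j : ℕ) : ℝ) + 3)) ≤ 1 / (4 * (2 * t + 3)) :=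
    one_div_le_one_div_of_le (by positivity) (by linarith)
  have eκ : 1 / (gapRate t : ℝ) = 3 * t / 4 + 5 / 4 + 1 / (4 * (2 * t + 3)) := by
    rw [gapRate]; push_cast; rw [one_div_one_div]
  have hsum : x + y ≤ 2 * (1 / (gapRate t : ℝ)) := by
    rw [ex, ey, eκ]
    linarith
  have hxy : x * y ≤ (1 / (gapRate t : ℝ)) ^ 2 := by
    nlinarith [sq_nonneg (x - y), mul_pos hx0 hy0]
  have e1 : (2 * (j : ℝ) + 3) / (j + 2) ^ 2 = 1 / x := by rw [hx, one_div_div]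
  have e2 : (2 * ((3 * t - j : ℕ) : ℝ) + 3) / ((3 * t - j : ℕ) + 2) ^ 2 = 1 / y := by
    rw [hy, one_div_div]
  rw [e1, e2, one_div_mul_one_div_rev, le_div_iff₀ (by positivity)]
  rw [div_pow, one_pow, le_div_iff₀ (by positivity)] at hxy
  linarith

theorem norm_three_sub_add_sq (z : ℂ) (j : ℕ) :
    ‖3 - z + j‖ ^ 2 = ‖z + j‖ ^ 2 + (3 - 2 * z.re) * (2 * j + 3) := by
  rw [← Complex.normSq_eq_norm_sq, ← Complex.normSq_eq_norm_sq, Complex.normSq_apply,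
    Complex.normSq_apply]
  simp
  ring

theorem le_norm_indProd_three_sub {t : ℕ} {z : ℂ} (hz : indProd t z = 2) {c : ℝ} (hzc : z.re ≤ c)
    (hc : c ≤ 1) : (1 + (3 - 2 * c) * gapRate t) ^ (t + 1) ≤ (‖indProd t (3 - z)‖ / 2) ^ 2 := by
  have hκ := gapRate_pos t
  have hcard : (Finset.Icc t (2 * t)).card = t + 1 := by rw [Nat.card_Icc]; omega
  have hpos : ∀ j ∈ Finset.Icc t (2 * t), 0 < ‖z + j‖ := fun j hj =>
    norm_pos_iff.2 (root_add_ne_zero hz hj)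
  have hn : ∏ j ∈ Finset.Icc t (2 * t), ‖z + j‖ ^ 2 / ((j : ℝ) + 2) ^ 2 = 1 := by
    have h1 := congrArg norm (prod_add_eq_of_root hz)
    simp only [norm_prod, norm_two_add] at h1
    rw [Finset.prod_div_distrib, Finset.prod_pow, Finset.prod_pow, h1]
    simp only [add_comm (2 : ℝ)]
    exact div_self (pow_ne_zero 2 (Finset.prod_ne_zero_iff.2 fun j _ => by positivity))
  have key : (‖indProd t (3 - z)‖ / 2) ^ 2 =
      ∏ j ∈ Finset.Icc t (2 * t), (1 + (3 - 2 * z.re) * ((2 * j + 3) / ‖z + j‖ ^ 2)) := by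
    have h1 : indProd t (3 - z) / 2 =
        ∏ j ∈ Finset.Icc t (2 * t), (3 - z + j) / (2 + j : ℂ) := by
      rw [indProd_eq_div, Finset.prod_div_distrib, prod_add_two, div_div,
        mul_comm (∏ j ∈ Finset.Icc t (2 * t), (j + 1 : ℂ))]
    have h2 : ‖indProd t (3 - z)‖ / 2 = ‖indProd t (3 - z) / 2‖ := by
      rw [norm_div, Complex.norm_ofNat]
    have h3 : ∏ j ∈ Finset.Icc t (2 * t), ‖(3 - z + j) / (2 + j : ℂ)‖ ^ 2 =
        (∏ j ∈ Finset.Icc t (2 * t), ‖(3 - z + j) / (2 + j : ℂ)‖ ^ 2) /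
          ∏ j ∈ Finset.Icc t (2 * t), ‖z + j‖ ^ 2 / ((j : ℝ) + 2) ^ 2 := by
      rw [hn, div_one]
    rw [h2, h1, norm_prod, ← Finset.prod_pow, h3, ← Finset.prod_div_distrib]
    refine Finset.prod_congr rfl fun j hj => ?_
    have := hpos j hj
    rw [norm_div, norm_two_add, div_pow, norm_three_sub_add_sq]
    field_simp
    ring
  rw [key, ← hcard]
  calc (1 + (3 - 2 * c) * gapRate t : ℝ) ^ (Finset.Icc t (2 * t)).card
      ≤ (1 + (3 - 2 * z.re) * gapRate t) ^ (Finset.Icc t (2 * t)).card := by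
        refine pow_le_pow_left₀ ?_ ?_ _
        · have : 0 ≤ (3 - 2 * c) * gapRate t := mul_nonneg (by linarith) hκ.le
          linarith
        · have := mul_le_mul_of_nonneg_right (by linarith : 3 - 2 * c ≤ 3 - 2 * z.re) hκ.le
          linarith
    _ ≤ _ := by
        refine one_add_mul_pow_le_prod _ (fun j hj => ?_) hκ ?_ (by linarith)
        · have := hpos j hj
          positivity
        · rw [hcard]
          refine (gapRate_pow_le t).trans (le_of_eq ?_)
          rw [← div_one (∏ j ∈ _, _), ← hn, ← Finset.prod_div_distrib]
          refine Finset.prod_congr rfl fun j hj => ?_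
          have := hpos j hj
          field_simp

/-- A rational lower bound for `‖indProd t (3 - z)‖ / 2` at a zero with real part at most `c`. -/
def halfProdBound (t : ℕ) (c : ℚ) : ℚ :=
  (1 + (3 - 2 * c) * gapRate t) ^ ((t + 1) / 2) *
    if t % 2 = 0 then 2 * (1 + (3 - 2 * c) * gapRate t) / (1 + (1 + (3 - 2 * c) * gapRate t)) else 1

theorem halfProdBound_le {t : ℕ} {z : ℂ} (hz : indProd t z = 2) {c : ℚ} (hzc : z.re ≤ c)
    (hc : c ≤ 1) : halfProdBound t c ≤ ‖indProd t (3 - z)‖ / 2 := by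
  have h := le_norm_indProd_three_sub hz hzc (by exact_mod_cast hc)
  refine le_of_sq_le_sq (le_trans ?_ h) (by positivity)
  have hκ := gapRate_pos t
  rw [halfProdBound]
  push_cast
  have hc' : (c : ℝ) ≤ 1 := by exact_mod_cast hc
  set y : ℝ := 1 + (3 - 2 * c) * gapRate t with hy
  have hy0 : 0 < y := by
    have : 0 ≤ (3 - 2 * (c : ℝ)) * gapRate t := mul_nonneg (by linarith) hκ.le
    linarith
  rw [mul_pow, ← pow_mul]
  split_ifs with h2
  · have h3 : (2 * y / (1 + y)) ^ 2 ≤ y := by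
      rw [div_pow, div_le_iff₀ (by positivity)]
      nlinarith [mul_nonneg hy0.le (sq_nonneg (1 - y))]
    have h4 : ((2 * (1 + (3 - 2 * c) * gapRate t) / (1 + (1 + (3 - 2 * c) * gapRate t)) : ℚ) : ℝ) =
        2 * y / (1 + y) := by
      rw [hy]
      push_cast
      rfl
    rw [h4]
    calc y ^ ((t + 1) / 2 * 2) * (2 * y / (1 + y)) ^ 2 ≤ y ^ ((t + 1) / 2 * 2) * y :=
          mul_le_mul_of_nonneg_left h3 (by positivity)
      _ = y ^ (t + 1) := by
          rw [← pow_succ]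
          congr 1
          omega
  · have e : (t + 1) / 2 * 2 = t + 1 := by omega
    rw [e]
    simp

/-! ### The covariance constant does not vanish -/

def resBound (t : ℕ) : ℚ :=
  ((2 + 3 * t / 2) ^ 2 + t ^ 2 / 4) / ((t + 1) * (2 + 3 * t / 2))

theorem norm_res_le {t : ℕ} {z : ℂ} (hz : indProd t z = 2) : ‖res t z‖ ≤ resBound t := by
  have h := le_norm_logDerivSum hz
  rw [res, norm_div, norm_one, resBound, one_div_le (norm_pos_iff.2 (logDerivSum_ne_zero hz))
    (by push_cast; positivity)]
  push_cast
  rw [one_div_div]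
  exact h

theorem resBound_pos (t : ℕ) : (0 : ℝ) < resBound t := by
  rw [resBound]
  push_cast
  positivity

/-- The contribution of a zero to `tsum_covToll` that involves the size of the subtrees. -/
def crossTerm (t : ℕ) (l : ℂ) : ℂ :=
  res t l / ((l - 1) * (2 * t + 2)) * (((2 * t + 2) / (1 - l) - 2 / (2 - l)) / (indProd t (3 - l) - 2))

theorem norm_crossTerm_le {t : ℕ} {l : ℂ} (hl : l ∈ (indRoots t).erase 2) {c : ℚ}
    (hlc : l.re ≤ c) (hc : c ≤ 1) (hq : 1 < halfProdBound t c) :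
    ‖crossTerm t l‖ ≤ resBound t / 2 / (halfProdBound t c - 1) / ‖1 - l‖ ^ 2 := by
  have hz := mem_indRoots.1 (Finset.mem_of_mem_erase hl)
  have h1 := one_sub_ne_zero_of_mem (Finset.mem_of_mem_erase hl)
  have h2 := two_sub_ne_zero_of_mem hl
  have hq' : (1 : ℝ) < halfProdBound t c := by exact_mod_cast hq
  have hc' : (c : ℝ) ≤ 1 := by exact_mod_cast hc
  have hR := resBound_pos t
  have n1 : 0 < ‖1 - l‖ := norm_pos_iff.2 h1
  have ht : ‖(2 * t + 2 : ℂ)‖ = 2 * t + 2 := by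
    have : (2 * t + 2 : ℂ) = ((2 * t + 2 : ℕ) : ℂ) := by push_cast; ring
    rw [this, Complex.norm_natCast]
    push_cast
    ring
  have hA : ‖((2 * t + 2) / (1 - l) - 2 / (2 - l) : ℂ)‖ ≤ (2 * t + 2) / ‖1 - l‖ := by
    have e : ((2 * t + 2) / (1 - l) - 2 / (2 - l) : ℂ) = (2 * t + 2 / (2 - l)) / (1 - l) := by
      field_simp
      ring
    rw [e, norm_div]
    refine div_le_div_of_nonneg_right ((norm_add_le _ _).trans ?_) n1.le
    have e1 : ‖(2 * t : ℂ)‖ = 2 * t := by simp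
    have e2 : ‖(2 / (2 - l) : ℂ)‖ ≤ 2 := by
      rw [norm_div, Complex.norm_ofNat, div_le_iff₀ (norm_pos_iff.2 h2)]
      have := Complex.re_le_norm (2 - l)
      simp only [Complex.sub_re, Complex.re_ofNat] at this
      linarith
    rw [e1]
    linarith
  have hB : 2 * (halfProdBound t c - 1 : ℝ) ≤ ‖indProd t (3 - l) - 2‖ := by
    have e1 := halfProdBound_le hz hlc hc
    have e2 := norm_sub_norm_le (indProd t (3 - l)) 2
    rw [Complex.norm_ofNat] at e2
    linarith
  have hB0 : 0 < 2 * (halfProdBound t c - 1 : ℝ) := by linarith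
  rw [crossTerm, norm_mul, norm_div, norm_div, norm_mul, ht, norm_sub_rev l 1]
  calc ‖res t l‖ / (‖1 - l‖ * (2 * t + 2)) *
        (‖((2 * t + 2) / (1 - l) - 2 / (2 - l) : ℂ)‖ / ‖indProd t (3 - l) - 2‖)
      ≤ resBound t / (‖1 - l‖ * (2 * t + 2)) *
        ((2 * t + 2) / ‖1 - l‖ / (2 * (halfProdBound t c - 1))) := by
        gcongr
        exact norm_res_le hz
    _ = _ := by
        have : (halfProdBound t c - 1 : ℝ) ≠ 0 := by linarith
        field_simp

def sumInvSucc (t : ℕ) : ℚ := ∑ j ∈ Finset.Icc t (2 * t), 1 / ((j : ℚ) + 1)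
def sumInvAddTwo (t : ℕ) : ℚ := ∑ j ∈ Finset.Icc t (2 * t), 1 / ((j : ℚ) + 2)
def sumInvAddTwoSq (t : ℕ) : ℚ := ∑ j ∈ Finset.Icc t (2 * t), 1 / ((j : ℚ) + 2) ^ 2
def sumInvPred (t : ℕ) : ℚ := ∑ j ∈ Finset.Icc t (2 * t), 1 / ((j : ℚ) - 1)

/-- The part of `tsum_covToll` that does not involve the size of the subtrees. -/
def mainTerm (t : ℕ) : ℚ :=
  1 / sumInvAddTwo t - 2 * sumInvSucc t -
    3 / (2 * t + 2) * (3 / 2 - 1 / sumInvAddTwo t + sumInvAddTwoSq t / (2 * sumInvAddTwo t ^ 2))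

theorem sum_mainTerm (t : ℕ) :
    ∑ l ∈ (indRoots t).erase 2, res t l / ((l - 1) * (2 * t + 2)) *
      ((2 * t + 2) / (1 - l) - 3 / (2 - l)) = ((mainTerm t : ℝ) : ℂ) := by
  have e1 : logDerivSum t 2 = ((sumInvAddTwo t : ℝ) : ℂ) := by
    rw [logDerivSum, sumInvAddTwo]
    push_cast
    exact Finset.sum_congr rfl fun j _ => by rw [add_comm]
  have e2 : logDerivSum t 1 = ((sumInvSucc t : ℝ) : ℂ) := by
    rw [logDerivSum, sumInvSucc]
    push_cast
    exact Finset.sum_congr rfl fun j _ => by rw [add_comm]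
  have e3 : logDerivSumSq t 2 = ((sumInvAddTwoSq t : ℝ) : ℂ) := by
    rw [logDerivSumSq, sumInvAddTwoSq]
    push_cast
    exact Finset.sum_congr rfl fun j _ => by rw [add_comm]
  have h1 := sum_res_div_one_sub t
  have h2 := sum_res_div_one_sub_sq t
  have h3 := sum_res_div_two_sub t
  rw [← Finset.add_sum_erase _ _ (two_mem_indRoots t)] at h1 h2
  have hm : logDerivSum t 2 ≠ 0 := logDerivSum_ne_zero (indProd_two t)
  have ht : (2 * t + 2 : ℂ) ≠ 0 := by exact_mod_cast (by omega : 2 * t + 2 ≠ 0)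
  have h4 : ∀ l ∈ (indRoots t).erase 2, res t l / ((l - 1) * (2 * t + 2)) *
      ((2 * t + 2) / (1 - l) - 3 / (2 - l)) = -(res t l / (1 - l) ^ 2) -
        3 / (2 * t + 2) * (res t l / (2 - l) - res t l / (1 - l)) := by
    intro l hl
    have g1 := one_sub_ne_zero_of_mem (Finset.mem_of_mem_erase hl)
    have g2 := two_sub_ne_zero_of_mem hl
    rw [show l - 1 = -(1 - l) by ring]
    field_simp
    ring
  rw [Finset.sum_congr rfl h4, Finset.sum_sub_distrib, Finset.sum_neg_distrib, ← Finset.mul_sum,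
    Finset.sum_sub_distrib, eq_sub_of_add_eq' h1, eq_sub_of_add_eq' h2, h3, mainTerm]
  simp only [res, e1, e2, e3] at hm ⊢
  push_cast
  rw [show (1 : ℂ) - 2 = -1 by norm_num]
  field_simp
  ring

theorem tsum_covToll_eq {t : ℕ} (h : ∀ z ∈ (indRoots t).erase 2, z.re < 1) :
    ∑' n, tollWeight t (covToll t) n =
      ∑ l ∈ (indRoots t).erase 2, crossTerm t l + ((mainTerm t : ℝ) : ℂ) := by
  rw [tsum_covToll h, ← sum_mainTerm, ← Finset.sum_add_distrib]
  exact Finset.sum_congr rfl fun l _ => by rw [crossTerm]; ring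

theorem tsum_covToll_ne_zero_of_lt {t : ℕ} (h : ∀ z ∈ (indRoots t).erase 2, z.re < 1)
    (h1 : ∑ l ∈ (indRoots t).erase 2, ‖crossTerm t l‖ < mainTerm t) :
    ∑' n, tollWeight t (covToll t) n ≠ 0 := by
  rw [tsum_covToll_eq h]
  intro h0
  have h2 := norm_sum_le ((indRoots t).erase 2) (crossTerm t)
  rw [eq_neg_of_add_eq_zero_left h0, norm_neg, Complex.norm_real, Real.norm_eq_abs] at h2
  linarith [le_abs_self (mainTerm t : ℝ)]

theorem sum_norm_crossTerm_le {t : ℕ} (h : ∀ z ∈ (indRoots t).erase 2, z.re < 1) {c : ℚ}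
    (hc : c < 1) (hq : 1 < halfProdBound t c) {s : Finset ℂ} (hs : s ⊆ (indRoots t).erase 2)
    (hsc : ∀ z ∈ s, z.re ≤ c) : ∑ l ∈ s, ‖crossTerm t l‖ ≤
      ((resBound t / 2 / (halfProdBound t c - 1) * ((1 - sumInvSucc t) / (1 - c)) : ℚ) : ℝ) := by
  have hc' : (0 : ℝ) < 1 - c := by
    have : (c : ℝ) < 1 := by exact_mod_cast hc
    linarith
  have hq' : (0 : ℝ) < halfProdBound t c - 1 := by
    have : (1 : ℝ) < halfProdBound t c := by exact_mod_cast hq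
    linarith
  have hR := resBound_pos t
  have h1 := sum_one_sub_re_div t
  have h2 : ∑ l ∈ s, (1 - l.re) / ‖1 - l‖ ^ 2 ≤ 1 - ∑ j ∈ Finset.Icc t (2 * t), 1 / ((j : ℝ) + 1) := by
    rw [← h1]
    refine Finset.sum_le_sum_of_subset_of_nonneg hs fun z hz _ => ?_
    have := h z hz
    exact div_nonneg (by linarith) (by positivity)
  have h3 : ∑ l ∈ s, 1 / ‖1 - l‖ ^ 2 ≤ (1 - ∑ j ∈ Finset.Icc t (2 * t), 1 / ((j : ℝ) + 1)) / (1 - c) := by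
    rw [le_div_iff₀ hc', Finset.sum_mul]
    refine (Finset.sum_le_sum fun l hl => ?_).trans h2
    rw [div_mul_eq_mul_div, one_mul]
    exact div_le_div_of_nonneg_right (by linarith [hsc l hl]) (by positivity)
  have hm : ((sumInvSucc t : ℚ) : ℝ) = ∑ j ∈ Finset.Icc t (2 * t), 1 / ((j : ℝ) + 1) := by
    rw [sumInvSucc]
    push_cast
    rfl
  push_cast
  rw [hm]
  refine le_trans (Finset.sum_le_sum fun l hl => (norm_crossTerm_le (hs hl) (hsc l hl) hc.le hq).trans
    (le_of_eq (div_eq_mul_one_div _ _))) ?_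
  rw [← Finset.mul_sum]
  exact mul_le_mul_of_nonneg_left h3 (by positivity)

/-! ### Localization of the zeros for small `t` -/

theorem re_le_neg_of_le_three {t : ℕ} (ht : t ≤ 3) : ∀ z ∈ (indRoots t).erase 2, z.re ≤ -t := by
  intro z hz
  by_contra! h
  have h1 := two_pi_le_of_root (mem_indRoots.1 (Finset.mem_of_mem_erase hz))
    (Finset.ne_of_mem_erase hz) h
  rw [argSum_eq_arctanSum h, abs_arctanSum h] at h1
  have h2 : arctanSum t z.re |z.im| < ∑ j ∈ Finset.Icc t (2 * t), Real.pi / 2 :=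
    Finset.sum_lt_sum_of_nonempty (Icc_nonempty t) fun j _ => Real.arctan_lt_pi_div_two _
  rw [Finset.sum_const, Nat.card_Icc, nsmul_eq_mul] at h2
  have h3 : ((2 * t + 1 - t : ℕ) : ℝ) ≤ 4 := by exact_mod_cast (by omega : 2 * t + 1 - t ≤ 4)
  nlinarith [Real.pi_pos]

theorem re_le_of_one : ∀ z ∈ (indRoots 1).erase 2, z.re ≤ -5 := by
  intro z hz
  have h := mem_indRoots.1 (Finset.mem_of_mem_erase hz)
  have h2 : z - 2 ≠ 0 := sub_ne_zero.2 (Finset.ne_of_mem_erase hz)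
  have h3 : (z - 2) * (z + 5) = 0 := by
    rw [indProd, show Finset.Icc 1 (2 * 1) = {1, 2} by decide, Finset.prod_pair (by norm_num)] at h
    push_cast at h
    field_simp at h
    linear_combination h
  have h4 : z = -5 := eq_neg_of_add_eq_zero_left ((mul_eq_zero.1 h3).resolve_left h2)
  rw [h4]
  simp

theorem im_sq_le_of_root {t : ℕ} {z : ℂ} (hz : indProd t z = 2) {x : ℝ} (hx : x ≤ z.re)
    (hx' : 0 ≤ x + 3 * t / 2) : z.im ^ 2 ≤ (2 + 3 * t / 2) ^ 2 - (x + 3 * t / 2) ^ 2 := by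
  have h := norm_root_le hz
  have h1 : ‖z + 3 * t / 2‖ ^ 2 ≤ (2 + 3 * t / 2 : ℝ) ^ 2 := pow_le_pow_left₀ (norm_nonneg _) h 2
  rw [← Complex.normSq_eq_norm_sq, Complex.normSq_apply] at h1
  have e1 : (z + 3 * t / 2).re = z.re + 3 * t / 2 := by
    have : (3 * t / 2 : ℂ) = ((3 * t / 2 : ℝ) : ℂ) := by push_cast; rfl
    rw [this, Complex.add_re, Complex.ofReal_re]
  have e2 : (z + 3 * t / 2).im = z.im := by
    have : (3 * t / 2 : ℂ) = ((3 * t / 2 : ℝ) : ℂ) := by push_cast; rfl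
    rw [this, Complex.add_im, Complex.ofReal_im, add_zero]
  rw [e1, e2] at h1
  nlinarith [mul_nonneg (sub_nonneg.2 hx) (by linarith : 0 ≤ z.re + x + 3 * t)]

/-- A rational upper bound for the square root of `(15 t + 15/2) / 2`. -/
def sqrtBound (t : ℕ) : ℚ :=
  ((t + 8) / 2 + (15 * t / 2 + 15 / 4) / ((t + 8) / 2)) / 2

def smallCheck (t : ℕ) (p : ℚ) : Prop :=
  (t + 1) * (p / 4 - 1 / 2) + sqrtBound t / 2 * ∑ j ∈ Finset.Icc t (2 * t), 1 / (-1 / 2 + (j : ℚ)) < 2 * p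

instance (t : ℕ) (p : ℚ) : Decidable (smallCheck t p) := by unfold smallCheck; infer_instance

theorem smallCheck_of_mem :
    ∀ t ∈ Finset.Icc 4 9, smallCheck t (3141 / 1000) ∧ smallCheck t (31416 / 10000) := by
  decide +kernel

theorem re_lt_neg_half {t : ℕ} (h4 : 4 ≤ t) (h9 : t ≤ 9) :
    ∀ z ∈ (indRoots t).erase 2, z.re < -1 / 2 := by
  intro z hz
  by_contra! h
  have ht4 : (4 : ℝ) ≤ t := by exact_mod_cast h4
  have hroot := mem_indRoots.1 (Finset.mem_of_mem_erase hz)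
  have hz' : -(t : ℝ) < z.re := by linarith
  have h1 := two_pi_le_of_root hroot (Finset.ne_of_mem_erase hz) hz'
  rw [argSum_eq_arctanSum hz', abs_arctanSum hz'] at h1
  have hy := im_sq_le_of_root hroot h (by linarith)
  set Y : ℝ := (sqrtBound t : ℝ) with hY
  have hY' : Y = (((t : ℝ) + 8) / 2 + (15 * t / 2 + 15 / 4) / ((t + 8) / 2)) / 2 := by
    rw [hY, sqrtBound]
    push_cast
    rfl
  have hy1 : |z.im| ≤ Y := by
    refine abs_le_of_sq_le_sq (hy.trans ?_) (by rw [hY']; positivity)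
    have : (2 + 3 * (t : ℝ) / 2) ^ 2 - (-1 / 2 + 3 * t / 2) ^ 2 =
        ((t + 8) / 2) * ((15 * t / 2 + 15 / 4) / ((t + 8) / 2)) := by
      field_simp
      ring
    rw [this, hY']
    nlinarith [sq_nonneg (((t : ℝ) + 8) / 2 - (15 * t / 2 + 15 / 4) / ((t + 8) / 2))]
  have h2 := arctanSum_le (t := t) (by linarith) h (abs_nonneg z.im) hy1
  have h3 : arctanSum t (-1 / 2) Y ≤ (t + 1) * (Real.pi / 4 - 1 / 2) +
      Y / 2 * ∑ j ∈ Finset.Icc t (2 * t), 1 / (-1 / 2 + (j : ℝ)) := by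
    have hcard : (Finset.Icc t (2 * t)).card = t + 1 := by rw [Nat.card_Icc]; omega
    have e : (t + 1) * (Real.pi / 4 - 1 / 2) +
        Y / 2 * ∑ j ∈ Finset.Icc t (2 * t), 1 / (-1 / 2 + (j : ℝ)) =
        ∑ j ∈ Finset.Icc t (2 * t), (Real.pi / 4 + (Y / (-1 / 2 + j) - 1) / 2) := by
      rw [Finset.mul_sum, show ((t : ℝ) + 1) = ((Finset.Icc t (2 * t)).card : ℝ) by
        rw [hcard]; push_cast; rfl, ← nsmul_eq_mul, ← Finset.sum_const, ← Finset.sum_add_distrib]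
      exact Finset.sum_congr rfl fun j _ => by ring
    rw [e]
    refine Finset.sum_le_sum fun j hj => arctan_le_tangent ?_
    have := add_pos_of_mem (x := -1 / 2) (by linarith : -(t : ℝ) < -1 / 2) hj
    exact div_nonneg ((abs_nonneg _).trans hy1) this.le
  obtain ⟨c1, c2⟩ := smallCheck_of_mem t (Finset.mem_Icc.2 ⟨h4, h9⟩)
  have d1 : (((t + 1) * ((3141 / 1000) / 4 - 1 / 2) + sqrtBound t / 2 *
    ∑ j ∈ Finset.Icc t (2 * t), 1 / (-1 / 2 + (j : ℚ)) : ℚ) : ℝ) < ((2 * (3141 / 1000) : ℚ) : ℝ) :=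
    Rat.cast_lt.2 c1
  have d2 : (((t + 1) * ((31416 / 10000) / 4 - 1 / 2) + sqrtBound t / 2 *
    ∑ j ∈ Finset.Icc t (2 * t), 1 / (-1 / 2 + (j : ℚ)) : ℚ) : ℝ) < ((2 * (31416 / 10000) : ℚ) : ℝ) :=
    Rat.cast_lt.2 c2
  push_cast at d1 d2
  rw [← hY] at d1 d2
  have p1 := Real.pi_gt_d4
  have p2 := Real.pi_lt_d4
  rcases le_total (t : ℝ) 7 with h7 | h7
  · nlinarith [mul_nonneg (sub_nonneg.2 h7) (by linarith : 0 ≤ Real.pi - 3.141)]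
  · nlinarith [mul_nonneg (sub_nonneg.2 h7) (by linarith : 0 ≤ 3.1416 - Real.pi)]

theorem re_le_zero_of_le_nine {t : ℕ} (h9 : t ≤ 9) :
    ∀ z ∈ (indRoots t).erase 2, z.re ≤ 0 := by
  intro z hz
  rcases le_or_gt t 3 with h3 | h3
  · have := re_le_neg_of_le_three h3 z hz
    have := t.cast_nonneg (α := ℝ)
    linarith
  · have := re_lt_neg_half h3 h9 z hz
    linarith

theorem re_lt_one_of_le {t : ℕ} (h28 : t ≤ 28) :
    ∀ z ∈ (indRoots t).erase 2, z.re < 1 := by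
  intro z hz
  rcases le_or_gt t 9 with h | h
  · linarith [re_le_zero_of_le_nine h z hz]
  · exact re_lt_one h h28 z hz

theorem re_lt_three_half_of_le {t : ℕ} (h58 : t ≤ 58) :
    ∀ z ∈ (indRoots t).erase 2, z.re < 3 / 2 := by
  intro z hz
  rcases le_or_gt t 9 with h | h
  · linarith [re_le_zero_of_le_nine h z hz]
  · exact re_lt_three_half h h58 z hz

/-! ### The covariance constant for `t ≤ 28` -/

def oneBoundCheck (t : ℕ) (c : ℚ) : Prop :=
  c < 1 ∧ 1 < halfProdBound t c ∧
    resBound t / 2 / (halfProdBound t c - 1) * ((1 - sumInvSucc t) / (1 - c)) < mainTerm t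

instance (t : ℕ) (c : ℚ) : Decidable (oneBoundCheck t c) := by unfold oneBoundCheck; infer_instance

theorem oneBoundCheck_one : oneBoundCheck 1 (-5) := by decide +kernel

theorem oneBoundCheck_of_mem_two : ∀ t ∈ Finset.Icc 2 3, oneBoundCheck t (-t) := by decide +kernel

theorem oneBoundCheck_of_mem_four : ∀ t ∈ Finset.Icc 4 9, oneBoundCheck t (-1 / 2) := by
  decide +kernel

theorem tsum_ne_zero_of_oneBoundCheck {t : ℕ} {c : ℚ} (hc : oneBoundCheck t c)
    (h : ∀ z ∈ (indRoots t).erase 2, z.re ≤ c) : ∑' n, tollWeight t (covToll t) n ≠ 0 := by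
  obtain ⟨h1, h2, h3⟩ := hc
  have h1' : (c : ℝ) < 1 := by exact_mod_cast h1
  have h' : ∀ z ∈ (indRoots t).erase 2, z.re < 1 := fun z hz => (h z hz).trans_lt h1'
  refine tsum_covToll_ne_zero_of_lt h' ?_
  exact (sum_norm_crossTerm_le h' h1 h2 subset_rfl h).trans_lt (Rat.cast_lt.2 h3)

theorem tsum_ne_zero_of_le_nine {t : ℕ} (h1 : 1 ≤ t) (h9 : t ≤ 9) :
    ∑' n, tollWeight t (covToll t) n ≠ 0 := by
  rcases le_or_gt t 3 with h3 | h3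
  · rcases h1.eq_or_lt with rfl | h1
    · refine tsum_ne_zero_of_oneBoundCheck oneBoundCheck_one fun z hz => ?_
      push_cast
      exact re_le_of_one z hz
    · refine tsum_ne_zero_of_oneBoundCheck (oneBoundCheck_of_mem_two t (Finset.mem_Icc.2 ⟨h1, h3⟩))
        fun z hz => ?_
      push_cast
      exact re_le_neg_of_le_three h3 z hz
  · refine tsum_ne_zero_of_oneBoundCheck (oneBoundCheck_of_mem_four t (Finset.mem_Icc.2 ⟨h3, h9⟩))
      fun z hz => ?_
    push_cast
    exact (re_lt_neg_half h3 h9 z hz).le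

def twoBoundCheck (t : ℕ) : Prop :=
  1 < halfProdBound t (-1) ∧ 1 < halfProdBound t 1 ∧
    (9 * t + 3) * sumInvPred t ^ 2 < 16 * (31415 / 10000) ^ 2 ∧
    resBound t / 2 / (halfProdBound t (-1) - 1) * ((1 - sumInvSucc t) / (1 - -1)) +
      2 * (resBound t / 2 / (halfProdBound t 1 - 1) *
        (sumInvPred t ^ 2 / (4 * (31415 / 10000) ^ 2))) < mainTerm t

instance (t : ℕ) : Decidable (twoBoundCheck t) := by unfold twoBoundCheck; infer_instance

theorem twoBoundCheck_of_mem : ∀ t ∈ Finset.Icc 10 28, twoBoundCheck t := by decide +kernel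

theorem argSum_le_mul_sumInvPred {t : ℕ} (ht : 2 ≤ t) {z : ℂ} (hz : -1 ≤ z.re) :
    |argSum t z| ≤ |z.im| * sumInvPred t := by
  have ht' : (2 : ℝ) ≤ t := by exact_mod_cast ht
  have hz' : -(t : ℝ) < z.re := by linarith
  rw [argSum_eq_arctanSum hz', abs_arctanSum hz']
  refine (arctanSum_le (by linarith : -(t : ℝ) < -1) hz (abs_nonneg _) le_rfl).trans ?_
  rw [sumInvPred]
  push_cast
  rw [Finset.mul_sum]
  refine Finset.sum_le_sum fun j hj => ?_
  have := add_pos_of_mem (x := -1) (by linarith : -(t : ℝ) < -1) hj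
  refine (arctan_le_self (div_nonneg (abs_nonneg _) this.le)).trans (le_of_eq ?_)
  rw [mul_one_div]
  congr 1
  ring

theorem tsum_ne_zero_of_ten_le {t : ℕ} (h10 : 10 ≤ t) (h28 : t ≤ 28) :
    ∑' n, tollWeight t (covToll t) n ≠ 0 := by
  have h' := re_lt_one h10 h28
  obtain ⟨c1, c2, c3, c4⟩ := twoBoundCheck_of_mem t (Finset.mem_Icc.2 ⟨h10, h28⟩)
  have ht : (10 : ℝ) ≤ t := by exact_mod_cast h10
  have hpi := Real.pi_gt_d4
  set σ : ℝ := (sumInvPred t : ℝ) with hσ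
  have hσ0 : 0 < σ := by
    rw [hσ, sumInvPred]
    push_cast
    refine Finset.sum_pos (fun j hj => ?_) (Icc_nonempty t)
    have := add_pos_of_mem (x := -1) (by linarith : -(t : ℝ) < -1) hj
    exact one_div_pos.2 (by linarith)
  have c3' : (9 * t + 3) * σ ^ 2 < 16 * (31415 / 10000 : ℝ) ^ 2 := by
    have : (((9 * t + 3) * sumInvPred t ^ 2 : ℚ) : ℝ) < ((16 * (31415 / 10000) ^ 2 : ℚ) : ℝ) :=
      Rat.cast_lt.2 c3
    push_cast at this
    exact this
  set A := ((indRoots t).erase 2).filter fun z => -1 ≤ z.re with hA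
  have hA1 : ∀ z ∈ A, indProd t z = 2 ∧ z ≠ 2 ∧ -1 ≤ z.re := fun z hz => by
    rw [hA, Finset.mem_filter] at hz
    exact ⟨mem_indRoots.1 (Finset.mem_of_mem_erase hz.1), Finset.ne_of_mem_erase hz.1, hz.2⟩
  have hAarg : ∀ z ∈ A, 2 * Real.pi ≤ |argSum t z| ∧ |argSum t z| < 4 * Real.pi := by
    intro z hz
    obtain ⟨h1, h2, h3⟩ := hA1 z hz
    refine ⟨two_pi_le_of_root h1 h2 (by linarith), ?_⟩
    refine (argSum_le_mul_sumInvPred (by omega) h3).trans_lt ?_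
    rw [← hσ]
    have hy := im_sq_le_of_root h1 h3 (by linarith)
    refine lt_of_pow_lt_pow_left₀ 2 (by positivity) ?_
    rw [mul_pow, sq_abs]
    have e : z.im ^ 2 ≤ 9 * t + 3 := by linarith
    calc z.im ^ 2 * σ ^ 2 ≤ (9 * t + 3) * σ ^ 2 := mul_le_mul_of_nonneg_right e (by positivity)
      _ < 16 * (31415 / 10000 : ℝ) ^ 2 := c3'
      _ ≤ (4 * Real.pi) ^ 2 := by nlinarith
  have hcard : A.card ≤ 2 := by
    have hmaps : ∀ z ∈ A, argSum t z ∈ ({2 * Real.pi, -(2 * Real.pi)} : Finset ℝ) := by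
      intro z hz
      obtain ⟨k, hk⟩ := exists_argSum_of_root (hA1 z hz).1
      obtain ⟨h1, h2⟩ := hAarg z hz
      rw [hk, abs_mul, abs_of_pos Real.two_pi_pos] at h1 h2
      have k1 : (1 : ℝ) ≤ |(k : ℝ)| := by
        by_contra! hcon
        nlinarith [Real.pi_pos]
      have k2 : |(k : ℝ)| < 2 := by
        by_contra! hcon
        nlinarith [Real.pi_pos]
      have k1' : 1 ≤ |k| := by exact_mod_cast k1
      have k2' : |k| < 2 := by exact_mod_cast k2
      have : |k| = 1 := by omega
      rw [Finset.mem_insert, Finset.mem_singleton, hk]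
      rcases (abs_eq zero_le_one).1 this with rfl | rfl
      · left; push_cast; ring
      · right; push_cast; ring
    have := Finset.card_le_card_of_injOn _ hmaps fun z hz z' hz' he =>
      eq_of_argSum_eq (hA1 z hz).1 (hA1 z' hz').1 (by linarith [(hA1 z hz).2.2])
        (by linarith [(hA1 z' hz').2.2]) he
    exact this.trans Finset.card_le_two
  have hR := resBound_pos t
  have q1 : (0 : ℝ) < halfProdBound t 1 - 1 := by
    have : (1 : ℝ) < halfProdBound t 1 := by exact_mod_cast c2
    linarith
  have hnear : ∑ l ∈ A, ‖crossTerm t l‖ ≤ 2 * (resBound t / 2 / (halfProdBound t 1 - 1) *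
      (σ ^ 2 / (4 * (31415 / 10000 : ℝ) ^ 2))) := by
    have : ∀ l ∈ A, ‖crossTerm t l‖ ≤ resBound t / 2 / (halfProdBound t 1 - 1) *
        (σ ^ 2 / (4 * (31415 / 10000 : ℝ) ^ 2)) := by
      intro l hl
      have hl' : l ∈ (indRoots t).erase 2 := (Finset.mem_filter.1 hl).1
      refine (norm_crossTerm_le hl' (c := 1) (by push_cast; exact (h' l hl').le) le_rfl c2).trans ?_
      rw [div_eq_mul_one_div _ (‖1 - l‖ ^ 2)]
      refine mul_le_mul_of_nonneg_left ?_ (by positivity)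
      have h1 := (hAarg l hl).1.trans (argSum_le_mul_sumInvPred (by omega) (hA1 l hl).2.2)
      rw [← hσ] at h1
      have h2 : |l.im| ≤ ‖1 - l‖ := by
        have := Complex.abs_im_le_norm (1 - l)
        rwa [Complex.sub_im, Complex.one_im, zero_sub, abs_neg] at this
      have h3 : 2 * (31415 / 10000 : ℝ) ≤ ‖1 - l‖ * σ := by
        have := mul_le_mul_of_nonneg_right h2 hσ0.le
        linarith
      have h4 : 0 < ‖1 - l‖ := norm_pos_iff.2 (one_sub_ne_zero_of_mem (Finset.mem_of_mem_erase hl'))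
      rw [div_le_div_iff₀ (by positivity) (by positivity), one_mul, ← mul_pow]
      calc 4 * (31415 / 10000 : ℝ) ^ 2 = (2 * (31415 / 10000 : ℝ)) ^ 2 := by ring
        _ ≤ (‖1 - l‖ * σ) ^ 2 := pow_le_pow_left₀ (by norm_num) h3 2
        _ = (σ * ‖1 - l‖) ^ 2 := by rw [mul_comm]
    refine (Finset.sum_le_card_nsmul _ _ _ this).trans ?_
    rw [nsmul_eq_mul]
    refine mul_le_mul_of_nonneg_right (by exact_mod_cast hcard) ?_
    positivity
  have hfar := sum_norm_crossTerm_le h' (c := -1) (by norm_num) c1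
    (s := ((indRoots t).erase 2).filter fun z => ¬ -1 ≤ z.re) (Finset.filter_subset _ _)
    fun z hz => by
      have := (Finset.mem_filter.1 hz).2
      push_cast
      linarith
  refine tsum_covToll_ne_zero_of_lt h' ?_
  rw [← Finset.sum_filter_add_sum_filter_not _ (fun z : ℂ => -1 ≤ z.re)]
  have c4' := (Rat.cast_lt (K := ℝ)).2 c4
  push_cast at c4' hfar
  rw [← hσ] at c4'
  linarith

theorem tsum_covToll_ne_zero {t : ℕ} (h1 : 1 ≤ t) (h28 : t ≤ 28) :
    ∑' n, tollWeight t (covToll t) n ≠ 0 := by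
  rcases le_or_gt t 9 with h | h
  · exact tsum_ne_zero_of_le_nine h1 h
  · exact tsum_ne_zero_of_ten_le h h28

/-! ### The digamma function -/

theorem norm_GammaSeq_le {s : ℂ} (hs : 0 < s.re) {n : ℕ} (hn : n ≠ 0) :
    ‖Complex.GammaSeq s n‖ ≤ Real.Gamma s.re := by
  rw [Complex.GammaSeq_eq_approx_Gamma_integral hs hn]
  have hn0 : (0 : ℝ) ≤ n := n.cast_nonneg
  have hint := Real.GammaIntegral_convergent hs
  have hint' : IntervalIntegrable (fun x : ℝ => Real.exp (-x) * x ^ (s.re - 1))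
      MeasureTheory.volume 0 n := by
    rw [intervalIntegrable_iff_integrableOn_Ioc_of_le hn0]
    exact hint.mono_set Set.Ioc_subset_Ioi_self
  refine (intervalIntegral.norm_integral_le_of_norm_le hn0 (Eventually.of_forall fun x hx => ?_)
    hint').trans ?_
  · rw [norm_mul, Complex.norm_real, Complex.norm_cpow_eq_rpow_re_of_pos hx.1, Complex.sub_re,
      Complex.one_re, Real.norm_eq_abs]
    refine mul_le_mul_of_nonneg_right ?_ (Real.rpow_nonneg hx.1.le _)
    rw [abs_of_nonneg]
    · exact Real.one_sub_div_pow_le_exp_neg hx.2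
    · have : x / n ≤ 1 := div_le_one_of_le₀ hx.2 hn0
      exact pow_nonneg (by linarith) n
  · rw [Real.Gamma_eq_integral hs, intervalIntegral.integral_of_le hn0]
    refine MeasureTheory.setIntegral_mono_set hint ?_ (LE.le.eventuallyLE
      Set.Ioc_subset_Ioi_self)
    filter_upwards [MeasureTheory.ae_restrict_mem measurableSet_Ioi] with x hx
    have hx' : 0 < x := hx
    have := Real.rpow_nonneg hx'.le (s.re - 1)
    positivity

theorem hasDerivAt_GammaSeq {a : ℂ} (ha : 0 < a.re) {n : ℕ} (hn : n ≠ 0) :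
    HasDerivAt (fun z => Complex.GammaSeq z n)
      (Complex.GammaSeq a n * (Complex.log n - psum a (n + 1))) a := by
  have hn' : (n : ℂ) ≠ 0 := Nat.cast_ne_zero.2 hn
  have h1 := (((hasDerivAt_id a).const_cpow (c := (n : ℂ)) (Or.inl hn')).mul_const (n ! : ℂ)).div
    (hasDerivAt_prod_add (Finset.range (n + 1)) (fun i => (i : ℂ)) (fun _ => 1)
      fun i _ => add_natCast_ne_zero ha i)
    (Finset.prod_ne_zero_iff.2 fun i _ => div_ne_zero (add_natCast_ne_zero ha i) one_ne_zero)
  have hP : ∏ j ∈ Finset.range (n + 1), (a + j) ≠ 0 :=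
    Finset.prod_ne_zero_iff.2 fun i _ => add_natCast_ne_zero ha i
  simp only [div_one, id] at h1
  refine (h1.congr_of_eventuallyEq (Eventually.of_forall fun z => ?_)).congr_deriv ?_
  · simp [Complex.GammaSeq]
  · rw [Complex.GammaSeq, psum]
    field_simp

/-- The digamma function as a limit. -/
theorem tendsto_log_sub_psum_succ {a : ℂ} (ha : 0 < a.re) :
    Tendsto (fun n : ℕ => Complex.log n - psum a (n + 1)) atTop (𝓝 (Complex.digamma a)) := by
  set U : Set ℂ := {z | 0 < z.re} with hU
  have hUo : IsOpen U := isOpen_lt continuous_const Complex.continuous_re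
  set r := a.re / 2 with hr
  have hr0 : 0 < r := by positivity
  have hball : Metric.closedBall a r ⊆ U := by
    intro z hz
    have h1 := Complex.abs_re_le_norm (z - a)
    rw [← dist_eq_norm] at h1
    have h2 := (abs_le.1 (h1.trans hz)).1
    rw [Complex.sub_re] at h2
    change 0 < z.re
    linarith
  have hsph : ∀ θ : ℝ, 0 < (circleMap a r θ).re := fun θ =>
    hball (circleMap_mem_closedBall a hr0.le θ)
  have hG : DifferentiableOn ℂ Complex.Gamma U := fun z hz =>
    (Complex.differentiableAt_Gamma z fun m h => by
      have h' : 0 < z.re := hz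
      rw [h, Complex.neg_re, Complex.natCast_re] at h'
      linarith [m.cast_nonneg (α := ℝ)]).differentiableWithinAt
  have hcd : Tendsto (fun n : ℕ => Complex.cderiv r (fun z => Complex.GammaSeq z n) a) atTop
      (𝓝 (Complex.cderiv r Complex.Gamma a)) := by
    refine Tendsto.const_smul ?_ _
    simp only [circleIntegral]
    refine intervalIntegral.tendsto_integral_filter_of_dominated_convergence
      (fun θ => r * ((r ^ 2)⁻¹ * Real.Gamma (circleMap a r θ).re)) ?_ ?_ ?_ ?_
    · filter_upwards [eventually_ne_atTop 0] with n hn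
      refine Continuous.aestronglyMeasurable ?_
      have hc : Continuous fun θ => Complex.GammaSeq (circleMap a r θ) n := by
        refine continuous_iff_continuousAt.2 fun θ => ?_
        exact (hasDerivAt_GammaSeq (hsph θ) hn).continuousAt.comp
          (continuous_circleMap a r).continuousAt
      have hc2 : Continuous fun θ => ((circleMap a r θ - a) ^ 2)⁻¹ := by
        refine Continuous.inv₀ (((continuous_circleMap a r).sub continuous_const).pow 2) fun θ => ?_
        exact pow_ne_zero 2 (sub_ne_zero.2 (circleMap_ne_center hr0.ne'))
      have hd : Continuous fun θ => deriv (circleMap a r) θ := by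
        simp only [deriv_circleMap]
        exact (continuous_circleMap 0 r).mul continuous_const
      exact hd.smul (hc2.smul hc)
    · filter_upwards [eventually_ne_atTop 0] with n hn
      refine Eventually.of_forall fun θ _ => ?_
      rw [norm_smul, norm_smul, deriv_circleMap, norm_mul, norm_circleMap_zero, Complex.norm_I,
        mul_one, abs_of_pos hr0, norm_inv, norm_pow, circleMap_sub_center, norm_circleMap_zero,
        abs_of_pos hr0]
      gcongr
      exact norm_GammaSeq_le (hsph θ) hn
    · refine Continuous.intervalIntegrable ?_ _ _
      refine continuous_const.mul (continuous_const.mul ?_)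
      refine continuous_iff_continuousAt.2 fun θ => ?_
      have h1 : ContinuousAt Real.Gamma (circleMap a r θ).re :=
        (Real.differentiableAt_Gamma fun m h => by
          have := hsph θ
          rw [h] at this
          linarith [m.cast_nonneg (α := ℝ)]).continuousAt
      exact ContinuousAt.comp (f := fun θ => (circleMap a r θ).re) h1
        (Complex.continuous_re.comp (continuous_circleMap a r)).continuousAt
    · refine Eventually.of_forall fun θ _ => ?_
      exact ((Complex.GammaSeq_tendsto_Gamma _).const_smul _).const_smul _
  rw [Complex.cderiv_eq_deriv hUo hG hr0 hball] at hcd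
  have h1 : Tendsto (fun n : ℕ => Complex.GammaSeq a n * (Complex.log n - psum a (n + 1))) atTop
      (𝓝 (deriv Complex.Gamma a)) := by
    refine hcd.congr' ?_
    filter_upwards [eventually_ne_atTop 0] with n hn
    rw [Complex.cderiv_eq_deriv hUo (fun z hz => (hasDerivAt_GammaSeq hz
      hn).differentiableAt.differentiableWithinAt) hr0 hball]
    exact (hasDerivAt_GammaSeq ha hn).deriv
  have hG0 := Complex.Gamma_ne_zero_of_re_pos ha
  have h2 := Complex.GammaSeq_tendsto_Gamma a
  have h3 := h1.div h2 hG0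
  rw [Complex.digamma_def, logDeriv_apply]
  refine h3.congr' ?_
  filter_upwards [h2.eventually_ne hG0] with n hn
  simp only [Pi.div_apply]
  field_simp

theorem tendsto_psum_sub_psum {a b : ℂ} (ha : 0 < a.re) (hb : 0 < b.re) :
    Tendsto (fun n : ℕ => psum a n - psum b n) atTop
      (𝓝 (Complex.digamma b - Complex.digamma a)) := by
  have h := (tendsto_log_sub_psum_succ hb).sub (tendsto_log_sub_psum_succ ha)
  rw [← tendsto_add_atTop_iff_nat 1]
  refine h.congr fun n => ?_
  ring

theorem psum_eq_digamma {a : ℂ} (ha : 0 < a.re) (n : ℕ) :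
    psum a n = Complex.digamma (a + n) - Complex.digamma a := by
  induction n with
  | zero => simp [psum]
  | succ n ih =>
    have h1 : 0 < (a + n).re := by
      rw [Complex.add_re, Complex.natCast_re]
      positivity
    have h2 := Complex.digamma_apply_add_one (a + n) fun m h => by
      rw [h, Complex.neg_re, Complex.natCast_re] at h1
      linarith [m.cast_nonneg (α := ℝ)]
    rw [psum, Finset.sum_range_succ, ← psum, ih, Nat.cast_succ, ← add_assoc, h2, one_div]
    ring

theorem digamma_nat_add_one (n : ℕ) :
    Complex.digamma (n + 1) = H n - Real.eulerMascheroniConstant := by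
  have h := psum_eq_digamma (a := 1) (by norm_num) n
  have h2 : psum 1 n = (H n : ℂ) := by
    have e := Finset.sum_Ico_add' (fun i : ℕ => 1 / (i : ℂ)) 0 n 1
    rw [H, psum, Finset.range_eq_Ico]
    push_cast
    rw [show Finset.Icc 1 n = Finset.Ico (0 + 1) (n + 1) by ext; simp, ← e]
    exact Finset.sum_congr rfl fun i _ => by push_cast; rw [add_comm]
  rw [Complex.digamma_one, h2] at h
  rw [add_comm (n : ℂ), h]
  ring

theorem eig_eq_Gamma {a : ℂ} (ha : 0 < a.re) (n : ℕ) :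
    eig a n = Complex.Gamma (a + n) / (Complex.Gamma a * n !) := by
  have hG := Complex.Gamma_ne_zero_of_re_pos ha
  induction n with
  | zero => simp [eig, div_self hG]
  | succ n ih =>
    have h1 : 0 < (a + n).re := by
      rw [Complex.add_re, Complex.natCast_re]
      positivity
    have hn : (n ! : ℂ) ≠ 0 := Nat.cast_ne_zero.2 n.factorial_ne_zero
    have hn1 : (n : ℂ) + 1 ≠ 0 := Nat.cast_add_one_ne_zero n
    rw [eig_succ, ih, Nat.cast_succ, ← add_assoc, Complex.Gamma_add_one _ (add_natCast_ne_zero ha n),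
      Nat.factorial_succ]
    push_cast
    field_simp

/-! ### The leading part of the expectation of `𝒮_n` -/

theorem conj_eig (a : ℂ) (n : ℕ) : starRingEnd ℂ (eig a n) = eig (starRingEnd ℂ a) n := by
  simp [eig, map_prod]

theorem conj_psum (a : ℂ) (n : ℕ) : starRingEnd ℂ (psum a n) = psum (starRingEnd ℂ a) n := by
  simp [psum, map_sum]

theorem conj_deig (a : ℂ) (n : ℕ) : starRingEnd ℂ (deig a n) = deig (starRingEnd ℂ a) n := by
  rw [deig, map_mul, conj_eig, conj_psum, deig]

theorem conj_logDerivSum (t : ℕ) (a : ℂ) :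
    starRingEnd ℂ (logDerivSum t a) = logDerivSum t (starRingEnd ℂ a) := by
  simp [logDerivSum, map_sum]

theorem conj_avg₂ (t : ℕ) (f g : ℕ → ℂ) (n : ℕ) : starRingEnd ℂ (avg₂ t f g n) =
    avg₂ t (fun k => starRingEnd ℂ (f k)) (fun k => starRingEnd ℂ (g k)) n := by
  simp [avg₂, map_sum, wt]

theorem conj_avg (t : ℕ) (f : ℕ → ℂ) (n : ℕ) : starRingEnd ℂ (avg t f n) =
    avg t (fun k => starRingEnd ℂ (f k)) n := by
  simp [avg, map_sum, wt]

theorem conj_sCoeff (t : ℕ) (a : ℂ) :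
    starRingEnd ℂ (sCoeff t a) = sCoeff t (starRingEnd ℂ a) := by
  have : starRingEnd ℂ 2 = 2 := Complex.conj_ofNat 2
  simp [sCoeff, res, conj_logDerivSum, conj_eig, this]

theorem C₂_eq_sCoeff {t : ℕ} {ρ : ℂ} : C₂ t ρ = sCoeff t ρ := by
  have h := eig_mul_factorial ρ t
  have h0 : (t ! : ℂ) ≠ 0 := Nat.cast_ne_zero.2 t.factorial_ne_zero
  have h1 : ∑ j ∈ Finset.Icc t (2 * t), 1 / ((j : ℂ) + ρ) = logDerivSum t ρ :=
    Finset.sum_congr rfl fun j _ => by rw [add_comm]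
  rw [C₂, ← h, h1, sCoeff, res, mul_comm (eig ρ t), div_div, div_div,
    show 2 * ((ρ - 1) * (t ! * eig ρ t)) * logDerivSum t ρ =
      t ! * (logDerivSum t ρ * (2 * (ρ - 1)) * eig ρ t) by ring, div_mul_eq_div_div, div_self h0]
  rw [one_div, one_div, mul_assoc, mul_assoc]

theorem IsSecondZero.root {t : ℕ} {ρ : ℂ} (h : IsSecondZero t ρ) : indProd t ρ = 2 :=
  indicial_eq_zero_iff.1 h.zero

theorem IsSecondZero.exists_expansion {t : ℕ} {ρ : ℂ} (h : IsSecondZero t ρ) {lo : ℝ}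
    (hlo : lo < ρ.re) : ∃ e, lo < e + 1 ∧ e + 1 < ρ.re ∧
      PolyBound (fun n => (sDev t n : ℂ) - (sCoeff t ρ * eig ρ n +
        starRingEnd ℂ (sCoeff t ρ * eig ρ n))) e := by
  have h2 : ρ ≠ 2 := fun h' => by
    have := h.im_pos
    rw [h'] at this
    simp at this
  have hc : starRingEnd ℂ ρ ≠ ρ := fun h' => by
    have := congrArg Complex.im h'
    rw [Complex.conj_im] at this
    linarith [h.im_pos]
  have hc2 : starRingEnd ℂ ρ ≠ 2 := fun h' => by
    have := congrArg Complex.im h'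
    rw [Complex.conj_im] at this
    simp at this
    linarith [h.im_pos]
  have hm : ρ ∈ (indRoots t).erase 2 := Finset.mem_erase.2 ⟨h2, mem_indRoots.2 h.root⟩
  have hmc : starRingEnd ℂ ρ ∈ ((indRoots t).erase 2).erase ρ :=
    Finset.mem_erase.2 ⟨hc, Finset.mem_erase.2 ⟨hc2, mem_indRoots.2 (conj_root h.root)⟩⟩
  set s := (((indRoots t).erase 2).erase ρ).erase (starRingEnd ℂ ρ) with hs
  have hlt : ∀ z ∈ s, z.re < ρ.re := by
    intro z hz
    simp only [hs, Finset.mem_erase] at hz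
    exact h.re_lt z (indicial_eq_zero_iff.2 (mem_indRoots.1 hz.2.2.2)) hz.2.2.1 hz.2.1 hz.1
  obtain ⟨y, hy1, hy2, hy3⟩ : ∃ y, lo < y ∧ y < ρ.re ∧ ∀ z ∈ s, z.re ≤ y := by
    set M := (insert lo (s.image Complex.re)).max' (Finset.insert_nonempty _ _) with hM
    have hMlt : M < ρ.re := by
      rw [hM, Finset.max'_lt_iff]
      intro x hx
      rcases Finset.mem_insert.1 hx with rfl | hx
      · exact hlo
      · obtain ⟨z, hz, rfl⟩ := Finset.mem_image.1 hx
        exact hlt z hz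
    have hlo' : lo ≤ M := Finset.le_max' _ _ (Finset.mem_insert_self _ _)
    refine ⟨(M + ρ.re) / 2, by linarith, by linarith, fun z hz => ?_⟩
    have : z.re ≤ M := Finset.le_max' _ _
      (Finset.mem_insert_of_mem (Finset.mem_image_of_mem _ hz))
    linarith
  refine ⟨y - 1, by linarith, by linarith, ?_⟩
  refine PolyBound.of_eq (N := t) (PolyBound.sum (s := s)
    (F := fun z n => sCoeff t z * eig z n) fun z hz =>
      (PolyBound.eig (by linarith [hy3 z hz])).const_mul (sCoeff t z)) fun n hn => ?_
  rw [sDev_eq hn, ← Finset.add_sum_erase _ _ hm, ← Finset.add_sum_erase _ _ hmc, map_mul, conj_eig,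
    conj_sCoeff]
  ring

/-! ### Comparison of solutions of the recurrence -/

theorem PolyBound.of_recurrence {t : ℕ} {M A T U : ℕ → ℂ} {e : ℝ} (he : 1 < e)
    (hM : ∀ n, 2 * t + 1 ≤ n → M n = 2 * avg t M n + T n)
    (hA : ∀ n, 2 * t + 1 ≤ n → A n = 2 * avg t A n + U n)
    (hTU : PolyBound (fun n => T n - U n) e) : PolyBound (fun n => M n - A n) e := by
  obtain ⟨C, hC, h⟩ := hTU
  refine transfer_superlinear (t := t) he (fun n hn => ?_) h
  rw [avg_sub]
  linear_combination hM n hn - hA n hn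

theorem avg₂_sub_left (t : ℕ) (f f' g : ℕ → ℂ) (n : ℕ) :
    avg₂ t (fun k => f k - f' k) g n = avg₂ t f g n - avg₂ t f' g n := by
  simp only [avg₂, ← Finset.sum_sub_distrib]
  exact Finset.sum_congr rfl fun k _ => by ring

theorem avg₂_sub_right (t : ℕ) (f g g' : ℕ → ℂ) (n : ℕ) :
    avg₂ t f (fun k => g k - g' k) n = avg₂ t f g n - avg₂ t f g' n := by
  simp only [avg₂, ← Finset.sum_sub_distrib]
  exact Finset.sum_congr rfl fun k _ => by ring

theorem PolyBound.avg₂_sub {t : ℕ} {f f' g g' : ℕ → ℂ} {a b d d' e : ℝ}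
    (hf : PolyBound (fun k => f k - f' k) d) (hg : PolyBound g b) (hf' : PolyBound f' a)
    (hgg : PolyBound (fun k => g k - g' k) d') (ha : -1 < a) (hb : -1 < b) (hd : -1 < d)
    (hd' : -1 < d') (h1 : d + b ≤ e) (h2 : a + d' ≤ e) :
    PolyBound (fun n => FBBST.avg₂ t f g n - FBBST.avg₂ t f' g' n) e := by
  refine ((hf.avg₂_le (t := t) hg hd hb h1).add (hf'.avg₂_le (t := t) hgg ha hd' h2)).of_eq
    (N := 0) fun n _ => ?_
  rw [avg₂_sub_left, avg₂_sub_right]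
  ring

theorem PolyBound.mul_sub {f f' g g' : ℕ → ℂ} {a b d d' e : ℝ}
    (hf : PolyBound (fun k => f k - f' k) d) (hg : PolyBound g b) (hf' : PolyBound f' a)
    (hgg : PolyBound (fun k => g k - g' k) d') (h1 : d + b ≤ e) (h2 : a + d' ≤ e) :
    PolyBound (fun n => f n * g n - f' n * g' n) e :=
  ((hf.mul_le hg h1).add (hf'.mul_le hgg h2)).of_eq (N := 0) fun n _ => by ring

/-! ### Shifts of the parameter -/

@[to_additive]
theorem prod_Icc_shift {M : Type*} [CommMonoid M] (t : ℕ) (f : ℕ → M) :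
    (∏ j ∈ Finset.Icc t (2 * t), f (j + 1)) * f t =
      (∏ j ∈ Finset.Icc t (2 * t), f j) * f (2 * t + 1) := by
  have h := Finset.prod_range_succ' (fun i => f (t + i)) (t + 1)
  rw [Finset.prod_range_succ] at h
  rw [← Finset.Ico_add_one_right_eq_Icc, Finset.prod_Ico_eq_prod_range,
    Finset.prod_Ico_eq_prod_range, show 2 * t + 1 - t = t + 1 by omega,
    show 2 * t + 1 = t + (t + 1) by omega, h, add_zero]
  rfl

theorem logDerivSum_add_one (t : ℕ) (a : ℂ) :
    logDerivSum t (a + 1) = logDerivSum t a - 1 / (a + t) + 1 / (a + (2 * t + 1)) := by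
  have := sum_Icc_shift t fun j => 1 / (a + j)
  push_cast at this
  rw [logDerivSum, logDerivSum]
  simp only [add_assoc, add_comm (1 : ℂ)]
  linear_combination this

theorem logDerivSumSq_add_one (t : ℕ) (a : ℂ) :
    logDerivSumSq t (a + 1) = logDerivSumSq t a - 1 / (a + t) ^ 2 + 1 / (a + (2 * t + 1)) ^ 2 := by
  have := sum_Icc_shift t fun j => 1 / (a + j) ^ 2
  push_cast at this
  rw [logDerivSumSq, logDerivSumSq]
  simp only [add_assoc, add_comm (1 : ℂ)]
  linear_combination this

theorem psum_add_one {a : ℂ} (n : ℕ) : psum (a + 1) n = psum a n - 1 / a + 1 / (a + n) := by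
  have h := Finset.sum_range_succ' (fun i : ℕ => 1 / (a + i)) n
  rw [Finset.sum_range_succ] at h
  rw [psum, psum]
  push_cast at h
  simp only [add_assoc, add_comm (1 : ℂ)]
  rw [add_zero] at h
  linear_combination -h

theorem range_add_Icc {M : Type*} [AddCommMonoid M] (t : ℕ) (f : ℕ → M) :
    ∑ i ∈ Finset.range (2 * t + 1), f i =
      ∑ i ∈ Finset.range t, f i + ∑ j ∈ Finset.Icc t (2 * t), f j := by
  rw [Finset.range_eq_Ico, Finset.range_eq_Ico,
    ← Finset.sum_Ico_consecutive f (Nat.zero_le t) (by omega : t ≤ 2 * t + 1)]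
  rfl

theorem psum_two_mul_add_one (t : ℕ) (a : ℂ) :
    psum a (2 * t + 1) = psum a t + logDerivSum t a := range_add_Icc t _

theorem indProd_add_one (t : ℕ) (a : ℂ) :
    (a + t) * indProd t (a + 1) = (a + (2 * t + 1)) * indProd t a := by
  have h := prod_Icc_shift t fun j => a + (j : ℂ)
  push_cast at h
  rw [indProd_eq_div, indProd_eq_div, ← mul_div_assoc, ← mul_div_assoc]
  simp only [add_assoc, add_comm (1 : ℂ)]
  rw [mul_comm, h, mul_comm]

theorem eig_three (n : ℕ) : eig (3 : ℂ) n = (n + 1) * (n + 2) / 2 := by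
  have h := add_mul_eig (2 : ℂ) n
  rw [eig_two', show (2 : ℂ) + 1 = 3 by norm_num] at h
  linear_combination -h / 2

/-! ### The variance of the path length -/

theorem indProd_three (t : ℕ) : indProd t (3 : ℂ) = 2 * (2 * t + 3) / (t + 2) := by
  have h := indProd_add_one t 2
  have h2 : (t : ℂ) + 2 ≠ 0 := by exact_mod_cast (by omega : t + 2 ≠ 0)
  rw [indProd_two, show (2 : ℂ) + 1 = 3 by norm_num] at h
  rw [eq_div_iff h2]
  linear_combination h

theorem deig_three (n : ℕ) :
    2 * deig 3 n = (n + 2) * deig 2 n - (n + 1) * (n + 2) / 2 + (n + 1) := by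
  have h := psum_add_one (a := 2) n
  have h2 : (2 : ℂ) + n ≠ 0 := by exact_mod_cast (by omega : 2 + n ≠ 0)
  rw [show (2 : ℂ) + 1 = 3 by norm_num] at h
  rw [deig, deig, h, eig_three, eig_two']
  field_simp
  ring

/-- The coefficient of `eig 3` in the leading part of the second moment of `𝒳_n`. -/
def xxCoeff (t : ℕ) : ℂ :=
  (t + 2) / (t + 1) * (2 / invSum t ^ 2 * (logDerivSum t 3 ^ 2 + logDerivSumSq t 3) -
      2 / invSum t ^ 2 * logDerivSum t 3) +
    2 / invSum t ^ 2 * ((psum 2 t - psum 3 (2 * t + 1)) ^ 2 + psumSq 3 (2 * t + 1)) +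
    (2 / invSum t - 2) * (2 * t + 3) / (t + 1)

/-- The leading part of the second moment of `𝒳_n`. -/
def xxLead (t n : ℕ) : ℂ :=
  2 / invSum t ^ 2 * ddeig 3 n + 2 / invSum t ^ 2 * deig 3 n + xxCoeff t * eig 3 n

theorem logDerivSum_three (t : ℕ) :
    logDerivSum t 3 = invSum t - 1 / (t + 2) + 1 / (2 * t + 3) := by
  have h := logDerivSum_add_one t 2
  rw [show (2 : ℂ) + 1 = 3 by norm_num, ← ofReal_invSum] at h
  rw [h, add_comm (2 : ℂ) t, show (2 : ℂ) + (2 * t + 1) = 2 * t + 3 by ring]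

theorem psum_two_sub_psum_three (t : ℕ) :
    psum 2 t - psum 3 (2 * t + 1) = 1 / 2 - 1 / (2 * t + 3) - invSum t := by
  have h := psum_add_one (a := 2) t
  rw [show (2 : ℂ) + 1 = 3 by norm_num] at h
  rw [psum_two_mul_add_one, h, logDerivSum_three, add_comm (2 : ℂ) t]
  ring

theorem xxLead_rec {t n : ℕ} (hn : 2 * t + 1 ≤ n) :
    xxLead t n = 2 * avg t (xxLead t) n + (2 * (1 / invSum t ^ 2 * avg₂ t (deig 2) (deig 2) n) +
      4 / invSum t * deig 3 n + (2 / invSum t - 2) * eig 3 n) := by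
  have him : (invSum t : ℂ) ≠ 0 := by exact_mod_cast (invSum_pos t).ne'
  have h1 : (t : ℂ) + 1 ≠ 0 := by exact_mod_cast (by omega : t + 1 ≠ 0)
  have h2 : (t : ℂ) + 2 ≠ 0 := by exact_mod_cast (by omega : t + 2 ≠ 0)
  have h3 : 2 * (t : ℂ) + 3 ≠ 0 := by exact_mod_cast (by omega : 2 * t + 3 ≠ 0)
  have ha : avg t (xxLead t) n = 2 / invSum t ^ 2 * avg t (ddeig 3) n +
      2 / invSum t ^ 2 * avg t (deig 3) n + xxCoeff t * avg t (eig 3) n := by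
    have : xxLead t = fun n => 2 / invSum t ^ 2 * ddeig 3 n + 2 / invSum t ^ 2 * deig 3 n +
      xxCoeff t * eig 3 n := rfl
    rw [this, avg_add, avg_add, avg_const_mul, avg_const_mul, avg_const_mul]
  have e1 := avg_ddeig_mul hn (a := 3) (by norm_num)
  have e2 := avg_deig_mul hn (a := 3) (by norm_num)
  have e3 := avg_eig_mul hn (3 : ℂ)
  have e4 := avg₂_deig_deig_mul hn (a := 2) (b := 2) (by norm_num) (by norm_num) (by norm_num)
  rw [show (2 : ℂ) + 2 - 1 = 3 by norm_num, eig_three (2 * t + 1), eig_two'] at e4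
  rw [indProd_three, mul_div_assoc', div_eq_iff h2] at e1 e2 e3
  have h6 : 2 * (2 * (t : ℂ) + 3) ≠ 0 := mul_ne_zero two_ne_zero h3
  push_cast at e4
  have k1 : avg t (ddeig 3) n = (t + 2) / (2 * (2 * t + 3)) * (ddeig 3 n -
      2 * logDerivSum t 3 * deig 3 n + (logDerivSum t 3 ^ 2 + logDerivSumSq t 3) * eig 3 n) := by
    rw [div_mul_eq_mul_div, eq_div_iff h6]; linear_combination e1
  have k2 : avg t (deig 3) n = (t + 2) / (2 * (2 * t + 3)) * (deig 3 n -
      logDerivSum t 3 * eig 3 n) := by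
    rw [div_mul_eq_mul_div, eq_div_iff h6]; linear_combination e2
  have k3 : avg t (eig (3 : ℂ)) n = (t + 2) / (2 * (2 * t + 3)) * eig 3 n := by
    rw [div_mul_eq_mul_div, eq_div_iff h6]; linear_combination e3
  set c := psum 2 t - psum 3 (2 * t + 1) with hc
  have hc' := psum_two_sub_psum_three t
  rw [← hc] at hc'
  have k4 : avg₂ t (deig 2) (deig 2) n = (t + 1) / (2 * t + 3) * (ddeig 3 n + 2 * c * deig 3 n +
      (c ^ 2 + psumSq 3 (2 * t + 1)) * eig 3 n) := by
    have h5 : (2 * (t : ℂ) + 1 + 1) * (2 * t + 1 + 2) / 2 = (t + 1) * (2 * t + 3) := by ring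
    rw [h5] at e4
    rw [div_mul_eq_mul_div, eq_div_iff h3, ← mul_right_inj' h1]
    rw [ddeig, deig]
    linear_combination e4
  rw [ha, k1, k2, k3, k4, xxLead, xxCoeff, ← hc]
  have hl := logDerivSum_three t
  generalize logDerivSumSq t 3 = l2
  generalize psumSq 3 (2 * t + 1) = b2
  rw [hl, hc']
  generalize ddeig 3 n = x
  generalize deig 3 n = y
  generalize eig (3 : ℂ) n = z
  generalize (invSum t : ℂ) = m at *
  field_simp
  ring

/-! ### Harmonic numbers -/

theorem H_succ (n : ℕ) : H (n + 1) = H n + 1 / (n + 1) := by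
  rw [H, Finset.sum_Icc_succ_top (by omega), ← H]
  push_cast
  rfl

theorem H2_succ (n : ℕ) : H2 (n + 1) = H2 n + 1 / (n + 1) ^ 2 := by
  rw [H2, Finset.sum_Icc_succ_top (by omega), ← H2]
  push_cast
  rfl

theorem H2_eq_add (t : ℕ) :
    H2 (2 * t + 2) = H2 (t + 1) + ∑ j ∈ Finset.Icc t (2 * t), 1 / ((j : ℝ) + 2) ^ 2 := by
  have h : ∀ d, H2 (t + d + 1) = H2 (t + 1) + ∑ i ∈ Finset.range d, 1 / (((t + i : ℕ) : ℝ) + 2) ^ 2 := by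
    intro d
    induction d with
    | zero => simp
    | succ d ih =>
      rw [← add_assoc t, Finset.sum_range_succ, ← add_assoc (H2 _), ← ih, H2_succ (t + d + 1)]
      push_cast
      ring
  rw [← Finset.Ico_add_one_right_eq_Icc, Finset.sum_Ico_eq_sum_range,
    show 2 * t + 1 - t = t + 1 by omega, ← h, show t + (t + 1) + 1 = 2 * t + 2 by ring]

theorem H_eq_add (t : ℕ) : H (2 * t + 2) = H (t + 1) + invSum t := by
  have h : ∀ d, H (t + d + 1) = H (t + 1) + ∑ i ∈ Finset.range d, 1 / (2 + ((t + i : ℕ) : ℝ)) := by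
    intro d
    induction d with
    | zero => simp
    | succ d ih =>
      rw [← add_assoc t, Finset.sum_range_succ, ← add_assoc (H _), ← ih, H_succ (t + d + 1)]
      push_cast
      ring
  rw [invSum, ← Finset.Ico_add_one_right_eq_Icc, Finset.sum_Ico_eq_sum_range,
    show 2 * t + 1 - t = t + 1 by omega, ← h, show t + (t + 1) + 1 = 2 * t + 2 by ring]

theorem psumSq_three (n : ℕ) : psumSq 3 n = H2 (n + 2) - 5 / 4 := by
  induction n with
  | zero =>
    rw [H2, show Finset.Icc 1 (0 + 2) = {1, 2} by decide, Finset.sum_pair (by norm_num), psumSq]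
    push_cast
    norm_num
  | succ n ih =>
    rw [psumSq, Finset.sum_range_succ, ← psumSq, ih, show n + 1 + 2 = (n + 2) + 1 by ring, H2_succ (n + 2)]
    push_cast
    ring

theorem tendsto_H2 : Tendsto H2 atTop (𝓝 (Real.pi ^ 2 / 6)) := by
  have h := hasSum_zeta_two.tendsto_sum_nat
  rw [← tendsto_add_atTop_iff_nat 1] at h
  refine h.congr fun n => ?_
  rw [Finset.sum_range_succ', H2]
  have e := Finset.sum_Ico_add' (fun i : ℕ => 1 / (i : ℝ) ^ 2) 0 n 1
  rw [← Finset.range_eq_Ico] at e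
  rw [show Finset.Icc 1 n = Finset.Ico (0 + 1) (n + 1) by ext; simp, ← e]
  simp

theorem H2_tail_le (N : ℕ) : Real.pi ^ 2 / 6 ≤ H2 N + 1 / (N + 1 / 2) := by
  have h : ∀ d : ℕ, H2 (N + d) + 1 / ((N + d : ℕ) + 1 / 2) ≤ H2 N + 1 / (N + 1 / 2) := by
    intro d
    induction d with
    | zero => simp
    | succ d ih =>
      refine le_trans ?_ ih
      rw [← add_assoc, H2_succ]
      have hn : (0 : ℝ) ≤ (N + d : ℕ) := Nat.cast_nonneg _
      push_cast at hn ⊢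
      set x : ℝ := N + d
      have : 1 / (x + 1) ^ 2 ≤ 1 / (x + 1 / 2) - 1 / (x + 1 + 1 / 2) := by
        rw [div_sub_div _ _ (by positivity) (by positivity), div_le_div_iff₀ (by positivity) (by positivity)]
        nlinarith
      linarith
  refine le_of_tendsto (tendsto_H2.comp (tendsto_add_atTop_nat N)) (Eventually.of_forall fun d => ?_)
  have := h d
  rw [add_comm N d] at this
  refine le_trans ?_ this
  rw [Function.comp_apply]
  have : (0 : ℝ) ≤ 1 / ((d + N : ℕ) + 1 / 2) := by positivity
  linarith

theorem sum_sq_lower (t : ℕ) :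
    1 / ((t : ℝ) + 2) - 1 / (2 * t + 3) +
      (1 / ((t + 2) * (t + 3)) - 1 / ((2 * t + 3) * (2 * t + 4))) / 2 ≤
      ∑ j ∈ Finset.Icc t (2 * t), 1 / ((j : ℝ) + 2) ^ 2 := by
  have h : ∀ d : ℕ, 1 / ((t : ℝ) + 2) - 1 / (t + d + 2) +
      (1 / ((t + 2) * (t + 3)) - 1 / ((t + d + 2) * (t + d + 3))) / 2 ≤
      ∑ i ∈ Finset.range d, 1 / (((t + i : ℕ) : ℝ) + 2) ^ 2 := by
    intro d
    induction d with
    | zero => simp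
    | succ d ih =>
      rw [Finset.sum_range_succ]
      refine le_trans ?_ (add_le_add_left ih _)
      have hx : (0 : ℝ) ≤ t + d := by positivity
      push_cast
      have e : (t : ℝ) + (d + 1) = t + d + 1 := by ring
      rw [e]
      set x : ℝ := t + d
      have : 1 / (x + 2) - 1 / (x + 1 + 2) +
          (1 / ((x + 2) * (x + 3)) - 1 / ((x + 1 + 2) * (x + 1 + 3))) / 2 ≤ 1 / (x + 2) ^ 2 := by
        have : 1 / (x + 2) ^ 2 - (1 / (x + 2) - 1 / (x + 1 + 2) +
          (1 / ((x + 2) * (x + 3)) - 1 / ((x + 1 + 2) * (x + 1 + 3))) / 2) =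
          2 / ((x + 2) ^ 2 * (x + 3) * (x + 4)) := by
          field_simp
          ring
        have h0 : 0 ≤ 2 / ((x + 2) ^ 2 * (x + 3) * (x + 4)) := by positivity
        linarith
      linarith
  have h1 := h (t + 1)
  rw [← Finset.Ico_add_one_right_eq_Icc, Finset.sum_Ico_eq_sum_range,
    show 2 * t + 1 - t = t + 1 by omega]
  refine le_trans (le_of_eq ?_) h1
  push_cast
  ring

theorem DX_pos (t : ℕ) : 0 < DX t := by
  have hm := H_eq_add t
  have hm0 := invSum_pos t
  rw [DX, hm, add_sub_cancel_left]
  refine mul_pos (by positivity) ?_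
  have h1 := H2_tail_le (2 * t + 2)
  have h2 := sum_sq_lower t
  have h3 := H2_eq_add t
  set h := ∑ j ∈ Finset.Icc t (2 * t), 1 / ((j : ℝ) + 2) ^ 2
  have ht : (0 : ℝ) ≤ t := t.cast_nonneg
  have e : (2 * (t : ℝ) + 3) / (t + 1) * H2 (2 * t + 2) - (t + 2) / (t + 1) * H2 (t + 1) =
      H2 (2 * t + 2) + (t + 2) / (t + 1) * h := by
    rw [h3]
    field_simp
    ring
  rw [e]
  have h4 := mul_le_mul_of_nonneg_left h2 (by positivity : 0 ≤ ((t : ℝ) + 2) / (t + 1))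
  have h5 : 1 / ((2 * t + 2 : ℕ) + 1 / 2 : ℝ) < ((t : ℝ) + 2) / (t + 1) *
      (1 / ((t : ℝ) + 2) - 1 / (2 * t + 3) +
        (1 / ((t + 2) * (t + 3)) - 1 / ((2 * t + 3) * (2 * t + 4))) / 2) := by
    have e2 : ((t : ℝ) + 2) / (t + 1) * (1 / ((t : ℝ) + 2) - 1 / (2 * t + 3) +
        (1 / ((t + 2) * (t + 3)) - 1 / ((2 * t + 3) * (2 * t + 4))) / 2) =
        (4 * t + 15) / (4 * (t + 3) * (2 * t + 3)) := by
      field_simp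
      ring
    rw [e2]
    push_cast
    rw [div_lt_div_iff₀ (by positivity) (by positivity)]
    nlinarith
  linarith

/-! ### The quadratic growth of the variance of the path length -/

theorem logDerivSumSq_two (t : ℕ) :
    logDerivSumSq t 2 = ((H2 (2 * t + 2) - H2 (t + 1) : ℝ) : ℂ) := by
  rw [H2_eq_add, add_sub_cancel_left, logDerivSumSq]
  push_cast
  exact Finset.sum_congr rfl fun j _ => by rw [add_comm]

theorem logDerivSumSq_three (t : ℕ) : logDerivSumSq t 3 =
    ((H2 (2 * t + 2) - H2 (t + 1) : ℝ) : ℂ) - 1 / (t + 2) ^ 2 + 1 / (2 * t + 3) ^ 2 := by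
  have h := logDerivSumSq_add_one t 2
  rw [show (2 : ℂ) + 1 = 3 by norm_num, logDerivSumSq_two] at h
  rw [h, add_comm (2 : ℂ) t, show (2 : ℂ) + (2 * t + 1) = 2 * t + 3 by ring]

theorem ofReal_DX (t : ℕ) : ((DX t : ℝ) : ℂ) =
    (xxCoeff t - 1 / (2 * invSum t ^ 2) -
      2 / invSum t ^ 2 * (((Real.pi ^ 2 / 6 : ℝ) : ℂ) - 5 / 4)) / 2 := by
  have him : (invSum t : ℂ) ≠ 0 := by exact_mod_cast (invSum_pos t).ne'
  have h1 : (t : ℂ) + 1 ≠ 0 := by exact_mod_cast (by omega : t + 1 ≠ 0)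
  have h2 : (t : ℂ) + 2 ≠ 0 := by exact_mod_cast (by omega : t + 2 ≠ 0)
  have h3 : 2 * (t : ℂ) + 3 ≠ 0 := by exact_mod_cast (by omega : 2 * t + 3 ≠ 0)
  rw [xxCoeff, logDerivSumSq_three, logDerivSum_three, psum_two_sub_psum_three, psumSq_three,
    show 2 * t + 1 + 2 = 2 * t + 2 + 1 by ring, H2_succ (2 * t + 2), DX, H_eq_add,
    add_sub_cancel_left]
  push_cast
  rw [show (2 * t + 2 + 1 : ℂ) = 2 * t + 3 by ring]
  generalize (H2 (2 * t + 2) : ℂ) = x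
  generalize (H2 (t + 1) : ℂ) = y
  generalize (Real.pi : ℂ) = p
  generalize (invSum t : ℂ) = m at *
  field_simp
  ring

theorem tendsto_eig_three : Tendsto (fun n : ℕ => eig (3 : ℂ) n / (n : ℂ) ^ 2) atTop (𝓝 (1 / 2)) := by
  have h := tendsto_eig 3
  have hG : Complex.Gamma 3 = 2 := by
    rw [show (3 : ℂ) = ((2 : ℕ) : ℂ) + 1 by norm_num, Complex.Gamma_nat_eq_factorial]
    norm_num
  rw [hG] at h
  refine h.congr fun n => ?_
  rw [show (3 : ℂ) - 1 = ((2 : ℕ) : ℂ) by norm_num, Complex.cpow_natCast]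

theorem xxLead_sub (t n : ℕ) :
    xxLead t n - (1 / invSum t * deig 2 n) * (1 / invSum t * deig 2 n) -
      (xxCoeff t - 1 / (2 * invSum t ^ 2) - 2 / invSum t ^ 2 * psumSq 3 n) * eig 3 n =
      1 / invSum t ^ 2 * (deig 2 n * psum 2 n + 2 * deig 2 n + (1 / 2 - psum 3 n + psum 2 n)) := by
  have him : (invSum t : ℂ) ≠ 0 := by exact_mod_cast (invSum_pos t).ne'
  have h := psum_add_one (a := 2) n
  have h2 : (2 : ℂ) + n ≠ 0 := by exact_mod_cast (by omega : 2 + n ≠ 0)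
  rw [show (2 : ℂ) + 1 = 3 by norm_num] at h
  rw [xxLead, ddeig, deig, deig, h, eig_three, eig_two']
  field_simp
  ring

theorem var_X_asymptotic (t : ℕ) :
    (fun n : ℕ => Var[X t n; permMeasure n]) ~[atTop] fun n : ℕ => DX t * (n : ℝ) ^ 2 := by
  obtain ⟨y, hy1, hy2, hy⟩ := exists_re_le (x := 2) (lo := 1) (t := t)
    (fun z hz => re_lt_two_of_mem hz) (by norm_num)
  obtain ⟨B, hB⟩ := xMean_expansion t
  set d := y - 1 with hd
  have hxe := hB d fun z hz => by linarith [hy z hz]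
  set x : ℕ → ℂ := fun n => ((xMean t n - B * (n + 1) : ℝ) : ℂ) with hx
  set g : ℕ → ℂ := fun n => 1 / invSum t * deig 2 n with hg
  set ε := (1 - d) / 2 with hε
  have hgb : PolyBound g (1 + ε) := (polyBound_deig (by norm_num; linarith)).const_mul _
  have hxg : PolyBound (fun n => x n - g n) d :=
    (hxe.add (PolyBound.const 2 (by linarith))).of_eq (N := 0) fun n _ => by simp only [hx, hg]; ring
  have hxb : PolyBound x (1 + ε) :=
    ((hxg.mono (e' := 1 + ε) (by linarith)).add hgb).of_eq (N := 0) fun n _ => by ring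
  set V : ℕ → ℂ := fun n => (covSeq (X t) (X t) n : ℂ) with hV
  have hM : ∀ n, 2 * t + 1 ≤ n → V n + x n * x n = 2 * avg t (fun n => V n + x n * x n) n +
      (2 * avg₂ t x x n + 2 * (n - 1) * x n - (n - 1) ^ 2) := by
    intro n hn
    have := congrArg (fun x : ℝ => (x : ℂ)) (covXX_rec B hn)
    simp only [Complex.ofReal_add, Complex.ofReal_sub, Complex.ofReal_mul, ofReal_avg,
      ofReal_avg₂, Complex.ofReal_ofNat, Complex.ofReal_natCast, Complex.ofReal_one,
      Complex.ofReal_pow] at this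
    simp only [hV, hx, Complex.ofReal_add, Complex.ofReal_sub, Complex.ofReal_mul,
      Complex.ofReal_natCast, Complex.ofReal_one]
    rw [this]
    ring
  have him : (invSum t : ℂ) ≠ 0 := by exact_mod_cast (invSum_pos t).ne'
  have hTU : PolyBound (fun n => (2 * avg₂ t x x n + 2 * (n - 1) * x n - (n - 1) ^ 2) -
      (2 * (1 / invSum t ^ 2 * avg₂ t (deig 2) (deig 2) n) +
      4 / invSum t * deig 3 n + (2 / invSum t - 2) * eig 3 n)) (2 - ε) := by
    have p1 : PolyBound (fun n => avg₂ t x x n - avg₂ t g g n) (2 - ε) :=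
      PolyBound.avg₂_sub hxg hxb hgb hxg (by linarith) (by linarith) (by linarith) (by linarith)
        (by linarith) (by linarith)
    have p2 : PolyBound (fun n => ((n : ℂ) + -1) * (x n - g n)) (2 - ε) :=
      (PolyBound.cast_add (e := 1) (-1) le_rfl).mul_le hxg (by linarith)
    have p3 : PolyBound (deig 2) (2 - ε) := polyBound_deig (by norm_num; linarith)
    have p4 : PolyBound (fun n => (n : ℂ) + 1) (2 - ε) := PolyBound.cast_add 1 (by linarith)
    have p5 : PolyBound (fun n => 5 * ((n : ℂ) + 1 / 5)) (2 - ε) :=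
      (PolyBound.cast_add (1 / 5) (by linarith)).const_mul 5
    refine ((((p1.const_mul 2).add (p2.const_mul 2)).add
      (((p3.const_mul (-3)).sub p4).const_mul (2 / invSum t : ℂ))).add p5).of_eq (N := 0) fun n _ => ?_
    have e1 : avg₂ t g g n = 1 / invSum t ^ 2 * avg₂ t (deig 2) (deig 2) n := by
      rw [hg, avg₂_const_mul_left, avg₂_const_mul_right]
      field_simp
    have e2 := deig_three n
    have e3 := eig_three n
    rw [e1, e3]
    simp only [hg]
    field_simp
    linear_combination (-2 * invSum t : ℂ) * e2
  have hR := PolyBound.of_recurrence (by linarith) hM (fun n hn => xxLead_rec hn) hTU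
  have hxx : PolyBound (fun n => x n * x n - g n * g n) (2 - ε) :=
    PolyBound.mul_sub hxg hxb hgb hxg (by linarith) (by linarith)
  have hps : PolyBound (fun n => deig 2 n * psum 2 n + 2 * deig 2 n +
      (1 / 2 - psum 3 n + psum 2 n)) (2 - ε) :=
    (((polyBound_deig (e := 1 + ε / 2) (by norm_num; linarith)).mul_le
      (polyBound_psum 2 (e := ε / 2) (by linarith)) (by linarith)).add
      ((polyBound_deig (by norm_num; linarith)).const_mul 2)).add
      (((PolyBound.const (1 / 2) (by linarith)).sub (polyBound_psum 3 (by linarith))).add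
        (polyBound_psum 2 (by linarith)))
  have hVe : PolyBound (fun n => V n - (xxCoeff t - 1 / (2 * invSum t ^ 2) -
      2 / invSum t ^ 2 * psumSq 3 n) * eig 3 n) (2 - ε) := by
    refine ((hR.sub hxx).add (hps.const_mul (1 / invSum t ^ 2 : ℂ))).of_eq (N := 0) fun n _ => ?_
    rw [← xxLead_sub]
    ring
  have hlo := hVe.isLittleO (e' := 2) (by linarith)
  have hlim : Tendsto (fun n : ℕ => V n / (n : ℂ) ^ 2) atTop (𝓝 (DX t : ℂ)) := by
    have h1 : Tendsto (fun n : ℕ => (V n - (xxCoeff t - 1 / (2 * invSum t ^ 2) -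
        2 / invSum t ^ 2 * psumSq 3 n) * eig 3 n) / (n : ℂ) ^ 2) atTop (𝓝 0) := by
      have h2 : (fun n : ℕ => V n - (xxCoeff t - 1 / (2 * invSum t ^ 2) -
          2 / invSum t ^ 2 * psumSq 3 n) * eig 3 n) =o[atTop] fun n : ℕ => (n : ℂ) ^ 2 := by
        refine hlo.trans_isBigO (IsBigO.of_bound 1 (Eventually.of_forall fun n => ?_))
        rw [Real.norm_of_nonneg (by positivity), norm_pow, Complex.norm_natCast, Real.rpow_two,
          one_mul]
      exact h2.tendsto_div_nhds_zero
    have h3 : Tendsto (fun n : ℕ => psumSq 3 n) atTop (𝓝 (((Real.pi ^ 2 / 6 : ℝ) : ℂ) - 5 / 4)) := by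
      refine Tendsto.congr (fun n => (psumSq_three n).symm) (Tendsto.sub_const ?_ _)
      exact (Complex.continuous_ofReal.tendsto _).comp
        (tendsto_H2.comp (tendsto_add_atTop_nat 2))
    have h4 := h1.add (((h3.const_mul (2 / invSum t ^ 2 : ℂ)).const_sub
      (xxCoeff t - 1 / (2 * invSum t ^ 2))).mul tendsto_eig_three)
    rw [zero_add, mul_one_div, ← ofReal_DX] at h4
    refine h4.congr fun n => ?_
    ring
  have hre : Tendsto (fun n : ℕ => covSeq (X t) (X t) n / (n : ℝ) ^ 2) atTop (𝓝 (DX t)) := by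
    have := (Complex.continuous_re.tendsto _).comp hlim
    rw [Complex.ofReal_re] at this
    refine this.congr fun n => ?_
    rw [Function.comp_apply, hV]
    simp only
    rw [← Complex.ofReal_natCast, ← Complex.ofReal_pow, ← Complex.ofReal_div, Complex.ofReal_re]
  have hD := (DX_pos t).ne'
  have hne : ∀ᶠ n : ℕ in atTop, DX t * (n : ℝ) ^ 2 ≠ 0 := by
    filter_upwards [eventually_ne_atTop 0] with n hn
    exact mul_ne_zero hD (pow_ne_zero 2 (Nat.cast_ne_zero.2 hn))
  rw [isEquivalent_iff_tendsto_one hne]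
  have := hre.div_const (DX t)
  rw [div_self hD] at this
  refine this.congr fun n => ?_
  rw [Pi.div_apply, var_X_eq_covSeq, div_div, mul_comm]

/-! ### The covariance beyond the phase transition -/

theorem PolyBound.conj {f : ℕ → ℂ} {e : ℝ} (hf : PolyBound f e) :
    PolyBound (fun n => starRingEnd ℂ (f n)) e := by
  obtain ⟨C, hC, h⟩ := hf
  exact ⟨C, hC, fun n => by rw [RCLike.norm_conj]; exact h n⟩

/-- The coefficient of `eig (ρ + 1)` in the contribution of `ρ` to the mixed second moment. -/
def sxCoeff (t : ℕ) (ρ : ℂ) : ℂ :=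
  ρ * (ρ + (2 * t + 1)) / (t + 1) + ρ / invSum t * (psum 2 t - psum (ρ + 1) (2 * t + 1)) -
    ρ / invSum t * ((ρ + t) / (t + 1)) * logDerivSum t (ρ + 1)

/-- The contribution of `ρ` to the mixed second moment of `𝒮_n` and `𝒳_n`. -/
def sxLead (t : ℕ) (ρ : ℂ) (n : ℕ) : ℂ :=
  ρ / invSum t * deig (ρ + 1) n + sxCoeff t ρ * eig (ρ + 1) n

theorem sxLead_rec {t n : ℕ} (hn : 2 * t + 1 ≤ n) {ρ : ℂ} (hρ : indProd t ρ = 2) (h0 : 0 < ρ.re) :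
    sxLead t ρ n = 2 * avg t (sxLead t ρ) n +
      (2 / invSum t * avg₂ t (eig ρ) (deig 2) n + ρ * eig (ρ + 1) n) := by
  have him : (invSum t : ℂ) ≠ 0 := by exact_mod_cast (invSum_pos t).ne'
  have h1 : (t : ℂ) + 1 ≠ 0 := by exact_mod_cast (by omega : t + 1 ≠ 0)
  have h2 : ρ + t ≠ 0 := add_natCast_ne_zero h0 t
  have h3 : ρ + (2 * t + 1) ≠ 0 := by
    have := add_natCast_ne_zero h0 (2 * t + 1)
    push_cast at this
    exact this
  have h4 : 0 < (ρ + 1).re := by rw [Complex.add_re, Complex.one_re]; linarith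
  have hi := indProd_add_one t ρ
  rw [hρ] at hi
  have ha : avg t (sxLead t ρ) n = ρ / invSum t * avg t (deig (ρ + 1)) n +
      sxCoeff t ρ * avg t (eig (ρ + 1)) n := by
    have : sxLead t ρ = fun n => ρ / invSum t * deig (ρ + 1) n + sxCoeff t ρ * eig (ρ + 1) n := rfl
    rw [this, avg_add, avg_const_mul, avg_const_mul]
  have hi0 : indProd t (ρ + 1) ≠ 0 := by
    intro h
    rw [h, mul_zero] at hi
    exact mul_ne_zero h3 two_ne_zero hi.symm
  have e2 := avg_deig_mul hn h4
  have e3 := avg_eig_mul hn (ρ + 1)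
  have e4 := avg₂_eig_deig_mul hn (a := ρ) (b := 2) (by norm_num) (by
    rw [show ρ + 2 - 1 = ρ + 1 by ring]; exact h4)
  rw [show ρ + 2 - 1 = ρ + 1 by ring, eig_two_mul_add_one, eig_two'] at e4
  have hm := add_mul_eig ρ t
  have he0 := eig_root_ne_zero hρ
  have hmul : 2 * (ρ + (2 * t + 1)) ≠ 0 := mul_ne_zero two_ne_zero h3
  have k2 : avg t (deig (ρ + 1)) n = (ρ + t) / (2 * (ρ + (2 * t + 1))) *
      (deig (ρ + 1) n - logDerivSum t (ρ + 1) * eig (ρ + 1) n) := by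
    rw [← e2, div_mul_eq_mul_div, eq_div_iff hmul]
    linear_combination -avg t (deig (ρ + 1)) n * hi
  have k3 : avg t (eig (ρ + 1)) n = (ρ + t) / (2 * (ρ + (2 * t + 1))) * eig (ρ + 1) n := by
    rw [← e3, div_mul_eq_mul_div, eq_div_iff hmul]
    linear_combination -avg t (eig (ρ + 1)) n * hi
  have k4 : avg₂ t (eig ρ) (deig 2) n = ρ * (t + 1) / (2 * (ρ + (2 * t + 1))) *
      (deig (ρ + 1) n + (psum 2 t - psum (ρ + 1) (2 * t + 1)) * eig (ρ + 1) n) := by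
    rw [div_mul_eq_mul_div, eq_div_iff hmul, ← mul_right_inj' he0, deig]
    linear_combination ρ * e4 + avg₂ t (eig ρ) (deig 2) n * indProd t (ρ + 1) * hm -
      avg₂ t (eig ρ) (deig 2) n * eig ρ t * hi
  rw [ha, k2, k3, k4, sxLead, sxCoeff]
  generalize psum 2 t - psum (ρ + 1) (2 * t + 1) = u
  generalize logDerivSum t (ρ + 1) = l
  generalize deig (ρ + 1) n = y
  generalize eig (ρ + 1) n = z
  generalize (invSum t : ℂ) = m at *
  field_simp
  ring

theorem sxLead_sub (t n : ℕ) (ρ : ℂ) :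
    sxLead t ρ n - eig ρ n * (1 / invSum t * deig 2 n) =
      eig (ρ + 1) n * (ρ / invSum t * (psum (ρ + 1) n - psum 2 n) + sxCoeff t ρ) -
        (1 - ρ) / invSum t * (eig ρ n * psum 2 n) := by
  have h := add_mul_eig ρ n
  rw [sxLead, deig, deig, eig_two']
  linear_combination -(1 / invSum t * psum 2 n : ℂ) * h

theorem invSum_eq (t : ℕ) : (invSum t : ℂ) = (H (2 * t + 2) : ℂ) - (H (t + 1) : ℂ) := by
  rw [H_eq_add]
  push_cast
  ring

/-- The limit of the contribution of `ρ` in terms of the digamma function. -/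
theorem sx_limit_eq {t : ℕ} {ρ : ℂ} (h0 : 0 < ρ.re) :
    1 / Complex.Gamma (ρ + 1) * (ρ / invSum t * (Complex.digamma 2 - Complex.digamma (ρ + 1)) +
      sxCoeff t ρ) = 1 / Complex.Gamma ρ *
    ((ρ + 2 * t + 1) / (t + 1) -
      ((ρ + 2 * t + 1) * Complex.digamma (ρ + 2 * t + 2)
        - (ρ + t) * Complex.digamma (ρ + t + 1)
        - (t + 1) * ((H (t + 1) : ℂ) - (Real.eulerMascheroniConstant : ℂ))) /
      ((t + 1) * ((H (2 * t + 2) : ℂ) - (H (t + 1) : ℂ)))) := by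
  have hρ0 : ρ ≠ 0 := by rintro rfl; simp at h0
  have h4 : 0 < (ρ + 1).re := by rw [Complex.add_re, Complex.one_re]; linarith
  have him : (invSum t : ℂ) ≠ 0 := by exact_mod_cast (invSum_pos t).ne'
  have h1 : (t : ℂ) + 1 ≠ 0 := by exact_mod_cast (by omega : t + 1 ≠ 0)
  have hG := Complex.Gamma_ne_zero_of_re_pos h0
  have d1 : psum 2 t + Complex.digamma 2 = (H (t + 1) : ℂ) - (Real.eulerMascheroniConstant : ℂ) := by
    have e1 := psum_eq_digamma (a := 2) (by norm_num) t
    have e2 := digamma_nat_add_one (t + 1)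
    rw [show (2 : ℂ) + t = ((t + 1 : ℕ) : ℂ) + 1 by push_cast; ring, e2] at e1
    linear_combination e1
  have d2 := psum_eq_digamma h4 t
  have d3 := psum_eq_digamma h4 (2 * t + 1)
  have d4 := psum_two_mul_add_one t (ρ + 1)
  rw [show ρ + 1 + t = ρ + t + 1 by ring] at d2
  rw [show ρ + 1 + ((2 * t + 1 : ℕ) : ℂ) = ρ + 2 * t + 2 by push_cast; ring] at d3
  have d5 : logDerivSum t (ρ + 1) = Complex.digamma (ρ + 2 * t + 2) - Complex.digamma (ρ + t + 1) := by
    linear_combination d3 - d4 - d2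
  rw [Complex.Gamma_add_one _ hρ0, ← invSum_eq, ← d1, sxCoeff, d5, d3]
  field_simp
  ring

theorem isLittleO_sub_cpow {w : ℕ → ℂ} {p L : ℂ} (hp : 0 < p.re)
    (hlim : Tendsto (fun n : ℕ => w n / (n : ℂ) ^ p) atTop (𝓝 L)) :
    (fun n : ℕ => w n - (n : ℂ) ^ p * L) =o[atTop] fun n : ℕ => (n : ℝ) ^ p.re := by
  have hnorm : ∀ n : ℕ, ‖(n : ℂ) ^ p‖ = (n : ℝ) ^ p.re := fun n =>
    Complex.norm_natCast_cpow_of_re_ne_zero n hp.ne'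
  have e1 : (fun n : ℕ => w n - (n : ℂ) ^ p * L) =o[atTop] fun n : ℕ => (n : ℂ) ^ p := by
    rw [isLittleO_iff_tendsto' ?_]
    · have := hlim.sub_const L
      rw [sub_self] at this
      refine this.congr' ?_
      filter_upwards [eventually_ne_atTop 0] with n hn
      have : (n : ℂ) ^ p ≠ 0 := by
        rw [← norm_ne_zero_iff, hnorm]
        positivity
      field_simp
    · filter_upwards [eventually_ne_atTop 0] with n hn h'
      rw [← norm_eq_zero, hnorm] at h'
      exact absurd h' (by positivity)
  refine e1.trans_isBigO (IsBigO.of_bound 1 (Eventually.of_forall fun n => ?_))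
  rw [hnorm, Real.norm_of_nonneg (by positivity), one_mul]

theorem natCast_cpow {n : ℕ} (hn : n ≠ 0) (ρ : ℂ) :
    (n : ℂ) ^ ρ = ((n : ℝ) ^ ρ.re : ℝ) * Complex.exp (Complex.I * (ρ.im * Real.log n : ℝ)) := by
  have hn' : (n : ℂ) ≠ 0 := Nat.cast_ne_zero.2 hn
  have hnp : (0 : ℝ) < n := by positivity
  rw [Complex.cpow_def_of_ne_zero hn', Real.rpow_def_of_pos hnp, Complex.ofReal_exp, ← Complex.exp_add,
    ← Complex.natCast_log]
  congr 1
  push_cast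
  nth_rewrite 1 [← Complex.re_add_im ρ]
  ring

theorem G₂_mul {t n : ℕ} (hn : n ≠ 0) {ρ : ℂ} (h0 : 0 < ρ.re) :
    ((G₂ t ρ (ρ.im * Real.log n) * (n : ℝ) ^ ρ.re : ℝ) : ℂ) =
      sCoeff t ρ * ((n : ℂ) ^ ρ * (1 / Complex.Gamma (ρ + 1) *
        (ρ / invSum t * (Complex.digamma 2 - Complex.digamma (ρ + 1)) + sxCoeff t ρ))) +
      starRingEnd ℂ (sCoeff t ρ * ((n : ℂ) ^ ρ * (1 / Complex.Gamma (ρ + 1) *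
        (ρ / invSum t * (Complex.digamma 2 - Complex.digamma (ρ + 1)) + sxCoeff t ρ)))) := by
  rw [Complex.add_conj, sx_limit_eq h0, natCast_cpow hn, G₂, C₂_eq_sCoeff, mul_assoc, mul_comm _ ((n : ℝ) ^ ρ.re),
    ← Complex.re_ofReal_mul]
  congr 3
  ring

theorem IsSecondZero.re_le {t : ℕ} {ρ : ℂ} (h : IsSecondZero t ρ) :
    ∀ z ∈ (indRoots t).erase 2, z.re ≤ ρ.re := by
  intro z hz
  by_cases h1 : z = ρ
  · rw [h1]
  · by_cases h2 : z = starRingEnd ℂ ρ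
    · rw [h2, Complex.conj_re]
    · exact (h.re_lt z (indicial_eq_zero_iff.2 (mem_indRoots.1 (Finset.mem_of_mem_erase hz)))
        (Finset.ne_of_mem_erase hz) h1 h2).le

theorem cov_asymptotic {t : ℕ} {ρ : ℂ} (h : IsSecondZero t ρ) (h1 : 1 < ρ.re) :
    (fun n : ℕ => cov[S t n, X t n; permMeasure n] - G₂ t ρ (ρ.im * Real.log n) * (n : ℝ) ^ ρ.re)
      =o[atTop] fun n : ℕ => (n : ℝ) ^ ρ.re := by
  have h0 : 0 < ρ.re := by linarith
  have h4 : 0 < (ρ + 1).re := by rw [Complex.add_re, Complex.one_re]; linarith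
  have h2 := h.re_lt_two
  obtain ⟨d, hd1, hd2, hsd⟩ := h.exists_expansion h1
  obtain ⟨B, hB⟩ := xMean_expansion t
  have hxe := hB (ρ.re - 1) fun z hz => by linarith [h.re_le z hz]
  set s : ℕ → ℂ := fun n => (sDev t n : ℂ) with hs
  set x : ℕ → ℂ := fun n => ((xMean t n - B * (n + 1) : ℝ) : ℂ) with hx
  set c := sCoeff t ρ with hc
  set σ : ℕ → ℂ := fun n => c * eig ρ n + starRingEnd ℂ (c * eig ρ n) with hσ
  set g : ℕ → ℂ := fun n => 1 / invSum t * deig 2 n with hg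
  set ε := (ρ.re - (d + 1)) / 2 with hε
  set e := max (d + 1 + ε) (2 * ρ.re - 2) with he
  have he1 : d + 1 + ε ≤ e := le_max_left _ _
  have he2 : 2 * ρ.re - 2 ≤ e := le_max_right _ _
  have he3 : e < ρ.re := max_lt (by linarith) (by linarith)
  have hgb : PolyBound g (1 + ε) := (polyBound_deig (by norm_num; linarith)).const_mul _
  have hxg : PolyBound (fun n => x n - g n) (ρ.re - 1) :=
    (hxe.add (PolyBound.const 2 (by linarith))).of_eq (N := 0) fun n _ => by simp only [hx, hg]; ring
  have hxb : PolyBound x (1 + ε) :=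
    ((hxg.mono (e' := 1 + ε) (by linarith)).add hgb).of_eq (N := 0) fun n _ => by ring
  have hce : PolyBound (fun n => c * eig ρ n) (ρ.re - 1) := (PolyBound.eig le_rfl).const_mul _
  have hσb : PolyBound σ (ρ.re - 1) := hce.add hce.conj
  set C : ℕ → ℂ := fun n => (covSeq (S t) (X t) n : ℂ) with hC
  have hM : ∀ n, 2 * t + 1 ≤ n → C n + s n * x n = 2 * avg t (fun n => C n + s n * x n) n +
      (2 * avg₂ t s x n + (n - 1) * s n) := by
    intro n hn
    have := congrArg (fun x : ℝ => (x : ℂ)) (covSX_rec B hn)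
    simp only [Complex.ofReal_add, Complex.ofReal_sub, Complex.ofReal_mul, ofReal_avg,
      ofReal_avg₂, Complex.ofReal_ofNat, Complex.ofReal_natCast, Complex.ofReal_one] at this
    simp only [hC, hs, hx, Complex.ofReal_add, Complex.ofReal_sub, Complex.ofReal_mul,
      Complex.ofReal_natCast, Complex.ofReal_one]
    rw [this]
    ring
  set A : ℕ → ℂ := fun n => c * sxLead t ρ n + starRingEnd ℂ (c * sxLead t ρ n) with hA
  set u : ℕ → ℂ := fun n => c * (2 / invSum t * avg₂ t (eig ρ) (deig 2) n + ρ * eig (ρ + 1) n) with hu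
  have hArec : ∀ n, 2 * t + 1 ≤ n → A n = 2 * avg t A n + (u n + starRingEnd ℂ (u n)) := by
    intro n hn
    have e1 : avg t A n = c * avg t (sxLead t ρ) n + starRingEnd ℂ (c * avg t (sxLead t ρ) n) := by
      rw [hA, avg_add, ← conj_avg t (fun n => c * sxLead t ρ n), avg_const_mul]
    have e2 : c * sxLead t ρ n = 2 * (c * avg t (sxLead t ρ) n) + u n := by
      rw [sxLead_rec hn h.root h0, hu]
      ring
    rw [e1]
    simp only [hA]
    rw [e2, map_add, map_mul, Complex.conj_ofNat]
    ring
  have hTU : PolyBound (fun n => (2 * avg₂ t s x n + (n - 1) * s n) - (u n + starRingEnd ℂ (u n))) e := by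
    have p1 : PolyBound (fun n => avg₂ t s x n - avg₂ t σ g n) e :=
      PolyBound.avg₂_sub hsd hxb hσb hxg (by linarith) (by linarith) (by linarith) (by linarith)
        (by linarith) (by linarith)
    have p2 : PolyBound (fun n => ((n : ℂ) + -1) * (s n - σ n)) e :=
      (PolyBound.cast_add (e := 1) (-1) le_rfl).mul_le hsd (by linarith)
    have p3 : PolyBound (fun n => (-(1 + ρ)) * (c * eig ρ n)) e :=
      (hce.const_mul _).mono (by linarith)
    refine (((p1.const_mul 2).add p2).add (p3.add p3.conj)).of_eq (N := 0) fun n _ => ?_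
    have e1 : avg₂ t σ g n = c / invSum t * avg₂ t (eig ρ) (deig 2) n +
        starRingEnd ℂ (c / invSum t * avg₂ t (eig ρ) (deig 2) n) := by
      have e2 : avg₂ t (fun n => starRingEnd ℂ (c * eig ρ n)) g n =
          starRingEnd ℂ (avg₂ t (fun n => c * eig ρ n) g n) := by
        rw [conj_avg₂]
        congr 1
        funext k
        simp only [hg]
        rw [map_mul, conj_deig, Complex.conj_ofNat, map_div₀, map_one, Complex.conj_ofReal]
      have e3 : avg₂ t (fun n => c * eig ρ n) g n = c / invSum t * avg₂ t (eig ρ) (deig 2) n := by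
        rw [hg, avg₂_const_mul_left, avg₂_const_mul_right]
        ring
      rw [hσ, avg₂_add_left, e2, e3]
    have e3 := add_mul_eig ρ n
    have e4 : u n = 2 * (c / invSum t * avg₂ t (eig ρ) (deig 2) n) + c * ((ρ + n) * eig ρ n) := by
      rw [e3, hu]
      ring
    rw [e1, e4]
    simp only [hσ, map_add, map_mul, Complex.conj_ofNat, Complex.conj_natCast, map_neg, map_one]
    ring
  have hR := PolyBound.of_recurrence (by linarith) hM hArec hTU
  have hsx : PolyBound (fun n => s n * x n - σ n * g n) e :=
    PolyBound.mul_sub hsd hxb hσb hxg (by linarith) (by linarith)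
  set w : ℕ → ℂ := fun n => eig (ρ + 1) n * (ρ / invSum t * (psum (ρ + 1) n - psum 2 n) + sxCoeff t ρ)
    with hw
  have hps : PolyBound (fun n => c * ((1 - ρ) / invSum t * (eig ρ n * psum 2 n))) e :=
    (((PolyBound.eig (a := ρ) (e := ρ.re - 1) le_rfl).mul_le (polyBound_psum 2 (e := ε) (by linarith))
      (by linarith)).const_mul _).const_mul _
  have hCw : PolyBound (fun n => C n - (c * w n + starRingEnd ℂ (c * w n))) e := by
    refine ((hR.sub hsx).sub (hps.add hps.conj)).of_eq (N := 0) fun n _ => ?_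
    have e1 : c * w n = c * sxLead t ρ n - c * eig ρ n * g n +
        c * ((1 - ρ) / invSum t * (eig ρ n * psum 2 n)) := by
      have := sxLead_sub t n ρ
      simp only [hw, hg]
      linear_combination -c * this
    have e2 : starRingEnd ℂ (g n) = g n := by
      simp only [hg]
      rw [map_mul, conj_deig, Complex.conj_ofNat, map_div₀, map_one, Complex.conj_ofReal]
    rw [e1]
    simp only [hA, hσ, map_add, map_sub]
    rw [map_mul (starRingEnd ℂ) (c * eig ρ n) (g n), e2]
    ring
  set L := 1 / Complex.Gamma (ρ + 1) * (ρ / invSum t * (Complex.digamma 2 - Complex.digamma (ρ + 1)) +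
    sxCoeff t ρ) with hL
  have hlim : Tendsto (fun n : ℕ => w n / (n : ℂ) ^ ρ) atTop (𝓝 L) := by
    have e1 := tendsto_eig (ρ + 1)
    rw [add_sub_cancel_right] at e1
    have e2 := (((tendsto_psum_sub_psum h4 (b := 2) (by norm_num)).const_mul
      (ρ / invSum t : ℂ)).add_const (sxCoeff t ρ))
    refine (e1.mul e2).congr fun n => ?_
    simp only [hw]
    ring
  have hwo := (isLittleO_sub_cpow h0 hlim).const_mul_left c
  have hwc : (fun n : ℕ => starRingEnd ℂ (c * (w n - (n : ℂ) ^ ρ * L))) =o[atTop]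
      fun n : ℕ => (n : ℝ) ^ ρ.re := by
    refine isLittleO_norm_left.1 ?_
    simpa only [RCLike.norm_conj] using hwo.norm_left
  have hall := (hCw.isLittleO he3).add (hwo.add hwc)
  rw [← isLittleO_norm_left] at hall ⊢
  refine hall.congr' ?_ EventuallyEq.rfl
  filter_upwards [eventually_ne_atTop 0] with n hn
  rw [cov_eq_covSeq, ← Complex.norm_real, Complex.ofReal_sub, G₂_mul hn h0, ← hL, ← hc]
  congr 1
  simp only [hC, map_mul, map_sub]
  ring

/-! ### The Gamma quotient in the variance of the number of nodes -/

theorem betaIntegral_self (t : ℕ) :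
    Complex.betaIntegral (t + 1) (t + 1) = (t ! : ℂ) ^ 2 / (2 * t + 1)! := by
  have h : 0 < ((t : ℂ) + 1).re := by
    rw [Complex.add_re, Complex.natCast_re, Complex.one_re]
    positivity
  rw [Complex.betaIntegral_eq_Gamma_mul_div _ _ h h, Complex.Gamma_nat_eq_factorial,
    show (t : ℂ) + 1 + (t + 1) = ((2 * t + 1 : ℕ) : ℂ) + 1 by push_cast; ring,
    Complex.Gamma_nat_eq_factorial, sq]

theorem betaIntegral_add_mul_indProd {t : ℕ} {a : ℂ} (ha : 0 < a.re) :
    Complex.betaIntegral (a + t) (t + 1) * indProd t a = (t ! : ℂ) ^ 2 / (2 * t + 1)! := by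
  have h1 : 0 < ((t : ℂ) + 1).re := by
    rw [Complex.add_re, Complex.natCast_re, Complex.one_re]
    positivity
  have h2 : ∀ n : ℕ, 0 < (a + n).re := fun n => by
    rw [Complex.add_re, Complex.natCast_re]
    positivity
  have h3 := eig_two_mul_add_one t a
  rw [eig_eq_Gamma ha, eig_eq_Gamma ha] at h3
  have g0 := Complex.Gamma_ne_zero_of_re_pos ha
  have g1 := Complex.Gamma_ne_zero_of_re_pos (h2 (2 * t + 1))
  have f1 : (t ! : ℂ) ≠ 0 := Nat.cast_ne_zero.2 t.factorial_ne_zero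
  have f2 : ((2 * t + 1)! : ℂ) ≠ 0 := Nat.cast_ne_zero.2 (Nat.factorial_ne_zero _)
  rw [Complex.betaIntegral_eq_Gamma_mul_div _ _ (h2 t) h1, Complex.Gamma_nat_eq_factorial,
    show a + t + (t + 1) = a + ((2 * t + 1 : ℕ) : ℂ) by push_cast; ring]
  field_simp at h3 ⊢
  linear_combination -h3

theorem betaIntegral_root {t : ℕ} {ρ : ℂ} (hρ : indProd t ρ = 2) (h0 : 0 < ρ.re) :
    2 * Complex.betaIntegral (ρ + t) (t + 1) = Complex.betaIntegral (t + 1) (t + 1) := by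
  rw [betaIntegral_self, ← betaIntegral_add_mul_indProd h0, hρ, mul_comm]

theorem indProd_re_lt_norm {t : ℕ} {z : ℂ} (h0 : 0 < z.re) (him : z.im ≠ 0) :
    indProd t z.re < ‖indProd t z‖ := by
  rw [indProd, indProd, norm_prod]
  refine Finset.prod_lt_prod_of_nonempty (fun j _ => by positivity) (fun j _ => ?_)
    ⟨t, Finset.mem_Icc.2 ⟨le_rfl, by omega⟩⟩
  have e : (j + 1 : ℂ) = ((j + 1 : ℝ) : ℂ) := by push_cast; ring
  rw [norm_div, e, Complex.norm_real, Real.norm_of_nonneg (by positivity)]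
  refine div_lt_div_of_pos_right ?_ (by positivity)
  have h1 : (z + j).re = z.re + j := by simp
  have h2 : |(z + j).re| < ‖z + j‖ := Complex.abs_re_lt_norm.2 (by simpa using him)
  rw [h1, abs_of_nonneg (by positivity)] at h2
  exact h2

/-- The function `x^(ρ-1) + (1-x)^(ρ-1) - 1`. -/
def powDefect (ρ : ℂ) (x : ℝ) : ℂ := (x : ℂ) ^ (ρ - 1) + (1 - (x : ℂ)) ^ (ρ - 1) - 1

theorem continuous_powDefect {ρ : ℂ} (h1 : 1 < ρ.re) : Continuous (powDefect ρ) := by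
  have h : 0 < (ρ - 1).re := by rw [Complex.sub_re, Complex.one_re]; linarith
  have e1 := Complex.continuous_ofReal_cpow_const h
  have e2 : Continuous fun x : ℝ => (1 - (x : ℂ)) ^ (ρ - 1) := by
    refine (e1.comp (continuous_const.sub continuous_id : Continuous fun x : ℝ => 1 - x)).congr
      fun x => ?_
    simp
  exact (e1.add e2).sub continuous_const

theorem conj_powDefect {ρ : ℂ} {x : ℝ} (hx : x ∈ Set.Icc (0 : ℝ) 1) :
    starRingEnd ℂ (powDefect ρ x) = powDefect (starRingEnd ℂ ρ) x := by
  have e : ∀ y : ℝ, 0 ≤ y → starRingEnd ℂ ((y : ℂ) ^ (ρ - 1)) = (y : ℂ) ^ (starRingEnd ℂ ρ - 1) := by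
    intro y hy
    rw [← map_one (starRingEnd ℂ), ← map_sub, Complex.cpow_conj _ _ (by
      rw [Complex.arg_ofReal_of_nonneg hy]; exact Real.pi_pos.ne), Complex.conj_ofReal, map_one]
  have e1 := e (1 - x) (by linarith [hx.2])
  push_cast at e1
  rw [powDefect, powDefect, map_sub, map_add, e x hx.1, e1, map_one]

theorem powDefect_half_ne_zero {ρ : ℂ} (h2 : ρ.re < 2) : powDefect ρ (1 / 2) ≠ 0 := by
  intro h
  have e : (1 - ((1 / 2 : ℝ) : ℂ)) = ((1 / 2 : ℝ) : ℂ) := by push_cast; norm_num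
  rw [powDefect, e, ← two_mul, sub_eq_zero] at h
  have := congrArg norm h
  rw [norm_mul, Complex.norm_ofNat, norm_one, Complex.norm_cpow_eq_rpow_re_of_pos (by norm_num),
    Complex.sub_re, Complex.one_re] at this
  have h3 : (1 / 2 : ℝ) ^ (1 : ℝ) < (1 / 2) ^ (ρ.re - 1) :=
    Real.rpow_lt_rpow_of_exponent_gt (by norm_num) (by norm_num) (by linarith)
  rw [Real.rpow_one] at h3
  linarith

/-- The integral of `x^t (1-x)^t` against the product of two functions `powDefect`. -/
def defectIntegral (t : ℕ) (ρ σ : ℂ) : ℂ :=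
  ∫ x : ℝ in (0 : ℝ)..1, ((x : ℂ) ^ t * (1 - (x : ℂ)) ^ t) * (powDefect ρ x * powDefect σ x)

theorem defectIntegral_eq {t : ℕ} {ρ σ : ℂ} (hρ : indProd t ρ = 2) (hσ : indProd t σ = 2)
    (h1 : 1 < ρ.re) (h2 : 1 < σ.re) :
    defectIntegral t ρ σ = 2 * Complex.betaIntegral (ρ + σ - 1 + t) (t + 1) +
      2 * Complex.betaIntegral (ρ + t) (σ + t) - Complex.betaIntegral (t + 1) (t + 1) := by
  have p1 : 0 < ((t : ℂ) + 1).re := by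
    rw [Complex.add_re, Complex.natCast_re, Complex.one_re]
    positivity
  have p2 : ∀ a : ℂ, 0 < a.re → 0 < (a + t).re := fun a ha => by
    rw [Complex.add_re, Complex.natCast_re]
    positivity
  have hν : 0 < (ρ + σ - 1).re := by
    rw [Complex.sub_re, Complex.add_re, Complex.one_re]
    linarith
  have q1 := p2 ρ (by linarith)
  have q2 := p2 σ (by linarith)
  have q3 := p2 _ hν
  have key : defectIntegral t ρ σ = Complex.betaIntegral (ρ + σ - 1 + t) (t + 1) +
      Complex.betaIntegral (t + 1) (ρ + σ - 1 + t) + Complex.betaIntegral (ρ + t) (σ + t) +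
      Complex.betaIntegral (σ + t) (ρ + t) + Complex.betaIntegral (t + 1) (t + 1) -
      Complex.betaIntegral (ρ + t) (t + 1) - Complex.betaIntegral (t + 1) (ρ + t) -
      Complex.betaIntegral (σ + t) (t + 1) - Complex.betaIntegral (t + 1) (σ + t) := by
    have i1 := Complex.betaIntegral_convergent q3 p1
    have i2 := Complex.betaIntegral_convergent p1 q3
    have i3 := Complex.betaIntegral_convergent q1 q2
    have i4 := Complex.betaIntegral_convergent q2 q1
    have i5 := Complex.betaIntegral_convergent p1 p1
    have i6 := Complex.betaIntegral_convergent q1 p1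
    have i7 := Complex.betaIntegral_convergent p1 q1
    have i8 := Complex.betaIntegral_convergent q2 p1
    have i9 := Complex.betaIntegral_convergent p1 q2
    simp only [Complex.betaIntegral]
    rw [← intervalIntegral.integral_add i1 i2, ← intervalIntegral.integral_add (i1.add i2) i3,
      ← intervalIntegral.integral_add ((i1.add i2).add i3) i4,
      ← intervalIntegral.integral_add (((i1.add i2).add i3).add i4) i5,
      ← intervalIntegral.integral_sub ((((i1.add i2).add i3).add i4).add i5) i6,
      ← intervalIntegral.integral_sub (((((i1.add i2).add i3).add i4).add i5).sub i6) i7,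
      ← intervalIntegral.integral_sub ((((((i1.add i2).add i3).add i4).add i5).sub i6).sub i7) i8,
      ← intervalIntegral.integral_sub
        (((((((i1.add i2).add i3).add i4).add i5).sub i6).sub i7).sub i8) i9, defectIntegral]
    refine intervalIntegral.integral_congr_Ioo_of_le zero_le_one fun x hx => ?_
    have hx0 : (x : ℂ) ≠ 0 := Complex.ofReal_ne_zero.2 hx.1.ne'
    have hx1 : 1 - (x : ℂ) ≠ 0 := by
      rw [← Complex.ofReal_one, ← Complex.ofReal_sub]
      exact Complex.ofReal_ne_zero.2 (sub_ne_zero.2 hx.2.ne')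
    have g1 : ∀ y : ℂ, y ≠ 0 → ∀ a : ℂ, y ^ (a + t - 1) = y ^ (a - 1) * y ^ t := fun y hy a => by
      rw [← Complex.cpow_natCast, ← Complex.cpow_add _ _ hy]
      congr 1
      ring
    have g2 : ∀ y : ℂ, y ^ ((t : ℂ) + 1 - 1) = y ^ t := fun y => by
      rw [add_sub_cancel_right, Complex.cpow_natCast]
    have g3 : ∀ y : ℂ, y ≠ 0 → y ^ (ρ + σ - 1 + t - 1) = y ^ (ρ - 1) * y ^ (σ - 1) * y ^ t :=
      fun y hy => by
        rw [← Complex.cpow_natCast, ← Complex.cpow_add _ _ hy, ← Complex.cpow_add _ _ hy]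
        congr 1
        ring
    simp only [powDefect, g3 _ hx0, g3 _ hx1, g1 _ hx0, g1 _ hx1, g2]
    ring
  have s1 := Complex.betaIntegral_symm (ρ + σ - 1 + t) (t + 1)
  have s2 := Complex.betaIntegral_symm (ρ + t) (σ + t)
  have s3 := Complex.betaIntegral_symm (ρ + t) (t + 1)
  have s4 := Complex.betaIntegral_symm (σ + t) (t + 1)
  have b1 := betaIntegral_root hρ (by linarith)
  have b2 := betaIntegral_root hσ (by linarith)
  rw [key, s1, s2, s3, s4]
  linear_combination -b1 - b2

/-- The integral of `x^t (1-x)^t` against the square of the modulus of `powDefect`. -/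
def defectNorm (t : ℕ) (ρ : ℂ) : ℝ :=
  ∫ x : ℝ in (0 : ℝ)..1, (x ^ t * (1 - x) ^ t) * ‖powDefect ρ x‖ ^ 2

theorem defectIntegral_conj (t : ℕ) (ρ : ℂ) :
    defectIntegral t ρ (starRingEnd ℂ ρ) = (defectNorm t ρ : ℂ) := by
  rw [defectIntegral, defectNorm, ← intervalIntegral.integral_ofReal]
  refine intervalIntegral.integral_congr fun x hx => ?_
  rw [Set.uIcc_of_le zero_le_one] at hx
  rw [← conj_powDefect hx, Complex.mul_conj, Complex.normSq_eq_norm_sq]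
  push_cast
  ring

theorem norm_defectIntegral_le (t : ℕ) (ρ : ℂ) : ‖defectIntegral t ρ ρ‖ ≤ defectNorm t ρ := by
  rw [defectIntegral, defectNorm]
  refine (intervalIntegral.norm_integral_le_integral_norm zero_le_one).trans_eq ?_
  refine intervalIntegral.integral_congr fun x hx => ?_
  rw [Set.uIcc_of_le zero_le_one] at hx
  have e : 1 - (x : ℂ) = ((1 - x : ℝ) : ℂ) := by push_cast; ring
  rw [norm_mul, norm_mul, norm_mul, norm_pow, norm_pow, e, Complex.norm_real, Complex.norm_real,
    Real.norm_of_nonneg hx.1, Real.norm_of_nonneg (by linarith [hx.2]), sq]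

theorem defectNorm_pos {t : ℕ} {ρ : ℂ} (h1 : 1 < ρ.re) (h2 : ρ.re < 2) : 0 < defectNorm t ρ := by
  have hc := continuous_powDefect h1
  refine intervalIntegral.integral_pos zero_lt_one (Continuous.continuousOn (by fun_prop))
    (fun x hx => ?_) ⟨1 / 2, by norm_num, ?_⟩
  · have : 0 ≤ 1 - x := by linarith [hx.2]
    have := hx.1.le
    positivity
  · have := norm_pos_iff.2 (powDefect_half_ne_zero h2)
    norm_num at this ⊢
    positivity

/-- The quotient of Gamma values `2(2t+1)!Γ(ρ+t)Γ(σ+t)/(t!²Γ(ρ+σ+2t) - 2t!(2t+1)!Γ(ρ+σ+t-1))`. -/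
def gammaQuot (t : ℕ) (ρ σ : ℂ) : ℂ :=
  2 * (2 * t + 1)! * (Complex.Gamma (ρ + t) * Complex.Gamma (σ + t)) /
    ((t ! : ℂ) ^ 2 * Complex.Gamma (ρ + σ + 2 * t)
      - 2 * t ! * (2 * t + 1)! * Complex.Gamma (ρ + σ + t - 1))

theorem gammaQuot_sub_one {t : ℕ} {ρ σ : ℂ} (hρ : indProd t ρ = 2) (hσ : indProd t σ = 2)
    (h1 : 1 < ρ.re) (h2 : 1 < σ.re) (h3 : 3 < ρ.re + σ.re) :
    gammaQuot t ρ σ - 1 = defectIntegral t ρ σ /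
      ((t ! : ℂ) ^ 2 / (2 * t + 1)! * (1 - 2 / indProd t (ρ + σ - 1))) := by
  have p1 : 0 < ((t : ℂ) + 1).re := by
    rw [Complex.add_re, Complex.natCast_re, Complex.one_re]
    positivity
  have p2 : ∀ a : ℂ, 0 < a.re → 0 < (a + t).re := fun a ha => by
    rw [Complex.add_re, Complex.natCast_re]
    positivity
  have hν2 : 2 < (ρ + σ - 1).re := by
    rw [Complex.sub_re, Complex.add_re, Complex.one_re]
    linarith
  have hν : 0 < (ρ + σ - 1).re := by linarith
  have q1 := p2 ρ (by linarith)
  have q2 := p2 σ (by linarith)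
  have q3 := p2 _ hν
  have f1 : (t ! : ℂ) ≠ 0 := Nat.cast_ne_zero.2 t.factorial_ne_zero
  have f2 : ((2 * t + 1)! : ℂ) ≠ 0 := Nat.cast_ne_zero.2 (Nat.factorial_ne_zero _)
  have hi := betaIntegral_add_mul_indProd (t := t) hν
  have hi0 : indProd t (ρ + σ - 1) ≠ 0 := by
    intro h
    rw [h, mul_zero] at hi
    exact div_ne_zero (pow_ne_zero 2 f1) f2 hi.symm
  have hi2 := sub_ne_zero.2 (indProd_ne_two (t := t) hν2)
  rw [defectIntegral_eq hρ hσ h1 h2, betaIntegral_self]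
  rw [Complex.betaIntegral_eq_Gamma_mul_div _ _ q3 p1, Complex.Gamma_nat_eq_factorial,
    show ρ + σ - 1 + t + (t + 1) = ρ + σ + 2 * t by ring,
    show ρ + σ - 1 + t = ρ + σ + t - 1 by ring] at hi ⊢
  rw [Complex.betaIntegral_eq_Gamma_mul_div _ _ q1 q2, show ρ + t + (σ + t) = ρ + σ + 2 * t by ring]
  have hg : Complex.Gamma (ρ + σ + 2 * t) ≠ 0 :=
    Complex.Gamma_ne_zero_of_re_pos (by
      rw [show ρ + σ + 2 * t = (ρ + t) + (σ + t) by ring, Complex.add_re]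
      linarith)
  rw [gammaQuot]
  set g := Complex.Gamma (ρ + σ + 2 * t)
  set k := Complex.Gamma (ρ + σ + t - 1)
  set I := indProd t (ρ + σ - 1)
  have hk : k * ((2 * t + 1)! * I) = t ! * g := by
    field_simp at hi
    linear_combination hi
  have hgk : g = k * ((2 * t + 1)! * I) / t ! := by rw [hk]; field_simp
  have hk0 : k ≠ 0 := by
    intro h
    rw [hgk, h] at hg
    simp at hg
  have hd : (t ! : ℂ) ^ 2 * g - 2 * t ! * (2 * t + 1)! * k = t ! * (2 * t + 1)! * k * (I - 2) := by
    linear_combination -(t ! : ℂ) * hk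
  have hd2 : (1 - 2 / I) = (I - 2) / I := by field_simp
  rw [hd, hd2, hgk]
  field_simp
  ring

theorem exists_gammaQuot_conj {t : ℕ} {ρ : ℂ} (hρ : indProd t ρ = 2) (h1 : 3 / 2 < ρ.re)
    (h2 : ρ.re < 2) (him : ρ.im ≠ 0) : ∃ q : ℝ, gammaQuot t ρ (starRingEnd ℂ ρ) = q ∧
      ‖gammaQuot t ρ ρ - 1‖ < q - 1 := by
  have hb : (0 : ℝ) < (t ! : ℝ) ^ 2 / (2 * t + 1)! := by positivity
  set b : ℝ := (t ! : ℝ) ^ 2 / (2 * t + 1)! with hbdef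
  have hbc : (t ! : ℂ) ^ 2 / (2 * t + 1)! = (b : ℂ) := by rw [hbdef]; push_cast; ring
  have e1 := gammaQuot_sub_one hρ (conj_root hρ) (by linarith) (by rw [Complex.conj_re]; linarith)
    (by rw [Complex.conj_re]; linarith)
  have e2 := gammaQuot_sub_one hρ hρ (by linarith) (by linarith) (by linarith)
  have hreal : ρ + starRingEnd ℂ ρ - 1 = ((2 * ρ.re - 1 : ℝ) : ℂ) := by
    rw [Complex.add_conj]
    push_cast
    ring
  have hI : indProd t ((2 * ρ.re - 1 : ℝ) : ℂ) = ((indProd t (2 * ρ.re - 1) : ℝ) : ℂ) := by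
    simp [indProd]
  have hI2 := indProd_real_gt (t := t) (show 2 < 2 * ρ.re - 1 by linarith)
  have hlt := indProd_re_lt_norm (t := t) (z := ρ + ρ - 1)
    (by rw [Complex.sub_re, Complex.add_re, Complex.one_re]; linarith)
    (by rw [Complex.sub_im, Complex.add_im, Complex.one_im]; intro h; exact him (by linarith))
  rw [show (ρ + ρ - 1).re = 2 * ρ.re - 1 by
    rw [Complex.sub_re, Complex.add_re, Complex.one_re]; ring] at hlt
  set I := indProd t (2 * ρ.re - 1)
  set J := indProd t (ρ + ρ - 1)
  rw [hreal, hI, defectIntegral_conj, hbc] at e1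
  rw [hbc] at e2
  refine ⟨defectNorm t ρ / (b * (1 - 2 / I)) + 1, ?_, ?_⟩
  · rw [sub_eq_iff_eq_add] at e1
    rw [e1]
    push_cast
    ring
  · have hN := defectNorm_pos (t := t) (show 1 < ρ.re by linarith) h2
    have hd1 : 0 < b * (1 - 2 / I) := by
      have : 2 / I < 1 := (div_lt_one (by linarith)).2 hI2
      exact mul_pos hb (by linarith)
    have hd2 : b * (1 - 2 / I) < ‖(b : ℂ) * (1 - 2 / J)‖ := by
      rw [norm_mul, Complex.norm_real, Real.norm_of_nonneg hb.le]
      refine mul_lt_mul_of_pos_left ?_ hb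
      have g1 : 2 / ‖J‖ < 2 / I := div_lt_div_of_pos_left two_pos (by linarith) hlt
      have g2 := norm_sub_norm_le (1 : ℂ) (2 / J)
      rw [norm_one, norm_div, Complex.norm_ofNat] at g2
      linarith
    rw [add_sub_cancel_right, e2, norm_div]
    exact (div_le_div_of_nonneg_right (norm_defectIntegral_le t ρ) (norm_nonneg _)).trans_lt
      (div_lt_div_of_pos_left hN hd1 hd2)

theorem sCoeff_ne_zero {t : ℕ} {ρ : ℂ} (hρ : indProd t ρ = 2) (h1 : 1 < ρ.re) : sCoeff t ρ ≠ 0 := by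
  have h0 : 0 < ρ.re := by linarith
  have h2 : ρ - 1 ≠ 0 := fun h => by
    rw [sub_eq_zero.1 h] at h1
    simp at h1
  have h3 : eig ρ t ≠ 0 := Finset.prod_ne_zero_iff.2 fun i _ =>
    div_ne_zero (add_natCast_ne_zero h0 i) (Nat.cast_add_one_ne_zero i)
  rw [sCoeff, res]
  exact div_ne_zero (div_ne_zero (one_div_ne_zero (logDerivSum_ne_zero hρ))
    (mul_ne_zero two_ne_zero h2)) h3

/-- The coefficient of the particular solution for the toll `2 avg₂ (eig ρ) (eig σ)`. -/
def pairCoeff (t : ℕ) (ρ σ : ℂ) : ℂ :=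
  2 * eig ρ t * eig σ t / (eig (ρ + σ - 1) (2 * t + 1) - 2 * eig (ρ + σ - 1) t)

theorem pairCoeff_mul_eig_rec {t n : ℕ} (hn : 2 * t + 1 ≤ n) {ρ σ : ℂ} (h : 3 < ρ.re + σ.re) :
    pairCoeff t ρ σ * eig (ρ + σ - 1) n =
      2 * avg t (fun k => pairCoeff t ρ σ * eig (ρ + σ - 1) k) n +
        2 * avg₂ t (eig ρ) (eig σ) n := by
  have hν2 : 2 < (ρ + σ - 1).re := by
    rw [Complex.sub_re, Complex.add_re, Complex.one_re]
    linarith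
  have hν : 0 < (ρ + σ - 1).re := by linarith
  have h1 := avg_eig_mul hn (ρ + σ - 1)
  have h2 := avg₂_eig_mul hn ρ σ
  have h3 := sub_ne_zero.2 (indProd_ne_two (t := t) hν2)
  have h4 : eig (ρ + σ - 1) t ≠ 0 := Finset.prod_ne_zero_iff.2 fun i _ =>
    div_ne_zero (add_natCast_ne_zero hν i) (Nat.cast_add_one_ne_zero i)
  rw [avg_const_mul, pairCoeff, eig_two_mul_add_one]
  generalize ρ + σ - 1 = ν at *
  have h0 : indProd t ν ≠ 0 := Finset.prod_ne_zero_iff.2 fun i _ =>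
    div_ne_zero (add_natCast_ne_zero hν i) (Nat.cast_add_one_ne_zero i)
  have e1 : avg t (eig ν) n = eig ν n / indProd t ν := by rw [← h1]; field_simp
  have e2 : avg₂ t (eig ρ) (eig σ) n = eig ρ t * eig σ t * eig ν n / (eig ν t * indProd t ν) := by
    rw [← h2]; field_simp
  have e3 : eig ν t * indProd t ν - 2 * eig ν t = eig ν t * (indProd t ν - 2) := by ring
  rw [e1, e2, e3]
  field_simp
  ring

theorem pairCoeff_mul_Gamma {t : ℕ} {ρ σ : ℂ} (h1 : 1 < ρ.re) (h2 : 1 < σ.re) :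
    pairCoeff t ρ σ * (1 / Complex.Gamma (ρ + σ - 1)) =
      gammaQuot t ρ σ * (1 / Complex.Gamma ρ * (1 / Complex.Gamma σ)) := by
  have hν : 0 < (ρ + σ - 1).re := by
    rw [Complex.sub_re, Complex.add_re, Complex.one_re]
    linarith
  have g1 := Complex.Gamma_ne_zero_of_re_pos (show 0 < ρ.re by linarith)
  have g2 := Complex.Gamma_ne_zero_of_re_pos (show 0 < σ.re by linarith)
  have g3 := Complex.Gamma_ne_zero_of_re_pos hν
  have f1 : (t ! : ℂ) ≠ 0 := Nat.cast_ne_zero.2 t.factorial_ne_zero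
  have f2 : ((2 * t + 1)! : ℂ) ≠ 0 := Nat.cast_ne_zero.2 (Nat.factorial_ne_zero _)
  rw [pairCoeff, gammaQuot, eig_eq_Gamma (show 0 < ρ.re by linarith),
    eig_eq_Gamma (show 0 < σ.re by linarith), eig_eq_Gamma hν, eig_eq_Gamma hν,
    show ρ + σ - 1 + ((2 * t + 1 : ℕ) : ℂ) = ρ + σ + 2 * t by push_cast; ring,
    show ρ + σ - 1 + t = ρ + σ + t - 1 by ring]
  generalize Complex.Gamma (ρ + σ - 1) = gν at *
  generalize Complex.Gamma (ρ + σ + 2 * t) = p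
  generalize Complex.Gamma (ρ + σ + t - 1) = q
  have e : p / (gν * (2 * t + 1)!) - 2 * (q / (gν * t !)) =
      ((t ! : ℂ) ^ 2 * p - 2 * t ! * (2 * t + 1)! * q) / (gν * (2 * t + 1)! * t ! ^ 2) := by
    field_simp
  rw [e, div_div_eq_mul_div]
  field_simp

theorem tendsto_pair (t : ℕ) {ρ σ : ℂ} (h1 : 1 < ρ.re) (h2 : 1 < σ.re) :
    Tendsto (fun n : ℕ => (pairCoeff t ρ σ * eig (ρ + σ - 1) n - eig ρ n * eig σ n) /
      (n : ℂ) ^ (ρ + σ - 2)) atTop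
      (𝓝 (1 / Complex.Gamma ρ * (1 / Complex.Gamma σ) * (gammaQuot t ρ σ - 1))) := by
  have e1 := (tendsto_eig (ρ + σ - 1)).const_mul (pairCoeff t ρ σ)
  have e2 := (tendsto_eig ρ).mul (tendsto_eig σ)
  rw [pairCoeff_mul_Gamma h1 h2] at e1
  have e3 := e1.sub e2
  rw [show gammaQuot t ρ σ * (1 / Complex.Gamma ρ * (1 / Complex.Gamma σ)) -
    1 / Complex.Gamma ρ * (1 / Complex.Gamma σ) =
    1 / Complex.Gamma ρ * (1 / Complex.Gamma σ) * (gammaQuot t ρ σ - 1) by ring] at e3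
  refine e3.congr' ?_
  filter_upwards [eventually_ne_atTop 0] with n hn
  have hn' : (n : ℂ) ≠ 0 := Nat.cast_ne_zero.2 hn
  rw [show ρ + σ - 1 - 1 = ρ + σ - 2 by ring, show ρ + σ - 2 = (ρ - 1) + (σ - 1) by ring,
    Complex.cpow_add _ _ hn', sub_div, mul_div_assoc, mul_div_mul_comm]

/-- The limit coefficients of the variance. -/
def varLimit (t : ℕ) (ρ σ : ℂ) : ℂ :=
  sCoeff t ρ * sCoeff t σ * (1 / Complex.Gamma ρ * (1 / Complex.Gamma σ) * (gammaQuot t ρ σ - 1))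

theorem G₁_eq {t : ℕ} {ρ : ℂ} {q : ℝ} (hq : gammaQuot t ρ (starRingEnd ℂ ρ) = q) (z : ℝ) :
    G₁ t ρ z = 2 * (‖sCoeff t ρ‖ ^ 2 / ‖Complex.Gamma ρ‖ ^ 2) * (q - 1) +
      2 * (varLimit t ρ ρ * Complex.exp (2 * Complex.I * z)).re := by
  have e1 : 2 * (2 * t + 1)! * ‖Complex.Gamma (ρ + t)‖ ^ 2 /
      ((t ! : ℝ) ^ 2 * Real.Gamma (2 * ρ.re + 2 * t)
          - 2 * t ! * (2 * t + 1)! * Real.Gamma (2 * ρ.re + t - 1)) = q := by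
    have h1 : ρ + starRingEnd ℂ ρ = ((2 * ρ.re : ℝ) : ℂ) := Complex.add_conj ρ
    have h2 : starRingEnd ℂ ρ + t = starRingEnd ℂ (ρ + t) := by simp
    rw [gammaQuot, h1, h2, Complex.Gamma_conj, Complex.mul_conj, Complex.normSq_eq_norm_sq,
      show ((2 * ρ.re : ℝ) : ℂ) + 2 * t = ((2 * ρ.re + 2 * t : ℝ) : ℂ) by push_cast; ring,
      show ((2 * ρ.re : ℝ) : ℂ) + t - 1 = ((2 * ρ.re + t - 1 : ℝ) : ℂ) by push_cast; ring,
      Complex.Gamma_ofReal, Complex.Gamma_ofReal] at hq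
    exact_mod_cast hq
  have e2 : 2 * (2 * t + 1)! * Complex.Gamma (ρ + t) ^ 2 /
        ((t ! : ℂ) ^ 2 * Complex.Gamma (2 * ρ + 2 * t)
          - 2 * t ! * (2 * t + 1)! * Complex.Gamma (2 * ρ + t - 1)) = gammaQuot t ρ ρ := by
    rw [gammaQuot, ← two_mul, sq]
  have e3 : sCoeff t ρ ^ 2 * Complex.exp (2 * Complex.I * z) / Complex.Gamma ρ ^ 2 *
      (-1 + gammaQuot t ρ ρ) = varLimit t ρ ρ * Complex.exp (2 * Complex.I * z) := by
    rw [varLimit]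
    ring
  rw [G₁, e1, e2, C₂_eq_sCoeff, e3]
  ring

theorem G₁_mul {t n : ℕ} (hn : n ≠ 0) {ρ : ℂ} {q : ℝ}
    (hq : gammaQuot t ρ (starRingEnd ℂ ρ) = q) :
    ((G₁ t ρ (ρ.im * Real.log n) * (n : ℝ) ^ (2 * ρ.re - 2) : ℝ) : ℂ) =
      ((n : ℂ) ^ (ρ + starRingEnd ℂ ρ - 2) * varLimit t ρ (starRingEnd ℂ ρ) +
        (n : ℂ) ^ (ρ + ρ - 2) * varLimit t ρ ρ) +
      starRingEnd ℂ ((n : ℂ) ^ (ρ + starRingEnd ℂ ρ - 2) * varLimit t ρ (starRingEnd ℂ ρ) +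
        (n : ℂ) ^ (ρ + ρ - 2) * varLimit t ρ ρ) := by
  have r1 : (ρ + starRingEnd ℂ ρ - 2).re = 2 * ρ.re - 2 := by
    rw [Complex.sub_re, Complex.add_re, Complex.conj_re, Complex.re_ofNat]; ring
  have i1 : (ρ + starRingEnd ℂ ρ - 2).im = 0 := by
    rw [Complex.sub_im, Complex.add_im, Complex.conj_im, Complex.im_ofNat]; ring
  have r2 : (ρ + ρ - 2).re = 2 * ρ.re - 2 := by
    rw [Complex.sub_re, Complex.add_re, Complex.re_ofNat]; ring
  have i2 : (ρ + ρ - 2).im = 2 * ρ.im := by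
    rw [Complex.sub_im, Complex.add_im, Complex.im_ofNat]; ring
  have v1 : varLimit t ρ (starRingEnd ℂ ρ) =
      ((‖sCoeff t ρ‖ ^ 2 / ‖Complex.Gamma ρ‖ ^ 2 * (q - 1) : ℝ) : ℂ) := by
    rw [varLimit, hq, ← conj_sCoeff, Complex.Gamma_conj, Complex.mul_conj, one_div_mul_one_div,
      Complex.mul_conj, Complex.normSq_eq_norm_sq, Complex.normSq_eq_norm_sq]
    push_cast
    ring
  rw [Complex.add_conj, G₁_eq hq, natCast_cpow hn, natCast_cpow hn, r1, i1, r2, i2, v1, zero_mul,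
    Complex.ofReal_zero, mul_zero, Complex.exp_zero, mul_one, ← Complex.ofReal_mul, Complex.add_re,
    Complex.ofReal_re, mul_assoc (((n : ℝ) ^ (2 * ρ.re - 2) : ℝ) : ℂ), Complex.re_ofReal_mul,
    mul_comm (Complex.exp _)]
  congr 1
  rw [show Complex.I * ((2 * ρ.im * Real.log n : ℝ) : ℂ) =
    2 * Complex.I * ((ρ.im * Real.log n : ℝ) : ℂ) by push_cast; ring]
  ring

theorem exists_le_G₁ {t : ℕ} {ρ : ℂ} (hρ : indProd t ρ = 2) (h1 : 3 / 2 < ρ.re)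
    (h2 : ρ.re < 2) (him : ρ.im ≠ 0) : ∃ c : ℝ, 0 < c ∧ ∀ z, c ≤ G₁ t ρ z := by
  obtain ⟨q, hq, hlt⟩ := exists_gammaQuot_conj hρ h1 h2 him
  have hg := Complex.Gamma_ne_zero_of_re_pos (show 0 < ρ.re by linarith)
  have hc := sCoeff_ne_zero hρ (by linarith)
  have hpos : 0 < ‖sCoeff t ρ‖ ^ 2 / ‖Complex.Gamma ρ‖ ^ 2 := by positivity
  refine ⟨2 * (‖sCoeff t ρ‖ ^ 2 / ‖Complex.Gamma ρ‖ ^ 2) * (q - 1 - ‖gammaQuot t ρ ρ - 1‖),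
    mul_pos (by linarith) (by linarith), fun z => ?_⟩
  have e1 : ‖varLimit t ρ ρ * Complex.exp (2 * Complex.I * z)‖ =
      ‖sCoeff t ρ‖ ^ 2 / ‖Complex.Gamma ρ‖ ^ 2 * ‖gammaQuot t ρ ρ - 1‖ := by
    rw [show 2 * Complex.I * (z : ℂ) = ((2 * z : ℝ) : ℂ) * Complex.I by push_cast; ring, norm_mul,
      Complex.norm_exp_ofReal_mul_I, varLimit]
    simp only [norm_mul, norm_div, norm_one]
    ring
  have e2 := Complex.abs_re_le_norm (varLimit t ρ ρ * Complex.exp (2 * Complex.I * z))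
  rw [e1] at e2
  have e3 := (abs_le.1 e2).1
  rw [G₁_eq hq]
  linarith

theorem var_S_periodic {t : ℕ} {ρ : ℂ} (h : IsSecondZero t ρ) (h1 : 3 / 2 < ρ.re) :
    (fun n : ℕ => Var[S t n; permMeasure n]) ~[atTop]
      fun n : ℕ => G₁ t ρ (ρ.im * Real.log n) * (n : ℝ) ^ (2 * ρ.re - 2) := by
  have h2 := h.re_lt_two
  obtain ⟨q, hq, -⟩ := exists_gammaQuot_conj h.root h1 h2 h.im_pos.ne'
  obtain ⟨c₀, hc₀, hle⟩ := exists_le_G₁ h.root h1 h2 h.im_pos.ne'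
  obtain ⟨d, hd1, hd2, hsd⟩ := h.exists_expansion (lo := 3 - ρ.re) (by linarith)
  have hr' : (starRingEnd ℂ ρ).re = ρ.re := Complex.conj_re ρ
  set s : ℕ → ℂ := fun n => (sDev t n : ℂ) with hs
  set c := sCoeff t ρ with hc
  set ρ' := starRingEnd ℂ ρ with hρ'
  have hcc : starRingEnd ℂ c = sCoeff t ρ' := conj_sCoeff t ρ
  set c' := sCoeff t ρ' with hc'
  have hce : ∀ n, starRingEnd ℂ (c * eig ρ n) = c' * eig ρ' n := fun n => by
    rw [map_mul, conj_eig, hcc]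
  set σ : ℕ → ℂ := fun n => c * eig ρ n + starRingEnd ℂ (c * eig ρ n) with hσ
  set e := d + (ρ.re - 1) with he
  have hceb : PolyBound (fun n => c * eig ρ n) (ρ.re - 1) := (PolyBound.eig le_rfl).const_mul _
  have hσb : PolyBound σ (ρ.re - 1) := hceb.add hceb.conj
  have hsb : PolyBound s (ρ.re - 1) :=
    ((hsd.mono (e' := ρ.re - 1) (by linarith)).add hσb).of_eq (N := 0) fun n _ => by ring
  set V : ℕ → ℂ := fun n => (covSeq (S t) (S t) n : ℂ) with hV
  have hM : ∀ n, 2 * t + 1 ≤ n → V n + s n * s n = 2 * avg t (fun n => V n + s n * s n) n +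
      2 * avg₂ t s s n := by
    intro n hn
    have := congrArg (fun x : ℝ => (x : ℂ)) (covSS_rec hn)
    simpa only [Complex.ofReal_add, Complex.ofReal_mul, ofReal_avg, ofReal_avg₂,
      Complex.ofReal_ofNat] using this
  set f : ℕ → ℂ := fun n => c * c' * (pairCoeff t ρ ρ' * eig (ρ + ρ' - 1) n) +
    c * c * (pairCoeff t ρ ρ * eig (ρ + ρ - 1) n) with hf
  set u : ℕ → ℂ := fun n => c * c' * (2 * avg₂ t (eig ρ) (eig ρ') n) +
    c * c * (2 * avg₂ t (eig ρ) (eig ρ) n) with hu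
  have hfrec : ∀ n, 2 * t + 1 ≤ n → f n = 2 * avg t f n + u n := by
    intro n hn
    have e1 := pairCoeff_mul_eig_rec hn (ρ := ρ) (σ := ρ') (by rw [hr']; linarith)
    have e2 := pairCoeff_mul_eig_rec hn (ρ := ρ) (σ := ρ) (by linarith)
    rw [hf, avg_add, avg_const_mul _ (c * c'), avg_const_mul _ (c * c)]
    simp only [hu]
    linear_combination c * c' * e1 + c * c * e2
  have hA : ∀ n, 2 * t + 1 ≤ n → f n + starRingEnd ℂ (f n) =
      2 * avg t (fun n => f n + starRingEnd ℂ (f n)) n + 2 * avg₂ t σ σ n := by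
    intro n hn
    have e1 := hfrec n hn
    have e2 : starRingEnd ℂ (f n) =
        2 * avg t (fun k => starRingEnd ℂ (f k)) n + starRingEnd ℂ (u n) := by
      conv_lhs => rw [e1, map_add, map_mul, conj_avg, Complex.conj_ofNat]
    have e3 : 2 * avg₂ t σ σ n = u n + starRingEnd ℂ (u n) := by
      have a1 : c * c' * avg₂ t (eig ρ) (eig ρ') n =
          avg₂ t (fun n => c * eig ρ n) (fun n => starRingEnd ℂ (c * eig ρ n)) n := by
        simp only [hce]
        rw [avg₂_const_mul_left, avg₂_const_mul_right]
        ring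
      have a2 : c * c * avg₂ t (eig ρ) (eig ρ) n =
          avg₂ t (fun n => c * eig ρ n) (fun n => c * eig ρ n) n := by
        rw [avg₂_const_mul_left, avg₂_const_mul_right]
        ring
      have a3 : u n = 2 * avg₂ t (fun n => c * eig ρ n) (fun n => starRingEnd ℂ (c * eig ρ n)) n +
          2 * avg₂ t (fun n => c * eig ρ n) (fun n => c * eig ρ n) n := by
        rw [← a1, ← a2, hu]
        ring
      rw [a3, map_add, map_mul, map_mul, conj_avg₂, conj_avg₂, Complex.conj_ofNat]
      simp only [Complex.conj_conj]
      rw [hσ, avg₂_add_left, avg₂_add_right, avg₂_add_right]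
      ring
    rw [avg_add, e3]
    linear_combination e1 + e2
  have hTU : PolyBound (fun n => 2 * avg₂ t s s n - 2 * avg₂ t σ σ n) e :=
    ((PolyBound.avg₂_sub (t := t) (e := e) hsd hsb hσb hsd (by linarith) (by linarith) (by linarith)
      (by linarith) le_rfl (by linarith)).const_mul 2).of_eq (N := 0)
      fun n _ => by ring
  have hR := PolyBound.of_recurrence (by linarith) hM hA hTU
  have hss : PolyBound (fun n => s n * s n - σ n * σ n) e :=
    PolyBound.mul_sub hsd hsb hσb hsd le_rfl (by linarith)
  set v₁ : ℕ → ℂ := fun n => pairCoeff t ρ ρ' * eig (ρ + ρ' - 1) n - eig ρ n * eig ρ' n with hv₁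
  set v₂ : ℕ → ℂ := fun n => pairCoeff t ρ ρ * eig (ρ + ρ - 1) n - eig ρ n * eig ρ n with hv₂
  have hVv : PolyBound (fun n => V n - ((c * c' * v₁ n + c * c * v₂ n) +
      starRingEnd ℂ (c * c' * v₁ n + c * c * v₂ n))) e := by
    refine (hR.sub hss).of_eq (N := 0) fun n _ => ?_
    have e1 : c * c' * v₁ n + c * c * v₂ n = f n - (c * eig ρ n) * starRingEnd ℂ (c * eig ρ n) -
        (c * eig ρ n) * (c * eig ρ n) := by
      rw [hce, hf, hv₁, hv₂]
      ring
    rw [e1]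
    simp only [hσ, map_sub, map_mul, Complex.conj_conj]
    ring
  have hl₁ := tendsto_pair t (ρ := ρ) (σ := ρ') (by linarith) (by linarith)
  have hl₂ := tendsto_pair t (ρ := ρ) (σ := ρ) (by linarith) (by linarith)
  have r1 : (ρ + ρ' - 2).re = 2 * ρ.re - 2 := by
    rw [Complex.sub_re, Complex.add_re, hr', Complex.re_ofNat]; ring
  have r2 : (ρ + ρ - 2).re = 2 * ρ.re - 2 := by
    rw [Complex.sub_re, Complex.add_re, Complex.re_ofNat]; ring
  have o1 := (isLittleO_sub_cpow (by linarith) hl₁).const_mul_left (c * c')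
  have o2 := (isLittleO_sub_cpow (by linarith) hl₂).const_mul_left (c * c)
  rw [r1] at o1
  rw [r2] at o2
  have o3 := o1.add o2
  have o4 : (fun n : ℕ => starRingEnd ℂ _) =o[atTop] _ :=
    isLittleO_norm_left.1 (by simpa only [RCLike.norm_conj] using o3.norm_left)
  have hall := (hVv.isLittleO (show e < 2 * ρ.re - 2 by linarith)).add (o3.add o4)
  have hO : (fun n : ℕ => (n : ℝ) ^ (2 * ρ.re - 2)) =O[atTop]
      fun n : ℕ => G₁ t ρ (ρ.im * Real.log n) * (n : ℝ) ^ (2 * ρ.re - 2) := by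
    refine IsBigO.of_bound (1 / c₀) (Eventually.of_forall fun n => ?_)
    have g := hle (ρ.im * Real.log n)
    have g0 : 0 ≤ (n : ℝ) ^ (2 * ρ.re - 2) := by positivity
    rw [Real.norm_of_nonneg g0, Real.norm_of_nonneg (mul_nonneg (hc₀.le.trans g) g0), one_div,
      ← div_eq_inv_mul, le_div_iff₀ hc₀, mul_comm]
    exact mul_le_mul_of_nonneg_right g g0
  refine IsLittleO.trans_isBigO ?_ hO
  rw [← isLittleO_norm_left] at hall ⊢
  refine hall.congr' ?_ EventuallyEq.rfl
  filter_upwards [eventually_ne_atTop 0] with n hn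
  rw [Pi.sub_apply, var_S_eq_covSeq, ← Complex.norm_real, Complex.ofReal_sub, G₁_mul hn hq, varLimit,
    varLimit, ← hρ', ← hc, ← hc']
  congr 1
  simp only [hV, hv₁, hv₂, map_mul, map_sub, map_add]
  ring

end FBBST

end

theorem theorem5p1 (t : ℕ) :
    (1 ≤ t → t ≤ 58 → ∃ D_S : ℝ, 0 < D_S ∧
      (fun n : ℕ => Var[FBBST.S t n; FBBST.permMeasure n]) ~[atTop] fun n : ℕ => D_S * (n : ℝ)) ∧
    (1 ≤ t → t ≤ 28 → ∃ D_R : ℝ, D_R ≠ 0 ∧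
      (fun n : ℕ => cov[FBBST.S t n, FBBST.X t n; FBBST.permMeasure n])
        ~[atTop] fun n : ℕ => D_R * (n : ℝ)) ∧
    (29 ≤ t → ∃ ρ : ℂ, FBBST.IsSecondZero t ρ ∧
      (59 ≤ t →
        (fun n : ℕ => Var[FBBST.S t n; FBBST.permMeasure n])
          ~[atTop] fun n : ℕ =>
            FBBST.G₁ t ρ (ρ.im * Real.log n) * (n : ℝ) ^ (2 * ρ.re - 2)) ∧
      (fun n : ℕ => cov[FBBST.S t n, FBBST.X t n; FBBST.permMeasure n]
          - FBBST.G₂ t ρ (ρ.im * Real.log n) * (n : ℝ) ^ ρ.re)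
        =o[atTop] fun n : ℕ => (n : ℝ) ^ ρ.re) ∧
    (fun n : ℕ => Var[FBBST.X t n; FBBST.permMeasure n])
      ~[atTop] fun n : ℕ => FBBST.DX t * (n : ℝ) ^ 2 := by
  refine ⟨fun h1 h58 => FBBST.var_S_linear h1 (FBBST.re_lt_three_half_of_le h58),
    fun h1 h28 => FBBST.cov_linear (FBBST.re_lt_one_of_le h28)
      (FBBST.tsum_covToll_ne_zero h1 h28), fun h29 => ?_, FBBST.var_X_asymptotic t⟩
  obtain ⟨ρ, hρ, h1, h59⟩ := FBBST.exists_secondZero h29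
  exact ⟨ρ, hρ, fun h => FBBST.var_S_periodic hρ (h59 h), FBBST.cov_asymptotic hρ h1⟩
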